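/- Let $k$ be a field of characteristic zero, $A$ a unital associative $k$-algebra and $d\in\mathbb Z$. Let $\operatorname{Nilp}$ be the category of commutative finite dimensional local $k$-algebras $(R,m)$ with $R/m=k$, and $k$-algebra homomorphisms. **Hochschild (co)chains.** Let $\bar{\mathfrak C}^p(A)$ be the space of normalized Hochschild cochains of degree $|x|=p$, i.e. of $k$-multilinear maps $x:A^{p+1}\to A$ which vanish as soon as one argument is $1$ ($p\ge -1$). It is a DG-Lie algebra with bracket $[x,y]=x\{y\}-(-1)^{|x||y|}y\{x\}$, where $$x\{y\}(b_1,\dots,b_n)=\sum_i(-1)^{|y|i}x(b_1,\dots,b_i,y(b_{i+1},\dots,b_{i+|y|+1}),\dots,b_n),$$ and differential $[\mu_0,-]$, where $\mu_0(a,b)=-ab$. On normalized Hochschild chains $\bar C_n(A)=A\otimes(A/k)^{\otimes n}$ put $$L_x(b_0\otimes\cdots\otimes b_n)=\sum_{i=0}^{n-|x|-1}(-1)^{|x|i}b_0\otimes\cdots\otimes b_i\otimes x(b_{i+1},\dots,b_{i+|x|+1})\otimes\cdots\otimes b_n$$ $$\qquad+\sum_{i=n-|x|}^{n}(-1)^{n(i+1)+|x|}x(b_{i+1},\dots,b_n,b_0,\dots,b_{|x|-n+i})\otimes\cdots\otimes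 b_i$$ (in the second sum only the indices $0\le i\le n$ with $|x|-n+i\le i$ occur) and $$\mathsf B(b_0\otimes\cdots\otimes b_n)=\sum_{i=0}^n(-1)^{ni}\,1\otimes b_i\otimes\cdots\otimes b_n\otimes b_0\otimes\cdots\otimes b_{i-1}.$$ The normalized negative cyclic complex has $\overline{CC}{}^-_n(A)=\prod_{i\ge0}\bar C_{n+2i}(A)u^i$ and differential $L_{\mu_0}+u\mathsf B$; the operations are extended $u$-linearly. For an $R$-module of the form $R\otimes_kA$ the same constructions are used relative to $R$, so that $\overline{CC}{}^-_n(A)\otimes_kR$ is identified with the normalized negative cyclic chains of $R\otimes_kA$ over $R$, and $\bar{\mathfrak C}^1(A)\otimes_k R$ with $R$-bilinear maps. **The DG-Lie algebra.** Let $\eta_0\in\overline{CC}{}^-_d(A)$ satisfy $(L_{\mu_0}+u\mathsf B)\eta_0=0$. Through $x\mapsto L_x$ the shift $\Sigma^{-d-1}\overline{CC}{}^-_\bullet(A)$ (whose part of cohomological degree $j$ is $s^{-d-1}\overline{CC}{}^-_{d+1-j}(A)$, with differential $(-1)^{d+1}(L_{\mu_0}+u\mathsf B)$ and with $x$ acting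 by $(-1)^{(d+1)|x|}L_x$) is a DG-module over $\bar{\mathfrak C}^\bullet(A)$. Let $\mathfrak D^\sharp=\bar{\mathfrak C}^\bullet(A)\ltimes\Sigma^{-d-1}\overline{CC}{}^-_\bullet(A)$, with bracket $[(g,n),(g',n')]=([g,g'],gn'-(-1)^{|g'||n|}g'n)$. The element $(0,s^{-d-1}\eta_0)$ satisfies the Maurer–Cartan equation; let $\mathfrak D(A,\eta_0)$ be $\mathfrak D^\sharp$ with the twisted differential $d+[(0,s^{-d-1}\eta_0),-]$. **The Maurer–Cartan groupoid.** For a nilpotent DG-Lie algebra $\mathfrak h$ the objects of $MC(\mathfrak h)$ are the $y\in\mathfrak h^1$ with $dy+\frac12[y,y]=0$; the gauge group $\exp(\mathfrak h^0)$ is the group of group-like elements of the enveloping algebra $\widehat U(\mathfrak h^0)$ completed at its augmentation ideal; it acts by $\exp(x)*y=e^{\operatorname{ad}x}(y)-\sum_{n\ge0}\frac1{(n+1)!}(\operatorname{ad}x)^n(dx)$, and the morphisms $y\to y'$ are the $g\in\exp(\mathfrak h^0)$ with $g*y=y'$. The deformation functor of $\mathfrak D(A,\eta_0)$ is $\mathcal{MC}:(R,m)\mapsto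 MC(\mathfrak D(A,\eta_0)\otimes_km)$. **The groupoid $\operatorname{Def}^\flat$.** For $(R,m)\in\operatorname{Nilp}$ the objects of $\operatorname{Def}^\flat_{A,\eta_0}(R)$ are pairs $(\mu,\eta)$ where $\mu$ is an $R$-bilinear map on $R\otimes_kA$ such that $-\mu$ is an associative multiplication with unit $1\otimes1$ and $\mu\equiv\mu_0$ modulo $m$, and $\eta\in\overline{CC}{}^-_d(A)\otimes_kR$ satisfies $(L_\mu+u\mathsf B)\eta=0$ and $\eta\equiv\eta_0$ modulo $m$. A morphism $(\mu_1,\eta_1)\to(\mu_2,\eta_2)$ is a pair $(\phi,\xi)$, where $\phi:(R\otimes_kA,-\mu_1)\to(R\otimes_kA,-\mu_2)$ is a unital homomorphism of $R$-algebras which is the identity modulo $m$, and $\xi\in\overline{CC}{}^-_{d+1}(A)\otimes_km$ satisfies $(L_{\mu_2}+u\mathsf B)\xi=\phi(\eta_1)-\eta_2$. Composition is $(\phi,\xi)\circ(\phi',\xi')=(\phi\circ\phi',\phi(\xi')+\xi)$. Base change along morphisms of $\operatorname{Nilp}$ makes $\operatorname{Def}^\flat_{A,\eta_0}$ a functor from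 $\operatorname{Nilp}$ to groupoids. **Theorem.** There are isomorphisms of groupoids $$\Phi(R):MC(\mathfrak D(A,\eta_0)\otimes_km)\longrightarrow\operatorname{Def}^\flat_{A,\eta_0}(R),\qquad (R,m)\in\operatorname{Nilp},$$ given on objects by $(\mu,s^{-d-1}\eta)\mapsto(\mu_0+\mu,\eta_0+\eta)$, which are natural in $R$. Thus $\Phi$ is an isomorphism of functors $\mathcal{MC}(\mathfrak D(A,\eta_0))\cong\operatorname{Def}^\flat_{A,\eta_0}$ from $\operatorname{Nilp}$ to groupoids. -/

import Mathlib

namespace CYDef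

section Cuts

variable {B : Type*} {M N : Type*} [AddCommGroup M] [AddCommGroup N]

/-- The sign `(-1)^n`. -/
def sgn (n : ℤ) : ℤ := (n.negOnePow : ℤ)

theorem sgn_add (a b : ℤ) : sgn (a + b) = sgn a * sgn b := by
  simp [sgn, Int.negOnePow_add]

theorem sgn_congr {a b : ℤ} (h : Even (a - b)) : sgn a = sgn b := by
  unfold sgn; rw [(Int.negOnePow_eq_iff a b).2 h]

theorem sgn_even {a : ℤ} (h : Even a) : sgn a = 1 := by
  unfold sgn; rw [Int.negOnePow_even a h]; rfl

theorem sgn_neg_of {a b : ℤ} (h : Odd (a - b)) : sgn a = - sgn b := by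
  have : sgn a = sgn (b + 1) := sgn_congr (by
    obtain ⟨c, hc⟩ := h; exact ⟨c, by omega⟩)
  rw [this, sgn_add]; simp [sgn]

@[simp] theorem sgn_zero : sgn 0 = 1 := rfl

theorem sgn_mul_sgn_self (a : ℤ) : sgn a * sgn a = 1 := by
  rw [← sgn_add]; exact sgn_even ⟨a, rfl⟩

theorem sgn_smul_smul (a b : ℤ) (z : M) : sgn a • sgn b • z = sgn (a + b) • z := by
  rw [smul_smul, sgn_add]

/-- The sum of `f u v` over all decompositions `l = u ++ v`. -/
def cut (l : List B) (f : List B → List B → M) : M :=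
  ∑ i ∈ Finset.range (l.length + 1), f (l.take i) (l.drop i)

/-- The sum of `f u v w` over all decompositions `l = u ++ v ++ w`. -/
def cut3 (l : List B) (f : List B → List B → List B → M) : M :=
  cut l fun u t => cut t fun v w => f u v w

@[simp] theorem cut_nil (f : List B → List B → M) : cut [] f = f [] [] := by simp [cut]

theorem cut_cons (a : B) (l : List B) (f : List B → List B → M) :
    cut (a :: l) f = f [] (a :: l) + cut l (fun u v => f (a :: u) v) := by
  unfold cut
  rw [List.length_cons, Finset.sum_range_succ' _ (l.length + 1), add_comm]
  simp

theorem cut_congr {l : List B} {f g : List B → List B → M}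
    (h : ∀ u v, u ++ v = l → f u v = g u v) : cut l f = cut l g :=
  Finset.sum_congr rfl fun i _ => h _ _ (List.take_append_drop i l)

theorem cut_add (l : List B) (f g : List B → List B → M) :
    cut l (fun u v => f u v + g u v) = cut l f + cut l g := Finset.sum_add_distrib

theorem map_cut (φ : M →+ N) (l : List B) (f : List B → List B → M) :
    φ (cut l f) = cut l (fun u v => φ (f u v)) := map_sum _ _ _

theorem cut_zsmul (c : ℤ) (l : List B) (f : List B → List B → M) :
    c • cut l f = cut l (fun u v => c • f u v) := Finset.smul_sum

theorem cut_zero (l : List B) : cut l (fun _ _ => (0 : M)) = 0 := by simp [cut]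

theorem cut_comm (l m : List B) (f : List B → List B → List B → List B → M) :
    cut l (fun u v => cut m (fun s t => f u v s t)) =
      cut m (fun s t => cut l (fun u v => f u v s t)) := Finset.sum_comm

theorem cut_append_cons (a : List B) (c : B) (b : List B) (f : List B → List B → M) :
    cut (a ++ c :: b) f = cut a (fun u v => f u (v ++ c :: b)) +
      cut b (fun u v => f (a ++ c :: u) v) := by
  induction a generalizing f with
  | nil => simp [cut_cons]
  | cons x a ih => simp [cut_cons, ih, add_assoc]

theorem cut_assoc (l : List B) (f : List B → List B → List B → M) :
    cut l (fun s w => cut s (fun u v => f u v w)) =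
      cut l (fun u t => cut t (fun v w => f u v w)) := by
  induction l generalizing f with
  | nil => simp
  | cons x l ih =>
    simp only [cut_cons, cut_nil, cut_add]
    rw [ih (fun u v w => f (x :: u) v w)]
    abel

theorem cut_swap₁ (l : List B) (F : List B → List B → List B → List B → List B → M) :
    (cut l fun l₁ t => cut t fun l₂ l₃ => cut l₁ fun u v => cut l₃ fun w z => F u v l₂ w z) =
      cut l fun u t => cut t fun v t => cut t fun l₂ t => cut t fun w z => F u v l₂ w z :=
  (cut_congr fun _ _ _ => cut_comm _ _ _).trans
    (cut_assoc l (fun u v t => cut t fun l₂ l₃ => cut l₃ fun w z => F u v l₂ w z))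

theorem cut_swap₂ (l : List B) (F : List B → List B → List B → List B → List B → M) :
    (cut l fun u t => cut t fun s z => cut s fun v s' => cut s' fun l₂ w => F u v l₂ w z) =
      cut l fun u t => cut t fun v t => cut t fun l₂ t => cut t fun w z => F u v l₂ w z :=
  cut_congr fun u t _ => (cut_assoc t (fun v s' z => cut s' fun l₂ w => F u v l₂ w z)).trans
    (cut_congr fun v t' _ => cut_assoc t' (fun l₂ w z => F u v l₂ w z))

theorem cut_swap₃ (l : List B) (F : List B → List B → List B → List B → List B → M) :
    (cut l fun l₁ t => cut t fun w z => cut l₁ fun u s => cut s fun v l₂ => F u v l₂ w z) =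
      cut l fun u t => cut t fun v t => cut t fun l₂ t => cut t fun w z => F u v l₂ w z :=
  (cut_congr fun _ _ _ => cut_comm _ _ _).trans
    ((cut_assoc l (fun u s t => cut t fun w z => cut s fun v l₂ => F u v l₂ w z)).trans
      (cut_congr fun _ _ _ => (cut_congr fun _ _ _ => cut_comm _ _ _).trans
        (cut_assoc _ (fun v l₂ t => cut t fun w z => F _ v l₂ w z))))

theorem cut3_append_cons (a : List B) (c : B) (b : List B)
    (f : List B → List B → List B → M) :
    cut3 (a ++ c :: b) f = cut3 a (fun u v w => f u v (w ++ c :: b)) +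
      cut a (fun u v => cut b (fun w t => f u (v ++ c :: w) t)) +
      cut3 b (fun u v w => f (a ++ c :: u) v w) := by
  unfold cut3
  rw [cut_append_cons]
  simp only [cut_append_cons, cut_add]

/-- If the summands pair off along the cuts, the sum telescopes. -/
theorem cut_telescope (l : List B) (f g : List B → List B → M)
    (h : ∀ u a v, f u (a :: v) + g (u ++ [a]) v = 0) :
    cut l f + cut l g = f l [] + g [] l := by
  induction l generalizing f g with
  | nil => simp
  | cons x l ih =>
    have h1 := ih (fun u v => f (x :: u) v) (fun u v => g (x :: u) v)
      (fun u a v => by simpa using h (x :: u) a v)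
    rw [cut_cons, cut_cons]
    have h2 := h [] x l
    simp only [List.nil_append] at h2
    calc _ = (cut l (fun u v => f (x :: u) v) + cut l (fun u v => g (x :: u) v))
          + f [] (x :: l) + g [] (x :: l) := by abel
      _ = f (x :: l) [] + g [] (x :: l) + (f [] (x :: l) + g [x] l) := by rw [h1]; abel
      _ = _ := by rw [h2, add_zero]

end Cuts

section Multilinear

variable {R S : Type*} [CommRing R] [CommRing S] {B B' M N : Type*}
  [AddCommGroup B] [Module R B] [AddCommGroup B'] [Module S B']
  [AddCommGroup M] [Module S M]

/-- A function of a finite list of arguments which is additive in each argument, and homogeneous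
in each argument along the ring homomorphism `σ`. -/
structure IsMultilin (σ : R →+* S) (f : List B → M) : Prop where
  add : ∀ u a b v, f (u ++ (a + b) :: v) = f (u ++ a :: v) + f (u ++ b :: v)
  smul : ∀ u (r : R) a v, f (u ++ (r • a) :: v) = σ r • f (u ++ a :: v)

/-- `f` vanishes as soon as one of its arguments is `e`. -/
def Kills (e : B) (f : List B → M) : Prop := ∀ u v, f (u ++ e :: v) = 0

variable {σ : R →+* S}

namespace IsMultilin

/-- The additive map in one slot. -/
def slot {f : List B → M} (hf : IsMultilin σ f) (u v : List B) : B →+ M :=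
  AddMonoidHom.mk' (fun a => f (u ++ a :: v)) (fun a b => hf.add u a b v)

theorem map_slot_cut {f : List B → M} (hf : IsMultilin σ f) (u v : List B) {C : Type*}
    (l : List C) (g : List C → List C → B) :
    f (u ++ cut l g :: v) = cut l (fun s t => f (u ++ g s t :: v)) :=
  map_cut (hf.slot u v) l g

theorem map_slot_zsmul {f : List B → M} (hf : IsMultilin σ f) (u v : List B) (c : ℤ) (a : B) :
    f (u ++ (c • a) :: v) = c • f (u ++ a :: v) := map_zsmul (hf.slot u v) c a

theorem map_slot_zero {f : List B → M} (hf : IsMultilin σ f) (u v : List B) :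
    f (u ++ 0 :: v) = 0 := map_zero (hf.slot u v)

theorem map_slot_neg {f : List B → M} (hf : IsMultilin σ f) (u v : List B) (a : B) :
    f (u ++ (-a) :: v) = - f (u ++ a :: v) := map_neg (hf.slot u v) a

theorem length_smul {f : List B → M} (hf : IsMultilin σ f) (c : ℕ → ℤ) :
    IsMultilin σ (fun l => c l.length • f l) where
  add u a b v := by simp [hf.add u a b v]
  smul u r a v := by
    rw [hf.smul u r a v, smul_comm]; simp

theorem const_smul {f : List B → M} (hf : IsMultilin σ f) (c : ℤ) :
    IsMultilin σ (fun l => c • f l) := hf.length_smul fun _ => c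

theorem add' {f g : List B → M} (hf : IsMultilin σ f) (hg : IsMultilin σ g) :
    IsMultilin σ (fun l => f l + g l) where
  add u a b v := by rw [hf.add, hg.add]; abel
  smul u r a v := by rw [hf.smul, hg.smul, smul_add]

theorem prefix_const {f : List B → M} (hf : IsMultilin σ f) (w : List B) :
    IsMultilin σ (fun l => f (w ++ l)) where
  add u a b v := by simpa using hf.add (w ++ u) a b v
  smul u r a v := by simpa using hf.smul (w ++ u) r a v

theorem suffix_const {f : List B → M} (hf : IsMultilin σ f) (w : List B) :
    IsMultilin σ (fun l => f (l ++ w)) where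
  add u a b v := by simpa using hf.add u a b (v ++ w)
  smul u r a v := by simpa using hf.smul u r a (v ++ w)

theorem cut' {f : List B → List B → M} (h1 : ∀ v, IsMultilin σ (fun u => f u v))
    (h2 : ∀ u, IsMultilin σ (f u)) : IsMultilin σ (fun l => cut l f) where
  add u a b v := by
    simp only [cut_append_cons, (h2 _).add, cut_add]
    have : ∀ s t, f (u ++ (a + b) :: s) t = f (u ++ a :: s) t + f (u ++ b :: s) t :=
      fun s t => (h1 t).add u a b s
    simp only [this, cut_add]
    abel
  smul u r a v := by
    simp only [cut_append_cons, (h2 _).smul]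
    have : ∀ s t, f (u ++ (r • a) :: s) t = σ r • f (u ++ a :: s) t :=
      fun s t => (h1 t).smul u r a s
    simp only [this, smul_add]
    congr 1 <;> simp [cut, Finset.smul_sum]

theorem cut3' {f : List B → List B → List B → M}
    (h1 : ∀ v w, IsMultilin σ (fun u => f u v w))
    (h2 : ∀ u w, IsMultilin σ (fun v => f u v w))
    (h3 : ∀ u v, IsMultilin σ (f u v)) : IsMultilin σ (fun l => cut3 l f) := by
  refine cut' (fun t => ?_) (fun u => cut' (h2 u) (h3 u))
  have key : ∀ t : List B, IsMultilin σ (fun u => cut t (fun v w => f u v w)) := fun t =>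
    { add := fun u a b v => by
        rw [← cut_add]; exact cut_congr fun s w _ => (h1 s w).add u a b v
      smul := fun u r a v => by
        have : ∀ s w, f (u ++ (r • a) :: v) s w = σ r • f (u ++ a :: v) s w :=
          fun s w => (h1 s w).smul u r a v
        simp only [this]; simp [cut, Finset.smul_sum] }
  exact key t

end IsMultilin

theorem Kills.cut' {e : B} {f : List B → List B → M} (h1 : ∀ v, Kills e (fun u => f u v))
    (h2 : ∀ u, Kills e (f u)) : Kills e (fun l => cut l f) := fun u v => by
  have : ∀ s t, f (u ++ e :: s) t = 0 := fun s t => h1 t u s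
  have h2' : ∀ s a b, f s (a ++ e :: b) = 0 := fun s a b => h2 s a b
  simp [cut_append_cons, h2', this, cut_zero]

theorem Kills.cut3' {e : B} {f : List B → List B → List B → M}
    (h1 : ∀ v w, Kills e (fun u => f u v w))
    (h2 : ∀ u w, Kills e (fun v => f u v w))
    (h3 : ∀ u v, Kills e (f u v)) : Kills e (fun l => cut3 l f) := by
  refine Kills.cut' (fun t => ?_) (fun u => Kills.cut' (h2 u) (h3 u))
  intro u v
  have : ∀ s w, f (u ++ e :: v) s w = 0 := fun s w => h1 s w u v
  simp [this, cut_zero]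

end Multilinear

section Braces

variable {R : Type*} [CommRing R] {B M : Type*}
  [AddCommGroup B] [Module R B] [AddCommGroup M] [Module R M]

/-- The brace `φ{x}` for a cochain `x` of degree `p` (that is, with `p + 1` arguments):
`φ{x}(b₁,…,bₙ) = ∑ (-1)^(p i) φ(b₁,…,bᵢ, x(bᵢ₊₁,…), …,bₙ)`. -/
def brace (p : ℤ) (φ : List B → M) (x : List B → B) (l : List B) : M :=
  cut3 l fun u v w => sgn (p * u.length) • φ (u ++ x v :: w)

/-- `x` vanishes on lists whose length is not `p + 1`. -/
def HasDegree (p : ℤ) (x : List B → M) : Prop := ∀ l : List B, (l.length : ℤ) ≠ p + 1 → x l = 0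

/-- The Gerstenhaber bracket `[x,y] = x{y} - (-1)^(pq) y{x}` of cochains of degrees `p`, `q`. -/
def gbr (p q : ℤ) (x y : List B → B) (l : List B) : B :=
  brace q x y l - sgn (p * q) • brace p y x l

theorem brace_multilin {p : ℤ} {φ : List B → M} {x : List B → B}
    (hφ : IsMultilin (RingHom.id R) φ) (hx : IsMultilin (RingHom.id R) x) :
    IsMultilin (RingHom.id R) (brace p φ x) := by
  refine IsMultilin.cut3' (fun v w => ?_) (fun u w => ?_) (fun u v => ?_)
  · exact (hφ.suffix_const (x v :: w)).length_smul fun n => sgn (p * n)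
  · refine IsMultilin.const_smul ?_ _
    exact { add := fun s a b t => by rw [hx.add, hφ.add]
            smul := fun s r a t => by rw [hx.smul]; exact hφ.smul _ _ _ _ }
  · refine IsMultilin.const_smul ?_ _
    have := hφ.prefix_const (u ++ [x v])
    simpa using this

theorem brace_kills {p : ℤ} {e : B} {φ : List B → M} {x : List B → B}
    (hφm : IsMultilin (RingHom.id R) φ) (hφ : Kills e φ) (hx : Kills e x) :
    Kills e (brace p φ x) := by
  refine Kills.cut3' (fun v w s t => ?_) (fun u w s t => ?_) (fun u v s t => ?_)
  · have := hφ s (t ++ x v :: w)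
    simp only [List.append_assoc, List.cons_append]
    rw [this, smul_zero]
  · simp only
    rw [hx s t, hφm.map_slot_zero, smul_zero]
  · have := hφ (u ++ x v :: s) t
    simp only [List.append_assoc, List.cons_append] at this
    rw [this, smul_zero]

theorem brace_hasDegree {p q : ℤ} {φ : List B → M} {x : List B → B}
    (hφm : IsMultilin (RingHom.id R) φ) (hφ : HasDegree p φ) (hx : HasDegree q x) :
    HasDegree (p + q) (brace q φ x) := by
  intro l hl
  unfold brace cut3
  rw [← cut_zero l]
  refine cut_congr fun u t h => ?_
  rw [← cut_zero t]
  refine cut_congr fun v w h' => ?_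
  subst h'; subst h
  show sgn (q * u.length) • φ (u ++ x v :: w) = 0
  by_cases hv : (v.length : ℤ) = q + 1
  · rw [hφ, smul_zero]
    simp only [List.length_append, List.length_cons] at hl ⊢
    push_cast at hl ⊢; omega
  · rw [hx v hv, hφm.map_slot_zero, smul_zero]

theorem brace_append_cons (p : ℤ) (φ : List B → M) (x : List B → B) (a : List B) (c : B)
    (b : List B) :
    brace p φ x (a ++ c :: b) =
      cut3 a (fun u v w => sgn (p * u.length) • φ (u ++ x v :: (w ++ c :: b))) +
      cut a (fun u v => cut b (fun w t => sgn (p * u.length) • φ (u ++ x (v ++ c :: w) :: t))) +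
      cut3 b (fun u v w => sgn (p * (a.length + 1 + u.length)) •
        φ (a ++ c :: (u ++ x v :: w))) := by
  unfold brace
  rw [cut3_append_cons]
  simp [add_assoc, add_comm (1 : ℤ)]

theorem brace_brace {p q : ℤ} {φ : List B → M} {x y : List B → B}
    (hφ : IsMultilin (RingHom.id R) φ) (l : List B) :
    brace q (brace p φ x) y l = brace (p + q) φ (brace q x y) l +
      (cut l fun m₁ t => cut t fun m₂ t => cut t fun v t => cut t fun l₂ l₃ =>
        sgn (q * (m₁.length + m₂.length + v.length) + p * m₁.length) •
          φ (m₁ ++ x m₂ :: (v ++ y l₂ :: l₃))) +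
      (cut l fun m₁ t => cut t fun m₂ t => cut t fun v t => cut t fun l₂ l₃ =>
        sgn (q * m₁.length + p * (m₁.length + 1 + v.length)) •
          φ (m₁ ++ y m₂ :: (v ++ x l₂ :: l₃))) := by
  have e1 : brace q (brace p φ x) y l =
      cut3 l (fun l₁ l₂ l₃ => sgn (q * l₁.length) •
        cut3 l₁ (fun u v w => sgn (p * u.length) • φ (u ++ x v :: (w ++ y l₂ :: l₃)))) +
      cut3 l (fun l₁ l₂ l₃ => sgn (q * l₁.length) •
        cut l₁ (fun u v => cut l₃ (fun w t => sgn (p * u.length) •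
          φ (u ++ x (v ++ y l₂ :: w) :: t)))) +
      cut3 l (fun l₁ l₂ l₃ => sgn (q * l₁.length) •
        cut3 l₃ (fun u v w => sgn (p * (l₁.length + 1 + u.length)) •
          φ (l₁ ++ y l₂ :: (u ++ x v :: w)))) := by
    rw [brace]
    simp only [brace_append_cons, smul_add]
    unfold cut3
    simp only [cut_add]
  rw [e1, add_comm (cut3 l _) (cut3 l _)]
  unfold cut3
  simp only [cut_zsmul, sgn_smul_smul]
  congr 1
  · congr 1
    · unfold brace cut3
      simp only [hφ.map_slot_cut, hφ.map_slot_zsmul, cut_zsmul, sgn_smul_smul]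
      refine (cut_congr fun l₁ t h₁ => cut_congr fun l₂ l₃ h₂ => cut_congr fun u v h₃ =>
        cut_congr fun w z h₄ => ?_).trans ((cut_swap₁ l (fun u v l₂ w z =>
          sgn (q * (u.length + v.length) + p * u.length) •
            φ (u ++ x (v ++ y l₂ :: w) :: z))).trans ?_)
      · subst h₃; simp
      · refine Eq.trans ?_ (cut_swap₂ l _).symm
        refine cut_congr fun u t h₁ => cut_congr fun v t' h₂ => cut_congr fun l₂ t'' h₃ =>
          cut_congr fun w z h₄ => ?_
        congr 2; ring
    · refine (cut_congr fun l₁ t h₁ => cut_congr fun l₂ l₃ h₂ => cut_congr fun u s h₃ =>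
        cut_congr fun v w h₄ => ?_).trans (cut_swap₃ l (fun u v w l₂ l₃ =>
          sgn (q * (u.length + v.length + w.length) + p * u.length) •
            φ (u ++ x v :: (w ++ y l₂ :: l₃))))
      subst h₄; subst h₃; simp [add_assoc]

theorem brace_prelie {p q : ℤ} {φ : List B → M} {x y : List B → B}
    (hφ : IsMultilin (RingHom.id R) φ) (hx : HasDegree p x) (hy : HasDegree q y) (l : List B) :
    brace q (brace p φ x) y l - brace (p + q) φ (brace q x y) l =
      sgn (p * q) • (brace p (brace q φ y) x l - brace (p + q) φ (brace p y x) l) := by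
  have key : ∀ {p q : ℤ} {x y : List B → B}, HasDegree p x → 
      (cut l fun m₁ t => cut t fun m₂ t => cut t fun v t => cut t fun l₂ l₃ =>
        sgn (q * (m₁.length + m₂.length + v.length) + p * m₁.length) •
          φ (m₁ ++ x m₂ :: (v ++ y l₂ :: l₃))) = sgn (p * q) •
      (cut l fun m₁ t => cut t fun m₂ t => cut t fun v t => cut t fun l₂ l₃ =>
        sgn (p * m₁.length + q * (m₁.length + 1 + v.length)) •
          φ (m₁ ++ x m₂ :: (v ++ y l₂ :: l₃))) := by
    intro p q x y hx
    simp only [cut_zsmul, sgn_smul_smul]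
    refine cut_congr fun m₁ t _ => cut_congr fun m₂ t _ => cut_congr fun v t _ =>
      cut_congr fun l₂ l₃ _ => ?_
    by_cases h : (m₂.length : ℤ) = p + 1
    · congr 1
      refine sgn_congr ⟨0, ?_⟩
      rw [h]; ring
    · rw [hx _ h, hφ.map_slot_zero, smul_zero, smul_zero]
  rw [brace_brace hφ, brace_brace hφ, add_comm q p, key hx, key hy]
  simp only [add_assoc, add_sub_cancel_left, smul_add, mul_comm q p, smul_smul, sgn_mul_sgn_self,
    one_smul]
  rw [add_comm]

end Braces

section Unital

variable {R : Type*} [CommRing R] {B M : Type*}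
  [AddCommGroup B] [Module R B] [AddCommGroup M] [Module R M]

theorem cut_eq_left {l : List B} {f : List B → List B → M} (h : ∀ u v, u ≠ [] → f u v = 0) :
    cut l f = f [] l := by
  cases l with
  | nil => simp
  | cons a l =>
    rw [cut_cons]
    simp [h _ _ (List.cons_ne_nil _ _), cut_zero]

theorem cut_eq_right {l : List B} {f : List B → List B → M} (h : ∀ u v, v ≠ [] → f u v = 0) :
    cut l f = f l [] := by
  rcases List.eq_nil_or_concat l with rfl | ⟨l, a, rfl⟩
  · simp
  · rw [List.concat_eq_append, cut_append_cons]
    simp [h, cut_zero]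

/-- `-μ` has the two-sided unit `e`. -/
def IsUnital (e : B) (μ : List B → B) : Prop := ∀ a, μ [e, a] = -a ∧ μ [a, e] = -a

theorem brace_unital {e : B} {φ : List B → M} {μ : List B → B}
    (hφm : IsMultilin (RingHom.id R) φ) (hφ : Kills e φ) (hμ : HasDegree 1 μ)
    (hu : IsUnital e μ) (u v : List B) :
    brace 1 φ μ (u ++ e :: v) = (if v = [] then 0 else - sgn u.length • φ (u ++ v)) +
      (if u = [] then 0 else sgn u.length • φ (u ++ v)) := by
  have hφ' : ∀ s a t w, φ (s ++ a :: (t ++ e :: w)) = 0 := fun s a t w => by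
    simpa using hφ (s ++ a :: t) w
  have hφ'' : ∀ s t, φ (s ++ e :: t) = 0 := hφ
  have z : ∀ (s t : List B) a b c d, (a ++ b :: c :: d).length ≠ 2 →
      φ (s ++ μ (a ++ b :: c :: d) :: t) = 0 := fun s t a b c d h => by
    rw [hμ _ (by exact_mod_cast h), hφm.map_slot_zero]
  rw [brace_append_cons]
  simp only [hφ', hφ'', smul_zero]
  unfold cut3
  simp only [cut_zero, zero_add, add_zero]
  have len : ∀ (s t a b : List B), a.length + b.length ≠ 1 →
      φ (s ++ μ (a ++ e :: b) :: t) = 0 := fun s t a b h => by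
    rw [hμ _ (by simp; omega), hφm.map_slot_zero]
  have inner0 : ∀ m : List B, (cut v fun w t => sgn (1 * m.length) • φ (m ++ μ ([] ++ e :: w) :: t))
      = if v = [] then 0 else - sgn m.length • φ (m ++ v) := by
    intro m
    cases v with
    | nil =>
      have := len m [] [] [] (by simp)
      simp only [List.nil_append] at this
      simp [this]
    | cons a v =>
      rw [cut_cons, len _ _ _ _ (by simp), smul_zero, zero_add, cut_eq_left]
      · simp [(hu a).1, hφm.map_slot_neg]
      · intro s t hs
        rw [len, smul_zero]
        have := List.length_pos_iff.2 hs
        simp; omega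
  have inner1 : ∀ (m : List B) a, (cut v fun w t => sgn (1 * m.length) •
      φ (m ++ μ ([a] ++ e :: w) :: t)) = - sgn m.length • φ (m ++ a :: v) := by
    intro m a
    rw [cut_eq_left]
    · simp [(hu a).2, hφm.map_slot_neg]
    · intro s t hs
      rw [len, smul_zero]
      have := List.length_pos_iff.2 hs
      simp; omega
  have inner2 : ∀ m s : List B, 2 ≤ s.length → (cut v fun w t => sgn (1 * m.length) •
      φ (m ++ μ (s ++ e :: w) :: t)) = 0 := by
    intro m s hs
    rw [← cut_zero v]
    refine cut_congr fun w t _ => ?_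
    rw [len _ _ _ _ (by omega), smul_zero]
  rcases List.eq_nil_or_concat u with rfl | ⟨u, a, rfl⟩
  · rw [cut_nil, inner0]; simp
  · rw [List.concat_eq_append, cut_append_cons, cut_nil, inner0, cut_eq_right]
    · rw [List.nil_append, show [a] = [a] ++ [] from rfl, List.append_nil]
      rw [inner1]
      rw [add_comm]
      congr 1
      simp [sgn_add, show sgn 1 = -1 from rfl]
    · intro s t ht
      apply inner2
      have := List.length_pos_iff.2 ht
      simp; omega

theorem gbr_unital_kills {p : ℤ} {e : B} {x μ : List B → B}
    (hxm : IsMultilin (RingHom.id R) x) (hx : Kills e x) (hxd : HasDegree p x)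
    (hμm : IsMultilin (RingHom.id R) μ) (hμ : HasDegree 1 μ)
    (hu : IsUnital e μ) : Kills e (gbr 1 p μ x) := by
  intro u v
  unfold gbr
  rw [brace_unital hxm hx hμ hu, brace_append_cons]
  have hx' : ∀ s t, x (s ++ e :: t) = 0 := hx
  have h2 : (cut u fun m s => cut v fun w t => sgn (p * m.length) •
      μ (m ++ x (s ++ e :: w) :: t)) = 0 := by
    simp [hx', hμm.map_slot_zero, cut_zero]
  have h1 : (cut3 u fun m s w => sgn (p * m.length) • μ (m ++ x s :: (w ++ e :: v))) =
      if v = [] then - x u else 0 := by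
    have z : ∀ m s w : List B, m.length + w.length + v.length ≠ 0 →
        μ (m ++ x s :: (w ++ e :: v)) = 0 := fun m s w h => hμ _ (by simp; omega)
    unfold cut3
    rw [cut_eq_left, cut_eq_right]
    · split_ifs with hv
      · subst hv; simp [(hu _).2]
      · dsimp only; rw [z _ _ _ (by simpa using hv), smul_zero]
    · intro s w hw
      dsimp only; rw [z _ _ _ (by simp [hw]), smul_zero]
    · intro m t hm
      rw [← cut_zero t]
      refine cut_congr fun s w _ => ?_
      dsimp only; rw [z _ _ _ (by simp [hm]), smul_zero]
  have h3 : (cut3 v fun m s w => sgn (p * (u.length + 1 + m.length)) •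
      μ (u ++ e :: (m ++ x s :: w))) = if u = [] then - sgn p • x v else 0 := by
    have z : ∀ m s w : List B, u.length + m.length + w.length ≠ 0 →
        μ (u ++ e :: (m ++ x s :: w)) = 0 := fun m s w h => hμ _ (by simp; omega)
    unfold cut3
    rw [cut_eq_left, cut_eq_right]
    · split_ifs with hv
      · subst hv; simp [(hu _).1]
      · dsimp only; rw [z _ _ _ (by simpa using hv), smul_zero]
    · intro s w hw
      dsimp only; rw [z _ _ _ (by simp [hw]), smul_zero]
    · intro m t hm
      rw [← cut_zero t]
      refine cut_congr fun s w _ => ?_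
      dsimp only; rw [z _ _ _ (by simp [hm]), smul_zero]
  rw [h1, h2, h3]
  have hs : ∀ l, x l = 0 ∨ sgn (p + l.length) • x l = - x l := by
    intro l
    by_cases h : (l.length : ℤ) = p + 1
    · right
      rw [h, sgn_neg_of (b := 0) ⟨p, by ring⟩]; simp
    · exact Or.inl (hxd l h)
  by_cases hu0 : u = [] <;> by_cases hv0 : v = []
  · subst hu0; subst hv0
    rcases hs [] with h | h
    · simp [h]
    · simp at h ⊢; simp [h]
  · subst hu0; simp [hv0]
  · subst hv0
    rcases hs u with h | h
    · simp [h, hu0]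
    · simp only [if_true, hu0, if_false, List.append_nil, zero_add, one_mul, sgn_smul_smul, h]
      simp
  · simp [hu0, hv0]

end Unital

section Chains

variable (R : Type*) [CommRing R] {B : Type*} [AddCommGroup B] [Module R B] (e : B)

/-- The relations which present `⨁ₙ B ⊗ (B/Re)^{⊗ n}` on the words `b₀ ⊗ b₁ ⊗ ⋯ ⊗ bₙ`: a word is
`R`-linear in each letter, and it vanishes if one of the letters `b₁,…,bₙ` is `e`. -/
noncomputable def chainRel : Submodule R ((B × List B) →₀ R) := Submodule.span R
  ({z | ∃ a b l, z = .single (a + b, l) 1 - .single (a, l) 1 - .single (b, l) 1} ∪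
   {z | ∃ (r : R) (a : B) (l : List B), z = .single (r • a, l) 1 - r • .single (a, l) 1} ∪
   {z | ∃ b₀ u a b v, z = .single (b₀, u ++ (a + b) :: v) 1 - .single (b₀, u ++ a :: v) 1 -
      .single (b₀, u ++ b :: v) 1} ∪
   {z | ∃ (b₀ : B) (u : List B) (r : R) (a : B) (v : List B),
      z = .single (b₀, u ++ (r • a) :: v) 1 - r • .single (b₀, u ++ a :: v) 1} ∪
   {z | ∃ b₀ u v, z = .single (b₀, u ++ e :: v) 1})

/-- The normalized Hochschild chains `⨁ₙ B ⊗ (B/Re)^{⊗ n}` of a module `B` with a distinguished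
element `e` (which will be the unit of an `R`-algebra structure on `B`). -/
abbrev NChain : Type _ := ((B × List B) →₀ R) ⧸ chainRel R e

/-- The chain `b₀ ⊗ b₁ ⊗ ⋯ ⊗ bₙ`. -/
noncomputable def word (b₀ : B) (l : List B) : NChain R e :=
  (chainRel R e).mkQ (.single (b₀, l) 1)

/-- The functions of words which define (semi)linear maps on normalized chains. -/
structure IsChainFun {R S : Type*} [CommRing R] [CommRing S] {B M : Type*} [AddCommGroup B]
    [Module R B] [AddCommGroup M] [Module S M] (σ : R →+* S) (e : B) (F : B → List B → M) :
    Prop where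
  add : ∀ a b l, F (a + b) l = F a l + F b l
  smul : ∀ (r : R) a l, F (r • a) l = σ r • F a l
  multilin : ∀ b, IsMultilin σ (F b)
  kills : ∀ b, Kills e (F b)

theorem word_isChainFun : IsChainFun (RingHom.id R) e (word R e) := by
  have key : ∀ {z : (B × List B) →₀ R}, z ∈ chainRel R e → (chainRel R e).mkQ z = 0 :=
    fun h => (Submodule.Quotient.mk_eq_zero _).2 h
  refine ⟨fun a b l => ?_, fun r a l => ?_, fun b₀ => ⟨fun u a b v => ?_, fun u r a v => ?_⟩,
    fun b₀ u v => ?_⟩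
  · have := key (Submodule.subset_span (Or.inl (Or.inl (Or.inl (Or.inl ⟨a, b, l, rfl⟩)))))
    rw [map_sub, map_sub, sub_sub, sub_eq_zero] at this
    exact this
  · have := key (Submodule.subset_span (Or.inl (Or.inl (Or.inl (Or.inr ⟨r, a, l, rfl⟩)))))
    rw [map_sub, map_smul, sub_eq_zero] at this
    exact this
  · have := key (Submodule.subset_span (Or.inl (Or.inl (Or.inr ⟨b₀, u, a, b, v, rfl⟩))))
    rw [map_sub, map_sub, sub_sub, sub_eq_zero] at this
    exact this
  · have := key (Submodule.subset_span (Or.inl (Or.inr ⟨b₀, u, r, a, v, rfl⟩)))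
    rw [map_sub, map_smul, sub_eq_zero] at this
    exact this
  · exact key (Submodule.subset_span (Or.inr ⟨b₀, u, v, rfl⟩))

variable {R e}

/-- The (semi)linear map on normalized chains given by a function of words. -/
noncomputable def NChain.lift {S M : Type*} [CommRing S] [AddCommGroup M] [Module S M]
    {σ : R →+* S} {F : B → List B → M} (hF : IsChainFun σ e F) : NChain R e →ₛₗ[σ] M :=
  (chainRel R e).liftQ
    { toFun := fun z => z.sum fun w r => σ r • F w.1 w.2
      map_add' := fun z z' => Finsupp.sum_add_index' (by simp) (by simp [add_smul])
      map_smul' := fun r z => by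
        rw [Finsupp.sum_smul_index (by simp), Finsupp.smul_sum]
        simp [mul_smul] }
    (by
      unfold chainRel
      rw [Submodule.span_le]
      have h1 : ∀ (r : R) w, (Finsupp.single w r).sum (fun (w : B × List B) r => σ r • F w.1 w.2) =
          σ r • F w.1 w.2 := fun r w => Finsupp.sum_single_index (by simp)
      rintro z ((((⟨a, b, l, rfl⟩ | ⟨r, a, l, rfl⟩) | ⟨b₀, u, a, b, v, rfl⟩) |
        ⟨b₀, u, r, a, v, rfl⟩) | ⟨b₀, u, v, rfl⟩) <;>
      rw [SetLike.mem_coe, LinearMap.mem_ker]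
      · rw [map_sub, map_sub]; simp [h1, hF.add]
      · rw [map_sub, map_smulₛₗ]; simp [h1, hF.smul]
      · rw [map_sub, map_sub]; simp [h1, (hF.multilin b₀).add]
      · rw [map_sub, map_smulₛₗ]; simp [h1, (hF.multilin b₀).smul]
      · have : F b₀ (u ++ e :: v) = 0 := hF.kills b₀ u v
        simp [h1, this])

@[simp] theorem NChain.lift_word {S M : Type*} [CommRing S] [AddCommGroup M] [Module S M]
    {σ : R →+* S} {F : B → List B → M} (hF : IsChainFun σ e F) (b₀ : B) (l : List B) :
    NChain.lift hF (word R e b₀ l) = F b₀ l := by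
  show ((Finsupp.single (b₀, l) (1 : R)).sum fun w r => σ r • F w.1 w.2) = _
  rw [Finsupp.sum_single_index (by simp)]; simp

theorem NChain.hom_ext {S M : Type*} [CommRing S] [AddCommGroup M] [Module S M]
    {σ : R →+* S} {f g : NChain R e →ₛₗ[σ] M} (h : ∀ b₀ l, f (word R e b₀ l) = g (word R e b₀ l)) :
    f = g := by
  refine LinearMap.ext fun z => ?_
  obtain ⟨z, rfl⟩ := (chainRel R e).mkQ_surjective z
  induction z using Finsupp.induction_linear with
  | zero => simp
  | add a b ha hb => rw [map_add, map_add, map_add, ha, hb]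
  | single w r =>
    have : Finsupp.single w r = r • Finsupp.single w (1 : R) := by simp
    rw [this, map_smul, map_smulₛₗ, map_smulₛₗ]
    congr 1
    exact h w.1 w.2

end Chains

section Operators

variable {R : Type*} [CommRing R] {B : Type*} [AddCommGroup B] [Module R B] {e : B}

/-- The terms of the Lie derivative in which the head `b₀` of a chain is an argument of `x`:
`∑ (-1)^(n(i+1)+p) x(bᵢ₊₁,…,bₙ,b₀,…,bⱼ) ⊗ bⱼ₊₁ ⊗ ⋯ ⊗ bᵢ`. -/
noncomputable def wrap (R : Type*) [CommRing R] {B : Type*} [AddCommGroup B] [Module R B] (e : B)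
    (p : ℤ) (x : List B → B) (b₀ : B) (l : List B) : NChain R e :=
  cut3 l fun u v w =>
    sgn ((u.length + v.length + w.length) * (u.length + v.length + 1) + p) •
      word R e (x (w ++ b₀ :: u)) v

/-- The Lie derivative `L_x(b₀ ⊗ ⋯ ⊗ bₙ)` along a cochain `x` of degree `p`:
`∑ (-1)^(p i) b₀ ⊗ ⋯ ⊗ bᵢ ⊗ x(bᵢ₊₁,…) ⊗ ⋯ ⊗ bₙ`, together with the terms of `wrap`. -/
noncomputable def lieFun (R : Type*) [CommRing R] {B : Type*} [AddCommGroup B] [Module R B] (e : B)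
    (p : ℤ) (x : List B → B) (b₀ : B) (l : List B) : NChain R e :=
  brace p (word R e b₀) x l + wrap R e p x b₀ l

/-- The additive map `a ↦ a ⊗ b₁ ⊗ ⋯ ⊗ bₙ`. -/
noncomputable def wordHead (R : Type*) [CommRing R] {B : Type*} [AddCommGroup B] [Module R B]
    (e : B) (v : List B) : B →+ NChain R e :=
  AddMonoidHom.mk' (fun a => word R e a v) fun a b => (word_isChainFun R e).add a b v

theorem word_cut (l : List B) (g : List B → List B → B) (v : List B) :
    word R e (cut l g) v = cut l (fun s t => word R e (g s t) v) :=
  map_cut (wordHead R e v) l g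

theorem word_zsmul (c : ℤ) (a : B) (v : List B) : word R e (c • a) v = c • word R e a v :=
  map_zsmul (wordHead R e v) c a

theorem word_zero (v : List B) : word R e 0 v = 0 := map_zero (wordHead R e v)

theorem word_neg (a : B) (v : List B) : word R e (-a) v = - word R e a v :=
  map_neg (wordHead R e v) a

theorem word_degen (b₀ : B) (u v : List B) : word R e b₀ (u ++ e :: v) = 0 :=
  (word_isChainFun R e).kills b₀ u v

theorem word_multilin (b₀ : B) : IsMultilin (RingHom.id R) (word R e b₀) :=
  (word_isChainFun R e).multilin b₀

theorem wrap_multilin {p : ℤ} {x : List B → B} (hx : IsMultilin (RingHom.id R) x) (b₀ : B) :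
    IsMultilin (RingHom.id R) (wrap R e p x b₀) := by
  refine IsMultilin.cut3' (fun v w => ?_) (fun u w => ?_) (fun u v => ?_)
  · refine IsMultilin.length_smul (f := fun u => word R e (x (w ++ b₀ :: u)) v) ?_
      (fun n => sgn ((n + v.length + w.length) * (n + v.length + 1) + p))
    have h := hx.prefix_const (w ++ [b₀])
    exact { add := fun s a b t => by
              have := h.add s a b t
              simp only [List.append_assoc, List.cons_append, List.nil_append] at this ⊢
              rw [this, (word_isChainFun R e).add]
            smul := fun s r a t => by
              have := h.smul s r a t
              simp only [List.append_assoc, List.cons_append, List.nil_append] at this ⊢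
              rw [this, (word_isChainFun R e).smul]; rfl }
  · exact (word_multilin (x (w ++ b₀ :: u))).length_smul
      (fun n => sgn ((u.length + n + w.length) * (u.length + n + 1) + p))
  · refine IsMultilin.length_smul (f := fun w => word R e (x (w ++ b₀ :: u)) v) ?_
      (fun n => sgn ((u.length + v.length + n) * (u.length + v.length + 1) + p))
    have h := hx.suffix_const (b₀ :: u)
    exact { add := fun s a b t => by
              rw [h.add s a b t, (word_isChainFun R e).add]
            smul := fun s r a t => by
              rw [h.smul s r a t, (word_isChainFun R e).smul]; rfl }

theorem wrap_kills {p : ℤ} {x : List B → B} (hx : Kills e x) (b₀ : B) :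
    Kills e (wrap R e p x b₀) := by
  refine Kills.cut3' (fun v w s t => ?_) (fun u w s t => ?_) (fun u v s t => ?_)
  · have := hx (w ++ b₀ :: s) t
    simp only [List.append_assoc, List.cons_append] at this ⊢
    rw [this, word_zero, smul_zero]
  · simp only
    rw [word_degen, smul_zero]
  · have := hx s (t ++ b₀ :: u)
    simp only [List.append_assoc, List.cons_append] at this ⊢
    rw [this, word_zero, smul_zero]

/-- `lieFun` is linear in the head and in the tail of a chain. -/
theorem lieFun_isChainFun_of {p : ℤ} {x : List B → B} (hx : IsMultilin (RingHom.id R) x)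
    (hk : ∀ b₀, Kills e (lieFun R e p x b₀)) :
    IsChainFun (RingHom.id R) e (lieFun R e p x) where
  add a b l := by
    unfold lieFun brace wrap cut3
    have : ∀ (w u : List B), x (w ++ (a + b) :: u) = x (w ++ a :: u) + x (w ++ b :: u) :=
      fun w u => hx.add w a b u
    simp only [this, (word_isChainFun R e).add, smul_add, cut_add]
    abel
  smul r a l := by
    unfold lieFun brace wrap cut3
    have : ∀ (w u : List B), x (w ++ (r • a) :: u) = r • x (w ++ a :: u) :=
      fun w u => hx.smul w r a u
    have h2 : ∀ b v, word R e (r • b) v = r • word R e b v := fun b v =>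
      (word_isChainFun R e).smul r b v
    simp only [this, h2, smul_comm _ r, smul_add]
    congr 1 <;> simp only [cut, Finset.smul_sum, RingHom.id_apply]
  multilin b := (brace_multilin (word_multilin b) hx).add' (wrap_multilin hx b)
  kills := hk

theorem lieFun_isChainFun {p : ℤ} {x : List B → B} (hx : IsMultilin (RingHom.id R) x)
    (hk : Kills e x) : IsChainFun (RingHom.id R) e (lieFun R e p x) :=
  lieFun_isChainFun_of hx fun b₀ u v => by
    have h1 : brace p (word R e b₀) x (u ++ e :: v) = 0 :=
      brace_kills (word_multilin b₀) ((word_isChainFun R e).kills b₀) hk u v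
    have h2 : wrap R e p x b₀ (u ++ e :: v) = 0 := wrap_kills hk b₀ u v
    rw [lieFun, h1, h2, add_zero]

theorem lieFun_isChainFun_unital {μ : List B → B} (hμm : IsMultilin (RingHom.id R) μ)
    (hμ : HasDegree 1 μ) (hu : IsUnital e μ) :
    IsChainFun (RingHom.id R) e (lieFun R e 1 μ) := by
  refine lieFun_isChainFun_of hμm fun b₀ u v => ?_
  unfold lieFun
  rw [brace_unital (word_multilin b₀) ((word_isChainFun R e).kills b₀) hμ hu]
  have hw : wrap R e 1 μ b₀ (u ++ e :: v) =
      (if v = [] then - sgn u.length • word R e b₀ u else 0) +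
        (if u = [] then word R e b₀ v else 0) := by
    unfold wrap
    rw [cut3_append_cons]
    simp only [word_degen, smul_zero, cut_zero, add_zero]
    have z : ∀ l v, l.length ≠ 2 → word R e (μ l) v = 0 := fun l v h => by
      rw [hμ l (by exact_mod_cast h), word_zero]
    congr 1
    · unfold cut3
      rw [cut_eq_left, cut_eq_right]
      · dsimp only
        split_ifs with h
        · subst h
          simp only [List.nil_append, (hu b₀).1, word_neg, List.cons_append]
          rw [smul_neg, neg_smul]
          congr 2
          refine sgn_congr ?_
          simp only [List.length_nil, List.length_cons]
          push_cast
          obtain ⟨c, hc⟩ := Int.even_mul_succ_self (u.length : ℤ)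
          exact ⟨c + 1, by linear_combination hc⟩
        · rw [z _ _ (by simpa using h), smul_zero]
      · intro s w hw
        dsimp only
        rw [z _ _ (by have := List.length_pos_iff.2 hw; simp; omega), smul_zero]
      · intro m t hm
        rw [← cut_zero t]
        refine cut_congr fun s w _ => ?_
        dsimp only
        rw [z _ _ (by have := List.length_pos_iff.2 hm; simp; omega), smul_zero]
    · unfold cut3
      rw [cut_eq_left, cut_eq_right]
      · dsimp only
        split_ifs with h
        · subst h
          simp only [List.nil_append, (hu b₀).2, word_neg]
          rw [sgn_neg_of (b := 0) (by
            simp only [List.length_nil, List.length_cons]; push_cast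
            obtain ⟨c, hc⟩ := Int.even_mul_succ_self ((v.length : ℤ) + 1)
            exact ⟨c, by linear_combination hc⟩)]
          simp
        · rw [z _ _ (by simpa using h), smul_zero]
      · intro s w hw
        dsimp only
        rw [z _ _ (by have := List.length_pos_iff.2 hw; simp; omega), smul_zero]
      · intro m t hm
        rw [← cut_zero t]
        refine cut_congr fun s w _ => ?_
        dsimp only
        rw [z _ _ (by have := List.length_pos_iff.2 hm; simp; omega), smul_zero]
  rw [hw]
  by_cases hu0 : u = [] <;> by_cases hv0 : v = [] <;> simp [hu0, hv0]


theorem lieFun_sub {p : ℤ} (x y : List B → B) (c : ℤ) (b₀ : B) (l : List B) :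
    lieFun R e p (fun l => x l - c • y l) b₀ l = lieFun R e p x b₀ l - c • lieFun R e p y b₀ l := by
  have h1 : ∀ u a b v, word R e b₀ (u ++ (a - c • b) :: v) =
      word R e b₀ (u ++ a :: v) - c • word R e b₀ (u ++ b :: v) := fun u a b v => by
    have := map_sub ((word_multilin (R := R) (e := e) b₀).slot u v) a (c • b)
    rw [map_zsmul] at this; exact this
  have h2 : ∀ a b v, word R e (a - c • b) v = word R e a v - c • word R e b v := fun a b v => by
    have := map_sub (wordHead R e v) a (c • b)
    rw [map_zsmul] at this; exact this
  unfold lieFun brace wrap cut3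
  simp only [h1, h2, smul_sub, smul_add, cut_zsmul, smul_comm _ c]
  simp only [sub_eq_add_neg, cut_add]
  have neg : ∀ (l : List B) (f : List B → List B → NChain R e),
      cut l (fun u v => - f u v) = - cut l f := fun l f => by simp [cut]
  simp only [neg]
  abel

theorem cut_swap₄ {M : Type*} [AddCommGroup M] (l : List B)
    (F : List B → List B → List B → List B → List B → M) :
    (cut l fun s t => cut t fun v s' => cut s' fun w z => cut s fun u u' => F u u' v w z) =
      cut l fun u t => cut t fun u' t => cut t fun v t => cut t fun w z => F u u' v w z := by
  refine Eq.trans (cut_congr fun s t _ => ?_)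
    (cut_assoc l (fun u u' t => cut t fun v s' => cut s' fun w z => F u u' v w z))
  refine Eq.trans (cut_congr fun v s' _ => cut_comm _ _ _) (cut_comm _ _ _)

/-- The terms of `L_x L_y` in which `x` meets the head of the chain, and `y` does not meet the
arguments of `x`. -/
noncomputable def apart (R : Type*) [CommRing R] {B : Type*} [AddCommGroup B] [Module R B] (e : B)
    (p q : ℤ) (x y : List B → B) (b₀ : B) (l : List B) : NChain R e :=
  cut l fun u t => cut t fun v t => cut t fun l₂ t => cut t fun w z =>
    sgn (q * (u.length + v.length) + ((u.length + (v.length + 1 + w.length) + z.length) *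
      (u.length + (v.length + 1 + w.length) + 1) + p)) •
      word R e (x (z ++ b₀ :: u)) (v ++ y l₂ :: w)

theorem wrap_apart {p q : ℤ} {x y : List B → B} (hx : HasDegree p x) (hy : HasDegree q y)
    (b₀ : B) (l : List B) :
    (cut3 l fun u s z => sgn ((u.length + s.length + z.length) * (u.length + s.length + 1) + p) •
      brace q (word R e (x (z ++ b₀ :: u))) y s) = sgn (p * q) • apart R e p q x y b₀ l := by
  unfold apart brace cut3
  simp only [cut_zsmul, sgn_smul_smul]
  refine (cut_congr fun u t h₁ => cut_congr fun s z h₂ => cut_congr fun v s' h₃ =>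
    cut_congr fun l₂ w h₄ => ?_).trans (cut_swap₂ l (fun u v l₂ w z =>
      sgn (p * q + (q * (u.length + v.length) + ((u.length + (v.length + 1 + w.length) + z.length) *
      (u.length + (v.length + 1 + w.length) + 1) + p))) •
      word R e (x (z ++ b₀ :: u)) (v ++ y l₂ :: w)))
  by_cases hl : (l₂.length : ℤ) = q + 1
  · by_cases hz : ((z ++ b₀ :: u).length : ℤ) = p + 1
    · congr 1
      refine sgn_congr ?_
      subst h₄; subst h₃
      simp only [List.length_append, List.length_cons] at hz ⊢
      push_cast at hz ⊢
      obtain rfl : p = z.length + u.length := by linarith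
      rw [hl]
      obtain ⟨c, hc⟩ := Int.even_mul_succ_self (q - 1)
      exact ⟨q * (v.length + (q + 1 + w.length)) - c, by linear_combination -hc⟩
    · rw [hx _ hz, word_zero, smul_zero, smul_zero]
  · rw [hy _ hl, (word_multilin _).map_slot_zero, smul_zero, smul_zero]

theorem wrap_wrap {p q : ℤ} {x y : List B → B} (hxm : IsMultilin (RingHom.id R) x)
    (hy : HasDegree q y) (b₀ : B) (l : List B) :
    brace q (wrap R e p x b₀) y l +
      (cut3 l fun u v w =>
        sgn ((u.length + v.length + w.length) * (u.length + v.length + 1) + q) •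
          wrap R e p x (y (w ++ b₀ :: u)) v) =
    wrap R e (p + q) (brace q x y) b₀ l + apart R e p q x y b₀ l := by
  have A1 : brace q (wrap R e p x b₀) y l =
      (cut3 l fun l₁ l₂ l₃ => cut3 l₁ fun u v w => sgn (q * l₁.length +
        ((u.length + v.length + (w ++ y l₂ :: l₃).length) * (u.length + v.length + 1) + p)) •
          word R e (x ((w ++ y l₂ :: l₃) ++ b₀ :: u)) v) +
      (cut3 l fun l₁ l₂ l₃ => cut l₁ fun u v => cut l₃ fun w z => sgn (q * l₁.length +
        ((u.length + (v ++ y l₂ :: w).length + z.length) *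
          (u.length + (v ++ y l₂ :: w).length + 1) + p)) •
          word R e (x (z ++ b₀ :: u)) (v ++ y l₂ :: w)) +
      (cut3 l fun l₁ l₂ l₃ => cut3 l₃ fun u v w => sgn (q * l₁.length +
        (((l₁ ++ y l₂ :: u).length + v.length + w.length) *
          ((l₁ ++ y l₂ :: u).length + v.length + 1) + p)) •
          word R e (x (w ++ b₀ :: (l₁ ++ y l₂ :: u))) v) := by
    rw [brace]
    unfold wrap
    simp only [cut3_append_cons, smul_add]
    unfold cut3
    simp only [cut_add, cut_zsmul, sgn_smul_smul]
  have A2 : wrap R e (p + q) (brace q x y) b₀ l =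
      (cut3 l fun u v w => cut3 w fun w₁ w₂ w₃ => sgn ((u.length + v.length + w.length) *
        (u.length + v.length + 1) + (p + q) + q * w₁.length) •
          word R e (x (w₁ ++ y w₂ :: (w₃ ++ b₀ :: u))) v) +
      (cut3 l fun u v w => cut w fun w₁ w₂ => cut u fun u₁ u₂ =>
        sgn ((u.length + v.length + w.length) *
        (u.length + v.length + 1) + (p + q) + q * w₁.length) •
          word R e (x (w₁ ++ y (w₂ ++ b₀ :: u₁) :: u₂)) v) +
      (cut3 l fun u v w => cut3 u fun u₁ u₂ u₃ => sgn ((u.length + v.length + w.length) *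
        (u.length + v.length + 1) + (p + q) + q * (w.length + 1 + u₁.length)) •
          word R e (x (w ++ b₀ :: (u₁ ++ y u₂ :: u₃))) v) := by
    unfold wrap
    simp only [brace_append_cons]
    unfold cut3
    have hadd : ∀ a b v, word R e (a + b) v = word R e a v + word R e b v := fun a b v =>
      (word_isChainFun R e).add a b v
    simp only [hadd, word_cut, word_zsmul, smul_add, cut_add, cut_zsmul, sgn_smul_smul]
  rw [A1, A2]
  have y0 : ∀ l₂ w t v, (l₂.length : ℤ) ≠ q + 1 → word R e (x (w ++ y l₂ :: t)) v = 0 :=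
    fun l₂ w t v h => by rw [hy _ h, hxm.map_slot_zero, word_zero]
  have E1 : (cut3 l fun l₁ l₂ l₃ => cut3 l₁ fun u v w => sgn (q * l₁.length +
        ((u.length + v.length + (w ++ y l₂ :: l₃).length) * (u.length + v.length + 1) + p)) •
          word R e (x ((w ++ y l₂ :: l₃) ++ b₀ :: u)) v) =
      (cut3 l fun u v w => cut3 w fun w₁ w₂ w₃ => sgn ((u.length + v.length + w.length) *
        (u.length + v.length + 1) + (p + q) + q * w₁.length) •
          word R e (x (w₁ ++ y w₂ :: (w₃ ++ b₀ :: u))) v) := by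
    unfold cut3
    refine (cut_congr fun l₁ t h₁ => cut_congr fun l₂ l₃ h₂ => cut_congr fun u s h₃ =>
      cut_congr fun v w h₄ => ?_).trans ((cut_swap₃ l (fun u v w l₂ l₃ =>
        sgn ((u.length + v.length + (w.length + l₂.length + l₃.length)) *
        (u.length + v.length + 1) + (p + q) + q * w.length) •
          word R e (x (w ++ y l₂ :: (l₃ ++ b₀ :: u))) v)).trans ?_)
    · dsimp only
      rw [List.append_assoc, List.cons_append]
      by_cases hl : (l₂.length : ℤ) = q + 1
      · congr 1
        refine sgn_congr ?_
        subst h₄; subst h₃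
        simp only [List.length_append, List.length_cons]
        push_cast
        rw [hl]
        exact ⟨-q, by ring⟩
      · rw [y0 _ _ _ _ hl, smul_zero, smul_zero]
    · refine cut_congr fun u t h₁ => cut_congr fun v w h₂ => cut_congr fun w₁ s h₃ =>
        cut_congr fun w₂ w₃ h₄ => ?_
      subst h₄; subst h₃
      simp [add_assoc]
  have E3 : (cut3 l fun l₁ l₂ l₃ => cut3 l₃ fun u v w => sgn (q * l₁.length +
        (((l₁ ++ y l₂ :: u).length + v.length + w.length) *
          ((l₁ ++ y l₂ :: u).length + v.length + 1) + p)) •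
          word R e (x (w ++ b₀ :: (l₁ ++ y l₂ :: u))) v) =
      (cut3 l fun u v w => cut3 u fun u₁ u₂ u₃ => sgn ((u.length + v.length + w.length) *
        (u.length + v.length + 1) + (p + q) + q * (w.length + 1 + u₁.length)) •
          word R e (x (w ++ b₀ :: (u₁ ++ y u₂ :: u₃))) v) := by
    unfold cut3
    refine Eq.symm ((cut_congr fun u t h₁ => cut_congr fun v w h₂ => cut_congr fun u₁ s h₃ =>
      cut_congr fun u₂ u₃ h₄ => ?_).trans (cut_swap₃ l (fun l₁ l₂ u v w =>
        sgn (q * l₁.length + (((l₁ ++ y l₂ :: u).length + v.length + w.length) *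
          ((l₁ ++ y l₂ :: u).length + v.length + 1) + p)) •
          word R e (x (w ++ b₀ :: (l₁ ++ y l₂ :: u))) v)))
    dsimp only
    by_cases hl : (u₂.length : ℤ) = q + 1
    · congr 1
      refine sgn_congr ?_
      subst h₄; subst h₃
      simp only [List.length_append, List.length_cons]
      push_cast
      rw [hl]
      obtain ⟨c, hc⟩ := Int.even_mul_succ_self q
      exact ⟨q * (u₁.length + 1 + u₃.length + v.length + w.length + 1) + c,
        by linear_combination hc⟩
    · have := y0 u₂ (w ++ b₀ :: u₁) u₃ v hl
      simp only [List.append_assoc, List.cons_append] at this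
      rw [this, smul_zero, smul_zero]
  have E4 : (cut3 l fun l₁ l₂ l₃ => cut l₁ fun u v => cut l₃ fun w z => sgn (q * l₁.length +
        ((u.length + (v ++ y l₂ :: w).length + z.length) *
          (u.length + (v ++ y l₂ :: w).length + 1) + p)) •
          word R e (x (z ++ b₀ :: u)) (v ++ y l₂ :: w)) = apart R e p q x y b₀ l := by
    unfold cut3 apart
    refine (cut_congr fun l₁ t h₁ => cut_congr fun l₂ l₃ h₂ => cut_congr fun u v h₃ =>
      cut_congr fun w z h₄ => ?_).trans (cut_swap₁ l _)
    subst h₃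
    simp only [List.length_append, List.length_cons]
    push_cast
    congr 2
    ring
  have E2 : (cut3 l fun u v w =>
        sgn ((u.length + v.length + w.length) * (u.length + v.length + 1) + q) •
          wrap R e p x (y (w ++ b₀ :: u)) v) =
      (cut3 l fun u v w => cut w fun w₁ w₂ => cut u fun u₁ u₂ =>
        sgn ((u.length + v.length + w.length) *
        (u.length + v.length + 1) + (p + q) + q * w₁.length) •
          word R e (x (w₁ ++ y (w₂ ++ b₀ :: u₁) :: u₂)) v) := by
    unfold wrap cut3
    simp only [cut_zsmul, sgn_smul_smul]
    refine (cut_congr fun u t h₁ => cut_congr fun s w₂ h₂ => cut_congr fun u₂ s' h₃ =>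
      cut_congr fun v w₁ h₄ => ?_).trans ((cut_swap₂ l (fun u₁ u₂ v w₁ w₂ =>
        sgn ((u₁.length + u₂.length + v.length + (w₁.length + w₂.length)) *
        (u₁.length + u₂.length + v.length + 1) + (p + q) + q * w₁.length) •
          word R e (x (w₁ ++ y (w₂ ++ b₀ :: u₁) :: u₂)) v)).trans
          (Eq.trans (cut_swap₄ l _).symm ?_))
    · by_cases hl : ((w₂ ++ b₀ :: u).length : ℤ) = q + 1
      · congr 1
        refine sgn_congr ?_
        subst h₄; subst h₃
        simp only [List.length_append, List.length_cons] at hl ⊢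
        push_cast at hl ⊢
        obtain rfl : q = w₂.length + u.length := by linarith
        obtain ⟨c, hc⟩ := Int.even_mul_succ_self ((u₂.length : ℤ) + v.length + w₁.length)
        exact ⟨c, by linear_combination hc⟩
      · rw [y0 _ _ _ _ hl, smul_zero, smul_zero]
    · refine cut_congr fun u t h₁ => cut_congr fun v w h₂ => cut_congr fun w₁ w₂ h₃ =>
        cut_congr fun u₁ u₂ h₄ => ?_
      subst h₄; subst h₃
      simp only [List.length_append]
      push_cast
      rfl
  rw [E1, E2, E3, E4]
  abel

open Classical in
/-- The Lie derivative `L_x` on normalized chains for a cochain `x` of degree `p`. It is defined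
by `lieFun` on words; for normalized `x`, and for `x = μ` with `-μ` a bilinear map with unit `e`,
this is compatible with the relations between words. -/
noncomputable def chainLie (R : Type*) [CommRing R] {B : Type*} [AddCommGroup B] [Module R B]
    (e : B) (p : ℤ) (x : List B → B) : NChain R e →ₗ[R] NChain R e :=
  if h : IsChainFun (RingHom.id R) e (lieFun R e p x) then NChain.lift h else 0

theorem chainLie_word {p : ℤ} {x : List B → B}
    (h : IsChainFun (RingHom.id R) e (lieFun R e p x)) (b₀ : B) (l : List B) :
    chainLie R e p x (word R e b₀ l) = lieFun R e p x b₀ l := by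
  rw [chainLie, dif_pos h, NChain.lift_word]

theorem chainLie_lieFun {p q : ℤ} {x y : List B → B} (hxm : IsMultilin (RingHom.id R) x)
    (hx : HasDegree p x) (hy : HasDegree q y)
    (h : IsChainFun (RingHom.id R) e (lieFun R e p x)) (b₀ : B) (l : List B) :
    chainLie R e p x (lieFun R e q y b₀ l) =
      brace q (brace p (word R e b₀) x) y l + wrap R e (p + q) (brace q x y) b₀ l +
      apart R e p q x y b₀ l + sgn (p * q) • apart R e q p y x b₀ l := by
  have e1 : chainLie R e p x (lieFun R e q y b₀ l) =
      brace q (brace p (word R e b₀) x) y l + brace q (wrap R e p x b₀) y l +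
      ((cut3 l fun u s z => sgn ((u.length + s.length + z.length) *
          (u.length + s.length + 1) + q) • brace p (word R e (y (z ++ b₀ :: u))) x s) +
       (cut3 l fun u v w =>
        sgn ((u.length + v.length + w.length) * (u.length + v.length + 1) + q) •
          wrap R e p x (y (w ++ b₀ :: u)) v)) := by
    have hc : ∀ (l : List B) (f : List B → List B → NChain R e),
        chainLie R e p x (cut l f) = cut l fun u v => chainLie R e p x (f u v) :=
      fun l f => map_cut (chainLie R e p x).toAddMonoidHom l f
    rw [lieFun, map_add]
    unfold brace
    rw [wrap]
    unfold cut3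
    simp only [hc, map_zsmul, chainLie_word h]
    simp only [lieFun, smul_add, cut_add]
    rfl
  rw [e1, wrap_apart hy hx, mul_comm q p]
  have := wrap_wrap (e := e) (p := p) hxm hy b₀ l
  calc _ = brace q (brace p (word R e b₀) x) y l + (brace q (wrap R e p x b₀) y l +
      (cut3 l fun u v w =>
        sgn ((u.length + v.length + w.length) * (u.length + v.length + 1) + q) •
          wrap R e p x (y (w ++ b₀ :: u)) v)) + sgn (p * q) • apart R e q p y x b₀ l := by abel
    _ = _ := by rw [this]; abel

/-- `[L_x, L_y] = L_{[x,y]}`. -/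
theorem chainLie_bracket {p q : ℤ} {x y : List B → B} (hxm : IsMultilin (RingHom.id R) x)
    (hym : IsMultilin (RingHom.id R) y) (hx : HasDegree p x) (hy : HasDegree q y)
    (hx' : IsChainFun (RingHom.id R) e (lieFun R e p x))
    (hy' : IsChainFun (RingHom.id R) e (lieFun R e q y))
    (hxy : IsChainFun (RingHom.id R) e (lieFun R e (p + q) (gbr p q x y))) (c : NChain R e) :
    chainLie R e p x (chainLie R e q y c) - sgn (p * q) • chainLie R e q y (chainLie R e p x c) =
      chainLie R e (p + q) (gbr p q x y) c := by
  suffices h : (chainLie R e p x).comp (chainLie R e q y) -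
      sgn (p * q) • (chainLie R e q y).comp (chainLie R e p x) =
      chainLie R e (p + q) (gbr p q x y) by
    rw [← h]; simp
  refine NChain.hom_ext fun b₀ l => ?_
  simp only [LinearMap.sub_apply, LinearMap.comp_apply, LinearMap.smul_apply]
  rw [chainLie_word hx', chainLie_word hy', chainLie_word hxy, chainLie_lieFun hxm hx hy hx',
    chainLie_lieFun hym hy hx hy']
  have hg : gbr p q x y = fun l => brace q x y l - sgn (p * q) • brace p y x l := rfl
  rw [hg, lieFun_sub]
  have := brace_prelie (φ := word R e b₀) (word_multilin b₀) hx hy l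
  rw [smul_sub, sub_eq_sub_iff_add_eq_add] at this
  unfold lieFun
  rw [mul_comm q p, add_comm q p]
  simp only [smul_add, smul_smul, sgn_mul_sgn_self, one_smul]
  have t : brace q (brace p (word R e b₀) x) y l = sgn (p * q) • brace p (brace q (word R e b₀) y) x l +
      brace (p + q) (word R e b₀) (brace q x y) l -
      sgn (p * q) • brace (p + q) (word R e b₀) (brace p y x) l := by
    rw [← this]; abel
  rw [t]
  abel

end Operators

section Connes

variable {R : Type*} [CommRing R] {B : Type*} [AddCommGroup B] [Module R B] {e : B}

/-- The Connes differential on words, in normalized chains: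
`b₀ ⊗ ⋯ ⊗ bₙ ↦ ∑ᵢ (-1)^(n i) e ⊗ bᵢ ⊗ ⋯ ⊗ bₙ ⊗ b₀ ⊗ ⋯ ⊗ bᵢ₋₁`. -/
noncomputable def connesFun (R : Type*) [CommRing R] {B : Type*} [AddCommGroup B] [Module R B]
    (e : B) (b₀ : B) (l : List B) : NChain R e :=
  cut l fun u v => sgn ((u.length + v.length) * (u.length + 1)) • word R e e (v ++ b₀ :: u)

theorem connesFun_isChainFun : IsChainFun (RingHom.id R) e (connesFun R e) where
  add a b l := by
    unfold connesFun
    rw [← cut_add]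
    exact cut_congr fun u v _ => by rw [(word_multilin e).add, smul_add]
  smul r a l := by
    unfold connesFun
    simp only [(word_multilin (R := R) (e := e) e).smul, smul_comm _ (RingHom.id R r)]
    simp only [cut, Finset.smul_sum]
  multilin b := by
    refine IsMultilin.cut' (fun v => ?_) (fun u => ?_)
    · refine IsMultilin.length_smul (f := fun u => word R e e (v ++ b :: u)) ?_
        (fun n => sgn ((n + v.length) * (n + 1)))
      simpa using (word_multilin (R := R) (e := e) e).prefix_const (v ++ [b])
    · exact ((word_multilin (R := R) (e := e) e).suffix_const (b :: u)).length_smul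
        (fun n => sgn ((u.length + n) * (u.length + 1)))
  kills b := by
    refine Kills.cut' (fun v s t => ?_) (fun u s t => ?_)
    · have := word_degen (R := R) (e := e) e (v ++ b :: s) t
      simp only [List.append_assoc, List.cons_append] at this ⊢
      rw [this, smul_zero]
    · have := word_degen (R := R) (e := e) e s (t ++ b :: u)
      simp only [List.append_assoc, List.cons_append] at this ⊢
      rw [this, smul_zero]

/-- The Connes differential on normalized chains. -/
noncomputable def connes (R : Type*) [CommRing R] {B : Type*} [AddCommGroup B] [Module R B]
    (e : B) : NChain R e →ₗ[R] NChain R e := NChain.lift connesFun_isChainFun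

theorem connes_word (b₀ : B) (l : List B) :
    connes R e (word R e b₀ l) = connesFun R e b₀ l := NChain.lift_word _ _ _

theorem connes_cut (l : List B) (f : List B → List B → NChain R e) :
    connes R e (cut l f) = cut l fun u v => connes R e (f u v) :=
  map_cut (connes R e).toAddMonoidHom l f

theorem connes_connes (c : NChain R e) : connes R e (connes R e c) = 0 := by
  suffices h : (connes R e).comp (connes R e) = 0 from congrArg (fun f => f c) h
  refine NChain.hom_ext fun b₀ l => ?_
  rw [LinearMap.comp_apply, connes_word, connesFun, connes_cut, LinearMap.zero_apply, ← cut_zero l]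
  refine cut_congr fun u v _ => ?_
  rw [map_zsmul, connes_word, connesFun]
  simp [word_degen, cut_zero]

theorem cut_swap₅ {M : Type*} [AddCommGroup M] (l : List B)
    (F : List B → List B → List B → List B → M) :
    (cut l fun s t => cut t fun w z => cut s fun u v => F u v w z) =
      cut l fun u t => cut t fun v t => cut t fun w z => F u v w z :=
  (cut_congr fun _ _ _ => cut_comm _ _ _).trans
    (cut_assoc l (fun u v t => cut t fun w z => F u v w z))

theorem connes_lieFun {p : ℤ} {x : List B → B} (hx : HasDegree p x) (b₀ : B) (l : List B) :
    connes R e (lieFun R e p x b₀ l) = sgn p • cut l fun u v =>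
      sgn ((u.length + v.length) * (u.length + 1)) • brace p (word R e e) x (v ++ b₀ :: u) := by
  have w0 : ∀ (l₂ u v : List B), (l₂.length : ℤ) ≠ p + 1 → word R e e (u ++ x l₂ :: v) = 0 :=
    fun l₂ u v h => by rw [hx _ h, (word_multilin _).map_slot_zero]
  have A1 : connes R e (brace p (word R e b₀) x l) =
      (cut3 l fun l₁ l₂ l₃ => cut l₁ fun u v => sgn (p * l₁.length +
        ((u.length + (v ++ x l₂ :: l₃).length) * (u.length + 1))) •
          word R e e ((v ++ x l₂ :: l₃) ++ b₀ :: u)) +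
      (cut3 l fun l₁ l₂ l₃ => cut l₃ fun u v => sgn (p * l₁.length +
        (((l₁ ++ x l₂ :: u).length + v.length) * ((l₁ ++ x l₂ :: u).length + 1))) •
          word R e e (v ++ b₀ :: (l₁ ++ x l₂ :: u))) := by
    unfold brace cut3
    simp only [connes_cut, map_zsmul, connes_word]
    unfold connesFun
    simp only [cut_append_cons, smul_add, cut_add, cut_zsmul, sgn_smul_smul]
  have A2 : connes R e (wrap R e p x b₀ l) =
      cut3 l fun u v w => cut v fun v₁ v₂ =>
        sgn ((u.length + v.length + w.length) * (u.length + v.length + 1) + p +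
          (v₁.length + v₂.length) * (v₁.length + 1)) •
          word R e e (v₂ ++ x (w ++ b₀ :: u) :: v₁) := by
    unfold wrap cut3
    simp only [connes_cut, map_zsmul, connes_word]
    unfold connesFun
    simp only [cut_zsmul, sgn_smul_smul]
  have A3 : (sgn p • cut l fun u v =>
      sgn ((u.length + v.length) * (u.length + 1)) • brace p (word R e e) x (v ++ b₀ :: u)) =
      (cut l fun u v => cut v fun v₁ s => cut s fun v₂ v₃ =>
        sgn (p + ((u.length + v.length) * (u.length + 1) + p * v₁.length)) •
          word R e e (v₁ ++ x v₂ :: (v₃ ++ b₀ :: u))) +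
      (cut l fun u v => cut v fun v₁ v₂ => cut u fun u₁ u₂ =>
        sgn (p + ((u.length + v.length) * (u.length + 1) + p * v₁.length)) •
          word R e e (v₁ ++ x (v₂ ++ b₀ :: u₁) :: u₂)) +
      (cut l fun u v => cut u fun u₁ s => cut s fun u₂ u₃ =>
        sgn (p + ((u.length + v.length) * (u.length + 1) + p * (v.length + 1 + u₁.length))) •
          word R e e (v ++ b₀ :: (u₁ ++ x u₂ :: u₃))) := by
    simp only [brace_append_cons]
    unfold cut3
    simp only [cut_zsmul, smul_add, cut_add, sgn_smul_smul]
  have E1 : (cut3 l fun l₁ l₂ l₃ => cut l₁ fun u v => sgn (p * l₁.length +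
        ((u.length + (v ++ x l₂ :: l₃).length) * (u.length + 1))) •
          word R e e ((v ++ x l₂ :: l₃) ++ b₀ :: u)) =
      (cut l fun u v => cut v fun v₁ s => cut s fun v₂ v₃ =>
        sgn (p + ((u.length + v.length) * (u.length + 1) + p * v₁.length)) •
          word R e e (v₁ ++ x v₂ :: (v₃ ++ b₀ :: u))) := by
    unfold cut3
    refine (cut_congr fun l₁ t h₁ => cut_congr fun l₂ l₃ h₂ => cut_congr fun u v h₃ =>
      ?_).trans ((cut_swap₅ l (fun u v l₂ l₃ => 
        sgn (p + ((u.length + (v.length + (l₂.length + l₃.length))) * (u.length + 1) +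
          p * v.length)) •
          word R e e (v ++ x l₂ :: (l₃ ++ b₀ :: u)))).trans ?_)
    · rw [List.append_assoc, List.cons_append]
      by_cases hl : (l₂.length : ℤ) = p + 1
      · congr 1
        refine sgn_congr ?_
        subst h₃
        simp only [List.length_append, List.length_cons]
        push_cast
        rw [hl]
        exact ⟨-p, by ring⟩
      · rw [w0 _ _ _ hl, smul_zero, smul_zero]
    · refine cut_congr fun u t h₁ => cut_congr fun v s h₂ => cut_congr fun v₂ v₃ h₃ => ?_
      subst h₃; subst h₂
      simp
  have E2 : (cut3 l fun u v w => cut v fun v₁ v₂ =>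
        sgn ((u.length + v.length + w.length) * (u.length + v.length + 1) + p +
          (v₁.length + v₂.length) * (v₁.length + 1)) •
          word R e e (v₂ ++ x (w ++ b₀ :: u) :: v₁)) =
      (cut l fun u v => cut v fun v₁ v₂ => cut u fun u₁ u₂ =>
        sgn (p + ((u.length + v.length) * (u.length + 1) + p * v₁.length)) •
          word R e e (v₁ ++ x (v₂ ++ b₀ :: u₁) :: u₂)) := by
    unfold cut3
    refine Eq.trans ?_ (Eq.symm ((cut_congr fun u v h₁ => cut_congr fun v₁ v₂ h₂ =>
      cut_congr fun u₁ u₂ h₃ => ?_).trans (cut_swap₅ l (fun u₁ u₂ v₁ v₂ =>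
        sgn (p + ((u₁.length + u₂.length + (v₁.length + v₂.length)) *
          (u₁.length + u₂.length + 1) + p * v₁.length)) •
          word R e e (v₁ ++ x (v₂ ++ b₀ :: u₁) :: u₂)))))
    · refine cut_congr fun u t h₁ => ?_
      refine (cut_congr fun v w h₂ => cut_congr fun v₁ v₂ h₃ => ?_).trans
        (cut_assoc t (fun v₁ v₂ w =>
          sgn (p + ((u.length + v₁.length + (v₂.length + w.length)) *
          (u.length + v₁.length + 1) + p * v₂.length)) •
          word R e e (v₂ ++ x (w ++ b₀ :: u) :: v₁)))
      by_cases hl : ((w ++ b₀ :: u).length : ℤ) = p + 1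
      · congr 1
        refine sgn_congr ?_
        subst h₃
        simp only [List.length_append, List.length_cons] at hl ⊢
        push_cast at hl ⊢
        obtain rfl : p = w.length + u.length := by linarith
        obtain ⟨c, hc⟩ := Int.even_mul_succ_self ((v₁.length : ℤ) + v₂.length)
        exact ⟨c, by linear_combination hc⟩
      · rw [w0 _ _ _ hl, smul_zero, smul_zero]
    · subst h₃; subst h₂
      simp
  have E3 : (cut3 l fun l₁ l₂ l₃ => cut l₃ fun u v => sgn (p * l₁.length +
        (((l₁ ++ x l₂ :: u).length + v.length) * ((l₁ ++ x l₂ :: u).length + 1))) •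
          word R e e (v ++ b₀ :: (l₁ ++ x l₂ :: u))) =
      (cut l fun u v => cut u fun u₁ s => cut s fun u₂ u₃ =>
        sgn (p + ((u.length + v.length) * (u.length + 1) + p * (v.length + 1 + u₁.length))) •
          word R e e (v ++ b₀ :: (u₁ ++ x u₂ :: u₃))) := by
    unfold cut3
    refine Eq.symm ((cut_congr fun u v h₁ => cut_congr fun u₁ s h₂ => cut_congr fun u₂ u₃ h₃ =>
      ?_).trans ((cut_assoc l (fun u₁ s v => cut s fun u₂ u₃ => sgn (p * u₁.length +
        (((u₁ ++ x u₂ :: u₃).length + v.length) * ((u₁ ++ x u₂ :: u₃).length + 1))) •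
          word R e e (v ++ b₀ :: (u₁ ++ x u₂ :: u₃)))).trans
          (cut_congr fun u₁ t _ => cut_assoc t _)))
    by_cases hl : (u₂.length : ℤ) = p + 1
    · congr 1
      refine sgn_congr ?_
      subst h₃; subst h₂
      simp only [List.length_append, List.length_cons]
      push_cast
      rw [hl]
      obtain ⟨c, hc⟩ := Int.even_mul_succ_self p
      exact ⟨p * (u₁.length + u₃.length + v.length + 2) + c, by linear_combination hc⟩
    · have := w0 u₂ (v ++ b₀ :: u₁) u₃ hl
      simp only [List.append_assoc, List.cons_append] at this
      rw [this, smul_zero, smul_zero]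
  rw [lieFun, map_add, A1, A2, A3, E1, E2, E3]
  abel

theorem chainLie_connesFun {p : ℤ} {x : List B → B}
    (h : IsChainFun (RingHom.id R) e (lieFun R e p x)) (b₀ : B) (l : List B) :
    chainLie R e p x (connesFun R e b₀ l) =
      (cut l fun u v => sgn ((u.length + v.length) * (u.length + 1)) •
        brace p (word R e e) x (v ++ b₀ :: u)) +
      (cut l fun u v => sgn ((u.length + v.length) * (u.length + 1)) •
        wrap R e p x e (v ++ b₀ :: u)) := by
  have hc : ∀ (l : List B) (f : List B → List B → NChain R e),
      chainLie R e p x (cut l f) = cut l fun u v => chainLie R e p x (f u v) :=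
    fun l f => map_cut (chainLie R e p x).toAddMonoidHom l f
  rw [connesFun, hc]
  simp only [map_zsmul, chainLie_word h]
  simp only [lieFun, smul_add, cut_add]

/-- `[B, L_x] = 0` for normalized `x`. -/
theorem connes_chainLie {p : ℤ} {x : List B → B} (hxm : IsMultilin (RingHom.id R) x)
    (hxk : Kills e x) (hx : HasDegree p x) (c : NChain R e) :
    connes R e (chainLie R e p x c) = sgn p • chainLie R e p x (connes R e c) := by
  suffices h : (connes R e).comp (chainLie R e p x) =
      sgn p • (chainLie R e p x).comp (connes R e) from congrArg (fun f => f c) h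
  refine NChain.hom_ext fun b₀ l => ?_
  have hx' := lieFun_isChainFun (p := p) hxm hxk
  simp only [LinearMap.comp_apply, LinearMap.smul_apply]
  rw [chainLie_word hx', connes_word, connes_lieFun hx, chainLie_connesFun hx']
  have hk : ∀ w u, x (w ++ e :: u) = 0 := hxk
  have : ∀ m, wrap R e p x e m = 0 := fun m => by
    unfold wrap cut3
    simp [hk, word_zero, cut_zero]
  simp [this, cut_zero]

/-- `B b + b B = 0` for the Hochschild differential `b = L_μ` of a unital multiplication `-μ`. -/
theorem connes_hochschild {μ : List B → B} (hμm : IsMultilin (RingHom.id R) μ)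
    (hμ : HasDegree 1 μ) (hu : IsUnital e μ) (c : NChain R e) :
    connes R e (chainLie R e 1 μ c) = - chainLie R e 1 μ (connes R e c) := by
  suffices h : (connes R e).comp (chainLie R e 1 μ) =
      - (chainLie R e 1 μ).comp (connes R e) from congrArg (fun f => f c) h
  refine NChain.hom_ext fun b₀ l => ?_
  have hx' := lieFun_isChainFun_unital hμm hμ hu
  simp only [LinearMap.comp_apply, LinearMap.neg_apply]
  rw [chainLie_word hx', connes_word, connes_lieFun hμ, chainLie_connesFun hx']
  have z : ∀ l v, l.length ≠ 2 → word R e (μ l) v = 0 := fun l v h => by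
    rw [hμ l (by exact_mod_cast h), word_zero]
  have W : ∀ (m : List B), wrap R e 1 μ e m =
      (match m with | [] => 0 | a :: t => word R e a t) +
      sgn m.length • (match m.reverse with | [] => 0 | a :: t => word R e a t.reverse) := by
    intro m
    have first : ∀ m : List B, (cut m fun m₂ m₃ =>
        sgn ((([] : List B).length + m₂.length + m₃.length) *
          (([] : List B).length + m₂.length + 1) + 1) • word R e (μ (m₃ ++ e :: [])) m₂) =
        sgn m.length • (match m.reverse with | [] => 0 | a :: t => word R e a t.reverse) := by
      intro m
      rcases List.eq_nil_or_concat m with rfl | ⟨t, b, rfl⟩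
      · simp only [cut_nil]
        rw [z _ _ (by simp), smul_zero]; simp
      · rw [List.concat_eq_append, cut_append_cons, cut_nil, z _ _ (by simp), smul_zero, add_zero,
          cut_eq_right]
        · simp only [List.nil_append, List.reverse_append, List.reverse_cons,
            List.reverse_nil, List.cons_append, List.reverse_reverse, (hu b).2, word_neg]
          rw [smul_neg, ← neg_smul, ← sgn_neg_of]
          simp only [List.length_append, List.length_cons, List.length_nil]
          push_cast
          obtain ⟨c, hc⟩ := Int.even_mul_succ_self (t.length : ℤ)
          exact ⟨-c-1, by linear_combination -hc⟩
        · intro s w hw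
          rw [z _ _ (by have := List.length_pos_iff.2 hw; simp; omega), smul_zero]
    unfold wrap cut3
    cases m with
    | nil => rw [cut_nil, first]; simp
    | cons a m' =>
      rw [cut_cons, first, add_comm, cut_eq_left, cut_eq_right]
      · congr 1
        simp only [List.nil_append, (hu a).1, word_neg]
        rw [sgn_neg_of (b := 0)]
        · simp
        · simp only [List.length_cons, List.length_nil]
          push_cast
          obtain ⟨c, hc⟩ := Int.even_mul_succ_self ((m'.length : ℤ) + 1)
          exact ⟨c, by linear_combination hc⟩
      · intro s w hw
        dsimp only
        rw [z _ _ (by have := List.length_pos_iff.2 hw; simp; omega), smul_zero]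
      · intro s t hs
        rw [← cut_zero t]
        refine cut_congr fun s' w _ => ?_
        dsimp only
        rw [z _ _ (by have := List.length_pos_iff.2 hs; simp; omega), smul_zero]
  have tot : (cut l fun u v => sgn ((u.length + v.length) * (u.length + 1)) •
        wrap R e 1 μ e (v ++ b₀ :: u)) = 0 := by
    simp only [W, smul_add, cut_add]
    rw [cut_telescope]
    · simp only [List.nil_append, List.length_nil, List.length_append, List.length_cons,
        List.reverse_append, List.reverse_cons, List.reverse_nil, List.cons_append,
        List.reverse_reverse, sgn_smul_smul]
      push_cast
      rw [sgn_even (by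
        have := Int.even_mul_succ_self (l.length : ℤ); simpa using this),
        sgn_neg_of (b := 0) (by exact ⟨l.length, by push_cast; ring⟩)]
      simp
    · intro u a v
      simp only [List.length_append, List.length_cons, List.length_nil, List.cons_append,
        List.reverse_append, List.reverse_cons, List.reverse_nil, List.nil_append,
        sgn_smul_smul]
      simp only [List.append_assoc, List.cons_append, List.nil_append, List.reverse_append,
        List.reverse_cons, List.reverse_reverse]
      rw [sgn_neg_of (b := ((u.length + 1 : ℕ) + v.length) * ((u.length + 1 : ℕ) + 1) +
        ((v.length + (u.length + 1 + 1) : ℕ) : ℤ))]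
      · simp
      · push_cast
        exact ⟨-(u.length + v.length + 2), by ring⟩
  rw [tot, show sgn 1 = -1 from rfl]; simp

end Connes

section Maps

variable {R S : Type*} [CommRing R] [CommRing S] {B B' : Type*} [AddCommGroup B] [Module R B]
  [AddCommGroup B'] [Module S B'] {σ : R →+* S}

/-- The map on normalized chains induced by a (semi)linear map `g` with `g e = e'`. -/
noncomputable def chainMap {e : B} {e' : B'} (g : B →ₛₗ[σ] B') (he : g e = e') :
    NChain R e →ₛₗ[σ] NChain S e' :=
  NChain.lift (F := fun b l => word S e' (g b) (l.map g))
    { add := fun a b l => by rw [map_add, (word_isChainFun S e').add]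
      smul := fun r a l => by rw [map_smulₛₗ, (word_isChainFun S e').smul]; rfl
      multilin := fun b =>
        { add := fun u a c v => by simp [(word_multilin (R := S) (e := e') (g b)).add]
          smul := fun u r a v => by simp [(word_multilin (R := S) (e := e') (g b)).smul] }
      kills := fun b u v => by simp [he, word_degen] }

@[simp] theorem chainMap_word {e : B} {e' : B'} (g : B →ₛₗ[σ] B') (he : g e = e') (b : B)
    (l : List B) : chainMap g he (word R e b l) = word S e' (g b) (l.map g) :=
  NChain.lift_word _ _ _

theorem cut_map {M C D : Type*} [AddCommGroup M] (g : C → D) (l : List C)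
    (f : List D → List D → M) :
    cut (l.map g) f = cut l fun u v => f (u.map g) (v.map g) := by
  simp [cut, List.map_take, List.map_drop]

theorem chainMap_cut {C : Type*} {e : B} {e' : B'} (g : B →ₛₗ[σ] B') (he : g e = e') (l : List C)
    (f : List C → List C → NChain R e) :
    chainMap g he (cut l f) = cut l fun u v => chainMap g he (f u v) :=
  map_cut (chainMap g he).toAddMonoidHom l f

theorem chainMap_connes {e : B} {e' : B'} (g : B →ₛₗ[σ] B') (he : g e = e') (c : NChain R e) :
    chainMap g he (connes R e c) = connes S e' (chainMap g he c) := by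
  suffices h : (chainMap g he).comp (connes R e) = (connes S e').comp (chainMap g he) from
    congrArg (fun f => f c) h
  refine NChain.hom_ext fun b₀ l => ?_
  simp only [LinearMap.comp_apply, chainMap_word, connes_word]
  unfold connesFun
  rw [chainMap_cut, cut_map]
  simp [he]

theorem chainMap_chainLie {e : B} {e' : B'} (g : B →ₛₗ[σ] B') (he : g e = e') {p : ℤ}
    {x : List B → B} {x' : List B' → B'} (hx : ∀ l, x' (l.map g) = g (x l))
    (h : IsChainFun (RingHom.id R) e (lieFun R e p x))
    (h' : IsChainFun (RingHom.id S) e' (lieFun S e' p x')) (c : NChain R e) :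
    chainMap g he (chainLie R e p x c) = chainLie S e' p x' (chainMap g he c) := by
  suffices h : (chainMap g he).comp (chainLie R e p x) =
    (chainLie S e' p x').comp (chainMap g he) from congrArg (fun f => f c) h
  refine NChain.hom_ext fun b₀ l => ?_
  simp only [LinearMap.comp_apply, chainMap_word, chainLie_word h, chainLie_word h']
  unfold lieFun brace wrap cut3
  simp only [map_add, chainMap_cut, cut_map]
  have : ∀ w u, x' (List.map g w ++ g b₀ :: List.map g u) = g (x (w ++ b₀ :: u)) := fun w u => by
    rw [← hx]; simp
  simp [hx, this]

theorem chainMap_chainMap {T : Type*} [CommRing T] {B'' : Type*} [AddCommGroup B''] [Module T B'']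
    {τ : S →+* T} {ρ : R →+* T} {e : B} {e' : B'} {e'' : B''} (g : B →ₛₗ[σ] B') (he : g e = e')
    (g' : B' →ₛₗ[τ] B'') (he' : g' e' = e'') (g'' : B →ₛₗ[ρ] B'') (he'' : g'' e = e'')
    (hg : ∀ b, g' (g b) = g'' b) (hσ : ∀ r, τ (σ r) = ρ r) (c : NChain R e) :
    chainMap g' he' (chainMap g he c) = chainMap g'' he'' c := by
  haveI : RingHomCompTriple σ τ ρ := ⟨RingHom.ext hσ⟩
  suffices h : ((chainMap g' he').comp (chainMap g he) : NChain R e →ₛₗ[ρ] NChain T e'') =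
    chainMap g'' he'' from congrArg (fun f => f c) h
  refine NChain.hom_ext fun b₀ l => ?_
  simp [LinearMap.comp_apply, hg, Function.comp_def]

theorem chainMap_id {e : B} (g : B →ₗ[R] B) (he : g e = e) (hg : ∀ b, g b = b) (c : NChain R e) :
    chainMap g he c = c := by
  suffices h : chainMap g he = LinearMap.id from congrArg (fun f => f c) h
  refine NChain.hom_ext fun b₀ l => ?_
  have : (g : B → B) = id := funext hg
  simp [this]

end Maps

section NegativeCyclic

variable (R : Type*) [CommRing R] {B : Type*} [AddCommGroup B] [Module R B] (e : B)

/-- The chains of degree `n`: the span of the words `b₀ ⊗ b₁ ⊗ ⋯ ⊗ bₙ`. It is zero for `n < 0`. -/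
noncomputable def chainDeg (n : ℤ) : Submodule R (NChain R e) :=
  Submodule.span R {z | ∃ (b₀ : B) (l : List B), (l.length : ℤ) = n ∧ z = word R e b₀ l}

/-- The part of (homological) degree `n` of the normalized negative cyclic complex: the power
series `∑ᵢ cᵢ uⁱ` with `cᵢ` a normalized Hochschild chain of degree `n + 2i`. -/
noncomputable def NegCyc (n : ℤ) : Submodule R (ℕ → NChain R e) where
  carrier := {f | ∀ i : ℕ, f i ∈ chainDeg R e (n + 2 * (i : ℤ))}
  add_mem' ha hb i := Submodule.add_mem _ (ha i) (hb i)
  zero_mem' _ := Submodule.zero_mem _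
  smul_mem' r _ ha i := Submodule.smul_mem _ r (ha i)

/-- Multiplication by `u`, followed by the Connes differential. -/
noncomputable def uConnes : (ℕ → NChain R e) →ₗ[R] (ℕ → NChain R e) where
  toFun f i := match i with
    | 0 => 0
    | i + 1 => connes R e (f i)
  map_add' f g := by
    ext i; cases i
    · simp
    · exact map_add (connes R e) _ _
  map_smul' r f := by
    ext i; cases i
    · simp
    · exact map_smul (connes R e) _ _

variable {R e}

theorem chainDeg_word (b₀ : B) (l : List B) {n : ℤ} (h : (l.length : ℤ) = n) :
    word R e b₀ l ∈ chainDeg R e n := Submodule.subset_span ⟨b₀, l, h, rfl⟩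

theorem cut_mem {C M : Type*} [AddCommGroup M] [Module R M] (N : Submodule R M) (l : List C)
    (f : List C → List C → M) (h : ∀ u v, u ++ v = l → f u v ∈ N) : cut l f ∈ N :=
  Submodule.sum_mem _ fun i _ => h _ _ (List.take_append_drop i l)

theorem connes_mem {n m : ℤ} (h : n + 1 = m) {c : NChain R e} (hc : c ∈ chainDeg R e n) :
    connes R e c ∈ chainDeg R e m := by
  induction hc using Submodule.span_induction with
  | mem c hc =>
    obtain ⟨b₀, l, hl, rfl⟩ := hc
    rw [connes_word, connesFun]
    refine cut_mem _ _ _ fun u v huv => zsmul_mem (chainDeg_word _ _ ?_) _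
    subst huv; simp at hl ⊢; omega
  | zero => simp
  | add a b _ _ ha hb => rw [map_add]; exact add_mem ha hb
  | smul r a _ ha => rw [map_smul]; exact Submodule.smul_mem _ _ ha

theorem chainLie_mem {p n m : ℤ} (h : n = m + p) {x : List B → B}
    (hx : HasDegree p x) {c : NChain R e} (hc : c ∈ chainDeg R e n) :
    chainLie R e p x c ∈ chainDeg R e m := by
  by_cases hC : IsChainFun (RingHom.id R) e (lieFun R e p x)
  swap
  · rw [chainLie, dif_neg hC]; simp
  induction hc using Submodule.span_induction with
  | mem c hc =>
    obtain ⟨b₀, l, hl, rfl⟩ := hc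
    rw [chainLie_word hC, lieFun, brace, wrap]
    refine add_mem (cut_mem _ _ _ fun u t h₁ => cut_mem _ _ _ fun v w h₂ => zsmul_mem ?_ _)
      (cut_mem _ _ _ fun u t h₁ => cut_mem _ _ _ fun v w h₂ => zsmul_mem ?_ _)
    · by_cases hv : (v.length : ℤ) = p + 1
      · refine chainDeg_word _ _ ?_
        subst h₂; subst h₁; simp at hl ⊢; omega
      · rw [hx _ hv, (word_multilin _).map_slot_zero]; simp
    · by_cases hv : ((w ++ b₀ :: u).length : ℤ) = p + 1
      · refine chainDeg_word _ _ ?_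
        subst h₂; subst h₁; simp at hl hv ⊢; omega
      · rw [hx _ hv, word_zero]; simp
  | zero => simp
  | add a b _ _ ha hb => rw [map_add]; exact add_mem ha hb
  | smul r a _ ha => rw [map_smul]; exact Submodule.smul_mem _ _ ha

theorem chainMap_mem {S : Type*} [CommRing S] {B' : Type*} [AddCommGroup B'] [Module S B']
    {σ : R →+* S} {e' : B'} (g : B →ₛₗ[σ] B') (he : g e = e') {n : ℤ} {c : NChain R e}
    (hc : c ∈ chainDeg R e n) : chainMap g he c ∈ chainDeg S e' n := by
  induction hc using Submodule.span_induction with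
  | mem c hc =>
    obtain ⟨b₀, l, hl, rfl⟩ := hc
    rw [chainMap_word]
    exact chainDeg_word _ _ (by simpa using hl)
  | zero => simp
  | add a b _ _ ha hb => rw [map_add]; exact add_mem ha hb
  | smul r a _ ha => rw [map_smulₛₗ]; exact Submodule.smul_mem _ _ ha

/-- The Lie derivative `L_x` on the negative cyclic complex, for `x` of degree `p`. -/
noncomputable def negLie {p n m : ℤ} (h : n = m + p) (x : List B → B)
    (hx : HasDegree p x) : NegCyc R e n →ₗ[R] NegCyc R e m where
  toFun c := ⟨fun i => chainLie R e p x (c.1 i), fun i =>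
    chainLie_mem (by omega) hx (c.2 i)⟩
  map_add' a b := by ext i; simp
  map_smul' r a := by ext i; simp

/-- The differential `L_μ + uB` of the negative cyclic complex. -/
noncomputable def negDiff {n m : ℤ} (h : n = m + 1) (μ : List B → B) (hμ : HasDegree 1 μ) :
    NegCyc R e n →ₗ[R] NegCyc R e m where
  toFun c := ⟨fun i => chainLie R e 1 μ (c.1 i) + uConnes R e c.1 i, fun i =>
    add_mem (chainLie_mem (by omega) hμ (c.2 i)) (by
      cases i with
      | zero => exact Submodule.zero_mem _
      | succ i => exact connes_mem (by push_cast; omega) (c.2 i))⟩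
  map_add' a b := by
    ext i; simp only [Submodule.coe_add, Pi.add_apply, map_add]; abel
  map_smul' r a := by ext i; simp

/-- The map on negative cyclic complexes induced by a (semi)linear map `g` with `g e = e'`. -/
noncomputable def negMap {S : Type*} [CommRing S] {B' : Type*} [AddCommGroup B'] [Module S B']
    {σ : R →+* S} {e' : B'} (g : B →ₛₗ[σ] B') (he : g e = e') (n : ℤ) :
    NegCyc R e n →ₛₗ[σ] NegCyc S e' n where
  toFun c := ⟨fun i => chainMap g he (c.1 i), fun i => chainMap_mem g he (c.2 i)⟩
  map_add' a b := by ext i; simp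
  map_smul' r a := by ext i; simp

end NegativeCyclic

open scoped TensorProduct

universe u v w

/-- A DG-Lie algebra over `k`, with cohomological grading. The graded pieces are indexed by `ℤ`, and
the operations carry a proof that the degrees match. -/
structure DGLie (k : Type u) [CommRing k] where
  X : ℤ → Type v
  [grp : ∀ i, AddCommGroup (X i)]
  [mod : ∀ i, Module k (X i)]
  d : ∀ {i j : ℤ}, i + 1 = j → X i →ₗ[k] X j
  br : ∀ {i j n : ℤ}, i + j = n → X i →ₗ[k] X j →ₗ[k] X n
  d_d : ∀ {i j n : ℤ} (h : i + 1 = j) (h' : j + 1 = n) (x : X i), d h' (d h x) = 0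
  symm : ∀ {i j n : ℤ} (h : i + j = n) (h' : j + i = n) (x : X i) (y : X j),
    br h x y = - sgn (i * j) • br h' y x
  jacobi : ∀ {i j l a b c n : ℤ} (h₁ : j + l = a) (h₂ : i + a = n) (h₃ : i + j = b)
    (h₄ : b + l = n) (h₅ : i + l = c) (h₆ : j + c = n) (x : X i) (y : X j) (z : X l),
    br h₂ x (br h₁ y z) = br h₄ (br h₃ x y) z + sgn (i * j) • br h₆ y (br h₅ x z)
  leibniz : ∀ {i j n i' j' n' : ℤ} (h : i + j = n) (hn : n + 1 = n') (hi : i + 1 = i')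
    (hj : j + 1 = j') (h₁ : i' + j = n') (h₂ : i + j' = n') (x : X i) (y : X j),
    d hn (br h x y) = br h₁ (d hi x) y + sgn i • br h₂ x (d hj y)

attribute [instance] DGLie.grp DGLie.mod

/-- A DG-module over a DG-Lie algebra. -/
structure DGLieModule {k : Type u} [CommRing k] (g : DGLie.{u, v} k) where
  X : ℤ → Type w
  [grp : ∀ i, AddCommGroup (X i)]
  [mod : ∀ i, Module k (X i)]
  d : ∀ {i j : ℤ}, i + 1 = j → X i →ₗ[k] X j
  act : ∀ {i j n : ℤ}, i + j = n → g.X i →ₗ[k] X j →ₗ[k] X n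
  d_d : ∀ {i j n : ℤ} (h : i + 1 = j) (h' : j + 1 = n) (x : X i), d h' (d h x) = 0
  act_act : ∀ {i j l a b c n : ℤ} (h₁ : j + l = a) (h₂ : i + a = n) (h₃ : i + j = b)
    (h₄ : b + l = n) (h₅ : i + l = c) (h₆ : j + c = n) (x : g.X i) (y : g.X j) (z : X l),
    act h₂ x (act h₁ y z) = act h₄ (g.br h₃ x y) z + sgn (i * j) • act h₆ y (act h₅ x z)
  leibniz : ∀ {i j n i' j' n' : ℤ} (h : i + j = n) (hn : n + 1 = n') (hi : i + 1 = i')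
    (hj : j + 1 = j') (h₁ : i' + j = n') (h₂ : i + j' = n') (x : g.X i) (y : X j),
    d hn (act h x y) = act h₁ (g.d hi x) y + sgn i • act h₂ x (d hj y)

attribute [instance] DGLieModule.grp DGLieModule.mod

/-- A morphism of DG-Lie algebras. -/
structure DGLieHom {k : Type u} [CommRing k] (g : DGLie.{u, v} k) (g' : DGLie.{u, w} k) where
  f : ∀ i, g.X i →ₗ[k] g'.X i
  map_d : ∀ {i j : ℤ} (h : i + 1 = j) (x : g.X i), f j (g.d h x) = g'.d h (f i x)
  map_br : ∀ {i j n : ℤ} (h : i + j = n) (x : g.X i) (y : g.X j),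
    f n (g.br h x y) = g'.br h (f i x) (f j y)

section

variable {k : Type u} [CommRing k]

/-- The semidirect product of a DG-Lie algebra with a DG-module, with bracket
`[(x,m),(y,n)] = ([x,y], x n - (-1)^(|y||m|) y m)`. -/
def DGLie.semidirect (g : DGLie.{u, v} k) (M : DGLieModule.{u, v, w} g) :
    DGLie.{u, max v w} k where
  X i := g.X i × M.X i
  d h := (g.d h).prodMap (M.d h)
  br {i j n} h := LinearMap.mk₂ k
    (fun x y => (g.br h x.1 y.1,
      M.act h x.1 y.2 - sgn (j * i) • M.act (by omega) y.1 x.2))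
    (fun x x' y => by ext <;> simp [smul_add]; abel)
    (fun c x y => by ext <;> simp [smul_sub, smul_comm c])
    (fun x y y' => by ext <;> simp [smul_add]; abel)
    (fun c x y => by ext <;> simp [smul_sub, smul_comm c])
  d_d h h' x := by ext <;> simp [g.d_d, M.d_d]
  symm {i j n} h h' x y := by
    ext
    · simpa using g.symm h h' x.1 y.1
    · simp only [LinearMap.mk₂_apply, Prod.smul_snd, smul_sub, smul_smul]
      rw [neg_mul, mul_comm j i, sgn_mul_sgn_self]
      simp only [neg_smul, one_smul, sub_neg_eq_add]
      abel
  jacobi {i j l a b c n} h₁ h₂ h₃ h₄ h₅ h₆ x y z := by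
    ext
    · simpa using g.jacobi h₁ h₂ h₃ h₄ h₅ h₆ x.1 y.1 z.1
    · simp only [LinearMap.mk₂_apply, Prod.snd_add, Prod.smul_snd, map_sub, map_zsmul,
        smul_sub, sgn_smul_smul]
      have h₇ : l + i = c := by omega
      have h₈ : l + j = a := by omega
      have h₉ : l + b = n := by omega
      have h₁₀ : a + i = n := by omega
      have h₁₁ : c + j = n := by omega
      have e1 := M.act_act h₁ h₂ h₃ h₄ h₅ h₆ x.1 y.1 z.2
      have e2 := M.act_act h₇ h₆ h₁ h₁₀ (show j + i = b by omega) h₉ y.1 z.1 x.2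
      have e3 := M.act_act h₈ h₂ h₅ h₁₁ h₃ h₉ x.1 z.1 y.2
      rw [e1, e2, e3]
      simp only [smul_add, sgn_smul_smul]
      subst h₁; subst h₃; subst h₅
      have t1 : sgn (l * j + i * l) = sgn (l * (i + j)) := sgn_congr ⟨0, by ring⟩
      have t2 : sgn (i * j + l * i) = sgn ((j + l) * i) := sgn_congr ⟨0, by ring⟩
      have t3 : sgn (i * j + (i + l) * j) = sgn (l * j) := sgn_congr ⟨i * j, by ring⟩
      have t4 : sgn (i * j + l * i + j * l) = sgn (l * (i + j) + j * i) :=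
        sgn_congr ⟨0, by ring⟩
      rw [t4, t1, t2, t3]
      abel
  leibniz {i j n i' j' n'} h hn hi hj h₁ h₂ x y := by
    ext
    · simpa using g.leibniz h hn hi hj h₁ h₂ x.1 y.1
    · have e1 := M.leibniz h hn hi hj h₁ h₂ x.1 y.2
      have e2 := M.leibniz (show j + i = n by omega) hn hj hi (show j' + i = n' by omega)
        (show j + i' = n' by omega) y.1 x.2
      simp only [LinearMap.mk₂_apply, LinearMap.prodMap_apply, Prod.snd_add, Prod.smul_snd,
        map_sub, map_zsmul, smul_sub, e1, e2, sgn_smul_smul, smul_add]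
      subst hi; subst hj
      have t1 : sgn (j * (i + 1)) = sgn (j * i + j) := by ring_nf
      have t2 : sgn (i + (j + 1) * i) = sgn (j * i) := sgn_congr ⟨i, by ring⟩
      rw [t1, t2]
      abel

end

section

variable {k : Type u} [Field k]

/-- The Maurer-Cartan equation `d x + ½ [x,x] = 0` in degree one. -/
def DGLie.IsMC (g : DGLie.{u, v} k) (x : g.X 1) : Prop :=
  g.d (show 1 + 1 = (2 : ℤ) by norm_num) x +
    (2 : k)⁻¹ • g.br (show 1 + 1 = (2 : ℤ) by norm_num) x x = 0

theorem DGLie.eq_zero_of_two [CharZero k] {g : DGLie.{u, v} k} {i : ℤ} {x : g.X i}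
    (h : x + x = 0) : x = 0 := by
  have h2 : (2 : k) • x = 0 := by rw [two_smul, h]
  exact (smul_eq_zero_iff_right (two_ne_zero)).1 h2

/-- The twist of a DG-Lie algebra by a Maurer-Cartan element `x`: the differential becomes
`d + [x, -]`. -/
def DGLie.twist [CharZero k] (g : DGLie.{u, v} k) (x : g.X 1) (hx : g.IsMC x) :
    DGLie.{u, v} k where
  X := g.X
  d {i j} h := g.d h + g.br (by omega) x
  br := g.br
  d_d {i j n} h h' y := by
    subst h; obtain rfl : n = i + 2 := by omega
    have e := g.leibniz (show 1 + i = i + 1 by omega) h' (show 1 + 1 = (2 : ℤ) by omega) rfl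
      (show 2 + i = i + 2 by omega) (by omega) x y
    simp only [LinearMap.add_apply, map_add, g.d_d, e]
    have e2 := g.jacobi (show 1 + i = i + 1 by omega) (show 1 + (i + 1) = i + 2 by omega)
      (show 1 + 1 = (2 : ℤ) by omega) (show 2 + i = i + 2 by omega) (show 1 + i = i + 1 by omega)
      (show 1 + (i + 1) = i + 2 by omega) x x y
    have e3 : g.br (show 1 + 1 = (2 : ℤ) by omega) x x = - (2 : k) • g.d (by omega) x := by
      have := congrArg (fun z => (2 : k) • z) hx
      simp only [smul_add, smul_smul, smul_zero, mul_inv_cancel₀ (two_ne_zero (α := k)),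
        one_smul] at this
      rw [neg_smul]
      exact (neg_eq_of_add_eq_zero_right this).symm
    rw [e3, show sgn (1 * 1) = -1 from rfl, neg_one_smul, map_smul, LinearMap.smul_apply,
      neg_smul, two_smul] at e2
    refine DGLie.eq_zero_of_two ?_
    rw [show sgn 1 = -1 from rfl, neg_one_smul]
    have e4 := eq_neg_iff_add_eq_zero.1 (sub_eq_iff_eq_add.2 e2 : _ - _ = _)
    refine Eq.trans ?_ e4
    abel
  symm := g.symm
  jacobi := g.jacobi
  leibniz {i j n i' j' n'} h hn hi hj h₁ h₂ y z := by
    simp only [LinearMap.add_apply, map_add, g.leibniz h hn hi hj h₁ h₂ y z, smul_add]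
    rw [g.jacobi h _ (show 1 + i = i' by omega) h₁ (show 1 + j = j' by omega) h₂, one_mul]
    abel

end

section

variable {k : Type u} [CommRing k] {R : Type w} [CommRing R] [Algebra k R] (I : Ideal R)

variable (k) in
/-- The multiplication of an ideal. -/
def idealMul : I →ₗ[k] I →ₗ[k] I := LinearMap.mk₂ k
  (fun a b => ⟨(a : R) * b, I.mul_mem_left _ b.2⟩)
  (fun a a' b => by ext; simp [add_mul])
  (fun c a b => by ext; simp)
  (fun a b b' => by ext; simp [mul_add])
  (fun c a b => by ext; simp)

@[simp] theorem coe_idealMul (a b : I) : (idealMul k I a b : R) = a * b := rfl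

/-- The DG-Lie algebra `g ⊗ I`, for an ideal `I` of a commutative `k`-algebra, with
`d (x ⊗ r) = d x ⊗ r` and `[x ⊗ r, y ⊗ s] = [x,y] ⊗ rs`. -/
noncomputable def DGLie.tensor (g : DGLie.{u, v} k) : DGLie.{u, max v w} k where
  X i := g.X i ⊗[k] I
  d h := (g.d h).rTensor I
  br h := TensorProduct.map₂ (g.br h) (idealMul k I)
  d_d h h' x := by
    induction x with
    | zero => simp
    | tmul x r => simp [g.d_d]
    | add a b ha hb => simp [ha, hb]
  symm {i j n} h h' x y := by
    induction x with
    | zero => simp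
    | add a b ha hb => simp only [map_add, LinearMap.add_apply, ha, hb, smul_add]
    | tmul x r =>
      induction y with
      | zero => simp
      | add a b ha hb => simp only [map_add, LinearMap.add_apply, ha, hb, smul_add]
      | tmul y s =>
        simp only [TensorProduct.map₂_apply_tmul, TensorProduct.map_tmul]
        rw [g.symm h h', show idealMul k I r s = idealMul k I s r from
          Subtype.ext (mul_comm _ _), TensorProduct.smul_tmul']
  jacobi {i j l a b c n} h₁ h₂ h₃ h₄ h₅ h₆ x y z := by
    induction x with
    | zero => simp
    | add a b ha hb => simp only [map_add, LinearMap.add_apply, ha, hb, smul_add]; abel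
    | tmul x r =>
      induction y with
      | zero => simp
      | add a b ha hb => simp only [map_add, LinearMap.add_apply, ha, hb, smul_add]; abel
      | tmul y s =>
        induction z with
        | zero => simp
        | add a b ha hb => simp only [map_add, ha, hb, smul_add]; abel
        | tmul z t =>
          simp only [TensorProduct.map₂_apply_tmul, TensorProduct.map_tmul]
          rw [g.jacobi h₁ h₂ h₃ h₄ h₅ h₆,
            show idealMul k I r (idealMul k I s t) = idealMul k I (idealMul k I r s) t from
              Subtype.ext (mul_assoc _ _ _).symm,
            show idealMul k I s (idealMul k I r t) = idealMul k I (idealMul k I r s) t from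
              Subtype.ext (by simp only [coe_idealMul]; ring), TensorProduct.add_tmul,
            TensorProduct.smul_tmul']
  leibniz {i j n i' j' n'} h hn hi hj h₁ h₂ x y := by
    induction x with
    | zero => simp
    | add a b ha hb => simp only [map_add, LinearMap.add_apply, ha, hb, smul_add]; abel
    | tmul x r =>
      induction y with
      | zero => simp
      | add a b ha hb => simp only [map_add, ha, hb, smul_add]; abel
      | tmul y s =>
        simp only [TensorProduct.map₂_apply_tmul, TensorProduct.map_tmul, LinearMap.rTensor_tmul]
        rw [g.leibniz h hn hi hj h₁ h₂, TensorProduct.add_tmul, TensorProduct.smul_tmul']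

/-- The map `I → J` which a homomorphism `f` with `f I ⊆ J` induces. -/
def idealMap {R' : Type*} [CommRing R'] [Algebra k R'] (f : R →ₐ[k] R') {I : Ideal R}
    {J : Ideal R'} (hf : ∀ r ∈ I, f r ∈ J) : I →ₗ[k] J where
  toFun r := ⟨f r, hf r r.2⟩
  map_add' a b := by ext; simp
  map_smul' c a := by ext; simp

/-- `g ⊗ I` is functorial in `I`. -/
noncomputable def DGLie.tensorMap (g : DGLie.{u, v} k) {R' : Type*} [CommRing R'] [Algebra k R']
    (f : R →ₐ[k] R') {I : Ideal R} {J : Ideal R'} (hf : ∀ r ∈ I, f r ∈ J) :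
    DGLieHom (g.tensor I) (g.tensor J) where
  f i := (idealMap f hf).lTensor (g.X i)
  map_d {i j} h (x : g.X i ⊗[k] I) := by
    change (idealMap f hf).lTensor _ ((g.d h).rTensor I x) =
      (g.d h).rTensor J ((idealMap f hf).lTensor _ x)
    induction x with
    | zero => simp
    | add a b ha hb => simp only [map_add, ha, hb]
    | tmul x r => simp
  map_br {i j n} h (x : g.X i ⊗[k] I) (y : g.X j ⊗[k] I) := by
    change (idealMap f hf).lTensor _ (TensorProduct.map₂ (g.br h) (idealMul k I) x y) =
      TensorProduct.map₂ (g.br h) (idealMul k J) ((idealMap f hf).lTensor _ x)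
        ((idealMap f hf).lTensor _ y)
    induction x with
    | zero => simp
    | add a b ha hb => simp only [map_add, LinearMap.add_apply, ha, hb]
    | tmul x r =>
      induction y with
      | zero => simp
      | add a b ha hb => simp only [map_add, ha, hb]
      | tmul y s =>
        simp only [TensorProduct.map₂_apply_tmul, TensorProduct.map_tmul, LinearMap.lTensor_tmul]
        congr 1
        ext
        simp [idealMap]

end


open scoped TensorProduct
open CategoryTheory


attribute [local instance 100] LieRing.ofAssociativeRing

section Gauge

variable {k : Type u} [Field k] [CharZero k] (h : DGLie.{u, v} k)

/-- The Lie algebra structure on the degree zero part of a DG-Lie algebra. -/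
instance DGLie.lieRing : LieRing (h.X 0) where
  bracket x y := h.br (add_zero 0) x y
  add_lie x y z := by simp
  lie_add x y z := by simp
  lie_self x := DGLie.eq_zero_of_two (by
    have := h.symm (add_zero 0) (add_zero 0) x x
    rw [mul_zero, sgn_zero, neg_one_smul] at this
    exact eq_neg_iff_add_eq_zero.1 this)
  leibniz_lie x y z := by
    have := h.jacobi (add_zero 0) (add_zero 0) (add_zero 0) (add_zero 0) (add_zero 0) (add_zero 0)
      x y z
    rw [mul_zero, sgn_zero, one_smul] at this
    exact this

theorem DGLie.lie_def (x y : h.X 0) : ⁅x, y⁆ = h.br (add_zero 0) x y := rfl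

instance DGLie.lieAlgebra : LieAlgebra k (h.X 0) where
  lie_smul c x y := by simp [DGLie.lie_def]

/-- The universal enveloping algebra of `h⁰`. -/
abbrev DGLie.U : Type _ := UniversalEnvelopingAlgebra k (h.X 0)

/-- The inclusion of `h⁰` in its universal enveloping algebra. -/
abbrev DGLie.ι : h.X 0 →ₗ⁅k⁆ h.U := UniversalEnvelopingAlgebra.ι k

/-- The counit of the universal enveloping algebra. -/
def DGLie.counit : h.U →ₐ[k] k := UniversalEnvelopingAlgebra.lift k 0

/-- The comultiplication of the universal enveloping algebra: `Δ x = x ⊗ 1 + 1 ⊗ x` on `h⁰`. -/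
def DGLie.comul : h.U →ₐ[k] h.U ⊗[k] h.U := UniversalEnvelopingAlgebra.lift k
  { toFun := fun x => h.ι x ⊗ₜ 1 + 1 ⊗ₜ h.ι x
    map_add' := fun x y => by simp only [map_add, TensorProduct.add_tmul, TensorProduct.tmul_add]; abel
    map_smul' := fun c x => by
      simp only [map_smul, TensorProduct.smul_tmul', TensorProduct.tmul_smul, smul_add,
        RingHom.id_apply]
    map_lie' := fun {x y} => by
      simp only [LieHom.map_lie, LieRing.of_associative_ring_bracket, mul_add, add_mul,
        Algebra.TensorProduct.tmul_mul_tmul, mul_one, one_mul, TensorProduct.sub_tmul,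
        TensorProduct.tmul_sub]
      abel }

/-- The counit of `U ⊗ U`. -/
def DGLie.counit₂ : h.U ⊗[k] h.U →ₐ[k] k :=
  Algebra.TensorProduct.lift h.counit h.counit fun _ _ => Commute.all _ _

/-- The augmentation ideal of `U`; the completed enveloping algebra is the limit of the
`U ⧸ Iⁿ`. -/
abbrev DGLie.aug : Ideal h.U := RingHom.ker h.counit

/-- The augmentation ideal of `U ⊗ U`. -/
abbrev DGLie.aug₂ : Ideal (h.U ⊗[k] h.U) := RingHom.ker h.counit₂

theorem DGLie.counit_ι (x : h.X 0) : h.counit (h.ι x) = 0 := by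
  rw [DGLie.counit, UniversalEnvelopingAlgebra.lift_ι_apply]; rfl

theorem DGLie.counit₂_comul (a : h.U) : h.counit₂ (h.comul a) = h.counit a := by
  suffices e : h.counit₂.comp h.comul = h.counit from congrArg (fun f => f a) e
  refine UniversalEnvelopingAlgebra.hom_ext _ (LieHom.ext fun x => ?_)
  change h.counit₂ (h.comul (h.ι x)) = h.counit (h.ι x)
  rw [DGLie.comul, UniversalEnvelopingAlgebra.lift_ι_apply]
  change h.counit₂ (h.ι x ⊗ₜ 1 + 1 ⊗ₜ h.ι x) = _
  simp only [DGLie.counit₂, map_add, Algebra.TensorProduct.lift_tmul, map_one, h.counit_ι]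
  simp

theorem pow_le_comap {A B : Type*} [Ring A] [Ring B] (f : A →+* B) {I : Ideal A} {J : Ideal B}
    [J.IsTwoSided] (hf : ∀ a ∈ I, f a ∈ J) (n : ℕ) : I ^ n ≤ (J ^ n).comap f := by
  induction n with
  | zero => rw [Submodule.pow_zero, Submodule.pow_zero, Ideal.one_eq_top, Ideal.one_eq_top]; simp
  | succ n ih =>
    rw [Submodule.pow_succ, Submodule.pow_succ]
    refine Ideal.mul_le.2 fun a ha b hb => ?_
    rw [Ideal.mem_comap, map_mul]
    exact Ideal.mul_mem_mul (ih ha) (hf b hb)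

/-- The comultiplication `U/Iⁿ → (U ⊗ U)/Jⁿ`. -/
def DGLie.comulQ (n : ℕ) : h.U ⧸ h.aug ^ n →+* (h.U ⊗[k] h.U) ⧸ h.aug₂ ^ n :=
  Ideal.quotientMap _ h.comul.toRingHom (pow_le_comap _ (fun a ha => by
    rw [RingHom.mem_ker] at ha ⊢
    exact (h.counit₂_comul a).trans ha) n)

/-- The map `U/Iⁿ → (U ⊗ U)/Jⁿ` induced by `a ↦ a ⊗ 1`. -/
def DGLie.leftQ (n : ℕ) : h.U ⧸ h.aug ^ n →+* (h.U ⊗[k] h.U) ⧸ h.aug₂ ^ n :=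
  Ideal.quotientMap _ (Algebra.TensorProduct.includeLeftRingHom) (pow_le_comap _ (fun a ha => by
    rw [RingHom.mem_ker] at ha ⊢
    simp [DGLie.counit₂, ha]) n)

/-- The map `U/Iⁿ → (U ⊗ U)/Jⁿ` induced by `a ↦ 1 ⊗ a`. -/
def DGLie.rightQ (n : ℕ) : h.U ⧸ h.aug ^ n →+* (h.U ⊗[k] h.U) ⧸ h.aug₂ ^ n :=
  Ideal.quotientMap _ (Algebra.TensorProduct.includeRight (R := k) (A := h.U)).toRingHom
    (pow_le_comap _ (fun a ha => by
      rw [RingHom.mem_ker] at ha ⊢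
      simp [DGLie.counit₂, ha]) n)

theorem DGLie.left_right_comm (n : ℕ) (a b : h.U ⧸ h.aug ^ n) :
    h.leftQ n a * h.rightQ n b = h.rightQ n b * h.leftQ n a := by
  obtain ⟨a, rfl⟩ := Ideal.Quotient.mk_surjective a
  obtain ⟨b, rfl⟩ := Ideal.Quotient.mk_surjective b
  simp only [DGLie.leftQ, DGLie.rightQ, Ideal.quotientMap_mk, ← map_mul]
  simp

/-- The gauge group of `h`: the group-like elements of the completed enveloping algebra
`lim U/Iⁿ` of `h⁰`. -/
def DGLie.gauge : Subgroup (∀ n, (h.U ⧸ h.aug ^ n)ˣ) where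
  carrier := {g |
    (∀ n, Ideal.Quotient.factor (Ideal.pow_le_pow_right n.le_succ)
      (g (n + 1) : h.U ⧸ h.aug ^ (n + 1)) = (g n : h.U ⧸ h.aug ^ n)) ∧
    g 1 = 1 ∧
    ∀ n, h.comulQ n (g n) = h.leftQ n (g n) * h.rightQ n (g n)}
  mul_mem' {a b} ha hb := by
    refine ⟨fun n => ?_, ?_, fun n => ?_⟩
    · simp only [Pi.mul_apply, Units.val_mul, map_mul, ha.1, hb.1]
    · rw [Pi.mul_apply, ha.2.1, hb.2.1, one_mul]
    · simp only [Pi.mul_apply, Units.val_mul, map_mul, ha.2.2, hb.2.2]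
      rw [mul_assoc, ← mul_assoc (h.rightQ n (a n)), ← h.left_right_comm]
      simp only [mul_assoc]
  one_mem' := by simp
  inv_mem' {a} ha := by
    refine ⟨fun n => ?_, ?_, fun n => ?_⟩
    · refine left_inv_eq_right_inv (a := (a n : h.U ⧸ h.aug ^ n)) ?_ (by simp)
      rw [← ha.1, ← map_mul]; simp
    · rw [Pi.inv_apply, ha.2.1, inv_one]
    · refine left_inv_eq_right_inv (a := h.comulQ n (a n)) (by rw [← map_mul]; simp) ?_
      rw [ha.2.2, mul_assoc, ← mul_assoc (h.rightQ n (a n)), ← h.left_right_comm, mul_assoc,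
        ← map_mul, ← mul_assoc, ← map_mul]
      simp

/-- The affine action of `h⁰` on `h¹`, linearized on `h¹ × k`: `x (y, c) = ([x,y] - c dx, 0)`. -/
def DGLie.affine : h.X 0 →ₗ⁅k⁆ Module.End k (h.X 1 × k) where
  toFun x := LinearMap.prod
    (h.br (zero_add 1) x ∘ₗ LinearMap.fst k _ _ -
      (LinearMap.toSpanSingleton k _ (h.d (zero_add 1) x)) ∘ₗ LinearMap.snd k _ _) 0
  map_add' x y := by ext <;> simp [smul_add]; abel
  map_smul' c x := by ext <;> simp
  map_lie' {x y} := by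
    ext z
    · have := h.jacobi (zero_add 1) (zero_add 1) (add_zero 0) (zero_add 1) (zero_add 1) (zero_add 1)
        x y z
      rw [mul_zero, sgn_zero, one_smul] at this
      simp [LieRing.of_associative_ring_bracket, DGLie.lie_def, this]
    · simp [LieRing.of_associative_ring_bracket]
    · have := h.leibniz (add_zero 0) (zero_add 1) (zero_add 1) (zero_add 1) (add_zero 1)
        (zero_add 1) x y
      rw [sgn_zero, one_smul] at this
      have s := h.symm (add_zero 1) (zero_add 1) (h.d (zero_add 1) x) y
      rw [mul_zero, sgn_zero, neg_one_smul] at s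
      simp [LieRing.of_associative_ring_bracket, DGLie.lie_def, this, s]
      try abel
    · simp [LieRing.of_associative_ring_bracket]

theorem DGLie.affine_apply (x : h.X 0) (v : h.X 1 × k) :
    h.affine x v = (h.br (zero_add 1) x v.1 - v.2 • h.d (zero_add 1) x, 0) := rfl

/-- The action of `U` on `h¹ × k`. -/
def DGLie.rep : h.U →ₐ[k] Module.End k (h.X 1 × k) := UniversalEnvelopingAlgebra.lift k h.affine

theorem DGLie.rep_ι (x : h.X 0) : h.rep (h.ι x) = h.affine x :=
  UniversalEnvelopingAlgebra.lift_ι_apply _ _ _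

/-- `h⁰` acts nilpotently on `h`: iterated brackets with sufficiently many elements of `h⁰`
vanish. -/
class DGLie.IsNilp : Prop where
  nilp : ∃ N : ℕ, ∀ l : List (h.X 0), l.length = N → ∀ (i : ℤ) (y : h.X i),
    l.foldr (fun x y => h.br (zero_add i) x y) y = 0

theorem U_induction {h : DGLie.{u, v} k} (S : Subalgebra k h.U)
    (hS : ∀ x, h.ι x ∈ S) (a : h.U) : a ∈ S := by
  let f : h.U →ₐ[k] S := UniversalEnvelopingAlgebra.lift k
    { toFun := fun x => ⟨h.ι x, hS x⟩
      map_add' := fun x y => by ext; simp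
      map_smul' := fun c x => by ext; simp
      map_lie' := fun {x y} => by ext; simp [LieRing.of_associative_ring_bracket] }
  have : S.val.comp f = AlgHom.id k h.U := by
    refine UniversalEnvelopingAlgebra.hom_ext _ (LieHom.ext fun x => ?_)
    change ((f (h.ι x) : S) : h.U) = h.ι x
    rw [UniversalEnvelopingAlgebra.lift_ι_apply]
    rfl
  rw [← show S.val (f a) = a from congrArg (fun g => g a) this]
  exact (f a).2


/-- The vectors which are killed by all words of length `j` in `h⁰`. -/
def DGLie.depth (j : ℕ) : Submodule k (h.X 1 × k) where
  carrier := {v | ∀ l : List (h.X 0), l.length = j → (l.map h.affine).prod v = 0}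
  add_mem' ha hb l hl := by rw [map_add, ha l hl, hb l hl, add_zero]
  zero_mem' l _ := map_zero _
  smul_mem' c _ ha l hl := by rw [map_smul, ha l hl, smul_zero]

theorem DGLie.depth_zero {v : h.X 1 × k} (hv : v ∈ h.depth 0) : v = 0 := hv [] rfl

theorem DGLie.affine_depth (x : h.X 0) {j : ℕ} {v : h.X 1 × k} (hv : v ∈ h.depth (j + 1)) :
    h.affine x v ∈ h.depth j := fun l hl => by
  have := hv (l ++ [x]) (by simp [hl])
  simpa using this

theorem DGLie.depth_succ {j : ℕ} {v : h.X 1 × k} (hv : v ∈ h.depth j) : v ∈ h.depth (j + 1) := by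
  rintro (_ | ⟨x, l⟩) hl
  · simp at hl
  · have := hv l (by simpa using hl)
    simp [this]

theorem DGLie.rep_depth (a : h.U) {j : ℕ} {v : h.X 1 × k} (hv : v ∈ h.depth (j + 1)) :
    h.rep a v - h.counit a • v ∈ h.depth j := by
  let S : Subalgebra k h.U :=
    { carrier := {a | ∀ j, ∀ v ∈ h.depth (j + 1), h.rep a v - h.counit a • v ∈ h.depth j}
      add_mem' := fun {a b} ha hb j v hv => by
        have := add_mem (ha j v hv) (hb j v hv)
        convert this using 1
        simp only [map_add, LinearMap.add_apply, add_smul]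
        abel
      mul_mem' := fun {a b} ha hb j v hv => by
        have h1 := hb j v hv
        have h2 : h.rep b v ∈ h.depth (j + 1) := by
          have := add_mem (h.depth_succ h1) ((h.depth (j + 1)).smul_mem (h.counit b) hv)
          simpa using this
        have := add_mem (ha j _ h2) ((h.depth j).smul_mem (h.counit a) h1)
        convert this using 1
        simp only [map_mul, Module.End.mul_apply, smul_sub, smul_smul]
        abel
      algebraMap_mem' := fun c j v hv => by
        simp [AlgHom.commutes, Module.algebraMap_end_apply] }
  refine U_induction (h := h) S (fun x j v hv => ?_) a j v hv
  rw [h.rep_ι, h.counit_ι, zero_smul, sub_zero]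
  exact h.affine_depth x hv

theorem DGLie.rep_depth_pow {n : ℕ} {a : h.U} (ha : a ∈ h.aug ^ n) {j : ℕ} {v : h.X 1 × k}
    (hv : v ∈ h.depth (j + n)) : h.rep a v ∈ h.depth j := by
  induction n generalizing a v j with
  | zero =>
    cases j with
    | zero => rw [h.depth_zero hv, map_zero]; exact Submodule.zero_mem _
    | succ j =>
      have := add_mem (h.depth_succ (h.rep_depth a hv)) ((h.depth (j + 1)).smul_mem (h.counit a) hv)
      simpa using this
  | succ n ih =>
    rw [Submodule.pow_succ] at ha
    induction ha using Submodule.smul_induction_on' with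
    | smul a ha b hb =>
      rw [smul_eq_mul, map_mul, Module.End.mul_apply]
      refine ih ha ?_
      have := h.rep_depth b (j := j + n) hv
      rwa [show h.counit b = 0 from hb, zero_smul, sub_zero] at this
    | add a _ b _ ha hb => rw [map_add, LinearMap.add_apply]; exact add_mem ha hb

theorem DGLie.exists_rep_eq_zero [hh : h.IsNilp] : ∃ N : ℕ, 0 < N ∧ ∀ a ∈ h.aug ^ N, h.rep a = 0 := by
  obtain ⟨N, hN⟩ := hh.nilp
  refine ⟨N + 1, N.succ_pos, fun a ha => LinearMap.ext fun v => h.depth_zero ?_⟩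
  refine h.rep_depth_pow ha ?_
  rw [zero_add]
  intro l hl
  have key : ∀ (l : List (h.X 0)) (y : h.X 1), (l.map h.affine).prod (y, 0) =
      (l.foldr (fun x y => h.br (zero_add 1) x y) y, 0) := by
    intro l y
    induction l with
    | nil => rfl
    | cons x l ih => simp [ih, h.affine_apply]
  rcases List.eq_nil_or_concat l with rfl | ⟨l, x, rfl⟩
  · simp at hl
  · have := key l (h.affine x v).1
    rw [hN l (by simpa using hl)] at this
    rw [List.concat_eq_append, List.map_append, List.prod_append, Module.End.mul_apply]
    simp only [List.map_cons, List.map_nil, List.prod_cons, List.prod_nil, mul_one]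
    exact this

theorem DGLie.rep_snd (a : h.U) (v : h.X 1 × k) : (h.rep a v).2 = h.counit a * v.2 := by
  let S : Subalgebra k h.U :=
    { carrier := {a | ∀ v, (h.rep a v).2 = h.counit a * v.2}
      add_mem' := fun {a b} ha hb v => by
        rw [map_add, LinearMap.add_apply, Prod.snd_add, ha, hb, map_add, add_mul]
      mul_mem' := fun {a b} ha hb v => by
        rw [map_mul, Module.End.mul_apply, ha, hb, map_mul, mul_assoc]
      algebraMap_mem' := fun c v => by
        simp [AlgHom.commutes, Module.algebraMap_end_apply] }
  refine U_induction (h := h) S (fun x v => ?_) a v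
  rw [h.rep_ι, h.counit_ι, zero_mul]
  rfl

theorem DGLie.gauge_lift (g : h.gauge) (N : ℕ) : ∃ a : h.U, ∀ n ≤ N,
    Ideal.Quotient.mk (h.aug ^ n) a = (g.1 n : h.U ⧸ h.aug ^ n) := by
  obtain ⟨a, ha⟩ := Ideal.Quotient.mk_surjective (g.1 N : h.U ⧸ h.aug ^ N)
  refine ⟨a, fun n hn => ?_⟩
  induction hn using Nat.decreasingInduction with
  | self => exact ha
  | of_succ m hm ih => rw [← g.2.1 m, ← ih, Ideal.Quotient.factor_mk]

variable [h.IsNilp]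

/-- The action of the gauge group on `h¹ × k`: an element `(gₙ)` of the completed enveloping algebra
acts through `gₙ ∈ U/Iⁿ` for any sufficiently large `n`. -/
noncomputable def DGLie.gaugeRep : h.gauge →* Module.End k (h.X 1 × k) where
  toFun g := Ideal.Quotient.lift (h.aug ^ h.exists_rep_eq_zero.choose) h.rep.toRingHom
    h.exists_rep_eq_zero.choose_spec.2 (g.1 h.exists_rep_eq_zero.choose).val
  map_one' := by simp
  map_mul' a b := by simp

/-- The gauge action on `h¹`; it is `exp(x) * y = e^{ad x}(y + δ) - δ`, where `[x, δ] = - d x`. -/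
noncomputable def DGLie.gaugeAct (g : h.gauge) (y : h.X 1) : h.X 1 := (h.gaugeRep g (y, 1)).1

theorem DGLie.gaugeRep_eq (g : h.gauge) (N : ℕ) :
    ∃ a : h.U, (∀ n ≤ N, Ideal.Quotient.mk (h.aug ^ n) a = (g.1 n : h.U ⧸ h.aug ^ n)) ∧
      h.gaugeRep g = h.rep a ∧ h.counit a = 1 := by
  obtain ⟨a, ha⟩ := h.gauge_lift g (max N (max 1 h.exists_rep_eq_zero.choose))
  refine ⟨a, fun n hn => ha n (hn.trans (le_max_left _ _)), ?_, ?_⟩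
  · have := ha h.exists_rep_eq_zero.choose ((le_max_right _ _).trans (le_max_right _ _))
    change Ideal.Quotient.lift (h.aug ^ h.exists_rep_eq_zero.choose) h.rep.toRingHom
      h.exists_rep_eq_zero.choose_spec.2 (g.1 h.exists_rep_eq_zero.choose).val = _
    rw [← this, Ideal.Quotient.lift_mk]
    rfl
  · have := ha 1 ((le_max_left _ _).trans (le_max_right _ _))
    rw [g.2.2.1, Units.val_one, ← map_one (Ideal.Quotient.mk (h.aug ^ 1)), Ideal.Quotient.mk_eq_mk_iff_sub_mem,
      Submodule.pow_one, RingHom.mem_ker, map_sub, map_one, sub_eq_zero] at this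
    exact this

theorem DGLie.gaugeRep_apply (g : h.gauge) (y : h.X 1) :
    h.gaugeRep g (y, 1) = (h.gaugeAct g y, 1) := by
  obtain ⟨a, -, h1, h2⟩ := h.gaugeRep_eq g 0
  refine Prod.ext rfl ?_
  rw [h1, h.rep_snd, h2, one_mul]

theorem DGLie.gaugeAct_one (y : h.X 1) : h.gaugeAct 1 y = y := by simp [DGLie.gaugeAct]

theorem DGLie.gaugeAct_mul (a b : h.gauge) (y : h.X 1) :
    h.gaugeAct (a * b) y = h.gaugeAct a (h.gaugeAct b y) := by
  rw [DGLie.gaugeAct, map_mul, Module.End.mul_apply, h.gaugeRep_apply]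
  rfl

/-- The Maurer-Cartan elements of `h`. -/
@[ext]
structure DGLie.MC where
  val : h.X 1
  prop : h.IsMC val

/-- The Maurer-Cartan groupoid: the morphisms `y ⟶ z` are the `g` in the gauge group with
`g * y = z`. -/
noncomputable instance DGLie.mcGroupoid : Groupoid h.MC where
  Hom y z := {g : h.gauge // h.gaugeAct g y.val = z.val}
  id y := ⟨1, h.gaugeAct_one _⟩
  comp f g := ⟨g.1 * f.1, by rw [h.gaugeAct_mul, f.2, g.2]⟩
  id_comp f := Subtype.ext (mul_one _)
  comp_id f := Subtype.ext (one_mul _)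
  assoc f g l := Subtype.ext (mul_assoc _ _ _).symm
  inv f := ⟨f.1⁻¹, by
    obtain ⟨g, hg⟩ := f
    dsimp only
    rw [← hg, ← h.gaugeAct_mul, inv_mul_cancel, h.gaugeAct_one]⟩
  inv_comp f := Subtype.ext (mul_inv_cancel _)
  comp_inv f := Subtype.ext (inv_mul_cancel _)

theorem DGLie.MC.id_val (y : h.MC) : Subtype.val (𝟙 y : y ⟶ y) = 1 := rfl

theorem DGLie.MC.comp_val {x y z : h.MC} (f : x ⟶ y) (g : y ⟶ z) :
    Subtype.val (f ≫ g) = Subtype.val g * Subtype.val f := rfl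

theorem DGLie.MC.eqToHom_val {y z : h.MC} (e : y = z) : Subtype.val (eqToHom e) = 1 := by
  subst e; rfl

end Gauge

section GaugeMap

variable {k : Type u} [Field k] [CharZero k] {h : DGLie.{u, v} k} {h' : DGLie.{u, w} k}
  (F : DGLieHom h h')

/-- A morphism of DG-Lie algebras induces a map of enveloping algebras. -/
def DGLieHom.U : h.U →ₐ[k] h'.U := UniversalEnvelopingAlgebra.lift k
  { toFun := fun x => h'.ι (F.f 0 x)
    map_add' := fun x y => by rw [map_add, map_add]
    map_smul' := fun c x => by rw [map_smul, map_smul]; rfl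
    map_lie' := fun {x y} => by rw [DGLie.lie_def, F.map_br, ← DGLie.lie_def, LieHom.map_lie] }

theorem DGLieHom.U_ι (x : h.X 0) : F.U (h.ι x) = h'.ι (F.f 0 x) :=
  UniversalEnvelopingAlgebra.lift_ι_apply _ _ _

theorem DGLieHom.counit_U (a : h.U) : h'.counit (F.U a) = h.counit a := by
  suffices e : h'.counit.comp F.U = h.counit from congrArg (fun f => f a) e
  refine UniversalEnvelopingAlgebra.hom_ext _ (LieHom.ext fun x => ?_)
  change h'.counit (F.U (h.ι x)) = h.counit (h.ι x)
  rw [F.U_ι, h.counit_ι, h'.counit_ι]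

/-- The map `F ⊗ F` on `U ⊗ U`. -/
noncomputable def DGLieHom.U₂ : h.U ⊗[k] h.U →ₐ[k] h'.U ⊗[k] h'.U := Algebra.TensorProduct.map F.U F.U

theorem DGLieHom.counit₂_U₂ (a : h.U ⊗[k] h.U) : h'.counit₂ (F.U₂ a) = h.counit₂ a := by
  induction a with
  | zero => simp
  | add a b ha hb => simp [ha, hb]
  | tmul a b => simp [DGLie.counit₂, DGLieHom.U₂, F.counit_U]

theorem DGLie.comul_ι (x : h.X 0) : h.comul (h.ι x) = h.ι x ⊗ₜ 1 + 1 ⊗ₜ h.ι x :=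
  UniversalEnvelopingAlgebra.lift_ι_apply _ _ _

theorem DGLieHom.comul_U (a : h.U) : h'.comul (F.U a) = F.U₂ (h.comul a) := by
  suffices e : h'.comul.comp F.U = F.U₂.comp h.comul from congrArg (fun f => f a) e
  refine UniversalEnvelopingAlgebra.hom_ext _ (LieHom.ext fun x => ?_)
  change h'.comul (F.U (h.ι x)) = F.U₂ (h.comul (h.ι x))
  rw [F.U_ι, h.comul_ι, h'.comul_ι, map_add]
  simp only [DGLieHom.U₂, Algebra.TensorProduct.map_tmul, F.U_ι, map_one]

/-- The map `U/Iⁿ → U'/I'ⁿ`. -/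
def DGLieHom.UQ (n : ℕ) : h.U ⧸ h.aug ^ n →+* h'.U ⧸ h'.aug ^ n :=
  Ideal.quotientMap _ F.U.toRingHom (pow_le_comap _ (fun a ha => by
    rw [RingHom.mem_ker] at ha ⊢
    exact (F.counit_U a).trans ha) n)

theorem DGLieHom.UQ_mk (n : ℕ) (a : h.U) : F.UQ n (Ideal.Quotient.mk _ a) =
    Ideal.Quotient.mk _ (F.U a) := Ideal.quotientMap_mk

/-- The map `(U ⊗ U)/Jⁿ → (U' ⊗ U')/J'ⁿ`. -/
noncomputable def DGLieHom.UQ₂ (n : ℕ) :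
    (h.U ⊗[k] h.U) ⧸ h.aug₂ ^ n →+* (h'.U ⊗[k] h'.U) ⧸ h'.aug₂ ^ n :=
  Ideal.quotientMap _ F.U₂.toRingHom (pow_le_comap _ (fun a ha => by
    rw [RingHom.mem_ker] at ha ⊢
    exact (F.counit₂_U₂ a).trans ha) n)

theorem DGLieHom.comulQ_UQ (n : ℕ) (a : h.U ⧸ h.aug ^ n) :
    h'.comulQ n (F.UQ n a) = F.UQ₂ n (h.comulQ n a) := by
  obtain ⟨a, rfl⟩ := Ideal.Quotient.mk_surjective a
  exact congrArg (Ideal.Quotient.mk _) (F.comul_U a)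

theorem DGLieHom.leftQ_UQ (n : ℕ) (a : h.U ⧸ h.aug ^ n) :
    h'.leftQ n (F.UQ n a) = F.UQ₂ n (h.leftQ n a) := by
  obtain ⟨a, rfl⟩ := Ideal.Quotient.mk_surjective a
  refine congrArg (Ideal.Quotient.mk _) (?_ : F.U a ⊗ₜ 1 = F.U₂ (a ⊗ₜ 1))
  simp [DGLieHom.U₂]

theorem DGLieHom.rightQ_UQ (n : ℕ) (a : h.U ⧸ h.aug ^ n) :
    h'.rightQ n (F.UQ n a) = F.UQ₂ n (h.rightQ n a) := by
  obtain ⟨a, rfl⟩ := Ideal.Quotient.mk_surjective a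
  refine congrArg (Ideal.Quotient.mk _) (?_ : 1 ⊗ₜ F.U a = F.U₂ (1 ⊗ₜ a))
  simp [DGLieHom.U₂]

/-- The map of gauge groups induced by a morphism of DG-Lie algebras. -/
def DGLieHom.gauge (g : h.gauge) : h'.gauge :=
  ⟨fun n => Units.map (F.UQ n).toMonoidHom (g.1 n), by
    refine ⟨fun n => ?_, ?_, fun n => ?_⟩
    · have := g.2.1 n
      simp only [Units.coe_map]
      rw [← this]
      obtain ⟨a, ha⟩ := Ideal.Quotient.mk_surjective (g.1 (n + 1) : h.U ⧸ h.aug ^ (n + 1))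
      rw [← ha]
      rfl
    · dsimp only
      rw [g.2.2.1, map_one]
    · have := congrArg (F.UQ₂ n) (g.2.2.2 n)
      rw [map_mul, ← F.comulQ_UQ, ← F.leftQ_UQ, ← F.rightQ_UQ] at this
      exact this⟩

theorem DGLieHom.gauge_mul (g g' : h.gauge) : F.gauge (g * g') = F.gauge g * F.gauge g' :=
  Subtype.ext (funext fun n => by simp [DGLieHom.gauge])

theorem DGLieHom.gauge_one : F.gauge 1 = 1 :=
  Subtype.ext (funext fun n => by simp [DGLieHom.gauge])

theorem DGLieHom.rep_U (a : h.U) (v : h.X 1 × k) :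
    h'.rep (F.U a) (F.f 1 v.1, v.2) = (F.f 1 (h.rep a v).1, (h.rep a v).2) := by
  let S : Subalgebra k h.U :=
    { carrier := {a | ∀ v : h.X 1 × k, h'.rep (F.U a) (F.f 1 v.1, v.2) =
        (F.f 1 (h.rep a v).1, (h.rep a v).2)}
      add_mem' := fun {a b} ha hb v => by
        rw [map_add, map_add, LinearMap.add_apply, ha, hb]
        simp
      mul_mem' := fun {a b} ha hb v => by
        rw [map_mul, map_mul, Module.End.mul_apply, hb, ha (h.rep b v)]
        simp
      algebraMap_mem' := fun c v => by
        simp [AlgHom.commutes, Module.algebraMap_end_apply] }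
  refine U_induction (h := h) S (fun x v => ?_) a v
  rw [F.U_ι, h.rep_ι, h'.rep_ι, h.affine_apply, h'.affine_apply]
  simp [F.map_br, F.map_d]

variable [h.IsNilp] [h'.IsNilp]

theorem DGLieHom.map_gaugeAct (g : h.gauge) (y : h.X 1) :
    F.f 1 (h.gaugeAct g y) = h'.gaugeAct (F.gauge g) (F.f 1 y) := by
  obtain ⟨N, -, hN⟩ := h'.exists_rep_eq_zero
  obtain ⟨a, h1, h2, -⟩ := h.gaugeRep_eq g N
  obtain ⟨b, h3, h4, -⟩ := h'.gaugeRep_eq (F.gauge g) N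
  have e : h'.rep b = h'.rep (F.U a) := by
    rw [← sub_eq_zero, ← map_sub]
    refine hN _ ?_
    rw [← Ideal.Quotient.mk_eq_mk_iff_sub_mem, h3 N le_rfl, ← F.UQ_mk, h1 N le_rfl]
    rfl
  have := congrArg Prod.fst (F.rep_U a (y, 1))
  rw [DGLie.gaugeAct, DGLie.gaugeAct, h2, h4, e]
  exact this.symm

/-- A morphism of DG-Lie algebras induces a functor of Maurer-Cartan groupoids. -/
noncomputable def DGLieHom.mc : h.MC ⥤ h'.MC where
  obj y := ⟨F.f 1 y.val, by
    have := congrArg (F.f 2) y.prop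
    rwa [map_add, map_smul, F.map_d, F.map_br, map_zero] at this⟩
  map {y z} g := ⟨F.gauge g.1, by rw [← F.map_gaugeAct, g.2]⟩
  map_id y := Subtype.ext F.gauge_one
  map_comp f g := Subtype.ext (F.gauge_mul _ _)

theorem DGLieHom.mc_map_val {y z : h.MC} (g : y ⟶ z) :
    Subtype.val (F.mc.map g) = F.gauge (Subtype.val g) := rfl

theorem DGLieHom.mc_ext {F G : h.MC ⥤ h'.MC} (h₀ : ∀ y, (F.obj y).val = (G.obj y).val)
    (h₁ : ∀ {y z : h.MC} (g : y ⟶ z), Subtype.val (F.map g) = Subtype.val (G.map g)) : F = G := by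
  refine CategoryTheory.Functor.ext (fun y => DGLie.MC.ext (h₀ y)) fun y z g => Subtype.ext ?_
  rw [DGLie.MC.comp_val, DGLie.MC.comp_val, DGLie.MC.eqToHom_val, DGLie.MC.eqToHom_val, one_mul,
    mul_one, h₁]

theorem DGLieHom.mc_id (F : DGLieHom h h) (hF : ∀ i x, F.f i x = x) : F.mc = 𝟭 h.MC := by
  refine DGLieHom.mc_ext (fun y => hF 1 _) fun {y z} g => ?_
  have e : F.U = AlgHom.id k h.U := by
    refine UniversalEnvelopingAlgebra.hom_ext _ (LieHom.ext fun x => ?_)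
    change F.U (h.ι x) = h.ι x
    rw [F.U_ι, hF]
  refine Subtype.ext (funext fun n => Units.ext ?_)
  change F.UQ n (g.1.1 n) = g.1.1 n
  obtain ⟨a, ha⟩ := Ideal.Quotient.mk_surjective (g.1.1 n : h.U ⧸ h.aug ^ n)
  rw [← ha, F.UQ_mk, e]
  rfl

theorem DGLieHom.mc_comp {h'' : DGLie k} [h''.IsNilp] (F : DGLieHom h h') (G : DGLieHom h' h'')
    (H : DGLieHom h h'') (hH : ∀ i x, H.f i x = G.f i (F.f i x)) : H.mc = F.mc ⋙ G.mc := by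
  refine DGLieHom.mc_ext (fun y => hH 1 _) fun {y z} g => ?_
  have e : H.U = G.U.comp F.U := by
    refine UniversalEnvelopingAlgebra.hom_ext _ (LieHom.ext fun x => ?_)
    change H.U (h.ι x) = G.U (F.U (h.ι x))
    rw [F.U_ι, G.U_ι, H.U_ι, hH]
  refine Subtype.ext (funext fun n => Units.ext ?_)
  change H.UQ n (g.1.1 n) = G.UQ n (F.UQ n (g.1.1 n))
  obtain ⟨a, ha⟩ := Ideal.Quotient.mk_surjective (g.1.1 n : h.U ⧸ h.aug ^ n)
  rw [← ha, F.UQ_mk, G.UQ_mk, H.UQ_mk, e]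
  rfl

end GaugeMap


open scoped TensorProduct
open CategoryTheory IsLocalRing


section Nilp

/-- The commutative local `k`-algebras `R` which are finite dimensional over `k` and have residue
field `k`. -/
structure Nilp (k : Type u) [Field k] where
  R : Type u
  [ring : CommRing R]
  [algebra : Algebra k R]
  [finite : Module.Finite k R]
  [isLocal : IsLocalRing R]
  residue : Function.Bijective (algebraMap k (ResidueField R))

attribute [instance] Nilp.ring Nilp.algebra Nilp.finite Nilp.isLocal

/-- The morphisms in `Nilp` are the homomorphisms of `k`-algebras. -/
instance Nilp.category (k : Type u) [Field k] : Category (Nilp k) where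
  Hom R S := R.R →ₐ[k] S.R
  id R := AlgHom.id k R.R
  comp f g := AlgHom.comp g f

variable {k : Type u} [Field k]

/-- The maximal ideal. -/
abbrev Nilp.m (R : Nilp k) : Ideal R.R := maximalIdeal R.R

theorem Nilp.m_nilpotent (R : Nilp k) : ∃ N : ℕ, R.m ^ N = ⊥ := by
  have : IsArtinianRing R.R := IsArtinianRing.of_finite k R.R
  have := IsArtinianRing.isNilpotent_jacobson_bot (R := R.R)
  rw [IsLocalRing.jacobson_eq_maximalIdeal _ bot_ne_top] at this
  exact this

/-- The underlying homomorphism of a morphism in `Nilp`. -/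
abbrev Nilp.hom {R S : Nilp k} (f : R ⟶ S) : R.R →ₐ[k] S.R := f

theorem Nilp.map_m {R S : Nilp k} (f : R ⟶ S) : ∀ r ∈ R.m, Nilp.hom f r ∈ S.m := by
  intro r hr
  obtain ⟨N, hN⟩ := R.m_nilpotent
  have h1 : r ^ N = 0 := by
    have := Ideal.pow_mem_pow hr N
    rwa [hN] at this
  rw [mem_maximalIdeal, mem_nonunits_iff]
  intro hu
  have h2 := hu.pow N
  rw [← map_pow, h1, map_zero] at h2
  exact not_isUnit_zero h2

variable (g : DGLie.{u, v} k)

/-- `g ⊗ m` is nilpotent. -/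
instance DGLie.tensor_isNilp [CharZero k] (R : Nilp k) : (g.tensor R.m).IsNilp where
  nilp := by
    obtain ⟨N, hN⟩ := R.m_nilpotent
    let P : ℕ → ∀ i, Submodule k (g.X i ⊗[k] R.m) := fun n i =>
      Submodule.span k {z | ∃ (x : g.X i) (r : R.m), (r : R.R) ∈ R.m ^ (n + 1) ∧ z = x ⊗ₜ r}
    have key : ∀ (n : ℕ) (i : ℤ) (x : g.X 0 ⊗[k] R.m) (y : g.X i ⊗[k] R.m), y ∈ P n i →
        (g.tensor R.m).br (zero_add i) x y ∈ P (n + 1) i := by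
      intro n i x y hy
      change TensorProduct.map₂ (g.br (zero_add i)) (idealMul k R.m) x y ∈ _
      induction x with
      | zero => simp
      | add a b ha hb => rw [map_add, LinearMap.add_apply]; exact add_mem ha hb
      | tmul x r =>
        induction hy using Submodule.span_induction with
        | zero => simp
        | add a b _ _ ha hb => rw [map_add]; exact add_mem ha hb
        | smul c a _ ha => rw [map_smul]; exact Submodule.smul_mem _ _ ha
        | mem z hz =>
          obtain ⟨y, s, hs, rfl⟩ := hz
          rw [TensorProduct.map₂_apply_tmul, TensorProduct.map_tmul]
          refine Submodule.subset_span ⟨_, _, ?_, rfl⟩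
          rw [coe_idealMul, mul_comm, pow_succ]
          exact Ideal.mul_mem_mul hs r.2
    have all : ∀ (i : ℤ) (y : g.X i ⊗[k] R.m), y ∈ P 0 i := by
      intro i y
      induction y with
      | zero => exact Submodule.zero_mem _
      | add a b ha hb => exact add_mem ha hb
      | tmul x r => exact Submodule.subset_span ⟨x, r, by simp, rfl⟩
    refine ⟨N, fun l hl i y => ?_⟩
    have main : ∀ (l : List (g.X 0 ⊗[k] R.m)),
        l.foldr (fun x y => (g.tensor R.m).br (zero_add i) x y) y ∈ P l.length i := by
      intro l
      induction l with
      | nil => exact all i y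
      | cons x l ih => exact key _ _ x _ ih
    have h1 := main l
    have h2 : ∀ z ∈ P l.length i, z = 0 := by
      intro z hz
      induction hz using Submodule.span_induction with
      | zero => rfl
      | add a b _ _ ha hb => rw [ha, hb, add_zero]
      | smul c a _ ha => rw [ha, smul_zero]
      | mem z hz =>
        obtain ⟨x, r, hr, rfl⟩ := hz
        rw [hl, pow_succ, hN, Ideal.bot_mul, Ideal.mem_bot] at hr
        rw [show r = 0 from Subtype.ext hr, TensorProduct.tmul_zero]
    exact h2 _ h1

/-- The deformation functor `R ↦ MC(g ⊗ m)` of a DG-Lie algebra, with values in groupoids. -/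
noncomputable def DGLie.mcFunctor [CharZero k] : Nilp k ⥤ Grpd.{max u v, max u v} where
  obj R := Grpd.of (g.tensor R.m).MC
  map f := (g.tensorMap (Nilp.hom f) (Nilp.map_m f)).mc
  map_id R := DGLieHom.mc_id _ fun i (x : g.X i ⊗[k] R.m) => by
    exact LinearMap.lTensor_id_apply _ _ x
  map_comp {R S T} f f' := DGLieHom.mc_comp _ _ _ fun i (x : g.X i ⊗[k] R.m) => by
    exact LinearMap.lTensor_comp_apply (g.X i) (idealMap (Nilp.hom f') (Nilp.map_m f'))
      (idealMap (Nilp.hom f) (Nilp.map_m f)) x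

end Nilp


section Bracket

variable {R : Type*} [CommRing R] {B M : Type*}
  [AddCommGroup B] [Module R B] [AddCommGroup M] [Module R M]

theorem sgn_cases (a : ℤ) : sgn a = 1 ∨ sgn a = -1 := by
  rcases Int.even_or_odd a with h | h
  · exact Or.inl (sgn_even h)
  · exact Or.inr (by rw [sgn_neg_of (b := 0) (by simpa using h), sgn_zero])

theorem brace_left (q : ℤ) (φ ψ : List B → M) (c : ℤ) (y : List B → B) (l : List B) :
    brace q (fun l => φ l - c • ψ l) y l = brace q φ y l - c • brace q ψ y l := by
  simp only [brace, cut3, cut, smul_sub, Finset.sum_sub_distrib, Finset.smul_sum, smul_comm c]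

theorem brace_right (q : ℤ) {φ : List B → M} (hφ : IsMultilin (RingHom.id R) φ)
    (x y : List B → B) (c : ℤ) (l : List B) :
    brace q φ (fun l => x l - c • y l) l = brace q φ x l - c • brace q φ y l := by
  have h : ∀ u a b v, φ (u ++ (a - c • b) :: v) = φ (u ++ a :: v) - c • φ (u ++ b :: v) := by
    intro u a b v
    have := map_sub (hφ.slot u v) a (c • b)
    rw [map_zsmul] at this; exact this
  simp only [brace, cut3, cut, h, smul_sub, Finset.sum_sub_distrib, Finset.smul_sum, smul_comm c]

theorem gbr_multilin {p q : ℤ} {x y : List B → B} (hx : IsMultilin (RingHom.id R) x)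
    (hy : IsMultilin (RingHom.id R) y) : IsMultilin (RingHom.id R) (gbr p q x y) := by
  have := (brace_multilin (p := q) hx hy).add' ((brace_multilin (p := p) hy hx).const_smul
    (-sgn (p * q)))
  have e : gbr p q x y = fun l => brace q x y l + (-sgn (p * q)) • brace p y x l := by
    funext l; rw [gbr, neg_smul, sub_eq_add_neg]
  rw [e]; exact this

theorem gbr_kills {p q : ℤ} {e : B} {x y : List B → B} (hxm : IsMultilin (RingHom.id R) x)
    (hym : IsMultilin (RingHom.id R) y) (hx : Kills e x) (hy : Kills e y) :
    Kills e (gbr p q x y) := fun u v => by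
  have h1 : brace q x y (u ++ e :: v) = 0 := brace_kills hxm hx hy u v
  have h2 : brace p y x (u ++ e :: v) = 0 := brace_kills hym hy hx u v
  rw [gbr, h1, h2, smul_zero, sub_zero]

theorem gbr_hasDegree {p q n : ℤ} (h : p + q = n) {x y : List B → B}
    (hxm : IsMultilin (RingHom.id R) x)
    (hym : IsMultilin (RingHom.id R) y) (hx : HasDegree p x) (hy : HasDegree q y) :
    HasDegree n (gbr p q x y) := fun l hl => by
  have h1 : brace q x y l = 0 := brace_hasDegree hxm hx hy l (by rwa [h])
  have h2 : brace p y x l = 0 := brace_hasDegree hym hy hx l (by rwa [add_comm q, h])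
  rw [gbr, h1, h2, smul_zero, sub_zero]

theorem gbr_symm (p q : ℤ) (x y : List B → B) (l : List B) :
    gbr p q x y l = - sgn (p * q) • gbr q p y x l := by
  rw [gbr, gbr, mul_comm q p]
  rcases sgn_cases (p * q) with a | a <;> rw [a] <;> module

theorem gbr_jacobi {i j l : ℤ} {x y z : List B → B} (hxm : IsMultilin (RingHom.id R) x)
    (hym : IsMultilin (RingHom.id R) y) (hzm : IsMultilin (RingHom.id R) z)
    (hx : HasDegree i x) (hy : HasDegree j y) (hz : HasDegree l z) (w : List B) :
    gbr i (j + l) x (gbr j l y z) w = gbr (i + j) l (gbr i j x y) z w +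
      sgn (i * j) • gbr j (i + l) y (gbr i l x z) w := by
  have e1 := brace_prelie hxm hy hz w
  have e2 := brace_prelie hym hx hz w
  have e3 := brace_prelie hzm hx hy w
  have g1 : ∀ (p q : ℤ) (x y : List B → B),
      gbr p q x y = fun l => brace q x y l - sgn (p * q) • brace p y x l := fun _ _ _ _ => rfl
  rw [g1 i (j + l), g1 (i + j) l, g1 j (i + l), g1 j l, g1 i j, g1 i l]
  simp only [brace_left, brace_right _ hxm, brace_right _ hym, brace_right _ hzm]
  simp only [mul_add, add_mul, sgn_add]
  rw [mul_comm j i]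
  rcases sgn_cases (i * j) with a | a <;> rcases sgn_cases (i * l) with b | b <;>
    rcases sgn_cases (j * l) with c | c <;> rw [a] at e3 ⊢ <;> rw [b] at e2 ⊢ <;>
    rw [c] at e1 ⊢
  · linear_combination (norm := module) -e1 + e2 - e3
  · linear_combination (norm := module) -e1 + e2 + e3
  · linear_combination (norm := module) -e1 + e2 + e3
  · linear_combination (norm := module) -e1 + e2 - e3
  · linear_combination (norm := module) -e1 - e2 - e3
  · linear_combination (norm := module) -e1 - e2 + e3
  · linear_combination (norm := module) -e1 - e2 + e3
  · linear_combination (norm := module) -e1 - e2 - e3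

end Bracket

section Bilinear

variable {R : Type*} [CommRing R] {B : Type*} [AddCommGroup B] [Module R B]

/-- A bilinear map, as a cochain of degree one. -/
def ofBilin (μ : B →ₗ[R] B →ₗ[R] B) : List B → B
  | [a, b] => μ a b
  | _ => 0

theorem ofBilin_of_length (μ : B →ₗ[R] B →ₗ[R] B) {l : List B} (h : l.length ≠ 2) :
    ofBilin μ l = 0 := by
  match l, h with
  | [], _ => rfl
  | [_], _ => rfl
  | _ :: _ :: _ :: _, _ => rfl

theorem ofBilin_hasDegree (μ : B →ₗ[R] B →ₗ[R] B) : HasDegree 1 (ofBilin μ) := fun _ hl =>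
  ofBilin_of_length μ fun h => hl (by rw [h]; rfl)

theorem ofBilin_multilin (μ : B →ₗ[R] B →ₗ[R] B) : IsMultilin (RingHom.id R) (ofBilin μ) where
  add u a b v := by
    match u, v with
    | [], [] => exact (add_zero 0).symm
    | [], [c] => simp [ofBilin]
    | [c], [] => simp [ofBilin]
    | [], _ :: _ :: _ => simp [ofBilin]
    | [_], _ :: _ => simp [ofBilin]
    | _ :: _ :: _, _ => simp [ofBilin_of_length]
  smul u r a v := by
    match u, v with
    | [], [] => exact (smul_zero r).symm
    | [], [c] => simp [ofBilin]
    | [c], [] => simp [ofBilin]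
    | [], _ :: _ :: _ => simp [ofBilin]
    | [_], _ :: _ => simp [ofBilin]
    | _ :: _ :: _, _ => simp [ofBilin_of_length]

/-- If `-μ` is associative then `[μ, μ] = 0`. -/
theorem gbr_assoc {μ : B →ₗ[R] B →ₗ[R] B} (h : ∀ a b c, μ (μ a b) c = μ a (μ b c)) :
    gbr 1 1 (ofBilin μ) (ofBilin μ) = 0 := by
  have hb : ∀ l, brace 1 (ofBilin μ) (ofBilin μ) l = 0 := by
    intro l
    by_cases hl : l.length = 3
    · match l, hl with
      | [a, b, c], _ =>
        simp [brace, cut3, cut_cons, ofBilin, sgn, h]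
    · exact brace_hasDegree (ofBilin_multilin μ) (ofBilin_hasDegree μ) (ofBilin_hasDegree μ) l
        (fun h' => hl (by omega))
  funext l
  rw [gbr, hb, smul_zero, sub_zero]
  rfl

end Bilinear

section Cochains

variable (R : Type*) [CommRing R] {B : Type*} [AddCommGroup B] [Module R B] (e : B)

/-- The normalized Hochschild cochains of degree `p`: the `R`-multilinear functions of `p + 1`
arguments in `B` which vanish as soon as one of the arguments is `e`. -/
def NCochain (p : ℤ) : Submodule R (List B → B) where
  carrier := {x | IsMultilin (RingHom.id R) x ∧ Kills e x ∧ HasDegree p x}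
  add_mem' ha hb := ⟨ha.1.add' hb.1, fun u v => by simp [ha.2.1 u v, hb.2.1 u v],
    fun l hl => by simp [ha.2.2 l hl, hb.2.2 l hl]⟩
  zero_mem' := ⟨⟨fun _ _ _ _ => (add_zero _).symm, fun _ _ _ _ => (smul_zero _).symm⟩,
    fun _ _ => rfl, fun _ _ => rfl⟩
  smul_mem' c x hx := ⟨⟨fun u a b v => by simp [hx.1.add], fun u r a v => by
      simp [hx.1.smul, smul_comm c r]⟩, fun u v => by simp [hx.2.1 u v],
    fun l hl => by simp [hx.2.2 l hl]⟩

variable {R e}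

theorem gbr_add_left {p q : ℤ} (x x' : List B → B) {y : List B → B}
    (hy : IsMultilin (RingHom.id R) y) :
    gbr p q (x + x') y = gbr p q x y + gbr p q x' y := by
  have e : x + x' = fun l => x l - (-1 : ℤ) • x' l := by funext l; simp
  funext l
  rw [e]
  simp only [gbr, brace_left, brace_right _ hy, Pi.add_apply]
  module

theorem gbr_smul_left {p q : ℤ} (c : R) (x : List B → B) {y : List B → B}
    (hy : IsMultilin (RingHom.id R) y) :
    gbr p q (c • x) y = c • gbr p q x y := by
  funext l
  have : ∀ u a v, y (u ++ (c • a) :: v) = c • y (u ++ a :: v) := fun u a v => hy.smul u c a v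
  simp only [gbr, Pi.smul_apply, smul_sub, brace, cut3, cut, this, Finset.smul_sum]
  simp only [smul_comm c]

theorem gbr_swap (p q : ℤ) (x y : List B → B) :
    gbr p q x y = - sgn (p * q) • gbr q p y x := funext fun l => gbr_symm p q x y l

/-- The Gerstenhaber bracket of normalized cochains. -/
def ncBr {p q n : ℤ} (h : p + q = n) :
    NCochain R e p →ₗ[R] NCochain R e q →ₗ[R] NCochain R e n := LinearMap.mk₂ R
  (fun x y => ⟨gbr p q x.1 y.1, gbr_multilin x.2.1 y.2.1,
    gbr_kills x.2.1 y.2.1 x.2.2.1 y.2.2.1, gbr_hasDegree h x.2.1 y.2.1 x.2.2.2 y.2.2.2⟩)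
  (fun x x' y => Subtype.ext (gbr_add_left _ _ y.2.1))
  (fun c x y => Subtype.ext (gbr_smul_left _ _ y.2.1))
  (fun x y y' => Subtype.ext (by
    simp only [Submodule.coe_add]
    rw [gbr_swap, gbr_add_left _ _ x.2.1, smul_add, ← gbr_swap, ← gbr_swap]))
  (fun c x y => Subtype.ext (by
    simp only [Submodule.coe_smul]
    rw [gbr_swap, gbr_smul_left _ _ x.2.1, smul_comm, ← gbr_swap]))

/-- The differential `[μ, -]` on normalized cochains, for a unital multiplication `-μ`. -/
def ncDiff {μ : List B → B} (hμm : IsMultilin (RingHom.id R) μ) (hμ : HasDegree 1 μ)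
    (hu : IsUnital e μ) {p n : ℤ} (h : p + 1 = n) : NCochain R e p →ₗ[R] NCochain R e n where
  toFun x := ⟨gbr 1 p μ x.1, gbr_multilin hμm x.2.1,
    gbr_unital_kills x.2.1 x.2.2.1 x.2.2.2 hμm hμ hu,
    gbr_hasDegree (by omega) hμm x.2.1 hμ x.2.2.2⟩
  map_add' x y := Subtype.ext (by
    simp only [Submodule.coe_add]
    rw [gbr_swap, gbr_add_left _ _ hμm, smul_add, ← gbr_swap, ← gbr_swap])
  map_smul' c x := Subtype.ext (by
    simp only [Submodule.coe_smul, RingHom.id_apply]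
    rw [gbr_swap, gbr_smul_left _ _ hμm, smul_comm, ← gbr_swap])

theorem chainLie_add {p : ℤ} {x y : List B → B} (hx : IsChainFun (RingHom.id R) e (lieFun R e p x))
    (hy : IsChainFun (RingHom.id R) e (lieFun R e p y))
    (hxy : IsChainFun (RingHom.id R) e (lieFun R e p (x + y))) :
    chainLie R e p (x + y) = chainLie R e p x + chainLie R e p y := by
  refine NChain.hom_ext fun b₀ l => ?_
  have e : x + y = fun l => x l - (-1 : ℤ) • y l := by funext l; simp
  rw [LinearMap.add_apply, chainLie_word hx, chainLie_word hy, chainLie_word hxy, e, lieFun_sub]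
  module

theorem chainLie_smul {p : ℤ} {x : List B → B} (c : R)
    (hx : IsChainFun (RingHom.id R) e (lieFun R e p x))
    (hcx : IsChainFun (RingHom.id R) e (lieFun R e p (c • x))) :
    chainLie R e p (c • x) = c • chainLie R e p x := by
  refine NChain.hom_ext fun b₀ l => ?_
  rw [LinearMap.smul_apply, chainLie_word hx, chainLie_word hcx]
  have h1 : ∀ u a v, word R e b₀ (u ++ (c • a) :: v) = c • word R e b₀ (u ++ a :: v) :=
    fun u a v => (word_multilin b₀).smul u c a v
  have h2 : ∀ a v, word R e (c • a) v = c • word R e a v :=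
    fun a v => (word_isChainFun R e).smul c a v
  simp only [lieFun, wrap, smul_add, brace, cut3, cut, h1, h2, Finset.smul_sum, Pi.smul_apply]
  simp only [smul_comm c]

end Cochains

section Algebra

variable (k : Type u) [CommRing k] (A : Type v) [Ring A] [Algebra k A]

/-- The cochain `μ₀ = -(multiplication)` of an algebra. -/
def mulBilin : A →ₗ[k] A →ₗ[k] A := -LinearMap.mul k A

theorem mulBilin_apply (a b : A) : mulBilin k A a b = -(a * b) := rfl

theorem mulBilin_unital : IsUnital (1 : A) (ofBilin (mulBilin k A)) := fun a => by
  simp [ofBilin, mulBilin_apply]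

theorem mulBilin_gbr : gbr 1 1 (ofBilin (mulBilin k A)) (ofBilin (mulBilin k A)) = 0 :=
  gbr_assoc fun a b c => by simp [mulBilin_apply, mul_assoc]

end Algebra

section Algebra

variable (k : Type u) [Field k] (A : Type v) [Ring A] [Algebra k A]

/-- The DG-Lie algebra of normalized Hochschild cochains of `A`, with the Gerstenhaber bracket and
the Hochschild differential `[μ₀, -]`. -/
def cochains [CharZero k] : DGLie.{u, v} k where
  X p := NCochain k (1 : A) p
  d h := ncDiff (ofBilin_multilin _) (ofBilin_hasDegree _) (mulBilin_unital k A) h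
  br h := ncBr h
  d_d {i j n} h h' x := by
    refine Subtype.ext (funext fun l => ?_)
    subst h
    have := gbr_jacobi (ofBilin_multilin (mulBilin k A)) (ofBilin_multilin (mulBilin k A)) x.2.1
      (ofBilin_hasDegree _) (ofBilin_hasDegree _) x.2.2.2 l
    rw [mulBilin_gbr, add_comm 1 i] at this
    change gbr 1 (i + 1) _ (gbr 1 i _ x.1) l = 0
    have z : gbr (1 + 1) i (0 : List A → A) x.1 l = 0 := by
      have := congrFun (gbr_smul_left (p := 1 + 1) (q := i) (0 : k) (0 : List A → A) x.2.1) l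
      simpa using this
    rw [z, zero_add, show sgn (1 * 1) = -1 from rfl, neg_one_smul] at this
    have h2 := eq_neg_iff_add_eq_zero.1 this
    rw [← two_smul k] at h2
    exact (smul_eq_zero_iff_right two_ne_zero).1 h2
  symm h h' x y := Subtype.ext (funext fun l => gbr_symm _ _ _ _ l)
  jacobi {i j l a b c n} h₁ h₂ h₃ h₄ h₅ h₆ x y z := by
    subst h₁; subst h₃; subst h₅
    exact Subtype.ext (funext fun l => gbr_jacobi x.2.1 y.2.1 z.2.1 x.2.2.2 y.2.2.2 z.2.2.2 l)
  leibniz {i j n i' j' n'} h hn hi hj h₁ h₂ x y := by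
    subst h
    obtain rfl : i' = 1 + i := by omega
    obtain rfl : j' = 1 + j := by omega
    refine Subtype.ext (funext fun l => ?_)
    have := gbr_jacobi (ofBilin_multilin (mulBilin k A)) x.2.1 y.2.1
      (ofBilin_hasDegree _) x.2.2.2 y.2.2.2 l
    rw [one_mul] at this
    exact this

end Algebra


section NegModule

variable {R : Type*} [CommRing R] {B : Type*} [AddCommGroup B] [Module R B] {e : B}

theorem chainLie_zero {p : ℤ} (c : NChain R e) : chainLie R e p 0 c = 0 := by
  have h : IsChainFun (RingHom.id R) e (lieFun R e p (0 : List B → B)) :=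
    lieFun_isChainFun (NCochain R e 0).zero_mem.1 (NCochain R e 0).zero_mem.2.1
  have h' : IsChainFun (RingHom.id R) e (lieFun R e p ((0 : R) • (0 : List B → B))) := by
    rw [smul_zero]; exact h
  have := chainLie_smul (0 : R) h h'
  rw [smul_zero, zero_smul] at this
  rw [this]; rfl

/-- `L_x` for a normalized cochain `x`, bilinearly. -/
noncomputable def ncAct {p n m : ℤ} (h : n = m + p) :
    NCochain R e p →ₗ[R] NegCyc R e n →ₗ[R] NegCyc R e m where
  toFun x := negLie h x.1 x.2.2.2
  map_add' x y := LinearMap.ext fun c => Subtype.ext (funext fun i =>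
    congrArg (fun f => f (c.1 i)) (chainLie_add (lieFun_isChainFun x.2.1 x.2.2.1)
      (lieFun_isChainFun y.2.1 y.2.2.1) (lieFun_isChainFun (x + y).2.1 (x + y).2.2.1)))
  map_smul' r x := LinearMap.ext fun c => Subtype.ext (funext fun i =>
    congrArg (fun f => f (c.1 i)) (chainLie_smul r (lieFun_isChainFun x.2.1 x.2.2.1)
      (lieFun_isChainFun (r • x).2.1 (r • x).2.2.1)))

theorem ncAct_val {p n m : ℤ} (h : n = m + p) (x : NCochain R e p) (c : NegCyc R e n) (i : ℕ) :
    (ncAct h x c).1 i = chainLie R e p x.1 (c.1 i) := rfl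

theorem ncAct_bracket {p q a b n m l : ℤ} (h₁ : p + q = a) (h₂ : n = b + q) (h₃ : b = m + p)
    (h₄ : n = m + a) (h₅ : n = l + p) (h₆ : l = m + q) (x : NCochain R e p)
    (y : NCochain R e q) (c : NegCyc R e n) :
    ncAct h₃ x (ncAct h₂ y c) = ncAct h₄ (ncBr h₁ x y) c + sgn (p * q) • ncAct h₆ y (ncAct h₅ x c) := by
  subst h₁
  refine Subtype.ext (funext fun i => ?_)
  have := chainLie_bracket x.2.1 y.2.1 x.2.2.2 y.2.2.2 (lieFun_isChainFun x.2.1 x.2.2.1)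
    (lieFun_isChainFun y.2.1 y.2.2.1) (lieFun_isChainFun (ncBr rfl x y).2.1 (ncBr rfl x y).2.2.1)
    (c.1 i)
  rw [sub_eq_iff_eq_add] at this
  exact this

theorem negDiff_act {μ : List B → B} (hμm : IsMultilin (RingHom.id R) μ) (hμ : HasDegree 1 μ)
    (hu : IsUnital e μ) {p q n m l a : ℤ} (hp : p + 1 = q) (h₁ : n = m + p) (h₂ : m = a + 1)
    (h₃ : n = a + q) (h₄ : n = l + 1) (h₅ : l = a + p) (x : NCochain R e p) (c : NegCyc R e n) :
    negDiff h₂ μ hμ (ncAct h₁ x c) =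
      ncAct h₃ (ncDiff hμm hμ hu hp x) c + sgn p • ncAct h₅ x (negDiff h₄ μ hμ c) := by
  obtain rfl : q = 1 + p := by omega
  have key : ∀ c : NChain R e, chainLie R e 1 μ (chainLie R e p x.1 c) =
      chainLie R e (1 + p) (gbr 1 p μ x.1) c + sgn p • chainLie R e p x.1 (chainLie R e 1 μ c) := by
    intro c
    have := chainLie_bracket hμm x.2.1 hμ x.2.2.2 (lieFun_isChainFun_unital hμm hμ hu)
      (lieFun_isChainFun x.2.1 x.2.2.1) (lieFun_isChainFun (ncDiff hμm hμ hu hp x).2.1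
        (ncDiff hμm hμ hu hp x).2.2.1) c
    rwa [sub_eq_iff_eq_add, one_mul] at this
  refine Subtype.ext (funext fun i => ?_)
  cases i with
  | zero =>
    refine (add_zero _).trans ((key (c.1 0)).trans ?_)
    change _ = _ + sgn p • chainLie R e p x.1 (chainLie R e 1 μ (c.1 0) + 0)
    rw [add_zero]; rfl
  | succ i =>
    change chainLie R e 1 μ (chainLie R e p x.1 (c.1 (i + 1))) +
      connes R e (chainLie R e p x.1 (c.1 i)) = chainLie R e (1 + p) (gbr 1 p μ x.1) (c.1 (i + 1)) +
      sgn p • chainLie R e p x.1 (chainLie R e 1 μ (c.1 (i + 1)) + connes R e (c.1 i))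
    rw [key, connes_chainLie x.2.1 x.2.2.1 x.2.2.2, map_add, smul_add, add_assoc]

end NegModule

theorem negDiff_negDiff {k : Type*} [Field k] [CharZero k] {B : Type*} [AddCommGroup B] [Module k B]
    {e : B} {μ : List B → B} (hμm : IsMultilin (RingHom.id k) μ) (hμ : HasDegree 1 μ)
    (hu : IsUnital e μ) (hμμ : gbr 1 1 μ μ = 0) {n m l : ℤ} (h₁ : n = m + 1) (h₂ : m = l + 1)
    (c : NegCyc k e n) : negDiff h₂ μ hμ (negDiff h₁ μ hμ c) = 0 := by
  have hC := lieFun_isChainFun_unital hμm hμ hu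
  have bb : ∀ c : NChain k e, chainLie k e 1 μ (chainLie k e 1 μ c) = 0 := by
    intro c
    have := chainLie_bracket hμm hμm hμ hμ hC hC (by
      rw [hμμ]
      exact lieFun_isChainFun (NCochain k e 0).zero_mem.1 (NCochain k e 0).zero_mem.2.1) c
    rw [hμμ, chainLie_zero, show sgn (1 * 1) = -1 from rfl, neg_one_smul, sub_neg_eq_add,
      ← two_smul k] at this
    exact (smul_eq_zero_iff_right two_ne_zero).1 this
  refine Subtype.ext (funext fun i => ?_)
  match i with
  | 0 =>
    change chainLie k e 1 μ (chainLie k e 1 μ (c.1 0) + 0) + 0 = 0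
    rw [add_zero, add_zero, bb]
  | 1 =>
    change chainLie k e 1 μ (chainLie k e 1 μ (c.1 1) + connes k e (c.1 0)) +
      connes k e (chainLie k e 1 μ (c.1 0) + 0) = 0
    rw [add_zero, map_add, bb, connes_hochschild hμm hμ hu]
    simp
  | i + 2 =>
    change chainLie k e 1 μ (chainLie k e 1 μ (c.1 (i + 2)) + connes k e (c.1 (i + 1))) +
      connes k e (chainLie k e 1 μ (c.1 (i + 1)) + connes k e (c.1 i)) = 0
    rw [map_add, map_add, bb, connes_hochschild hμm hμ hu, connes_connes]
    simp

section Algebra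

variable (k : Type u) [Field k] (A : Type v) [Ring A] [Algebra k A]

/-- The shifted negative cyclic complex `Σ^(-d-1) CC⁻(A)` as a DG-module over the normalized
Hochschild cochains. Its part of cohomological degree `j` is `CC⁻(A)` in homological degree
`d + 1 - j`; the shift `s^(-d-1)` contributes the signs: the differential is
`(-1)^(d+1) (b + uB)` and `x` acts by `(-1)^((d+1)|x|) L_x`. -/
noncomputable def shiftedNegCyc [CharZero k] (d : ℤ) : DGLieModule.{u, v, max u v} (cochains k A) where
  X j := NegCyc k (1 : A) (d + 1 - j)
  d {i j} h := sgn (d + 1) • negDiff (by omega) (ofBilin (mulBilin k A)) (ofBilin_hasDegree _)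
  act {i j n} h := sgn ((d + 1) * i) • ncAct (R := k) (e := (1 : A)) (n := d + 1 - j) (m := d + 1 - n) (p := i) (by omega)
  d_d h h' c := by
    simp only [LinearMap.smul_apply, map_zsmul, negDiff_negDiff (ofBilin_multilin _)
      (ofBilin_hasDegree _) (mulBilin_unital k A) (mulBilin_gbr k A), smul_zero]
  act_act {i j l a b c n} h₁ h₂ h₃ h₄ h₅ h₆ x y z := by
    have e := ncAct_bracket (R := k) (e := (1 : A)) (n := d + 1 - l) h₃ (b := d + 1 - a)
      (m := d + 1 - n) (l := d + 1 - c)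
      (by omega) (by omega) (by omega) (by omega) (by omega) x y z
    change sgn ((d + 1) * i) • ncAct (R := k) (e := (1 : A)) _ x
      (sgn ((d + 1) * j) • ncAct _ y z) =
      sgn ((d + 1) * b) • ncAct _ (ncBr h₃ x y) z +
      sgn (i * j) • sgn ((d + 1) * j) • ncAct _ y (sgn ((d + 1) * i) • ncAct _ x z)
    rw [map_zsmul, map_zsmul, e]
    subst h₃
    simp only [sgn_smul_smul, smul_add]
    congr 2
    · congr 1; ring
    · refine sgn_congr ⟨0, by ring⟩
  leibniz {i j n i' j' n'} h hn hi hj h₁ h₂ x y := by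
    have e := negDiff_act (ofBilin_multilin _) (ofBilin_hasDegree _) (mulBilin_unital k A) hi
      (n := d + 1 - j) (m := d + 1 - n) (a := d + 1 - n') (l := d + 1 - j') (by omega) (by omega)
      (by omega) (by omega) (by omega) x y
    change sgn (d + 1) • negDiff _ (ofBilin (mulBilin k A)) (ofBilin_hasDegree _)
        (sgn ((d + 1) * i) • ncAct (R := k) (e := (1 : A)) _ x y) =
      sgn ((d + 1) * i') • ncAct (R := k) (e := (1 : A)) _ (ncDiff (ofBilin_multilin _)
        (ofBilin_hasDegree _) (mulBilin_unital k A) hi x) y +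
      sgn i • sgn ((d + 1) * i) • ncAct (R := k) (e := (1 : A)) _ x
        (sgn (d + 1) • negDiff _ (ofBilin (mulBilin k A)) (ofBilin_hasDegree _) y)
    rw [map_zsmul, map_zsmul, e]
    subst hi
    simp only [sgn_smul_smul, smul_add]
    congr 2
    · congr 1; ring
    · refine sgn_congr ⟨0, by ring⟩

/-- The identification of pieces of equal degree. -/
def NegCyc.cast {R : Type*} [CommRing R] {B : Type*} [AddCommGroup B] [Module R B] {e : B}
    {n m : ℤ} (h : n = m) : NegCyc R e n →ₗ[R] NegCyc R e m where
  toFun c := ⟨c.1, h ▸ c.2⟩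
  map_add' _ _ := rfl
  map_smul' _ _ := rfl

variable {k A}

/-- `η₀` is a cycle of the negative cyclic complex `(CC⁻(A), b + uB)`. -/
def IsNegCycle {d : ℤ} (η₀ : NegCyc k (1 : A) d) : Prop :=
  negDiff (show d = (d - 1) + 1 by omega) (ofBilin (mulBilin k A)) (ofBilin_hasDegree _) η₀ = 0

/-- The element `(0, s^(-d-1) η₀)` of degree one in the semidirect product. -/
noncomputable def twistElement [CharZero k] {d : ℤ} (η₀ : NegCyc k (1 : A) d) :
    ((cochains k A).semidirect (shiftedNegCyc k A d)).X 1 :=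
  (0, NegCyc.cast (by omega) η₀)

theorem semidirect_isMC {g : DGLie.{u, v} k} (M : DGLieModule.{u, v, w} g) (z : M.X 1)
    (hz : M.d (show (1 : ℤ) + 1 = 2 by norm_num) z = 0) : (g.semidirect M).IsMC (0, z) := by
  refine Prod.ext ?_ ?_
  · change g.d _ 0 + (2 : k)⁻¹ • g.br (show (1 : ℤ) + 1 = 2 by norm_num) 0 0 = 0
    rw [map_zero, map_zero, smul_zero, add_zero]
  · change M.d _ z + (2 : k)⁻¹ • (M.act (show (1 : ℤ) + 1 = 2 by norm_num) 0 z -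
        sgn (1 * 1) • M.act (show (1 : ℤ) + 1 = 2 by norm_num) 0 z) = 0
    rw [hz, map_zero, LinearMap.zero_apply, smul_zero, sub_zero, smul_zero, add_zero]

theorem negDiff_cast_eq_zero {R : Type*} [CommRing R] {B : Type*} [AddCommGroup B] [Module R B]
    {e : B} {n n' m m' : ℤ} (hn : n = n') (h : n = m + 1) (h' : n' = m' + 1) {μ : List B → B}
    (hμ : HasDegree 1 μ) {c : NegCyc R e n} (hc : negDiff h μ hμ c = 0) :
    negDiff h' μ hμ (NegCyc.cast hn c) = 0 := by
  subst hn
  obtain rfl : m = m' := by omega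
  exact hc

theorem shiftedNegCyc_d [CharZero k] {d i j : ℤ} (h : i + 1 = j) (h' : d + 1 - i = d + 1 - j + 1)
    (c : NegCyc k (1 : A) (d + 1 - i)) : (shiftedNegCyc k A d).d h c =
      sgn (d + 1) • negDiff h' (ofBilin (mulBilin k A)) (ofBilin_hasDegree _) c := rfl

theorem twistElement_isMC [CharZero k] {d : ℤ} (η₀ : NegCyc k (1 : A) d) (h : IsNegCycle η₀) :
    ((cochains k A).semidirect (shiftedNegCyc k A d)).IsMC (twistElement η₀) := by
  refine semidirect_isMC (shiftedNegCyc k A d) _ ?_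
  have e : sgn (d + 1) • negDiff (show d + 1 - 1 = d + 1 - 2 + 1 by omega) (ofBilin (mulBilin k A))
      (ofBilin_hasDegree _) (NegCyc.cast (show d = d + 1 - 1 by omega) η₀) = 0 := by
    rw [negDiff_cast_eq_zero _ _ _ _ h, smul_zero]
  exact (shiftedNegCyc_d _ (by omega) _).trans e

/-- The DG-Lie algebra `𝔇(A, η₀)`: the semidirect product of the normalized Hochschild cochains with
the shifted negative cyclic chains, twisted by `(0, s^(-d-1) η₀)`. -/
noncomputable def frakD [CharZero k] {d : ℤ} (η₀ : NegCyc k (1 : A) d) (h : IsNegCycle η₀) :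
    DGLie.{u, max u v} k :=
  ((cochains k A).semidirect (shiftedNegCyc k A d)).twist (twistElement η₀)
    (twistElement_isMC η₀ h)

end Algebra

open scoped TensorProduct
open CategoryTheory


section SmulTop

variable {R S : Type*} [CommRing R] [CommRing S] {σ : R →+* S} {I : Ideal R} {J : Ideal S}
  {M N : Type*} [AddCommGroup M] [Module R M] [AddCommGroup N] [Module S N]

theorem map_smul_top (hσ : ∀ r ∈ I, σ r ∈ J) (f : M →ₛₗ[σ] N) {x : M}
    (hx : x ∈ I • (⊤ : Submodule R M)) : f x ∈ J • (⊤ : Submodule S N) := by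
  induction hx using Submodule.smul_induction_on' with
  | smul r hr a _ => rw [map_smulₛₗ]; exact Submodule.smul_mem_smul (hσ r hr) trivial
  | add a _ b _ ha hb => rw [map_add]; exact add_mem ha hb

theorem map_smul_top' {M N : Type*} [AddCommGroup M] [Module R M] [AddCommGroup N] [Module R N]
    (f : M →ₗ[R] N) {x : M}
    (hx : x ∈ I • (⊤ : Submodule R M)) : f x ∈ I • (⊤ : Submodule R N) :=
  map_smul_top (fun _ h => h) f hx

/-- An endomorphism which is the identity modulo a nilpotent ideal is invertible. -/
theorem isUnit_of_sub_mem {N : ℕ} (hI : I ^ N = ⊥) (φ : Module.End R M)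
    (hφ : ∀ x, φ x - x ∈ I • (⊤ : Submodule R M)) : IsUnit φ := by
  have key : ∀ n x, ((φ - 1) ^ n) x ∈ (I ^ n) • (⊤ : Submodule R M) := by
    intro n
    induction n with
    | zero => intro x; simp
    | succ n ih =>
      intro x
      rw [pow_succ (φ - 1), Module.End.mul_apply]
      have h := hφ x
      change ((φ - 1) ^ n) (φ x - x) ∈ _
      generalize φ x - x = z at h
      induction h using Submodule.smul_induction_on' with
      | smul r hr a _ =>
        rw [map_smul, pow_succ', Submodule.mul_smul]
        exact Submodule.smul_mem_smul hr (ih a)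
      | add a _ b _ ha hb => rw [map_add]; exact add_mem ha hb
  have : IsNilpotent (φ - 1) := ⟨N, LinearMap.ext fun x => by
    have := key N x
    rw [hI, Submodule.bot_smul, Submodule.mem_bot] at this
    exact this⟩
  have h2 := this.isUnit_add_one
  rwa [sub_add_cancel] at h2

end SmulTop

section BaseChange

variable {k : Type u} [CommRing k] {A : Type v} [Ring A] [Algebra k A]

/-- The map `a ↦ 1 ⊗ a`, semilinear over `k → R`. -/
def incl (R : Type w) [CommRing R] [Algebra k R] (A : Type v) [Ring A] [Algebra k A] :
    A →ₛₗ[algebraMap k R] R ⊗[k] A where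
  toFun a := 1 ⊗ₜ a
  map_add' a b := TensorProduct.tmul_add _ _ _
  map_smul' c a := by
    rw [TensorProduct.tmul_smul, algebraMap_smul]

variable {R S T : Type*} [CommRing R] [CommRing S] [CommRing T] [Algebra k R] [Algebra k S]
  [Algebra k T]

/-- The map `f ⊗ id : R ⊗ A → S ⊗ A`, semilinear over `f : R → S`. -/
def bcMap (A : Type v) [Ring A] [Algebra k A] (f : R →ₐ[k] S) :
    R ⊗[k] A →ₛₗ[(f : R →+* S)] S ⊗[k] A where
  toFun := f.toLinearMap.rTensor A
  map_add' := map_add _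
  map_smul' r x := by
    induction x with
    | zero => simp
    | add a b ha hb => rw [smul_add, map_add, ha, hb, map_add, smul_add]
    | tmul s a => simp [TensorProduct.smul_tmul']

theorem bcMap_tmul (f : R →ₐ[k] S) (r : R) (a : A) : bcMap A f (r ⊗ₜ a) = f r ⊗ₜ a := rfl

theorem bcMap_one (f : R →ₐ[k] S) : bcMap A f 1 = 1 := by
  rw [Algebra.TensorProduct.one_def, bcMap_tmul, map_one, Algebra.TensorProduct.one_def]

theorem bcMap_mul (f : R →ₐ[k] S) (x y : R ⊗[k] A) :
    bcMap A f (x * y) = bcMap A f x * bcMap A f y := by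
  induction x with
  | zero => simp
  | add a b ha hb => simp only [add_mul, map_add, ha, hb]
  | tmul r a =>
    induction y with
    | zero => simp
    | add a b ha hb => simp only [mul_add, map_add, ha, hb]
    | tmul s b => simp [bcMap_tmul]

theorem bcMap_id (x : R ⊗[k] A) : bcMap A (AlgHom.id k R) x = x :=
  LinearMap.rTensor_id_apply _ _ x

theorem bcMap_comp (f : R →ₐ[k] S) (g : S →ₐ[k] T) (x : R ⊗[k] A) :
    bcMap A (g.comp f) x = bcMap A g (bcMap A f x) :=
  LinearMap.rTensor_comp_apply A g.toLinearMap f.toLinearMap x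

theorem bcMap_incl (f : R →ₐ[k] S) (a : A) : bcMap A f (incl R A a) = incl S A a := by
  simp [incl, bcMap_tmul]

theorem bc_induction (f : R →ₐ[k] S) {p : S ⊗[k] A → Prop} (hz : p 0)
    (hadd : ∀ x y, p x → p y → p (x + y)) (hs : ∀ (s : S) x, p (s • bcMap A f x)) (x : S ⊗[k] A) : p x := by
  induction x with
  | zero => exact hz
  | add a b ha hb => exact hadd _ _ ha hb
  | tmul s a =>
    have := hs s (1 ⊗ₜ a)
    rwa [bcMap_tmul, map_one, TensorProduct.smul_tmul', smul_eq_mul, mul_one] at this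

/-- The `S`-linear extension of a `k`-linear map on `A`. -/
noncomputable def ext₁ {M : Type*} [AddCommGroup M] [Module k M] [Module S M] [IsScalarTower k S M] :
    (A →ₗ[k] M) →ₗ[k] (S ⊗[k] A →ₗ[S] M) :=
  (LinearMap.liftBaseChangeEquiv (R := k) (M := A) (N := M) S).toLinearMap.restrictScalars k

/-- The `S`-bilinear extension of a `k`-bilinear map on `A`. -/
noncomputable def ext₂ (S : Type*) [CommRing S] [Algebra k S] {M : Type*} [AddCommGroup M] [Module k M]
    [Module S M] [IsScalarTower k S M] (l : A →ₗ[k] A →ₗ[k] M) :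
    S ⊗[k] A →ₗ[S] S ⊗[k] A →ₗ[S] M := ext₁ (ext₁ ∘ₗ l)

theorem ext₁_tmul {M : Type*} [AddCommGroup M] [Module k M] [Module S M] [IsScalarTower k S M]
    (l : A →ₗ[k] M) (s : S) (a : A) : ext₁ l (s ⊗ₜ a) = s • l a := rfl

theorem ext₂_tmul {M : Type*} [AddCommGroup M] [Module k M] [Module S M] [IsScalarTower k S M]
    (l : A →ₗ[k] A →ₗ[k] M) (s t : S) (a b : A) :
    ext₂ S l (s ⊗ₜ a) (t ⊗ₜ b) = s • t • l a b := rfl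

/-- The map of `S ⊗ A` induced by base change along `f` from a linear map of `R ⊗ A`. -/
noncomputable def bcEnd (f : R →ₐ[k] S) (φ : R ⊗[k] A →ₗ[R] R ⊗[k] A) : S ⊗[k] A →ₗ[S] S ⊗[k] A :=
  ext₁ (f.toLinearMap.rTensor A ∘ₗ φ.restrictScalars k ∘ₗ TensorProduct.mk k R A 1)

/-- The bilinear map on `S ⊗ A` induced by base change along `f` from one on `R ⊗ A`. -/
noncomputable def bcBilin (f : R →ₐ[k] S) (μ : R ⊗[k] A →ₗ[R] R ⊗[k] A →ₗ[R] R ⊗[k] A) :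
    S ⊗[k] A →ₗ[S] S ⊗[k] A →ₗ[S] S ⊗[k] A :=
  ext₂ S (LinearMap.mk₂ k (fun a b => bcMap A f (μ (1 ⊗ₜ a) (1 ⊗ₜ b)))
    (fun a a' b => by simp [TensorProduct.tmul_add])
    (fun c a b => by
      simp only [TensorProduct.tmul_smul, LinearMap.map_smul_of_tower, LinearMap.smul_apply]
      exact map_smul (f.toLinearMap.rTensor A) c _)
    (fun a b b' => by simp [TensorProduct.tmul_add])
    (fun c a b => by
      simp only [TensorProduct.tmul_smul, LinearMap.map_smul_of_tower]
      exact map_smul (f.toLinearMap.rTensor A) c _))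

theorem bcEnd_bcMap (f : R →ₐ[k] S) (φ : R ⊗[k] A →ₗ[R] R ⊗[k] A) (x : R ⊗[k] A) :
    bcEnd f φ (bcMap A f x) = bcMap A f (φ x) := by
  induction x with
  | zero => simp
  | add a b ha hb => simp only [map_add, ha, hb]
  | tmul r a =>
    rw [bcMap_tmul, bcEnd, ext₁_tmul]
    change f r • bcMap A f (φ (1 ⊗ₜ a)) = _
    rw [show r ⊗ₜ[k] a = r • (1 ⊗ₜ[k] a) by rw [TensorProduct.smul_tmul', smul_eq_mul, mul_one],
      map_smul, map_smulₛₗ]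
    rfl

theorem bcBilin_bcMap (f : R →ₐ[k] S) (μ : R ⊗[k] A →ₗ[R] R ⊗[k] A →ₗ[R] R ⊗[k] A)
    (x y : R ⊗[k] A) : bcBilin f μ (bcMap A f x) (bcMap A f y) = bcMap A f (μ x y) := by
  induction x with
  | zero => simp
  | add a b ha hb => simp only [map_add, LinearMap.add_apply, ha, hb]
  | tmul r a =>
    induction y with
    | zero => simp
    | add a b ha hb => simp only [map_add, ha, hb]
    | tmul s b =>
      rw [bcMap_tmul, bcMap_tmul, bcBilin, ext₂_tmul]
      change f r • f s • bcMap A f (μ (1 ⊗ₜ a) (1 ⊗ₜ b)) = _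
      rw [show r ⊗ₜ[k] a = r • (1 ⊗ₜ[k] a) by rw [TensorProduct.smul_tmul', smul_eq_mul, mul_one],
        show s ⊗ₜ[k] b = s • (1 ⊗ₜ[k] b) by rw [TensorProduct.smul_tmul', smul_eq_mul, mul_one],
        map_smul μ, LinearMap.smul_apply, map_smul (μ _), map_smulₛₗ, map_smulₛₗ]
      rfl

theorem bcEnd_unique (f : R →ₐ[k] S) {φ : R ⊗[k] A →ₗ[R] R ⊗[k] A} {ψ : S ⊗[k] A →ₗ[S] S ⊗[k] A}
    (h : ∀ x, ψ (bcMap A f x) = bcMap A f (φ x)) : ψ = bcEnd f φ := by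
  refine LinearMap.ext fun x => ?_
  induction x using bc_induction f with
  | hz => simp
  | hadd x y hx hy => rw [map_add, map_add, hx, hy]
  | hs s x => rw [map_smul, map_smul, h, bcEnd_bcMap]

theorem bcBilin_unique (f : R →ₐ[k] S) {μ : R ⊗[k] A →ₗ[R] R ⊗[k] A →ₗ[R] R ⊗[k] A}
    {ν : S ⊗[k] A →ₗ[S] S ⊗[k] A →ₗ[S] S ⊗[k] A}
    (h : ∀ x y, ν (bcMap A f x) (bcMap A f y) = bcMap A f (μ x y)) : ν = bcBilin f μ := by
  refine LinearMap.ext fun x => LinearMap.ext fun y => ?_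
  induction x using bc_induction f with
  | hz => simp
  | hadd x y hx hy => rw [map_add, map_add, LinearMap.add_apply, LinearMap.add_apply, hx, hy]
  | hs s x =>
    rw [map_smul, map_smul, LinearMap.smul_apply, LinearMap.smul_apply]
    congr 1
    induction y using bc_induction f with
    | hz => simp
    | hadd x y hx hy => rw [map_add, map_add, hx, hy]
    | hs s x => rw [map_smul, map_smul, h, bcBilin_bcMap]

theorem bcEnd_id (φ : R ⊗[k] A →ₗ[R] R ⊗[k] A) : bcEnd (AlgHom.id k R) φ = φ :=
  (bcEnd_unique _ fun x => by rw [bcMap_id, bcMap_id]).symm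

theorem bcEnd_bcEnd (f : R →ₐ[k] S) (g : S →ₐ[k] T) (φ : R ⊗[k] A →ₗ[R] R ⊗[k] A) :
    bcEnd g (bcEnd f φ) = bcEnd (g.comp f) φ :=
  bcEnd_unique _ fun x => by rw [bcMap_comp, bcEnd_bcMap, bcEnd_bcMap, bcMap_comp]

theorem bcEnd_one (f : R →ₐ[k] S) : bcEnd f (LinearMap.id : R ⊗[k] A →ₗ[R] R ⊗[k] A) =
    (LinearMap.id : S ⊗[k] A →ₗ[S] S ⊗[k] A) :=
  (bcEnd_unique f fun x => by rw [LinearMap.id_apply, LinearMap.id_apply]).symm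

theorem bcEnd_comp (f : R →ₐ[k] S) (φ ψ : R ⊗[k] A →ₗ[R] R ⊗[k] A) :
    bcEnd f (φ ∘ₗ ψ) = bcEnd f φ ∘ₗ bcEnd f ψ :=
  (bcEnd_unique _ fun x => by
    rw [LinearMap.comp_apply, bcEnd_bcMap, bcEnd_bcMap, LinearMap.comp_apply]).symm

theorem bcBilin_id (μ : R ⊗[k] A →ₗ[R] R ⊗[k] A →ₗ[R] R ⊗[k] A) :
    bcBilin (AlgHom.id k R) μ = μ :=
  (bcBilin_unique _ fun x y => by rw [bcMap_id, bcMap_id, bcMap_id]).symm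

theorem bcBilin_bcBilin (f : R →ₐ[k] S) (g : S →ₐ[k] T)
    (μ : R ⊗[k] A →ₗ[R] R ⊗[k] A →ₗ[R] R ⊗[k] A) :
    bcBilin g (bcBilin f μ) = bcBilin (g.comp f) μ :=
  bcBilin_unique _ fun x y => by
    rw [bcMap_comp, bcMap_comp, bcBilin_bcMap, bcBilin_bcMap, bcMap_comp]

end BaseChange

section NegMaps

variable {R S T : Type*} [CommRing R] [CommRing S] [CommRing T] {B B' B'' : Type*}
  [AddCommGroup B] [Module R B] [AddCommGroup B'] [Module S B'] [AddCommGroup B''] [Module T B'']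
  {σ : R →+* S} {τ : S →+* T} {ρ : R →+* T} {e : B} {e' : B'} {e'' : B''}

theorem negMap_negDiff (g : B →ₛₗ[σ] B') (he : g e = e') {n m : ℤ} (h : n = m + 1)
    {μ : B →ₗ[R] B →ₗ[R] B} {μ' : B' →ₗ[S] B' →ₗ[S] B'} (hu : IsUnital e (ofBilin μ))
    (hu' : IsUnital e' (ofBilin μ')) (hg : ∀ a b, g (μ a b) = μ' (g a) (g b)) (c : NegCyc R e n) :
    negMap g he m (negDiff h (ofBilin μ) (ofBilin_hasDegree μ) c) =
      negDiff h (ofBilin μ') (ofBilin_hasDegree μ') (negMap g he n c) := by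
  have hx : ∀ l, ofBilin μ' (l.map g) = g (ofBilin μ l) := by
    intro l
    by_cases hl : l.length = 2
    · match l, hl with
      | [a, b], _ => exact (hg a b).symm
    · rw [ofBilin_of_length μ hl, ofBilin_of_length μ' (by simpa using hl), map_zero]
  have key := chainMap_chainLie g he (p := 1) hx
    (lieFun_isChainFun_unital (ofBilin_multilin μ) (ofBilin_hasDegree μ) hu)
    (lieFun_isChainFun_unital (ofBilin_multilin μ') (ofBilin_hasDegree μ') hu')
  refine Subtype.ext (funext fun i => ?_)
  cases i with
  | zero =>
    change chainMap g he (chainLie R e 1 (ofBilin μ) (c.1 0) + 0) =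
      chainLie S e' 1 (ofBilin μ') (chainMap g he (c.1 0)) + 0
    rw [add_zero, add_zero, key]
  | succ i =>
    change chainMap g he (chainLie R e 1 (ofBilin μ) (c.1 (i + 1)) + connes R e (c.1 i)) =
      chainLie S e' 1 (ofBilin μ') (chainMap g he (c.1 (i + 1))) +
        connes S e' (chainMap g he (c.1 i))
    rw [map_add, key, chainMap_connes]

theorem negMap_negMap (g : B →ₛₗ[σ] B') (he : g e = e') (g' : B' →ₛₗ[τ] B'') (he' : g' e' = e'')
    (g'' : B →ₛₗ[ρ] B'') (he'' : g'' e = e'') (hg : ∀ b, g' (g b) = g'' b)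
    (hσ : ∀ r, τ (σ r) = ρ r) {n : ℤ} (c : NegCyc R e n) :
    negMap g' he' n (negMap g he n c) = negMap g'' he'' n c :=
  Subtype.ext (funext fun i => chainMap_chainMap g he g' he' g'' he'' hg hσ (c.1 i))

theorem negMap_id {σ : R →+* R} (g : B →ₛₗ[σ] B) (he : g e = e) (hσ : ∀ r, σ r = r)
    (hg : ∀ b, g b = b) {n : ℤ} (c : NegCyc R e n) : negMap g he n c = c := by
  obtain rfl : σ = RingHom.id R := RingHom.ext hσ
  exact Subtype.ext (funext fun i => chainMap_id g he hg (c.1 i))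

end NegMaps

section DefFlat

variable {k : Type u} [Field k] {A : Type v} [Ring A] [Algebra k A]

theorem incl_one (R : Type w) [CommRing R] [Algebra k R] : incl R A (1 : A) = (1 : R ⊗[k] A) := rfl

/-- The image of a negative cyclic chain of `A` in the negative cyclic chains of `R ⊗ A` over
`R`. -/
noncomputable def bcNeg (R : Type w) [CommRing R] [Algebra k R] (d : ℤ) :
    NegCyc k (1 : A) d →ₛₗ[algebraMap k R] NegCyc R (1 : R ⊗[k] A) d :=
  negMap (incl R A) (incl_one R) d

section

variable {R S T : Type*} [CommRing R] [CommRing S] [CommRing T] [Algebra k R] [Algebra k S]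
  [Algebra k T]

/-- The map on negative cyclic chains induced by `f ⊗ id : R ⊗ A → S ⊗ A`. -/
noncomputable def bcNegMap (A : Type v) [Ring A] [Algebra k A] (f : R →ₐ[k] S) (n : ℤ) :
    NegCyc R (1 : R ⊗[k] A) n →ₛₗ[(f : R →+* S)] NegCyc S (1 : S ⊗[k] A) n :=
  negMap (bcMap A f) (bcMap_one f) n

theorem bcNegMap_id {n : ℤ} (c : NegCyc R (1 : R ⊗[k] A) n) :
    bcNegMap A (AlgHom.id k R) n c = c :=
  negMap_id _ _ (fun _ => rfl) bcMap_id c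

theorem bcNegMap_comp (f : R →ₐ[k] S) (g : S →ₐ[k] T) {n : ℤ} (c : NegCyc R (1 : R ⊗[k] A) n) :
    bcNegMap A (g.comp f) n c = bcNegMap A g n (bcNegMap A f n c) :=
  (negMap_negMap _ _ _ _ _ _ (fun b => (bcMap_comp f g b).symm) (fun _ => rfl) c).symm

theorem bcNegMap_bcNeg (f : R →ₐ[k] S) {n : ℤ} (c : NegCyc k (1 : A) n) :
    bcNegMap A f n (bcNeg R n c) = bcNeg S n c :=
  negMap_negMap (incl R A) (incl_one R) (bcMap A f) (bcMap_one f) (incl S A) (incl_one S)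
    (bcMap_incl f) (fun r => f.commutes r) c

theorem bcNegMap_negDiff (f : R →ₐ[k] S) {n m : ℤ} (h : n = m + 1)
    {μ : R ⊗[k] A →ₗ[R] R ⊗[k] A →ₗ[R] R ⊗[k] A} (hu : IsUnital 1 (ofBilin μ))
    (hu' : IsUnital 1 (ofBilin (bcBilin f μ))) (c : NegCyc R (1 : R ⊗[k] A) n) :
    bcNegMap A f m (negDiff h (ofBilin μ) (ofBilin_hasDegree μ) c) =
      negDiff h (ofBilin (bcBilin f μ)) (ofBilin_hasDegree _) (bcNegMap A f n c) :=
  negMap_negDiff _ _ h hu hu' (fun a b => (bcBilin_bcMap f μ a b).symm) c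

theorem bcNegMap_negMap (f : R →ₐ[k] S) {φ : R ⊗[k] A →ₗ[R] R ⊗[k] A} (h : φ 1 = 1)
    (h' : bcEnd f φ 1 = 1) {n : ℤ} (c : NegCyc R (1 : R ⊗[k] A) n) :
    bcNegMap A f n (negMap φ h n c) = negMap (bcEnd f φ) h' n (bcNegMap A f n c) := by
  have h2 : (bcMap A f ∘ₛₗ φ) 1 = 1 := by rw [LinearMap.comp_apply, h, bcMap_one]
  exact (negMap_negMap φ h (bcMap A f) (bcMap_one f) (bcMap A f ∘ₛₗ φ) h2 (fun _ => rfl)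
    (fun _ => rfl) c).trans
    (negMap_negMap (bcMap A f) (bcMap_one f) (bcEnd f φ) h' (bcMap A f ∘ₛₗ φ) h2
      (fun a => bcEnd_bcMap f φ a) (fun _ => rfl) c).symm

end

variable {d : ℤ} (η₀ : NegCyc k (1 : A) d) (R : Nilp k)

/-- The objects of `Def♭(R)`: pairs `(μ, η)`, where `-μ` is a unital associative multiplication on
`R ⊗ A` which reduces to the multiplication of `A` modulo `m`, and `η` is a negative cyclic cycle
for it which reduces to `η₀` modulo `m`. -/
@[ext]
structure DefFlat where
  μ : R.R ⊗[k] A →ₗ[R.R] R.R ⊗[k] A →ₗ[R.R] R.R ⊗[k] A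
  η : NegCyc R.R (1 : R.R ⊗[k] A) d
  unital : IsUnital (1 : R.R ⊗[k] A) (ofBilin μ)
  assoc : ∀ a b c, μ (μ a b) c = μ a (μ b c)
  μ_mod : ∀ a b, μ a b - mulBilin R.R (R.R ⊗[k] A) a b ∈
    R.m • (⊤ : Submodule R.R (R.R ⊗[k] A))
  cycle : negDiff (show d = (d - 1) + 1 by omega) (ofBilin μ) (ofBilin_hasDegree μ) η = 0
  η_mod : η - bcNeg R.R d η₀ ∈ R.m • (⊤ : Submodule R.R (NegCyc R.R (1 : R.R ⊗[k] A) d))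

variable {η₀ R}

/-- The morphisms `(μ₁, η₁) ⟶ (μ₂, η₂)` of `Def♭(R)`: pairs `(φ, ξ)`, where `φ` is a unital
homomorphism of `R`-algebras which is the identity modulo `m`, and `ξ` is a negative cyclic chain
which is zero modulo `m`, with `(L_{μ₂} + uB) ξ = φ(η₁) - η₂`. -/
@[ext]
structure DefFlat.Hom (X Y : DefFlat η₀ R) where
  φ : R.R ⊗[k] A →ₗ[R.R] R.R ⊗[k] A
  ξ : NegCyc R.R (1 : R.R ⊗[k] A) (d + 1)
  map_one : φ 1 = 1
  map_μ : ∀ a b, φ (X.μ a b) = Y.μ (φ a) (φ b)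
  φ_mod : ∀ a, φ a - a ∈ R.m • (⊤ : Submodule R.R (R.R ⊗[k] A))
  ξ_mem : ξ ∈ R.m • (⊤ : Submodule R.R (NegCyc R.R (1 : R.R ⊗[k] A) (d + 1)))
  boundary : negDiff rfl (ofBilin Y.μ) (ofBilin_hasDegree Y.μ) ξ =
    negMap φ map_one d X.η - Y.η

namespace DefFlat

/-- The identity `(id, 0)`. -/
noncomputable def Hom.id (X : DefFlat η₀ R) : Hom X X where
  φ := LinearMap.id
  ξ := 0
  map_one := rfl
  map_μ _ _ := rfl
  φ_mod a := by simp
  ξ_mem := Submodule.zero_mem _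
  boundary := by rw [map_zero, negMap_id _ _ (fun _ => rfl) fun _ => rfl, sub_self]

/-- The composition `(φ, ξ) ∘ (φ', ξ') = (φ ∘ φ', φ(ξ') + ξ)`. -/
noncomputable def Hom.comp {X Y Z : DefFlat η₀ R} (f : Hom X Y) (g : Hom Y Z) : Hom X Z where
  φ := g.φ ∘ₗ f.φ
  ξ := negMap g.φ g.map_one _ f.ξ + g.ξ
  map_one := by rw [LinearMap.comp_apply, f.map_one, g.map_one]
  map_μ a b := by simp only [LinearMap.comp_apply, f.map_μ, g.map_μ]
  φ_mod a := by
    have := add_mem (map_smul_top' g.φ (f.φ_mod a)) (g.φ_mod a)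
    rwa [map_sub, sub_add_sub_cancel] at this
  ξ_mem := add_mem (map_smul_top' _ f.ξ_mem) g.ξ_mem
  boundary := by
    rw [map_add, g.boundary, ← negMap_negDiff g.φ g.map_one rfl Y.unital Z.unital g.map_μ,
      f.boundary, map_sub, negMap_negMap f.φ f.map_one g.φ g.map_one (g.φ ∘ₗ f.φ) (by
        rw [LinearMap.comp_apply, f.map_one, g.map_one]) (fun _ => rfl) (fun _ => rfl)]
    abel

theorem Hom.isUnit {X Y : DefFlat η₀ R} (f : Hom X Y) : IsUnit (f.φ : Module.End R.R _) := by
  obtain ⟨N, hN⟩ := R.m_nilpotent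
  exact isUnit_of_sub_mem hN _ f.φ_mod

/-- The inverse of `φ`. -/
noncomputable def Hom.invφ {X Y : DefFlat η₀ R} (f : Hom X Y) : R.R ⊗[k] A →ₗ[R.R] R.R ⊗[k] A :=
  (↑(f.isUnit.unit⁻¹) : Module.End R.R (R.R ⊗[k] A))

theorem Hom.invφ_φ {X Y : DefFlat η₀ R} (f : Hom X Y) (a : R.R ⊗[k] A) : f.invφ (f.φ a) = a :=
  congrArg (fun g : Module.End R.R (R.R ⊗[k] A) => g a) f.isUnit.val_inv_mul

theorem Hom.φ_invφ {X Y : DefFlat η₀ R} (f : Hom X Y) (a : R.R ⊗[k] A) : f.φ (f.invφ a) = a :=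
  congrArg (fun g : Module.End R.R (R.R ⊗[k] A) => g a) f.isUnit.mul_val_inv

theorem Hom.invφ_one {X Y : DefFlat η₀ R} (f : Hom X Y) : f.invφ 1 = 1 := by
  have := f.invφ_φ 1
  rwa [f.map_one] at this

theorem Hom.invφ_μ {X Y : DefFlat η₀ R} (f : Hom X Y) (a b : R.R ⊗[k] A) :
    f.invφ (Y.μ a b) = X.μ (f.invφ a) (f.invφ b) := by
  have := f.map_μ (f.invφ a) (f.invφ b)
  rw [f.φ_invφ, f.φ_invφ] at this
  rw [← this, f.invφ_φ]

/-- The inverse of a morphism. -/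
noncomputable def Hom.inv {X Y : DefFlat η₀ R} (f : Hom X Y) : Hom Y X where
  φ := f.invφ
  ξ := - negMap f.invφ f.invφ_one _ f.ξ
  map_one := f.invφ_one
  map_μ := f.invφ_μ
  φ_mod a := by
    have := neg_mem (map_smul_top' f.invφ (f.φ_mod a))
    rwa [map_sub, f.invφ_φ, neg_sub] at this
  ξ_mem := neg_mem (map_smul_top' _ f.ξ_mem)
  boundary := by
    rw [map_neg, ← negMap_negDiff f.invφ f.invφ_one rfl Y.unital X.unital f.invφ_μ,
      f.boundary, map_sub, negMap_negMap f.φ f.map_one f.invφ f.invφ_one LinearMap.id rfl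
        (fun b => f.invφ_φ b) (fun _ => rfl), negMap_id _ _ (fun _ => rfl) fun _ => rfl, neg_sub]

/-- The groupoid `Def♭(R)`. -/
noncomputable instance groupoid : Groupoid (DefFlat η₀ R) where
  Hom := Hom
  id := Hom.id
  comp f g := Hom.comp f g
  id_comp f := Hom.ext rfl (by
    change negMap f.φ f.map_one _ 0 + f.ξ = f.ξ
    rw [map_zero, zero_add])
  comp_id f := Hom.ext rfl (by
    change negMap LinearMap.id rfl _ f.ξ + 0 = f.ξ
    rw [negMap_id _ _ (fun _ => rfl) fun _ => rfl, add_zero])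
  assoc f g l := Hom.ext rfl (by
    change negMap l.φ l.map_one _ (negMap g.φ g.map_one _ f.ξ + g.ξ) + l.ξ =
      negMap (l.φ ∘ₗ g.φ) (Hom.comp g l).map_one _ f.ξ + (negMap l.φ l.map_one _ g.ξ + l.ξ)
    rw [map_add, negMap_negMap g.φ g.map_one l.φ l.map_one (l.φ ∘ₗ g.φ) (Hom.comp g l).map_one
      (fun _ => rfl) (fun _ => rfl), add_assoc])
  inv f := Hom.inv f
  inv_comp f := Hom.ext (LinearMap.ext f.φ_invφ) (by
    change negMap f.φ f.map_one _ (- negMap f.invφ f.invφ_one _ f.ξ) + f.ξ = 0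
    rw [map_neg, negMap_negMap f.invφ f.invφ_one f.φ f.map_one LinearMap.id rfl
        (fun b => f.φ_invφ b) (fun _ => rfl), negMap_id _ _ (fun _ => rfl) fun _ => rfl, neg_add_cancel])
  comp_inv f := Hom.ext (LinearMap.ext f.invφ_φ) (by
    change negMap f.invφ f.invφ_one _ f.ξ + - negMap f.invφ f.invφ_one _ f.ξ = 0
    rw [add_neg_cancel])

theorem comp_φ {X Y Z : DefFlat η₀ R} (f : X ⟶ Y) (g : Y ⟶ Z) :
    Hom.φ (f ≫ g) = Hom.φ g ∘ₗ Hom.φ f := rfl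

theorem comp_ξ {X Y Z : DefFlat η₀ R} (f : X ⟶ Y) (g : Y ⟶ Z) :
    Hom.ξ (f ≫ g) = negMap (Hom.φ g) (Hom.map_one g) _ (Hom.ξ f) + Hom.ξ g := rfl

theorem eqToHom_φ {X Y : DefFlat η₀ R} (h : X = Y) : Hom.φ (eqToHom h) = LinearMap.id := by
  subst h; rfl

theorem eqToHom_ξ {X Y : DefFlat η₀ R} (h : X = Y) : Hom.ξ (eqToHom h) = 0 := by
  subst h; rfl

theorem functor_ext {C : Type*} [Category C] {F G : C ⥤ DefFlat η₀ R}
    (h₁ : ∀ X, (F.obj X).μ = (G.obj X).μ) (h₂ : ∀ X, (F.obj X).η = (G.obj X).η)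
    (h₃ : ∀ {X Y : C} (f : X ⟶ Y), Hom.φ (F.map f) = Hom.φ (G.map f))
    (h₄ : ∀ {X Y : C} (f : X ⟶ Y), Hom.ξ (F.map f) = Hom.ξ (G.map f)) : F = G := by
  refine CategoryTheory.Functor.ext (fun X => DefFlat.ext (h₁ X) (h₂ X)) fun X Y f => ?_
  refine Hom.ext ?_ ?_
  · rw [comp_φ, comp_φ, eqToHom_φ, eqToHom_φ, LinearMap.comp_id, LinearMap.id_comp, h₃]
  · rw [comp_ξ, comp_ξ, eqToHom_ξ, map_zero, zero_add, h₄]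
    have : ∀ (ψ : R.R ⊗[k] A →ₗ[R.R] R.R ⊗[k] A) (hψ : ψ 1 = 1), ψ = LinearMap.id →
        ∀ c : NegCyc R.R (1 : R.R ⊗[k] A) (d + 1), negMap ψ hψ _ c = c := by
      rintro ψ hψ rfl c
      exact negMap_id _ _ (fun _ => rfl) (fun _ => rfl) c
    rw [eqToHom_ξ, add_zero, this _ _ (eqToHom_φ _)]

variable {S T : Nilp k}

theorem bcBilin_unital (f : R ⟶ S) (X : DefFlat η₀ R) :
    IsUnital (1 : S.R ⊗[k] A) (ofBilin (bcBilin (Nilp.hom f) X.μ)) := by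
  intro x
  constructor
  · change bcBilin (Nilp.hom f) X.μ 1 x = -x
    rw [← bcMap_one (Nilp.hom f)]
    induction x using bc_induction (Nilp.hom f) with
    | hz => simp
    | hadd x y hx hy => rw [map_add, hx, hy, neg_add]
    | hs s x =>
      rw [map_smul, bcBilin_bcMap, show X.μ 1 x = -x from (X.unital x).1, map_neg, smul_neg]
  · change bcBilin (Nilp.hom f) X.μ x 1 = -x
    rw [← bcMap_one (Nilp.hom f)]
    induction x using bc_induction (Nilp.hom f) with
    | hz => simp
    | hadd x y hx hy => rw [map_add, LinearMap.add_apply, hx, hy, neg_add]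
    | hs s x =>
      rw [map_smul, LinearMap.smul_apply, bcBilin_bcMap, show X.μ x 1 = -x from (X.unital x).2,
        map_neg, smul_neg]

/-- Base change of objects of `Def♭`. -/
noncomputable def baseChange (f : R ⟶ S) (X : DefFlat η₀ R) : DefFlat η₀ S where
  μ := bcBilin (Nilp.hom f) X.μ
  η := bcNegMap A (Nilp.hom f) d X.η
  unital := bcBilin_unital f X
  assoc a b c := by
    induction a using bc_induction (Nilp.hom f) with
    | hz => simp
    | hadd x y hx hy => simp only [map_add, LinearMap.add_apply, hx, hy]
    | hs s a =>
      simp only [map_smul, LinearMap.smul_apply]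
      congr 1
      induction b using bc_induction (Nilp.hom f) with
      | hz => simp
      | hadd x y hx hy => simp only [map_add, LinearMap.add_apply, hx, hy]
      | hs s b =>
        simp only [map_smul, LinearMap.smul_apply]
        congr 1
        induction c using bc_induction (Nilp.hom f) with
        | hz => simp
        | hadd x y hx hy => simp only [map_add, hx, hy]
        | hs s c => simp only [map_smul, bcBilin_bcMap, X.assoc]
  μ_mod a b := by
    induction a using bc_induction (Nilp.hom f) with
    | hz => simp
    | hadd x y hx hy =>
      simp only [map_add, LinearMap.add_apply]
      rw [add_sub_add_comm]
      exact add_mem hx hy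
    | hs s a =>
      simp only [map_smul, LinearMap.smul_apply]
      rw [← smul_sub]
      refine Submodule.smul_mem _ _ ?_
      induction b using bc_induction (Nilp.hom f) with
      | hz => simp
      | hadd x y hx hy =>
        simp only [map_add]
        rw [add_sub_add_comm]
        exact add_mem hx hy
      | hs s b =>
        simp only [map_smul]
        rw [← smul_sub]
        refine Submodule.smul_mem _ _ ?_
        have := map_smul_top (σ := (Nilp.hom f : R.R →+* S.R)) (Nilp.map_m f) (bcMap A (Nilp.hom f)) (X.μ_mod a b)
        have e : bcMap A (Nilp.hom f) (X.μ a b - mulBilin R.R (R.R ⊗[k] A) a b) =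
            bcMap A (Nilp.hom f) (X.μ a b) - bcMap A (Nilp.hom f) (-(a * b)) :=
          map_sub (bcMap A (Nilp.hom f)) _ _
        have e' : bcMap A (Nilp.hom f) (-(a * b)) =
            - (bcMap A (Nilp.hom f) a * bcMap A (Nilp.hom f) b) :=
          (map_neg (bcMap A (Nilp.hom f)) _).trans (congrArg _ (bcMap_mul _ a b))
        rw [e, e'] at this
        rw [bcBilin_bcMap]
        exact this
  cycle := by
    rw [← bcNegMap_negDiff (Nilp.hom f) _ X.unital (bcBilin_unital f X), X.cycle, map_zero]
  η_mod := by
    have := map_smul_top (σ := (Nilp.hom f : R.R →+* S.R)) (Nilp.map_m f)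
      (bcNegMap A (Nilp.hom f) d) X.η_mod
    rwa [map_sub, bcNegMap_bcNeg] at this

/-- Base change of morphisms of `Def♭`. -/
noncomputable def baseChangeHom (f : R ⟶ S) {X Y : DefFlat η₀ R} (g : Hom X Y) :
    Hom (baseChange f X) (baseChange f Y) where
  φ := bcEnd (Nilp.hom f) g.φ
  ξ := bcNegMap A (Nilp.hom f) _ g.ξ
  map_one := by
    rw [← bcMap_one (Nilp.hom f), bcEnd_bcMap, g.map_one]
  map_μ a b := by
    change bcEnd _ _ (bcBilin _ _ a b) = bcBilin _ _ _ _
    induction a using bc_induction (Nilp.hom f) with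
    | hz => simp
    | hadd x y hx hy => simp only [map_add, LinearMap.add_apply, hx, hy]
    | hs s a =>
      simp only [map_smul, LinearMap.smul_apply]
      congr 1
      induction b using bc_induction (Nilp.hom f) with
      | hz => simp
      | hadd x y hx hy => simp only [map_add, hx, hy]
      | hs s b => simp only [map_smul, bcEnd_bcMap, bcBilin_bcMap, g.map_μ]
  φ_mod a := by
    induction a using bc_induction (Nilp.hom f) with
    | hz => simp
    | hadd x y hx hy =>
      rw [map_add, add_sub_add_comm]
      exact add_mem hx hy
    | hs s a =>
      rw [map_smul, ← smul_sub]
      refine Submodule.smul_mem _ _ ?_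
      have := map_smul_top (σ := (Nilp.hom f : R.R →+* S.R)) (Nilp.map_m f) (bcMap A (Nilp.hom f))
        (g.φ_mod a)
      rwa [map_sub, ← bcEnd_bcMap] at this
  ξ_mem := map_smul_top (σ := (Nilp.hom f : R.R →+* S.R)) (Nilp.map_m f) _ g.ξ_mem
  boundary := by
    change negDiff rfl (ofBilin (bcBilin (Nilp.hom f) Y.μ)) _
      (bcNegMap A (Nilp.hom f) (d + 1) g.ξ) =
      negMap (bcEnd (Nilp.hom f) g.φ) _ _ (bcNegMap A (Nilp.hom f) d X.η) -
        bcNegMap A (Nilp.hom f) d Y.η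
    rw [← bcNegMap_negDiff (Nilp.hom f) _ Y.unital (bcBilin_unital f Y), g.boundary, map_sub,
      bcNegMap_negMap]

/-- Base change `Def♭(R) → Def♭(S)`. -/
noncomputable def baseChangeFunctor (η₀ : NegCyc k (1 : A) d) (f : R ⟶ S) :
    DefFlat η₀ R ⥤ DefFlat η₀ S where
  obj := baseChange f
  map g := baseChangeHom f g
  map_id X := Hom.ext (bcEnd_one (Nilp.hom f)) (map_zero (bcNegMap A (Nilp.hom f) (d + 1)))
  map_comp {X Y Z} g g' := Hom.ext (bcEnd_comp (Nilp.hom f) (Hom.φ g') (Hom.φ g)) (by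
    change bcNegMap A (Nilp.hom f) (d + 1)
      (negMap (Hom.φ g') (Hom.map_one g') _ (Hom.ξ g) + Hom.ξ g') =
      negMap (bcEnd (Nilp.hom f) (Hom.φ g')) (baseChangeHom f g').map_one _
        (bcNegMap A (Nilp.hom f) (d + 1) (Hom.ξ g)) + bcNegMap A (Nilp.hom f) (d + 1) (Hom.ξ g')
    rw [map_add, bcNegMap_negMap (Nilp.hom f) (Hom.map_one g') (baseChangeHom f g').map_one])

theorem baseChangeFunctor_id (η₀ : NegCyc k (1 : A) d) (R : Nilp k) :
    baseChangeFunctor η₀ (𝟙 R) = 𝟭 (DefFlat η₀ R) :=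
  functor_ext (fun X => bcBilin_id X.μ) (fun X => bcNegMap_id X.η) (fun g => bcEnd_id (Hom.φ g))
    (fun g => bcNegMap_id (Hom.ξ g))

theorem baseChangeFunctor_comp (η₀ : NegCyc k (1 : A) d) (f : R ⟶ S) (g : S ⟶ T) :
    baseChangeFunctor η₀ (f ≫ g) = baseChangeFunctor η₀ f ⋙ baseChangeFunctor η₀ g :=
  functor_ext (fun X => (bcBilin_bcBilin (Nilp.hom f) (Nilp.hom g) X.μ).symm)
    (fun X => bcNegMap_comp (Nilp.hom f) (Nilp.hom g) X.η)
    (fun l => (bcEnd_bcEnd (Nilp.hom f) (Nilp.hom g) (Hom.φ l)).symm)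
    (fun l => bcNegMap_comp (Nilp.hom f) (Nilp.hom g) (Hom.ξ l))

end DefFlat

/-- The functor `Def♭`, from `Nilp` to groupoids. -/
noncomputable def defFlat (η₀ : NegCyc k (1 : A) d) : Nilp k ⥤ Grpd.{max u v, max u v} where
  obj R := Grpd.of (DefFlat η₀ R)
  map f := DefFlat.baseChangeFunctor η₀ f
  map_id R := DefFlat.baseChangeFunctor_id η₀ R
  map_comp f g := DefFlat.baseChangeFunctor_comp η₀ f g

end DefFlat

open scoped TensorProduct
open CategoryTheory


section Comparison

variable {k : Type u} [Field k] {A : Type v} [Ring A] [Algebra k A] {d : ℤ}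

/-- A normalized cochain of degree one, as a bilinear map. -/
def toBilin : NCochain k (1 : A) 1 →ₗ[k] (A →ₗ[k] A →ₗ[k] A) where
  toFun x := LinearMap.mk₂ k (fun a b => x.1 [a, b])
    (fun a a' b => x.2.1.add [] a a' [b]) (fun c a b => x.2.1.smul [] c a [b])
    (fun a b b' => x.2.1.add [a] b b' []) (fun c a b => x.2.1.smul [a] c b [])
  map_add' _ _ := rfl
  map_smul' _ _ := rfl

/-- The first component of an element of `(C ⊕ M) ⊗ m` as an `R`-bilinear map on `R ⊗ A`:
`(x, c) ⊗ r` is sent to the `R`-bilinear map with `(1 ⊗ a, 1 ⊗ b) ↦ r ⊗ x(a, b)`. -/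
noncomputable def cochainPart (R : Nilp k)
    (y : (NCochain k (1 : A) 1 × NegCyc k (1 : A) (d + 1 - 1)) ⊗[k] R.m) :
    R.R ⊗[k] A →ₗ[R.R] R.R ⊗[k] A →ₗ[R.R] R.R ⊗[k] A :=
  ext₂ R.R (TensorProduct.lift (LinearMap.mk₂ k
    (fun z (r : R.m) => (toBilin z.1).compr₂ (TensorProduct.mk k R.R A (r : R.R)))
    (fun z z' r => by ext a b; simp [TensorProduct.tmul_add])
    (fun c z r => by ext a b; simp)
    (fun z r r' => by ext a b; simp)
    (fun c z r => by ext a b; simp [TensorProduct.smul_tmul'])) y)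

/-- The second component of an element of `(C ⊕ M) ⊗ m` as a negative cyclic chain of `R ⊗ A`:
`(x, c) ⊗ r` is sent to `r` times the image of `c`. -/
noncomputable def chainPart (R : Nilp k) :
    (NCochain k (1 : A) 1 × NegCyc k (1 : A) (d + 1 - 1)) ⊗[k] R.m →+
      NegCyc R.R (1 : R.R ⊗[k] A) d :=
  TensorProduct.liftAddHom
    (AddMonoidHom.mk' (fun z => AddMonoidHom.mk'
      (fun r : R.m => (r : R.R) • bcNeg R.R d (NegCyc.cast (by omega) z.2))
      (fun r r' => by rw [Submodule.coe_add, add_smul]))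
      (fun z z' => by ext1 r; simp [smul_add]))
    (fun c z r => by
      change (r : R.R) • bcNeg R.R d (NegCyc.cast _ (c • z.2)) =
        ((c • r : R.m) : R.R) • bcNeg R.R d (NegCyc.cast _ z.2)
      have e : ((c • r : R.m) : R.R) = c • (r : R.R) := rfl
      rw [map_smul, map_smulₛₗ, smul_smul, e, Algebra.smul_def, mul_comm])

/-- The map on objects of a morphism of groupoids. -/
def onObj {C D : Type u} [Groupoid.{v} C] [Groupoid.{v} D] (F : Grpd.of C ⟶ Grpd.of D) : C → D :=
  Functor.obj F

end Comparison

end CYDef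

open CategoryTheory CYDef
open scoped TensorProduct

/-! Over `R` the statement becomes concrete. Because `R` is finite dimensional, `𝔇(A, η₀) ⊗ m` is
the space of pairs of a normalized cochain and a negative cyclic chain of `R ⊗ A` over `R` which
vanish modulo `m`, and its bracket and differential are given by the same formulas over `R`. This
dictionary is `frakReal`; it rests on `real_injective` and `real_surjective`, and everything else is
proved for an abstract `Realization`.

Objects. In the twisted algebra the Maurer–Cartan expression of `(μ, η)` has the two components `[μ₀
+ μ, μ₀ + μ]` and `(L_{μ₀ + μ} + uB)(η₀ + η)`, up to the factors 2 and `(-1)^(d+1)` (`gbr_mul`,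
`negDiff_chain`). The first is twice an associator. So Maurer–Cartan elements are exactly deformed
products together with a cycle (`isMC_iff`, `mul_assoc_iff`).

Gauge group. An element of degree zero is a pair `(x, c)`, where `x` is an endomorphism which kills
the unit and `c` is a chain of degree `d + 1`. It acts on `R ⊗ A` by `x` and on chains by the affine
map `z ↦ L_x z + c`; this representation is faithful, and its values are divisible by `m`, hence
nilpotent. A group-like element of `U/Iⁿ` has a primitive logarithm. The Adams operation `mul ∘ Δ`
is multiplication by `2^i` on the `i`-th quotient of the standard filtration of `U`, so modulo `Iⁿ`
a primitive element comes from `h⁰` (`exists_ι_of_adams`, `exists_ιQ`); this does not pass through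
the Poincaré–Birkhoff–Witt theorem. The faithful nilpotent representation forces the logarithms for
different `n` to agree (`NilRep.exists_gaugeExp`). Hence gauge elements are exponentials, and they
are determined by their action. As `L_x` acts letter by letter, `exp(L_x)` is induced by `φ =
exp(x)` (`nexp_chainLie`). A gauge element is therefore a pair of `φ` and an affine map with linear
part `φ` and translation part `±ξ`; composition of affine maps is the composition law of `Def♭`, and
taking logarithms shows that every admissible pair `(φ, ξ)` occurs (`exists_gauge`).

Morphisms. The gauge action is the exponential of the affine action of `h⁰` on `h¹ × k`. The
deformed product, and the boundary of a chain plus the deformed cycle, are bilinear pairings with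
`h¹ × k` which satisfy a Leibniz rule for the actions of `h⁰`, and exponentials of operators with a
Leibniz rule are multiplicative (`nexp_bilin`). So `φ` carries the product of `y` to that of `g *
y`, and `ξ` bounds the difference of the cycles (`exp_mul`, `exp_chain`). Conversely these two
relations determine `g * y` (`gaugeAct_eq`). The resulting functor is bijective on objects and fully
faithful, hence an isomorphism of groupoids. It is natural because base change intertwines all
operators involved, and therefore their exponentials. -/

namespace CYDef

/-! ### Exponentials and logarithms of nilpotent elements. -/

section NilpotentExponential

variable (k : Type*) [Field k] {A B : Type*} [Ring A] [Algebra k A] [Ring B]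
  [Algebra k B]

/-- The exponential of a nilpotent element of an algebra over a field of characteristic zero. -/
noncomputable def nexp (a : A) : A :=
  -- If `a` is not nilpotent then `nilpotencyClass a` is 0 and the sum is the junk value 0.
  ∑ i ∈ Finset.range (nilpotencyClass a), (i.factorial : k)⁻¹ • a ^ i

/-- Frees the truncation point from the nilpotency class, so that exponentials of different elements
can be compared over one common range. -/
theorem nexp_eq_sum {a : A} {N : ℕ} (h : a ^ N = 0) :
    nexp k a = ∑ i ∈ Finset.range N, (i.factorial : k)⁻¹ • a ^ i := by
  refine Finset.sum_subset (Finset.range_mono (csInf_le' h)) fun i _ hi => ?_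
  rw [pow_eq_zero_of_le (not_lt.1 (fun h => hi (Finset.mem_range.2 h)))
    (pow_nilpotencyClass ⟨N, h⟩), smul_zero]

theorem commute_nexp {a b : A} (h : Commute b a) : Commute b (nexp k a) :=
  Commute.sum_right _ _ _ fun i _ => (h.pow_right i).smul_right _

theorem nexp_add_of_commute [CharZero k] {a b : A} (h : Commute a b) (ha : IsNilpotent a)
    (hb : IsNilpotent b) : nexp k (a + b) = nexp k a * nexp k b := by
  -- With the scalars pulled back along `ℚ → k`, `nexp` becomes `IsNilpotent.exp`, whose addition
  -- formula can be quoted.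
  let _ : Module ℚ A := Module.compHom A (algebraMap ℚ k)
  have key : ∀ a : A, nexp k a = IsNilpotent.exp a := fun a => by
    unfold nexp IsNilpotent.exp
    refine Finset.sum_congr rfl fun i _ => ?_
    change _ = (algebraMap ℚ k (i.factorial : ℚ)⁻¹) • (a ^ i)
    rw [map_inv₀, map_natCast]
  rw [key, key, key, IsNilpotent.exp_add_of_commute h ha hb]

@[simp] theorem nexp_zero : nexp k (0 : A) = 1 := by
  simp [nexp_eq_sum k (pow_one (0 : A))]

/-- It is enough that `f` is a ring homomorphism which respects the scalars; the maps between the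
quotients `U/Iⁿ` are available only in this form. -/
theorem map_nexp {a : A} (h : IsNilpotent a) (f : A →+* B)
    (hf : ∀ c : k, f (algebraMap k A c) = algebraMap k B c) : f (nexp k a) = nexp k (f a) := by
  obtain ⟨N, hN⟩ := h
  rw [nexp_eq_sum k hN, nexp_eq_sum k (N := N) (by rw [← map_pow, hN, map_zero]), map_sum]
  refine Finset.sum_congr rfl fun i _ => ?_
  rw [Algebra.smul_def, Algebra.smul_def, map_mul, hf, map_pow]

/-- `exp a = 1 + a (1 + b)` with `b` a nilpotent element commuting with everything that commutes
with `a`. -/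
theorem exists_nexp_eq {a : A} (h : IsNilpotent a) : ∃ q : Polynomial k,
    nexp k a = 1 + a * (1 + a * Polynomial.aeval a q) := by
  obtain ⟨N, hN⟩ := h
  -- The polynomial is a truncation of `∑ Xⁱ/(i+2)!`, which is what remains of the exponential
  -- series after its first two terms are split off and `X²` is divided out. Truncating the series
  -- at `N + 2` leaves exactly `N` terms.
  refine ⟨∑ i ∈ Finset.range N, Polynomial.C ((i + 2).factorial : k)⁻¹ * Polynomial.X ^ i, ?_⟩
  have h2 : a ^ (N + 1 + 1) = 0 := pow_eq_zero_of_le (by omega) hN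
  rw [nexp_eq_sum k h2, Finset.sum_range_succ', Finset.sum_range_succ', map_sum, mul_add,
    Finset.mul_sum, Finset.mul_sum]
  simp only [zero_add, Nat.factorial_one, Nat.factorial_zero, Nat.cast_one, inv_one, one_smul, pow_zero,
    pow_one, mul_one, map_mul, map_pow, Polynomial.aeval_X, Polynomial.aeval_C]
  have : ∀ i : ℕ, a * (a * ((algebraMap k A) ((i + 2).factorial : k)⁻¹ * a ^ i)) =
      ((i + 1 + 1).factorial : k)⁻¹ • a ^ (i + 1 + 1) := fun i => by
    rw [← Algebra.smul_def, mul_smul_comm, mul_smul_comm, pow_succ', pow_succ']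
  simp only [this]
  abel

theorem commute_aeval {a b : A} (h : Commute b a) (p : Polynomial k) :
    Commute b (Polynomial.aeval a p) := by
  induction p using Polynomial.induction_on' with
  | add p q hp hq => rw [map_add]; exact hp.add_right hq
  | monomial n c =>
    rw [Polynomial.aeval_monomial]
    exact Commute.mul_right (Algebra.commutes c b).symm (h.pow_right n)

theorem commute_aeval_aeval {a b : A} (h : Commute a b) (p q : Polynomial k) :
    Commute (Polynomial.aeval a p) (Polynomial.aeval b q) :=
  commute_aeval k (commute_aeval k h.symm p).symm q

theorem isNilpotent_aeval {a : A} (h : IsNilpotent a) (q : Polynomial k) :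
    IsNilpotent (Polynomial.aeval a (Polynomial.X * q)) := by
  rw [map_mul, Polynomial.aeval_X]
  exact (commute_aeval k rfl q).isNilpotent_mul_right h

/-- By `exists_nexp_eq`, `exp a - 1` is `a` times the unit `1 + a q(a)`. -/
theorem eq_zero_of_nexp_eq_one {a : A} (h : IsNilpotent a) (h1 : nexp k a = 1) : a = 0 := by
  obtain ⟨q, hq⟩ := exists_nexp_eq k h
  rw [h1, left_eq_add] at hq
  have hu : IsUnit (1 + a * Polynomial.aeval a q) := by
    have := isNilpotent_aeval k h q
    rw [map_mul, Polynomial.aeval_X] at this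
    exact this.isUnit_one_add
  exact (hu.mul_left_eq_zero).1 hq

variable [CharZero k]

theorem nexp_mul_nexp_neg {a : A} (h : IsNilpotent a) : nexp k a * nexp k (-a) = 1 := by
  rw [← nexp_add_of_commute k (Commute.neg_right rfl) h h.neg, add_neg_cancel, nexp_zero]

theorem nexp_neg_mul_nexp {a : A} (h : IsNilpotent a) : nexp k (-a) * nexp k a = 1 := by
  rw [← nexp_add_of_commute k (Commute.neg_left rfl) h.neg h, neg_add_cancel, nexp_zero]

/-- For commuting elements equality of the exponentials gives `exp (a - b) = 1`, and `a - b` is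
again nilpotent. -/
theorem nexp_injOn_commute {a b : A} (h : Commute a b) (ha : IsNilpotent a) (hb : IsNilpotent b)
    (hab : nexp k a = nexp k b) : a = b := by
  have hc : Commute a (-b) := h.neg_right
  have := nexp_add_of_commute k hc ha hb.neg
  rw [hab, nexp_mul_nexp_neg k hb, ← sub_eq_add_neg] at this
  refine sub_eq_zero.1 (eq_zero_of_nexp_eq_one k ?_ this)
  exact h.isNilpotent_sub ha hb

/-- A unipotent element is the exponential of a polynomial in it. -/
theorem exists_nexp_aeval_eq {a : A} (ha : IsNilpotent a) : ∃ q : Polynomial k,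
    nexp k (Polynomial.aeval a (Polynomial.X * q)) = 1 + a := by
  open Polynomial in
  -- The logarithm is found by successive approximation: the error in `(1 + a) exp(-log)` is pushed
  -- into higher and higher powers of `a`. Adding the current error `P` to the approximate logarithm
  -- squares the error, because `(1 + P) exp(-P) = 1 + O(P²)`.
  have step : ∀ n : ℕ, ∃ q r : Polynomial k,
      (1 + a) * nexp k (-(aeval a (X * q))) = 1 + aeval a (X ^ (n + 1) * r) := by
    intro n
    induction n with
    | zero => exact ⟨0, 1, by simp⟩
    | succ n ih =>
      obtain ⟨q, r, h⟩ := ih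
      let P : Polynomial k := X ^ (n + 1) * r
      have hP : P = X * (X ^ n * r) := by simp only [P]; ring
      have hp : IsNilpotent (aeval a P) := by rw [hP]; exact isNilpotent_aeval k ha _
      obtain ⟨s, hs⟩ := exists_nexp_eq k hp.neg
      let S := s.comp (-P)
      have hS : aeval (-aeval a P) s = aeval a S := by
        rw [aeval_comp, map_neg]
      -- With `exp(-P) = 1 - P + P² S` one finds `(1 + P) exp(-P) - 1 = P² (-1 + S + P S)`, and `P²
      -- = X^(n+2) · Xⁿ r²`.
      refine ⟨q + X ^ n * r, X ^ n * r ^ 2 * (-1 + S + P * S), ?_⟩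
      have e1 : (X * (q + X ^ n * r) : Polynomial k) = X * q + P := by rw [hP]; ring
      rw [e1, map_add, neg_add, nexp_add_of_commute k _ (isNilpotent_aeval k ha q).neg hp.neg,
        ← mul_assoc, h, hs, hS]
      · have e2 : (X ^ (n + 1 + 1) * (X ^ n * r ^ 2 * (-1 + S + P * S)) : Polynomial k) =
            (1 + P) * (1 + -P * (1 + -P * S)) - 1 := by simp only [P]; ring
        rw [e2]
        simp only [map_sub, map_mul, map_add, map_neg, map_one]
        simp only [P, map_mul, map_pow]
        abel
      · exact ((commute_aeval_aeval k rfl _ _).neg_left).neg_right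
  obtain ⟨N, hN⟩ := ha
  obtain ⟨q, r, h⟩ := step N
  refine ⟨q, ?_⟩
  have hx := isNilpotent_aeval k ⟨N, hN⟩ q
  rw [map_mul _ (_ ^ _), map_pow, Polynomial.aeval_X, pow_succ, hN, zero_mul, zero_mul, add_zero] at h
  have h' := congrArg (· * nexp k (Polynomial.aeval a (Polynomial.X * q))) h
  simp only [mul_assoc, nexp_neg_mul_nexp k hx, mul_one, one_mul] at h'
  exact h'.symm

/-- No commutation is needed: the polynomial logarithm of `exp a` commutes with `a` and has the same
exponential, so it equals `a`. The polynomial depends on `exp a` only, hence it recovers `b` as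
well. -/
theorem nexp_injective {a b : A} (ha : IsNilpotent a) (hb : IsNilpotent b)
    (hab : nexp k a = nexp k b) : a = b := by
  have hn : ∀ {a : A}, IsNilpotent a → IsNilpotent (nexp k a - 1) := by
    intro a ha
    obtain ⟨q, hq⟩ := exists_nexp_eq k ha
    have := isNilpotent_aeval k ha (1 + Polynomial.X * q)
    rw [hq, add_sub_cancel_left]
    simpa using this
  have key : ∀ {a : A}, IsNilpotent a → ∀ q : Polynomial k,
      nexp k (Polynomial.aeval (nexp k a - 1) (Polynomial.X * q)) = 1 + (nexp k a - 1) →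
      a = Polynomial.aeval (nexp k a - 1) (Polynomial.X * q) := by
    intro a ha q hq
    refine nexp_injOn_commute k (commute_aeval k ?_ _) ha (isNilpotent_aeval k (hn ha) q) ?_
    · exact (commute_nexp k rfl).sub_right (Commute.one_right _)
    · rw [hq]; abel
  obtain ⟨q, hq⟩ := exists_nexp_aeval_eq k (hn ha)
  rw [key ha q hq]
  rw [hab] at hq ⊢
  exact (key hb q hq).symm

end NilpotentExponential

/-! ### Exponentials of nilpotent operators: intertwining maps and Leibniz rules. -/

section Operators

variable {k : Type*} [Field k] {R S V W : Type*} [CommRing R] [Algebra k R] [CommRing S]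
  [Algebra k S] [AddCommGroup V] [Module k V] [Module R V] [IsScalarTower k R V]
  [AddCommGroup W] [Module k W] [Module S W] [IsScalarTower k S W]

theorem nexp_apply {D : Module.End R V} {N : ℕ} (h : D ^ N = 0) (v : V) :
    nexp k D v = ∑ i ∈ Finset.range N, (i.factorial : k)⁻¹ • (D ^ i) v := by
  rw [nexp_eq_sum k h, LinearMap.sum_apply]
  rfl

/-- The exponentials of intertwined operators are intertwined. -/
theorem nexp_intertwine (T : V →ₗ[k] W) {D : Module.End R V} {D' : Module.End S W}
    (hD : IsNilpotent D) (hD' : IsNilpotent D') (h : ∀ v, T (D v) = D' (T v)) (v : V) :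
    T (nexp k D v) = nexp k D' (T v) := by
  obtain ⟨N, hN⟩ := hD
  obtain ⟨N', hN'⟩ := hD'
  have hi : ∀ (i : ℕ) (v : V), T ((D ^ i) v) = (D' ^ i) (T v) := by
    intro i
    induction i with
    | zero => intro v; rfl
    | succ i ih => intro v; rw [pow_succ, pow_succ, Module.End.mul_apply, Module.End.mul_apply, ih, h]
  rw [nexp_apply (N := max N N') (pow_eq_zero_of_le (le_max_left _ _) hN),
    nexp_apply (N := max N N') (pow_eq_zero_of_le (le_max_right _ _) hN'), map_sum]
  simp only [map_smul, hi]

variable [CharZero k]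

/-- The exponentials of operators which satisfy the Leibniz rule for a bilinear map are
multiplicative. -/
theorem nexp_bilin {M N P : Type*} [AddCommGroup M] [Module k M] [AddCommGroup N] [Module k N]
    [AddCommGroup P] [Module k P] (β : M →ₗ[k] N →ₗ[k] P) {X : Module.End k M}
    {Y : Module.End k N} {Z : Module.End k P} (hX : IsNilpotent X) (hY : IsNilpotent Y)
    (hZ : IsNilpotent Z) (h : ∀ x y, Z (β x y) = β (X x) y + β x (Y y)) (x : M) (y : N) :
    nexp k Z (β x y) = β (nexp k X x) (nexp k Y y) := by
  -- The Leibniz rule says that `β`, as a map on `M ⊗ N`, intertwines `X ⊗ 1 + 1 ⊗ Y` with `Z`. The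
  -- two summands commute, so the exponential of their sum is `exp X ⊗ exp Y`.
  let L : Module.End k (M ⊗[k] N) := X.rTensor N
  let L' : Module.End k (M ⊗[k] N) := Y.lTensor M
  have hL : IsNilpotent L := hX.map (Module.End.rTensorAlgHom k M N)
  have hL' : IsNilpotent L' := hY.map (Module.End.lTensorAlgHom k N M)
  have hc : Commute L L' := by
    refine TensorProduct.ext' fun x y => ?_
    simp [L, L']
  have e1 := nexp_intertwine (TensorProduct.lift β) (hc.isNilpotent_add hL hL') hZ (fun v => by
    induction v with
    | zero => simp
    | add a b ha hb => simp only [map_add, ha, hb]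
    | tmul x y => simp [L, L', h]) (x ⊗ₜ y)
  rw [TensorProduct.lift.tmul] at e1
  rw [← e1, nexp_add_of_commute k hc hL hL', Module.End.mul_apply]
  have e2 : nexp k L = (nexp k X).rTensor N :=
    (map_nexp k hX (Module.End.rTensorAlgHom k M N).toRingHom (fun c => AlgHom.commutes _ c)).symm
  have e3 : nexp k L' = (nexp k Y).lTensor M :=
    (map_nexp k hY (Module.End.lTensorAlgHom k N M).toRingHom (fun c => AlgHom.commutes _ c)).symm
  rw [e2, e3, LinearMap.lTensor_tmul, LinearMap.rTensor_tmul, TensorProduct.lift.tmul]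

end Operators
end CYDef

namespace CYDef

attribute [local instance 100] LieRing.ofAssociativeRing

/-! ### Product filtrations on `U ⊗ U`. -/

section Filtrations

variable {k U : Type*} [Field k] [Ring U] [Algebra k U]

/-- The filtration of `U ⊗ U` induced by a filtration `F` of `U`. -/
def tensFilt (F : ℕ → Submodule k U) (n : ℕ) : Submodule k (U ⊗[k] U) :=
  Submodule.span k {z | ∃ i j a b, i + j = n ∧ a ∈ F i ∧ b ∈ F j ∧ z = a ⊗ₜ b}

theorem tmul_mem_tensFilt {F : ℕ → Submodule k U} {i j n : ℕ} (h : i + j = n) {a b : U}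
    (ha : a ∈ F i) (hb : b ∈ F j) : a ⊗ₜ[k] b ∈ tensFilt F n :=
  Submodule.subset_span ⟨i, j, a, b, h, ha, hb, rfl⟩

/-- Only multiplicativity of `F` enters, so the lemma serves both the increasing standard filtration
and the decreasing powers of the augmentation ideal. -/
theorem tensFilt_mul {F : ℕ → Submodule k U}
    (hF : ∀ {i j a b}, a ∈ F i → b ∈ F j → a * b ∈ F (i + j)) {n m : ℕ} {x y : U ⊗[k] U}
    (hx : x ∈ tensFilt F n) (hy : y ∈ tensFilt F m) : x * y ∈ tensFilt F (n + m) := by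
  induction hx using Submodule.span_induction with
  | zero => rw [zero_mul]; exact Submodule.zero_mem _
  | add a b _ _ ha hb => rw [add_mul]; exact add_mem ha hb
  | smul c a _ ha => rw [smul_mul_assoc]; exact Submodule.smul_mem _ _ ha
  | mem x hx =>
    obtain ⟨i, j, a, b, rfl, ha, hb, rfl⟩ := hx
    induction hy using Submodule.span_induction with
    | zero => rw [mul_zero]; exact Submodule.zero_mem _
    | add a b _ _ ha hb => rw [mul_add]; exact add_mem ha hb
    | smul c a _ ha => rw [mul_smul_comm]; exact Submodule.smul_mem _ _ ha
    | mem y hy =>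
      obtain ⟨i', j', a', b', rfl, ha', hb', rfl⟩ := hy
      rw [Algebra.TensorProduct.tmul_mul_tmul]
      exact tmul_mem_tensFilt (by omega) (hF ha ha') (hF hb hb')

theorem mul'_mem_of_tensFilt {F : ℕ → Submodule k U}
    (hF : ∀ {i j a b}, a ∈ F i → b ∈ F j → a * b ∈ F (i + j)) {n : ℕ} {x : U ⊗[k] U}
    (hx : x ∈ tensFilt F n) : LinearMap.mul' k U x ∈ F n := by
  induction hx using Submodule.span_induction with
  | zero => rw [map_zero]; exact Submodule.zero_mem _
  | add a b _ _ ha hb => rw [map_add]; exact add_mem ha hb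
  | smul c a _ ha => rw [map_smul]; exact Submodule.smul_mem _ _ ha
  | mem x hx =>
    obtain ⟨i, j, a, b, rfl, ha, hb, rfl⟩ := hx
    rw [LinearMap.mul'_apply]
    exact hF ha hb

end Filtrations

/-! ### Adams operations, and primitive elements modulo powers of the augmentation ideal. -/

section Primitive

variable {k : Type*} [Field k] [CharZero k] (h : DGLie k)

/-- The standard filtration of the enveloping algebra: the span of the products of at most `n`
elements of `h⁰`. -/
def DGLie.filt (n : ℕ) : Submodule k h.U := (1 ⊔ LinearMap.range (h.ι : h.X 0 →ₗ[k] h.U)) ^ n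

variable {h}

theorem DGLie.filt_mul {i j : ℕ} {a b : h.U} (ha : a ∈ h.filt i) (hb : b ∈ h.filt j) :
    a * b ∈ h.filt (i + j) := by
  rw [DGLie.filt, pow_add]
  exact Submodule.mul_mem_mul ha hb

theorem DGLie.mem_filt_one {a : h.U} : a ∈ h.filt 1 ↔ ∃ (c : k) (x : h.X 0),
    a = algebraMap k h.U c + h.ι x := by
  rw [DGLie.filt, pow_one, Submodule.mem_sup]
  constructor
  · rintro ⟨y, hy, z, ⟨x, rfl⟩, rfl⟩
    obtain ⟨c, rfl⟩ := Submodule.mem_one.1 hy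
    exact ⟨c, x, rfl⟩
  · rintro ⟨c, x, rfl⟩
    exact ⟨_, Submodule.mem_one.2 ⟨c, rfl⟩, _, ⟨x, rfl⟩, rfl⟩

theorem DGLie.ι_mem_filt (x : h.X 0) : h.ι x ∈ h.filt 1 :=
  DGLie.mem_filt_one.2 ⟨0, x, by simp⟩

theorem DGLie.algebraMap_mem_filt (c : k) (n : ℕ) : algebraMap k h.U c ∈ h.filt n := by
  have h1 : (1 : Submodule k h.U) ≤ h.filt n :=
    Submodule.one_le.2 (by
      have := Submodule.pow_mem_pow (1 ⊔ LinearMap.range (h.ι : h.X 0 →ₗ[k] h.U))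
        (Submodule.mem_sup_left (Submodule.one_le.1 le_rfl)) n
      rwa [one_pow] at this)
  exact h1 (Submodule.mem_one.2 ⟨c, rfl⟩)

theorem DGLie.filt_le {i j : ℕ} (hij : i ≤ j) : h.filt i ≤ h.filt j := by
  obtain ⟨n, rfl⟩ := Nat.exists_eq_add_of_le hij
  intro a ha
  have := DGLie.filt_mul ha (DGLie.algebraMap_mem_filt 1 n)
  rwa [map_one, mul_one] at this

theorem DGLie.exists_mem_filt (a : h.U) : ∃ n, a ∈ h.filt (n + 1) := by
  let S : Subalgebra k h.U :=
    { carrier := {a | ∃ n, a ∈ h.filt (n + 1)}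
      add_mem' := by
        rintro a b ⟨i, hi⟩ ⟨j, hj⟩
        exact ⟨i + j, add_mem (DGLie.filt_le (by omega) hi) (DGLie.filt_le (by omega) hj)⟩
      mul_mem' := by
        rintro a b ⟨i, hi⟩ ⟨j, hj⟩
        exact ⟨i + 1 + j, DGLie.filt_mul (i := i + 1) (j := j + 1) hi hj⟩
      algebraMap_mem' := fun c => ⟨0, DGLie.algebraMap_mem_filt c _⟩ }
  exact U_induction S (fun x => ⟨0, DGLie.ι_mem_filt x⟩) a

/-- The filtration consists of the powers of `k + h⁰`, so one left factor can be split off and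
separated into its scalar and its part in `h⁰`. -/
theorem DGLie.filt_succ_induction {n : ℕ} {P : h.U → Prop}
    (hs : ∀ (c : k), ∀ w ∈ h.filt n, P (c • w)) (hx : ∀ x, ∀ w ∈ h.filt n, P (h.ι x * w))
    (hadd : ∀ a b, P a → P b → P (a + b)) {a : h.U} (ha : a ∈ h.filt (n + 1)) : P a := by
  rw [DGLie.filt, pow_succ'] at ha
  induction ha using Submodule.mul_induction_on' with
  | add a _ b _ ha hb => exact hadd _ _ ha hb
  | mem_mul_mem c hc w hw =>
    have hc' : c ∈ h.filt 1 := by rwa [DGLie.filt, pow_one]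
    obtain ⟨t, x, rfl⟩ := DGLie.mem_filt_one.1 hc'
    rw [add_mul, ← Algebra.smul_def]
    exact hadd _ _ (hs t w hw) (hx x w hw)

/-- The commutator with `x` is a derivation of `U` which maps `h⁰` into `h⁰`, so it preserves each
level: `[y w, x] = y [w, x] + [y, x] w`. -/
theorem DGLie.filt_comm {n : ℕ} (x : h.X 0) {a : h.U} (ha : a ∈ h.filt n) :
    a * h.ι x - h.ι x * a ∈ h.filt n := by
  induction n generalizing a with
  | zero =>
    rw [DGLie.filt, pow_zero] at ha
    obtain ⟨c, rfl⟩ := Submodule.mem_one.1 ha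
    rw [Algebra.commutes, sub_self]
    exact Submodule.zero_mem _
  | succ n ih =>
    refine DGLie.filt_succ_induction (P := fun a => a * h.ι x - h.ι x * a ∈ h.filt (n + 1))
      (fun c w hw => ?_) (fun y w hw => ?_) (fun a b ha hb => ?_) ha
    · rw [smul_mul_assoc, mul_smul_comm, ← smul_sub]
      exact Submodule.smul_mem _ _ (DGLie.filt_le n.le_succ (ih hw))
    · have e : h.ι y * w * h.ι x - h.ι x * (h.ι y * w) =
          h.ι y * (w * h.ι x - h.ι x * w) + h.ι (h.br (add_zero 0) y x) * w := by
        have : h.ι (h.br (add_zero 0) y x) = h.ι y * h.ι x - h.ι x * h.ι y :=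
          (LieHom.map_lie h.ι y x).trans (LieRing.of_associative_ring_bracket _ _)
        rw [this]; noncomm_ring
      rw [e, add_comm n 1]
      exact add_mem (DGLie.filt_mul (DGLie.ι_mem_filt y) (ih hw))
        (DGLie.filt_mul (DGLie.ι_mem_filt _) hw)
    · rw [add_mul, mul_add, add_sub_add_comm]; exact add_mem ha hb

/-- `Δ` is multiplicative and sends `h⁰` into level one of the product filtration. -/
theorem DGLie.comul_filt {n : ℕ} {a : h.U} (ha : a ∈ h.filt n) :
    h.comul a ∈ tensFilt h.filt n := by
  induction n generalizing a with
  | zero =>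
    have ha' := ha
    rw [DGLie.filt, pow_zero] at ha'
    obtain ⟨c, rfl⟩ := Submodule.mem_one.1 ha'
    rw [Algebra.algebraMap_eq_smul_one, map_smul, map_one, Algebra.TensorProduct.one_def]
    have h1 : (1 : h.U) ∈ h.filt 0 := by simpa using DGLie.algebraMap_mem_filt (h := h) 1 0
    exact Submodule.smul_mem _ _ (tmul_mem_tensFilt (add_zero 0) h1 h1)
  | succ n ih =>
    have h1 : ∀ m, (1 : h.U) ∈ h.filt m := fun m => by
      simpa using DGLie.algebraMap_mem_filt (h := h) 1 m
    refine DGLie.filt_succ_induction (P := fun a => h.comul a ∈ tensFilt h.filt (n + 1))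
      (fun c w hw => ?_) (fun y w hw => ?_) (fun a b ha hb => ?_) ha
    · rw [map_smul]
      refine Submodule.smul_mem _ _ ?_
      have := tensFilt_mul DGLie.filt_mul (tmul_mem_tensFilt (zero_add 1) (h1 0) (h1 1)) (ih hw)
      rwa [← Algebra.TensorProduct.one_def, one_mul, add_comm] at this
    · rw [map_mul, DGLie.comul_ι, add_comm n 1]
      exact tensFilt_mul DGLie.filt_mul (add_mem
        (tmul_mem_tensFilt (add_zero 1) (DGLie.ι_mem_filt y) (h1 0))
        (tmul_mem_tensFilt (zero_add 1) (h1 0) (DGLie.ι_mem_filt y))) (ih hw)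
    · rw [map_add]; exact add_mem ha hb

variable (h) in
/-- The Adams operation `mul ∘ Δ` on the enveloping algebra. -/
noncomputable def DGLie.adams : h.U →ₗ[k] h.U := LinearMap.mul' k h.U ∘ₗ h.comul.toLinearMap

theorem DGLie.adams_apply (a : h.U) : h.adams a = LinearMap.mul' k h.U (h.comul a) := rfl

theorem DGLie.adams_algebraMap (c : k) : h.adams (algebraMap k h.U c) = algebraMap k h.U c := by
  rw [DGLie.adams_apply, Algebra.algebraMap_eq_smul_one, map_smul, map_one, map_smul,
    Algebra.TensorProduct.one_def, LinearMap.mul'_apply, mul_one]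

theorem DGLie.adams_ι (x : h.X 0) : h.adams (h.ι x) = h.ι x + h.ι x := by
  rw [DGLie.adams_apply, DGLie.comul_ι, map_add, LinearMap.mul'_apply, LinearMap.mul'_apply, mul_one, one_mul]

/-- If `Δ w = ∑ a ⊗ b`, then the Adams operation sends `x w` to `∑ (x a b + a x b)`. By `filt_comm`,
moving `x` to the left in the second term costs an element of level `n` only. -/
theorem DGLie.adams_ι_mul {n : ℕ} (x : h.X 0) {w : h.U} (hw : w ∈ h.filt n) :
    h.adams (h.ι x * w) - (2 : k) • (h.ι x * h.adams w) ∈ h.filt n := by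
  rw [DGLie.adams_apply, DGLie.adams_apply, map_mul, DGLie.comul_ι]
  have hz := DGLie.comul_filt hw
  generalize h.comul w = z at hz
  induction hz using Submodule.span_induction with
  | zero => simp
  | add a b _ _ ha hb =>
    have := add_mem ha hb
    rwa [← add_sub_add_comm, ← map_add, ← mul_add, ← smul_add, ← mul_add, ← map_add] at this
  | smul c a _ ha =>
    have := Submodule.smul_mem _ c ha
    rwa [smul_sub, ← map_smul, ← mul_smul_comm, smul_comm c, ← mul_smul_comm, ← map_smul] at this
  | mem z hz =>
    obtain ⟨i, j, a, b, rfl, ha, hb, rfl⟩ := hz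
    rw [add_mul, map_add, Algebra.TensorProduct.tmul_mul_tmul, Algebra.TensorProduct.tmul_mul_tmul]
    simp only [LinearMap.mul'_apply, one_mul]
    have := DGLie.filt_mul (DGLie.filt_comm x ha) hb
    convert this using 1
    rw [two_smul]
    noncomm_ring

/-- The Adams operation is `2ⁿ` on the quotients of the standard filtration. -/
theorem DGLie.adams_filt {n : ℕ} {a : h.U} (ha : a ∈ h.filt (n + 1)) :
    h.adams a - (2 ^ (n + 1) : k) • a ∈ h.filt n := by
  induction n generalizing a with
  | zero =>
    obtain ⟨c, x, rfl⟩ := DGLie.mem_filt_one.1 ha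
    have e : h.adams (algebraMap k h.U c + h.ι x) -
        (2 ^ (0 + 1) : k) • (algebraMap k h.U c + h.ι x) = algebraMap k h.U (-c) := by
      rw [map_add, DGLie.adams_algebraMap, DGLie.adams_ι, zero_add, pow_one, two_smul, map_neg]
      abel
    rw [e]
    exact DGLie.algebraMap_mem_filt _ _
  | succ n ih =>
    refine DGLie.filt_succ_induction
      (P := fun a => h.adams a - (2 ^ (n + 1 + 1) : k) • a ∈ h.filt (n + 1))
      (fun c w hw => ?_) (fun x w hw => ?_) (fun a b ha hb => ?_) ha
    -- `w` already has level `n + 1`, so replacing the factor `2^(n+1)` by `2^(n+2)` changes the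
    -- difference by an element of that level.
    · have h1 := DGLie.filt_le n.le_succ (ih hw)
      have h2 := Submodule.smul_mem _ c (add_mem h1
        (Submodule.smul_mem _ (2 ^ (n + 1) - 2 ^ (n + 1 + 1) : k) hw))
      convert h2 using 1
      rw [map_smul, smul_comm, ← smul_sub]
      congr 1
      module
    · have h1 := DGLie.adams_ι_mul x hw
      have h2 := DGLie.filt_mul (DGLie.ι_mem_filt x) (ih hw)
      rw [add_comm 1 n] at h2
      convert add_mem h1 (Submodule.smul_mem _ (2 : k) h2) using 1
      rw [mul_sub, mul_smul_comm, smul_sub, smul_smul, ← pow_succ']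
      abel
    · rw [map_add, smul_add, add_sub_add_comm]
      exact add_mem ha hb

theorem DGLie.aug_pow_mul {i j : ℕ} {a b : h.U} (ha : a ∈ (h.aug ^ i).restrictScalars k)
    (hb : b ∈ (h.aug ^ j).restrictScalars k) : a * b ∈ (h.aug ^ (i + j)).restrictScalars k := by
  rw [Submodule.restrictScalars_mem, Ideal.IsTwoSided.pow_add]
  exact Ideal.mul_mem_mul ha hb

/-- The augmentation ideal of `U ⊗ U` is `I ⊗ U + U ⊗ I`, so the terms of its `n`-th power
distribute `n` factors of `I` over the two sides. -/
theorem DGLie.aug₂_pow_le {n : ℕ} {z : h.U ⊗[k] h.U} (hz : z ∈ h.aug₂ ^ n) :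
    z ∈ tensFilt (fun i => (h.aug ^ i).restrictScalars k) n := by
  have top : ∀ a : h.U, a ∈ (h.aug ^ 0).restrictScalars k := fun a => by
    rw [Submodule.restrictScalars_mem, Submodule.pow_zero, Ideal.one_eq_top]; trivial
  have all : ∀ z : h.U ⊗[k] h.U, z - algebraMap k _ (h.counit₂ z) ∈
      tensFilt (fun i => (h.aug ^ i).restrictScalars k) 1 := by
    intro z
    induction z with
    | zero => simp
    | add a b ha hb => rw [map_add, map_add, add_sub_add_comm]; exact add_mem ha hb
    | tmul a b =>
      have hsub : ∀ a : h.U, a - algebraMap k _ (h.counit a) ∈ (h.aug ^ 1).restrictScalars k := by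
        intro a
        rw [Submodule.restrictScalars_mem, Submodule.pow_one, RingHom.mem_ker, map_sub,
          AlgHom.commutes]
        simp
      -- The decomposition used is `a ⊗ b - ε(a) ε(b) = (a - ε(a)) ⊗ b + ε(a) ⊗ (b - ε(b))`.
      have := add_mem (tmul_mem_tensFilt (F := fun i => (h.aug ^ i).restrictScalars k)
          (add_zero 1) (hsub a) (top b))
        (tmul_mem_tensFilt (F := fun i => (h.aug ^ i).restrictScalars k)
          (zero_add 1) (top (algebraMap k _ (h.counit a))) (hsub b))
      convert this using 1
      have e : h.counit₂ (a ⊗ₜ b) = h.counit a * h.counit b := by simp [DGLie.counit₂]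
      rw [e, TensorProduct.sub_tmul, TensorProduct.tmul_sub, map_mul,
        Algebra.TensorProduct.algebraMap_apply, Algebra.TensorProduct.algebraMap_apply',
        Algebra.TensorProduct.tmul_mul_tmul, mul_one, one_mul]
      abel
  induction n generalizing z with
  | zero =>
    clear hz
    induction z with
    | zero => exact Submodule.zero_mem _
    | add a b ha hb => exact add_mem ha hb
    | tmul a b => exact tmul_mem_tensFilt (add_zero 0) (top a) (top b)
  | succ n ih =>
    rw [Submodule.pow_succ] at hz
    induction hz using Submodule.smul_induction_on' with
    | add a _ b _ ha hb => exact add_mem ha hb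
    | smul a ha b hb =>
      have := all b
      rw [show h.counit₂ b = 0 from hb, map_zero, sub_zero] at this
      exact tensFilt_mul DGLie.aug_pow_mul (ih ha) this

/-- Both factors of the Adams operation, `Δ` and the multiplication, respect the adic filtrations.
-/
theorem DGLie.adams_aug {n : ℕ} {a : h.U} (ha : a ∈ h.aug ^ n) : h.adams a ∈ h.aug ^ n := by
  have h1 : h.comul a ∈ h.aug₂ ^ n := pow_le_comap h.comul.toRingHom (J := h.aug₂) (fun a ha => by
    rw [RingHom.mem_ker] at ha ⊢
    exact (h.counit₂_comul a).trans ha) n ha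
  exact mul'_mem_of_tensFilt DGLie.aug_pow_mul (DGLie.aug₂_pow_le h1)

/-- An element on which the Adams operation is multiplication by `2` lies in `h⁰`, modulo powers
of the augmentation ideal. -/
theorem DGLie.exists_ι_of_adams {n : ℕ} (hn : 0 < n) {a : h.U}
    (ha : h.adams a - (2 : k) • a ∈ h.aug ^ n) : ∃ x, a - h.ι x ∈ h.aug ^ n := by
  obtain ⟨r, hr⟩ := DGLie.exists_mem_filt a
  have smul_mem : ∀ (c : k) {b : h.U}, b ∈ h.aug ^ n → c • b ∈ h.aug ^ n := fun c b hb =>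
    Submodule.smul_mem ((h.aug ^ n).restrictScalars k) c hb
  induction r generalizing a with
  | zero =>
    obtain ⟨c, x, rfl⟩ := DGLie.mem_filt_one.1 hr
    rw [map_add, DGLie.adams_algebraMap, DGLie.adams_ι, two_smul] at ha
    have e : algebraMap k h.U c + (h.ι x + h.ι x) -
      (algebraMap k h.U c + h.ι x + (algebraMap k h.U c + h.ι x)) = algebraMap k h.U (-c) := by
      rw [map_neg]; abel
    rw [e] at ha
    -- On level one the defect `ψ a - 2 a` of the Adams operation `ψ` is minus the constant term of
    -- `a`. The counit shows that this term is zero, which is where `0 < n` enters.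
    have h1 : algebraMap k h.U (-c) ∈ h.aug := by
      have := Ideal.pow_le_pow_right (I := h.aug) hn ha
      rwa [Submodule.pow_one] at this
    rw [RingHom.mem_ker, AlgHom.commutes] at h1
    have h0 : c = 0 := by simpa using h1
    exact ⟨x, by rw [h0, map_zero, zero_add, sub_self]; exact Submodule.zero_mem _⟩
  | succ r ih =>
    have hv := DGLie.adams_filt hr
    -- The gap between the factor `2^(r+2)` by which the Adams operation acts on the top quotient
    -- and the prescribed factor 2. It is nonzero because the characteristic is zero.
    set t : k := 2 ^ (r + 1 + 1) - 2 with ht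
    have ht0 : t ≠ 0 := by
      have : ((2 ^ (r + 1 + 1) - 2 : ℤ) : k) ≠ 0 := by
        rw [Int.cast_ne_zero]
        have h2 : (2 : ℤ) ^ (r + 1 + 1) = 4 * 2 ^ r := by ring
        have h3 : (0 : ℤ) < 2 ^ r := by positivity
        omega
      simpa [ht] using this
    -- `b` has smaller level by `adams_filt`, while `a - b` is a multiple of `ψ a - 2 a` and so lies
    -- in `Iⁿ`. As `ψ` preserves `Iⁿ`, the hypothesis passes from `a` to `b`.
    set b := t⁻¹ • ((2 ^ (r + 1 + 1) : k) • a - h.adams a) with hb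
    have e1 : a - b = t⁻¹ • (h.adams a - (2 : k) • a) := by
      have : a = t⁻¹ • t • a := by rw [smul_smul, inv_mul_cancel₀ ht0, one_smul]
      conv_lhs => rw [this, hb]
      rw [← smul_sub, ht]
      congr 1
      module
    have hab : a - b ∈ h.aug ^ n := by rw [e1]; exact smul_mem _ ha
    have hb1 : b ∈ h.filt (r + 1) := by
      refine Submodule.smul_mem _ _ ?_
      rw [← neg_sub]
      exact neg_mem hv
    obtain ⟨x, hx⟩ := ih (a := b) (by
      have := sub_mem ha (sub_mem (DGLie.adams_aug hab) (smul_mem 2 hab))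
      convert this using 1
      rw [map_sub, smul_sub]
      abel) hb1
    exact ⟨x, by have := add_mem hab hx; rwa [sub_add_sub_cancel] at this⟩

end Primitive
end CYDef

namespace CYDef

attribute [local instance 100] LieRing.ofAssociativeRing

theorem map_aeval_of {k : Type*} [Field k] {A B : Type*} [Ring A] [Algebra k A] [Ring B] [Algebra k B] (f : A →+* B)
    (hf : ∀ c : k, f (algebraMap k A c) = algebraMap k B c) (a : A) (p : Polynomial k) :
    f (Polynomial.aeval a p) = Polynomial.aeval (f a) p :=
  (Polynomial.aeval_algHom_apply ({ f with commutes' := hf } : A →ₐ[k] B) a p).symm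

/-! ### Group-like elements of the completed enveloping algebra and exponentials. -/

section GaugeExponential

variable {k : Type*} [Field k] [CharZero k] (h : DGLie k)

theorem DGLie.ι_pow_mem (x : h.X 0) (n : ℕ) : h.ι x ^ n ∈ h.aug ^ n :=
  Ideal.pow_mem_pow (h.counit_ι x) n

/-- The image of an element of `h⁰` in `U/Iⁿ`. -/
noncomputable def DGLie.ιQ (n : ℕ) (x : h.X 0) : h.U ⧸ h.aug ^ n := Ideal.Quotient.mk _ (h.ι x)

theorem DGLie.isNilpotent_mk {a : h.U} (ha : a ∈ h.aug) (n : ℕ) :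
    IsNilpotent (Ideal.Quotient.mk (h.aug ^ n) a) := by
  refine ⟨n, ?_⟩
  rw [← map_pow, Ideal.Quotient.eq_zero_iff_mem]
  exact Ideal.pow_mem_pow ha n

theorem DGLie.isNilpotent_ιQ (n : ℕ) (x : h.X 0) : IsNilpotent (h.ιQ n x) :=
  h.isNilpotent_mk (h.counit_ι x) n

theorem DGLie.comulQ_ιQ (n : ℕ) (x : h.X 0) :
    h.comulQ n (h.ιQ n x) = h.leftQ n (h.ιQ n x) + h.rightQ n (h.ιQ n x) := by
  refine (congrArg (Ideal.Quotient.mk (h.aug₂ ^ n)) (DGLie.comul_ι x)).trans ?_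
  rw [map_add]
  rfl

theorem DGLie.comulQ_algebraMap (n : ℕ) (c : k) :
    h.comulQ n (algebraMap k _ c) = algebraMap k _ c :=
  congrArg (Ideal.Quotient.mk (h.aug₂ ^ n)) (h.comul.commutes c)

theorem DGLie.leftQ_algebraMap (n : ℕ) (c : k) :
    h.leftQ n (algebraMap k _ c) = algebraMap k _ c := rfl

theorem DGLie.rightQ_algebraMap (n : ℕ) (c : k) :
    h.rightQ n (algebraMap k _ c) = algebraMap k _ c :=
  congrArg (Ideal.Quotient.mk (h.aug₂ ^ n)) (Algebra.TensorProduct.includeRight.commutes c)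

/-- The exponential of an element of `h⁰`, as an element of the gauge group. -/
noncomputable def DGLie.gaugeExp (x : h.X 0) : h.gauge :=
  ⟨fun n =>
    { val := nexp k (h.ιQ n x)
      inv := nexp k (-h.ιQ n x)
      val_inv := nexp_mul_nexp_neg k (h.isNilpotent_ιQ n x)
      inv_val := nexp_neg_mul_nexp k (h.isNilpotent_ιQ n x) }, by
    refine ⟨fun n => ?_, ?_, fun n => ?_⟩
    · exact map_nexp k (h.isNilpotent_ιQ _ x)
        (Ideal.Quotient.factor (Ideal.pow_le_pow_right n.le_succ)) (fun c => rfl)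
    · refine Units.ext ?_
      have : h.ιQ 1 x = 0 := by
        rw [DGLie.ιQ, Ideal.Quotient.eq_zero_iff_mem, Submodule.pow_one]
        exact h.counit_ι x
      change nexp k (h.ιQ 1 x) = 1
      rw [this, nexp_zero]
    · change h.comulQ n (nexp k (h.ιQ n x)) = h.leftQ n (nexp k (h.ιQ n x)) *
        h.rightQ n (nexp k (h.ιQ n x))
      have hn := h.isNilpotent_ιQ n x
      rw [map_nexp k hn _ (h.comulQ_algebraMap n), map_nexp k hn _ (h.leftQ_algebraMap n),
        map_nexp k hn _ (h.rightQ_algebraMap n), h.comulQ_ιQ, nexp_add_of_commute k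
        (h.left_right_comm n _ _) (hn.map (h.leftQ n)) (hn.map (h.rightQ n))]⟩

theorem DGLie.gaugeExp_val (x : h.X 0) (n : ℕ) :
    ((h.gaugeExp x).1 n : h.U ⧸ h.aug ^ n) = nexp k (h.ιQ n x) := rfl

/-- The components of a group-like element are exponentials of elements of `h⁰`. -/
theorem DGLie.exists_ιQ (g : h.gauge) {n : ℕ} (hn : 0 < n) :
    ∃ x : h.X 0, (g.1 n : h.U ⧸ h.aug ^ n) = nexp k (h.ιQ n x) := by
  obtain ⟨u, hu⟩ := h.gauge_lift g n
  have hu1 : u - 1 ∈ h.aug := by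
    have := hu 1 hn
    rw [g.2.2.1, Units.val_one, ← map_one (Ideal.Quotient.mk (h.aug ^ 1)),
      Ideal.Quotient.mk_eq_mk_iff_sub_mem, Submodule.pow_one] at this
    exact this
  set a : h.U ⧸ h.aug ^ n := Ideal.Quotient.mk _ (u - 1) with ha
  have hga : (g.1 n : h.U ⧸ h.aug ^ n) = 1 + a := by
    rw [ha, map_sub, hu n le_rfl, map_one]; abel
  have han : IsNilpotent a := h.isNilpotent_mk hu1 n
  obtain ⟨q, hq⟩ := exists_nexp_aeval_eq k han
  -- `x` is the logarithm of the component `1 + a` in `U/Iⁿ`; the task is to show that it is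
  -- primitive and then that it comes from `h⁰`.
  set x := Polynomial.aeval a (Polynomial.X * q) with hx
  have hxn : IsNilpotent x := isNilpotent_aeval k han q
  have hcom : Commute (h.leftQ n a) (h.rightQ n a) := h.left_right_comm n a a
  have hgl := g.2.2.2 n
  rw [hga] at hgl
  have hca : h.comulQ n a = (1 + h.leftQ n a) * (1 + h.rightQ n a) - 1 := by
    rw [map_add, map_add, map_add, map_one, map_one, map_one] at hgl
    rw [← hgl]; abel
  -- Both sides have the same exponential, because `1 + a` is group-like. They commute, being
  -- polynomials in elements which commute with each other, so `nexp_injOn_commute` applies.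
  have prim : h.comulQ n x = h.leftQ n x + h.rightQ n x := by
    refine nexp_injOn_commute k ?_ (hxn.map _)
      (Commute.isNilpotent_add (h.left_right_comm n x x) (hxn.map _) (hxn.map _)) ?_
    · have e1 := map_aeval_of (h.comulQ n) (h.comulQ_algebraMap n) a (Polynomial.X * q)
      have e2 := map_aeval_of (h.leftQ n) (h.leftQ_algebraMap n) a (Polynomial.X * q)
      have e3 := map_aeval_of (h.rightQ n) (h.rightQ_algebraMap n) a (Polynomial.X * q)
      rw [← hx] at e1 e2 e3
      rw [e1, e2, e3, hca]
      have c1 : Commute ((1 + h.leftQ n a) * (1 + h.rightQ n a) - 1) (h.leftQ n a) :=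
        (((Commute.one_left _).add_left rfl).mul_left
          ((Commute.one_left _).add_left hcom.symm)).sub_left (Commute.one_left _)
      have c2 : Commute ((1 + h.leftQ n a) * (1 + h.rightQ n a) - 1) (h.rightQ n a) :=
        (((Commute.one_left _).add_left hcom).mul_left
          ((Commute.one_left _).add_left rfl)).sub_left (Commute.one_left _)
      exact (commute_aeval_aeval k c1 _ _).add_right (commute_aeval_aeval k c2 _ _)
    · rw [← map_nexp k hxn _ (h.comulQ_algebraMap n), nexp_add_of_commute k
        (h.left_right_comm n x x) (hxn.map _) (hxn.map _),
        ← map_nexp k hxn _ (h.leftQ_algebraMap n), ← map_nexp k hxn _ (h.rightQ_algebraMap n),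
        hq, hgl]
  -- A lift `w` of `x` to `U` is primitive modulo `Jⁿ`. Multiplying the two tensor factors turns
  -- this into `ψ w - 2 w ∈ Iⁿ`, the hypothesis of `exists_ι_of_adams`.
  obtain ⟨w, hw⟩ := Ideal.Quotient.mk_surjective x
  have hmem : h.comul w - (w ⊗ₜ 1 + 1 ⊗ₜ w) ∈ h.aug₂ ^ n := by
    rw [← Ideal.Quotient.mk_eq_mk_iff_sub_mem, map_add]
    rw [← hw] at prim
    exact prim
  have hψ : h.adams w - (2 : k) • w ∈ h.aug ^ n := by
    have := mul'_mem_of_tensFilt DGLie.aug_pow_mul (DGLie.aug₂_pow_le hmem)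
    rw [map_sub, map_add, LinearMap.mul'_apply, LinearMap.mul'_apply, mul_one, one_mul,
      ← two_smul k] at this
    exact this
  obtain ⟨y, hy⟩ := DGLie.exists_ι_of_adams hn hψ
  refine ⟨y, ?_⟩
  rw [hga, ← hq, ← hw, DGLie.ιQ]
  congr 1
  exact (Ideal.Quotient.mk_eq_mk_iff_sub_mem _ _).2 hy

end GaugeExponential

/-! ### Faithful nilpotent representations and the gauge group. -/

section GaugeRepresentation

variable {k : Type*} [Field k] [CharZero k] {h : DGLie k}

/-- A representation of `h⁰` by elements of an `R`-algebra which lie in a nilpotent ideal of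
`R`. -/
structure NilRep (h : DGLie k) (R : Type*) [CommRing R] [Algebra k R] (m : Ideal R)
    (𝒜 : Type*) [Ring 𝒜] [Algebra R 𝒜] [Algebra k 𝒜] where
  ρ : h.X 0 →ₗ[k] 𝒜
  map_br : ∀ x y, ρ (h.br (add_zero 0) x y) = ρ x * ρ y - ρ y * ρ x
  mem : ∀ x, ρ x ∈ m • (⊤ : Submodule R 𝒜)
  nilp : ∃ N : ℕ, m ^ N = ⊥

variable {R : Type*} [CommRing R] [Algebra k R] {m : Ideal R}
  {𝒜 : Type*} [Ring 𝒜] [Algebra R 𝒜] [Algebra k 𝒜] [IsScalarTower k R 𝒜]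

theorem mul_mem_smul_top {I J : Ideal R} {a b : 𝒜} (ha : a ∈ I • (⊤ : Submodule R 𝒜))
    (hb : b ∈ J • (⊤ : Submodule R 𝒜)) : a * b ∈ (I * J) • (⊤ : Submodule R 𝒜) := by
  induction ha using Submodule.smul_induction_on' with
  | add a _ b _ ha hb => rw [add_mul]; exact add_mem ha hb
  | smul r hr a _ =>
    induction hb using Submodule.smul_induction_on' with
    | add a _ b _ ha hb => rw [mul_add]; exact add_mem ha hb
    | smul s hs b _ =>
      rw [smul_mul_smul_comm]
      exact Submodule.smul_mem_smul (Ideal.mul_mem_mul hr hs) trivial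

/-- Divisibility by the ideal multiplies along products; this is the source of all nilpotency of
elements of `I 𝒜`. -/
theorem pow_mem_smul_top {I : Ideal R} {a : 𝒜} (ha : a ∈ I • (⊤ : Submodule R 𝒜)) (n : ℕ) :
    a ^ n ∈ (I ^ n) • (⊤ : Submodule R 𝒜) := by
  induction n with
  | zero => simp
  | succ n ih => rw [pow_succ, pow_succ]; exact mul_mem_smul_top ih ha

theorem isNilpotent_of_mem_smul_top {I : Ideal R} (hI : ∃ N : ℕ, I ^ N = ⊥) {a : 𝒜}
    (ha : a ∈ I • (⊤ : Submodule R 𝒜)) : IsNilpotent a := by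
  obtain ⟨N, hN⟩ := hI
  refine ⟨N, ?_⟩
  have := pow_mem_smul_top ha N
  rwa [hN, Submodule.bot_smul, Submodule.mem_bot] at this

namespace NilRep

variable (Q : NilRep h R m 𝒜)

theorem isNilpotent (x : h.X 0) : IsNilpotent (Q.ρ x) := isNilpotent_of_mem_smul_top Q.nilp (Q.mem x)

/-- The homomorphism from the enveloping algebra. -/
def lift : h.U →ₐ[k] 𝒜 := UniversalEnvelopingAlgebra.lift k
  { toFun := Q.ρ
    map_add' := map_add Q.ρ
    map_smul' := map_smul Q.ρ
    map_lie' := fun {x y} => Q.map_br x y }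

theorem lift_ι (x : h.X 0) : Q.lift (h.ι x) = Q.ρ x :=
  UniversalEnvelopingAlgebra.lift_ι_apply _ _ _

/-- Modulo `m` the representation is the counit, because `h⁰` acts by elements of `m 𝒜`.
Consequently `Iⁿ` acts through `mⁿ`, and a power of `I` acts by zero. -/
theorem lift_sub_mem (a : h.U) :
    Q.lift a - algebraMap k 𝒜 (h.counit a) ∈ m • (⊤ : Submodule R 𝒜) := by
  have hs : ∀ (c : k) {b : 𝒜}, b ∈ m • (⊤ : Submodule R 𝒜) → c • b ∈ m • (⊤ : Submodule R 𝒜) :=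
    fun c b hb => by
      rw [← algebraMap_smul R c b]; exact Submodule.smul_mem _ _ hb
  have hm : ∀ (a : 𝒜) {b : 𝒜}, b ∈ m • (⊤ : Submodule R 𝒜) → a * b ∈ m • (⊤ : Submodule R 𝒜) :=
    fun a b hb => by
      have := mul_mem_smul_top (I := ⊤) (J := m) (a := a) (by simp) hb
      rwa [Ideal.top_mul] at this
  let S : Subalgebra k h.U :=
    { carrier := {a | Q.lift a - algebraMap k 𝒜 (h.counit a) ∈ m • (⊤ : Submodule R 𝒜)}
      add_mem' := fun {a b} ha hb => by
        rw [Set.mem_ofPred_eq] at ha hb ⊢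
        rw [map_add, map_add, map_add, add_sub_add_comm]
        exact add_mem ha hb
      mul_mem' := fun {a b} ha hb => by
        rw [Set.mem_ofPred_eq] at ha hb ⊢
        rw [map_mul, map_mul, map_mul]
        convert add_mem (hm (Q.lift a) hb) (hs (h.counit b) ha) using 1
        rw [Algebra.smul_def, mul_sub, mul_sub, ← Algebra.commutes (h.counit b),
          ← Algebra.commutes (h.counit b) (Q.lift a)]
        abel
      algebraMap_mem' := fun c => by
        rw [Set.mem_ofPred_eq, AlgHom.commutes, AlgHom.commutes]
        simp }
  refine U_induction S (fun x => ?_) a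
  change Q.lift (h.ι x) - algebraMap k 𝒜 (h.counit (h.ι x)) ∈ m • (⊤ : Submodule R 𝒜)
  rw [Q.lift_ι, h.counit_ι, map_zero, sub_zero]
  exact Q.mem x

theorem lift_pow_mem {n : ℕ} {a : h.U} (ha : a ∈ h.aug ^ n) :
    Q.lift a ∈ (m ^ n) • (⊤ : Submodule R 𝒜) := by
  induction n generalizing a with
  | zero => simp
  | succ n ih =>
    rw [Submodule.pow_succ] at ha
    induction ha using Submodule.smul_induction_on' with
    | add a _ b _ ha hb => rw [map_add]; exact add_mem ha hb
    | smul a ha b hb =>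
      rw [smul_eq_mul, map_mul, pow_succ]
      refine mul_mem_smul_top (ih ha) ?_
      have := Q.lift_sub_mem b
      rwa [show h.counit b = 0 from hb, map_zero, sub_zero] at this

theorem exists_lift_eq_zero : ∃ N : ℕ, 0 < N ∧ ∀ a ∈ h.aug ^ N, Q.lift a = 0 := by
  obtain ⟨N, hN⟩ := Q.nilp
  refine ⟨N + 1, N.succ_pos, fun a ha => ?_⟩
  have := Q.lift_pow_mem ha
  rwa [pow_succ, hN, Ideal.bot_mul, Submodule.bot_smul, Submodule.mem_bot] at this

/-- The homomorphism from the gauge group. -/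
noncomputable def gauge : h.gauge →* 𝒜 where
  toFun g := Ideal.Quotient.lift (h.aug ^ Q.exists_lift_eq_zero.choose) Q.lift.toRingHom
    Q.exists_lift_eq_zero.choose_spec.2 (g.1 Q.exists_lift_eq_zero.choose).val
  map_one' := by simp
  map_mul' a b := by simp

theorem gauge_gaugeExp (x : h.X 0) : Q.gauge (h.gaugeExp x) = nexp k (Q.ρ x) := by
  rw [← Q.lift_ι]
  exact map_nexp k (h.isNilpotent_ιQ _ x) (Ideal.Quotient.lift
    (h.aug ^ Q.exists_lift_eq_zero.choose) Q.lift.toRingHom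
    Q.exists_lift_eq_zero.choose_spec.2) (fun c => Q.lift.commutes c)

/-- If `h⁰` has a faithful nilpotent representation then the elements of the gauge group are the
exponentials of the elements of `h⁰`. -/
theorem exists_gaugeExp (hQ : ∀ x, Q.ρ x = 0 → x = 0) (g : h.gauge) : ∃ x, g = h.gaugeExp x := by
  obtain ⟨N, hN0, hN⟩ := Q.exists_lift_eq_zero
  obtain ⟨x, hx⟩ := h.exists_ιQ g hN0
  have fac : ∀ {i j : ℕ} (hij : i ≤ j), Ideal.Quotient.factor (Ideal.pow_le_pow_right hij)
      (g.1 j : h.U ⧸ h.aug ^ j) = (g.1 i : h.U ⧸ h.aug ^ i) := by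
    intro i j hij
    obtain ⟨a, ha⟩ := h.gauge_lift g j
    rw [← ha j le_rfl, ← ha i hij, Ideal.Quotient.factor_mk]
  have fexp : ∀ {i j : ℕ} (hij : i ≤ j) (y : h.X 0),
      Ideal.Quotient.factor (Ideal.pow_le_pow_right hij) (nexp k (h.ιQ j y)) =
        nexp k (h.ιQ i y) := fun {i j} hij y =>
    map_nexp k (h.isNilpotent_ιQ j y) (Ideal.Quotient.factor (Ideal.pow_le_pow_right hij))
      (fun c => rfl)
  refine ⟨x, Subtype.ext (funext fun n => Units.ext ?_)⟩
  rw [h.gaugeExp_val]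
  rcases le_total n N with hn | hn
  · rw [← fac hn, hx, fexp hn]
  -- At a deeper level the component has some logarithm `y`. Injectivity of the exponential in
  -- `U/Iᴺ` gives `y ≡ x` modulo `Iᴺ`; as `Iᴺ` acts by zero and the representation is faithful on
  -- `h⁰`, `y = x`.
  · obtain ⟨y, hy⟩ := h.exists_ιQ g (hN0.trans_le hn)
    have e := fac hn
    rw [hy, hx, fexp hn] at e
    have e2 := nexp_injective k (h.isNilpotent_ιQ N y) (h.isNilpotent_ιQ N x) e
    have e3 : y - x = 0 := by
      refine hQ _ ?_
      rw [← Q.lift_ι]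
      refine hN _ ?_
      rw [map_sub]
      exact (Ideal.Quotient.mk_eq_mk_iff_sub_mem _ _).1 e2
    rw [hy, sub_eq_zero.1 e3]

/-- Gauge elements are exponentials, and the nilpotent exponential is injective in `𝒜`, so
faithfulness on `h⁰` passes to the group. -/
theorem gauge_injective (hQ : ∀ x, Q.ρ x = 0 → x = 0) : Function.Injective Q.gauge := by
  intro g g' hg
  obtain ⟨x, rfl⟩ := Q.exists_gaugeExp hQ g
  obtain ⟨y, rfl⟩ := Q.exists_gaugeExp hQ g'
  rw [Q.gauge_gaugeExp, Q.gauge_gaugeExp] at hg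
  have := nexp_injective k (Q.isNilpotent x) (Q.isNilpotent y) hg
  have e : x - y = 0 := hQ _ (by rw [map_sub, this, sub_self])
  rw [sub_eq_zero.1 e]

end NilRep

variable (h) in
/-- The gauge action of an exponential is the exponential of the affine action. -/
theorem DGLie.gaugeRep_gaugeExp [h.IsNilp] (x : h.X 0) :
    h.gaugeRep (h.gaugeExp x) = nexp k (h.affine x) := by
  rw [← h.rep_ι]
  exact map_nexp k (h.isNilpotent_ιQ _ x) (Ideal.Quotient.lift
    (h.aug ^ h.exists_rep_eq_zero.choose) h.rep.toRingHom
    h.exists_rep_eq_zero.choose_spec.2) (fun c => h.rep.commutes c)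

variable (h) in
theorem DGLie.isNilpotent_affine [h.IsNilp] (x : h.X 0) : IsNilpotent (h.affine x) := by
  obtain ⟨N, -, hN⟩ := h.exists_rep_eq_zero
  exact ⟨N, by rw [← h.rep_ι, ← map_pow]; exact hN _ (h.ι_pow_mem x N)⟩

/-- Reduces the base change of gauge elements to the base change of their logarithms. -/
theorem DGLieHom.gauge_gaugeExp {h' : DGLie k} (F : DGLieHom h h') (x : h.X 0) :
    F.gauge (h.gaugeExp x) = h'.gaugeExp (F.f 0 x) := by
  refine Subtype.ext (funext fun n => Units.ext ?_)
  change F.UQ n (nexp k (h.ιQ n x)) = nexp k (h'.ιQ n (F.f 0 x))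
  rw [map_nexp k (h.isNilpotent_ιQ n x) (F.UQ n) (fun c =>
    congrArg (Ideal.Quotient.mk (h'.aug ^ n)) (F.U.commutes c))]
  congr 1
  exact (F.UQ_mk n _).trans (congrArg _ (F.U_ι x))

end GaugeRepresentation
end CYDef

namespace CYDef

/-! ### Exponentials and restriction of scalars. -/

section RestrictScalars

variable {k : Type*} [Field k] {R V : Type*} [CommRing R] [Algebra k R]
  [AddCommGroup V] [Module k V] [Module R V] [IsScalarTower k R V]

theorem isNilpotent_restrictScalars {D : Module.End R V} (hD : IsNilpotent D) :
    IsNilpotent (D.restrictScalars k : Module.End k V) := by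
  obtain ⟨N, hN⟩ := hD
  refine ⟨N, LinearMap.ext fun v => ?_⟩
  have : ∀ (i : ℕ) (v : V), ((D.restrictScalars k : Module.End k V) ^ i) v = (D ^ i) v := by
    intro i
    induction i with
    | zero => intro v; rfl
    | succ i ih => intro v; rw [pow_succ, pow_succ, Module.End.mul_apply, ih]; rfl
  rw [this, hN]
  rfl

/-- `nexp_bilin` is about `k`-linear operators, while the operators on chains and cochains are
`R`-linear; the exponential does not see the difference. -/
theorem nexp_restrictScalars {D : Module.End R V} (hD : IsNilpotent D) (v : V) :
    nexp k (D.restrictScalars k : Module.End k V) v = nexp k D v :=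
  (nexp_intertwine (R := R) (S := k) (LinearMap.id : V →ₗ[k] V) hD
    (isNilpotent_restrictScalars hD) (fun _ => rfl) v).symm

end RestrictScalars

/-! ### Cochains of degree zero, and their Lie derivatives letter by letter. -/

section Snoc

variable {R : Type*} [CommRing R] {B : Type*} [AddCommGroup B] [Module R B] {e : B}

/-- A cochain of degree zero, as an endomorphism. -/
def coEnd : NCochain R e 0 →ₗ[R] Module.End R B where
  toFun x :=
    { toFun := fun b => x.1 [b]
      map_add' := fun a b => x.2.1.add [] a b []
      map_smul' := fun r a => x.2.1.smul [] r a [] }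
  map_add' _ _ := rfl
  map_smul' _ _ := rfl

theorem coEnd_unit (x : NCochain R e 0) : coEnd x e = 0 := x.2.2.1 [] []

theorem cochain_nil (x : NCochain R e 0) : x.1 [] = 0 := x.2.2.2 [] (by simp)

theorem cochain_eq_zero (x : NCochain R e 0) {l : List B} (h : l.length ≠ 1) : x.1 l = 0 :=
  x.2.2.2 l (by rw [zero_add]; exact_mod_cast h)

theorem coEnd_injective : Function.Injective (coEnd (R := R) (e := e)) := by
  intro x y h
  refine Subtype.ext (funext fun l => ?_)
  by_cases hl : l.length = 1
  · obtain ⟨b, rfl⟩ := List.length_eq_one_iff.1 hl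
    exact LinearMap.congr_fun h b
  · rw [cochain_eq_zero x hl, cochain_eq_zero y hl]

/-- An endomorphism which kills `e`, as a normalized cochain. -/
def ofEnd (φ : Module.End R B) (h : φ e = 0) : NCochain R e 0 :=
  ⟨fun l => match l with
    | [b] => φ b
    | _ => 0,
   { add := fun u a b v => by
      match u, v with
      | [], [] => exact map_add φ a b
      | [], _ :: _ => exact (add_zero 0).symm
      | _ :: [], _ => exact (add_zero 0).symm
      | _ :: _ :: _, _ => exact (add_zero 0).symm
     smul := fun u r a v => by
      match u, v with
      | [], [] => exact map_smul φ r a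
      | [], _ :: _ => exact (smul_zero _).symm
      | _ :: [], _ => exact (smul_zero _).symm
      | _ :: _ :: _, _ => exact (smul_zero _).symm },
   fun u v => by
      match u, v with
      | [], [] => exact h
      | [], _ :: _ => rfl
      | _ :: [], _ => rfl
      | _ :: _ :: _, _ => rfl,
   fun l hl => by
      match l with
      | [] => rfl
      | [b] => exact absurd rfl hl
      | _ :: _ :: _ => rfl⟩

theorem coEnd_ofEnd (φ : Module.End R B) (h : φ e = 0) : coEnd (ofEnd φ h) = φ := rfl

theorem coEnd_ncBr (x y : NCochain R e 0) :
    coEnd (ncBr (add_zero 0) x y) = coEnd x * coEnd y - coEnd y * coEnd x := by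
  refine LinearMap.ext fun b => ?_
  change gbr 0 0 x.1 y.1 [b] = x.1 [y.1 [b]] - y.1 [x.1 [b]]
  have h : ∀ a b : B, ∀ x : NCochain R e 0, x.1 [a, b] = 0 := fun a b x =>
    cochain_eq_zero x (by simp)
  simp [gbr, brace, cut3, cut_cons, h]

theorem ncBr_one_apply (x : NCochain R e 0) (y : NCochain R e 1) (a b : B) :
    (ncBr (zero_add 1) x y).1 [a, b] =
      x.1 [y.1 [a, b]] - y.1 [x.1 [a], b] - y.1 [a, x.1 [b]] := by
  change gbr 0 1 x.1 y.1 [a, b] = _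
  have h : ∀ a b : B, x.1 [a, b] = 0 := fun a b => cochain_eq_zero x (by simp)
  have h' : ∀ a b c : B, x.1 [a, b, c] = 0 := fun a b c => cochain_eq_zero x (by simp)
  have w : ∀ a b c, y.1 [a, b, c] = 0 := fun a b c => y.2.2.2 _ (by simp)
  have w' : ∀ a, y.1 [a] = 0 := fun a => y.2.2.2 _ (by simp)
  simp [gbr, brace, cut3, cut_cons, h, h', w, w', cochain_nil x]
  abel

theorem gbr_one_zero_apply (x : NCochain R e 0) (μ : B →ₗ[R] B →ₗ[R] B) (a b : B) :
    gbr 1 0 (ofBilin μ) x.1 [a, b] =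
      μ (x.1 [a]) b + μ a (x.1 [b]) - x.1 [μ a b] := by
  have h : ∀ a b : B, x.1 [a, b] = 0 := fun a b => cochain_eq_zero x (by simp)
  have h' : ∀ a b c : B, x.1 [a, b, c] = 0 := fun a b c => cochain_eq_zero x (by simp)
  simp [gbr, brace, cut3, cut_cons, ofBilin, h, h']

/-- The operation `b₀ ⊗ ⋯ ⊗ bₙ ↦ b₀ ⊗ ⋯ ⊗ bₙ ⊗ b` on chains. -/
noncomputable def snoc : NChain R e →ₗ[R] B →ₗ[R] NChain R e :=
  NChain.lift (F := fun b₀ l =>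
    { toFun := fun b => word R e b₀ (l ++ [b])
      map_add' := fun a b => (word_multilin b₀).add l a b []
      map_smul' := fun r a => (word_multilin b₀).smul l r a [] })
    { add := fun a b l => LinearMap.ext fun c => (word_isChainFun R e).add a b _
      smul := fun r a l => LinearMap.ext fun c => (word_isChainFun R e).smul r a _
      multilin := fun b₀ =>
        { add := fun u a b v => LinearMap.ext fun c => by
            simpa using (word_multilin b₀).add u a b (v ++ [c])
          smul := fun u r a v => LinearMap.ext fun c => by
            simpa using (word_multilin b₀).smul u r a (v ++ [c]) }
      kills := fun b₀ u v => LinearMap.ext fun c => by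
        simpa using word_degen (R := R) b₀ u (v ++ [c]) }

theorem snoc_word (b₀ : B) (l : List B) (b : B) :
    snoc (word R e b₀ l) b = word R e b₀ (l ++ [b]) := by
  rw [snoc, NChain.lift_word]
  rfl

/-- A cochain of degree zero takes a single argument. Hence among the terms which involve the head
only the one where nothing is wrapped around survives. -/
theorem wrap_zero (x : NCochain R e 0) (b₀ : B) (l : List B) :
    wrap R e 0 x.1 b₀ l = word R e (x.1 [b₀]) l := by
  unfold wrap cut3
  rw [cut_eq_left, cut_eq_right]
  · simp only [List.nil_append, List.length_nil]
    -- The exponent of the surviving sign is `n (n + 1)` for a tail of length `n`.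
    rw [sgn_even, one_smul]
    simpa using Int.even_mul_succ_self (l.length : ℤ)
  · intro v w hw
    have : 0 < w.length := List.length_pos_iff.2 hw
    dsimp only
    rw [cochain_eq_zero x (by simp; omega), word_zero, smul_zero]
  · intro u t hu
    have : 0 < u.length := List.length_pos_iff.2 hu
    refine (cut_congr fun v w _ => ?_).trans (cut_zero t)
    dsimp only
    rw [cochain_eq_zero x (by simp; omega), word_zero, smul_zero]

theorem lieFun_nil (x : NCochain R e 0) (b₀ : B) :
    lieFun R e 0 x.1 b₀ [] = word R e (x.1 [b₀]) [] := by
  rw [lieFun, wrap_zero, brace, cut3, cut_nil, cut_nil, cochain_nil x,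
    (word_multilin b₀).map_slot_zero [] [], smul_zero, zero_add]

/-- The single argument of `x` is either an earlier letter or the last one, and in degree zero there
are no signs. -/
theorem lieFun_snoc (x : NCochain R e 0) (b₀ : B) (l : List B) (b : B) :
    lieFun R e 0 x.1 b₀ (l ++ [b]) =
      snoc (lieFun R e 0 x.1 b₀ l) b + word R e b₀ (l ++ [x.1 [b]]) := by
  have hc : ∀ (l : List B) (f : List B → List B → NChain R e),
      snoc (cut l f) b = cut l fun u v => snoc (f u v) b :=
    fun l f => map_cut ((snoc (R := R) (e := e)).flip b).toAddMonoidHom l f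
  have e2 : (cut l fun u v => cut [] fun w t => sgn (0 * u.length) •
      word R e b₀ (u ++ x.1 (v ++ b :: w) :: t)) = word R e b₀ (l ++ [x.1 [b]]) := by
    simp only [cut_nil]
    rw [cut_eq_right]
    · simp
    · intro u v hv
      have : 0 < v.length := List.length_pos_iff.2 hv
      rw [cochain_eq_zero x (by simp; omega), (word_multilin b₀).map_slot_zero, smul_zero]
  have e3 : (cut3 [] fun u v w => sgn (0 * (l.length + 1 + u.length)) •
      word R e b₀ (l ++ b :: (u ++ x.1 v :: w))) = 0 := by
    have := (word_multilin (R := R) (e := e) b₀).map_slot_zero (l ++ [b]) []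
    simp only [List.append_assoc, List.cons_append, List.nil_append] at this
    simp [cut3, cochain_nil x, this]
  rw [lieFun, lieFun, wrap_zero, wrap_zero, brace_append_cons, e2, e3, map_add, LinearMap.add_apply,
    snoc_word, add_zero]
  unfold brace cut3
  simp only [hc, map_zsmul, LinearMap.smul_apply, snoc_word]
  simp only [List.append_assoc, List.cons_append]
  abel

/-- This Leibniz rule for appending a letter is the input of `nexp_bilin` in the computation of
`exp(L_x)`. -/
theorem chainLie_snoc (x : NCochain R e 0) (c : NChain R e) (b : B) :
    chainLie R e 0 x.1 (snoc c b) = snoc (chainLie R e 0 x.1 c) b + snoc c (coEnd x b) := by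
  have hx := lieFun_isChainFun (p := 0) x.2.1 x.2.2.1
  have : chainLie R e 0 x.1 ∘ₗ snoc.flip b =
      snoc.flip b ∘ₗ chainLie R e 0 x.1 + snoc.flip (coEnd x b) := by
    refine NChain.hom_ext fun b₀ l => ?_
    simp only [LinearMap.comp_apply, LinearMap.add_apply, LinearMap.flip_apply, snoc_word]
    rw [chainLie_word hx, chainLie_word hx, lieFun_snoc]
    rfl
  exact LinearMap.congr_fun this c

end Snoc

/-! ### The exponential of a Lie derivative on chains. -/

section ChainExponential

variable {k : Type*} [Field k] [CharZero k] {R : Type*} [CommRing R] [Algebra k R] {B : Type*}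
  [AddCommGroup B] [Module R B] [Module k B] [IsScalarTower k R B] {e : B}

/-- The exponential of a Lie derivative is induced by the exponential. -/
theorem nexp_chainLie (x : NCochain R e 0) (hx : IsNilpotent (coEnd x))
    (hL : IsNilpotent (chainLie R e 0 x.1 : Module.End R (NChain R e)))
    (he : nexp k (coEnd x) e = e) (c : NChain R e) :
    nexp k (chainLie R e 0 x.1 : Module.End R (NChain R e)) c = chainMap (nexp k (coEnd x)) he c := by
  suffices h : nexp k (chainLie R e 0 x.1 : Module.End R (NChain R e)) =
      chainMap (nexp k (coEnd x)) he from LinearMap.congr_fun h c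
  refine NChain.hom_ext fun b₀ l => ?_
  rw [chainMap_word]
  have hC := lieFun_isChainFun (p := 0) x.2.1 x.2.2.1
  -- Words are built from the head by appending letters. On words with empty tail, `b ↦ b`
  -- intertwines `x` with `L_x`; appending a letter is a bilinear map with a Leibniz rule, so the
  -- exponentials multiply.
  induction l using List.reverseRecOn with
  | nil =>
    let T : B →ₗ[k] NChain R e :=
      { toFun := fun b => word R e b []
        map_add' := fun a b => (word_isChainFun R e).add a b []
        map_smul' := fun c a => by
          rw [← algebraMap_smul R c a, (word_isChainFun R e).smul]
          exact algebraMap_smul R c _ }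
    refine (nexp_intertwine (R := R) (S := R) T hx hL (fun b => ?_) b₀).symm
    change word R e (x.1 [b]) [] = chainLie R e 0 x.1 (word R e b [])
    rw [chainLie_word hC, lieFun_nil]
  | append_singleton l b ih =>
    let β : NChain R e →ₗ[k] B →ₗ[k] NChain R e := LinearMap.mk₂ k (fun c b => snoc c b)
      (fun c c' b => by rw [map_add]; rfl)
      (fun t c b => by rw [← algebraMap_smul R t c, map_smul, LinearMap.smul_apply, algebraMap_smul])
      (fun c b b' => map_add _ _ _)
      (fun t c b => by rw [← algebraMap_smul R t b, map_smul, algebraMap_smul])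
    have key := nexp_bilin β (isNilpotent_restrictScalars (k := k) hL)
      (isNilpotent_restrictScalars (k := k) hx)
      (isNilpotent_restrictScalars (k := k) hL) (fun c b => chainLie_snoc x c b)
      (word R e b₀ l) b
    rw [nexp_restrictScalars hL, nexp_restrictScalars hx, nexp_restrictScalars hL, ih] at key
    change nexp k (chainLie R e 0 x.1 : Module.End R (NChain R e)) (snoc (word R e b₀ l) b) = snoc (word R e _ _) _ at key
    rw [snoc_word, snoc_word] at key
    rw [key, List.map_append]
    rfl

/-- Taking the coefficient of `uⁱ` intertwines the two Lie derivatives, which reduces the claim to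
`nexp_chainLie` for each power of `u`. -/
theorem nexp_ncAct (x : NCochain R e 0) (hx : IsNilpotent (coEnd x))
    (hL : IsNilpotent (chainLie R e 0 x.1 : Module.End R (NChain R e))) {n : ℤ}
    (hN : IsNilpotent (ncAct (add_zero n).symm x : Module.End R (NegCyc R e n)))
    (he : nexp k (coEnd x) e = e) (c : NegCyc R e n) :
    nexp k (ncAct (add_zero n).symm x : Module.End R (NegCyc R e n)) c =
      negMap (nexp k (coEnd x)) he n c := by
  refine Subtype.ext (funext fun i => ?_)
  let T : NegCyc R e n →ₗ[k] NChain R e :=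
    { toFun := fun c => c.1 i
      map_add' := fun _ _ => rfl
      map_smul' := fun _ _ => rfl }
  exact (nexp_intertwine (R := R) (S := R) T hN hL (fun c => rfl) c).trans
    (nexp_chainLie x hx hL he (c.1 i))

end ChainExponential
end CYDef

namespace CYDef

/-! ### Extension of multilinear functions from `A` to `R ⊗ A`, and slices. -/

section Extension

variable {k : Type*} [CommRing k] {A : Type*} [Ring A] [Algebra k A] {M : Type*} [AddCommGroup M]
  [Module k M]

variable (k A M) in
/-- The multilinear functions of finite lists. -/
def multilinFun : Submodule k (List A → M) where
  carrier := {f | IsMultilin (RingHom.id k) f}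
  add_mem' ha hb := ha.add' hb
  zero_mem' := ⟨fun _ _ _ _ => (add_zero _).symm, fun _ _ _ _ => (smul_zero _).symm⟩
  smul_mem' c x hx := ⟨fun u a b v => by simp [hx.add], fun u r a v => by
      simp [hx.smul, smul_comm c r]⟩

variable (k A M) in
/-- The first argument of a multilinear function. -/
def contract : multilinFun k A M →ₗ[k] A →ₗ[k] multilinFun k A M := LinearMap.mk₂ k
  (fun f a => ⟨fun l => f.1 (a :: l), f.2.prefix_const [a]⟩)
  (fun _ _ _ => rfl) (fun _ _ _ => rfl)
  (fun f a b => Subtype.ext (funext fun l => f.2.add [] a b l))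
  (fun c f a => Subtype.ext (funext fun l => f.2.smul [] c a l))

variable (M) in
/-- The extension of multilinear functions on `A` to `R`-multilinear functions on `R ⊗ A`. -/
noncomputable def extFun (R : Type*) [CommRing R] [Algebra k R] :
    List (R ⊗[k] A) → multilinFun k A M →ₗ[k] R ⊗[k] M
  | [] => TensorProduct.mk k R M 1 ∘ₗ LinearMap.proj [] ∘ₗ (multilinFun k A M).subtype
  | z :: l =>
    { toFun := fun f => ext₁ (extFun R l ∘ₗ contract k A M f) z
      map_add' := fun f g => by
        rw [map_add, LinearMap.comp_add, map_add, LinearMap.add_apply]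
      map_smul' := fun c f => by
        rw [map_smul, LinearMap.comp_smul, map_smul, LinearMap.smul_apply, RingHom.id_apply] }

variable {R : Type*} [CommRing R] [Algebra k R]

theorem extFun_cons (z : R ⊗[k] A) (l : List (R ⊗[k] A)) (f : multilinFun k A M) :
    extFun M R (z :: l) f = ext₁ (extFun M R l ∘ₗ contract k A M f) z := rfl

/-- `ext₁` is only declared `k`-linear in the function, but homogeneity of `extFun` in a later
argument needs scalars from `R`. -/
theorem ext₁_smul {N : Type*} [AddCommGroup N] [Module k N] [Module R N] [IsScalarTower k R N]
    (r : R) (L L' : A →ₗ[k] N) (h : ∀ a, L' a = r • L a) (z : R ⊗[k] A) :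
    ext₁ L' z = r • ext₁ L z := by
  induction z with
  | zero => simp
  | add a b ha hb => rw [map_add, map_add, ha, hb, smul_add]
  | tmul s a => rw [ext₁_tmul, ext₁_tmul, h, smul_comm]

theorem extFun_multilin (f : multilinFun k A M) :
    IsMultilin (RingHom.id R) (fun l => extFun M R l f) where
  add u a b v := by
    induction u generalizing f with
    | nil => simp only [List.nil_append, extFun_cons, map_add]
    | cons c u ih =>
      simp only [List.cons_append, extFun_cons]
      rw [← LinearMap.add_apply, ← map_add]
      congr 2
      exact LinearMap.ext fun x => ih _
  smul u r a v := by
    induction u generalizing f with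
    | nil => simp only [List.nil_append, extFun_cons, map_smul, RingHom.id_apply]
    | cons c u ih =>
      simp only [List.cons_append, extFun_cons]
      exact ext₁_smul r _ _ (fun x => ih _) c

theorem extFun_map_incl (f : multilinFun k A M) (l : List A) :
    extFun M R (l.map (incl R A)) f = 1 ⊗ₜ f.1 l := by
  induction l generalizing f with
  | nil => rfl
  | cons a l ih =>
    rw [List.map_cons, extFun_cons]
    change ext₁ _ (1 ⊗ₜ a) = _
    rw [ext₁_tmul, one_smul, LinearMap.comp_apply, ih]
    rfl

theorem tmul_eq_smul_incl (r : R) (a : A) : r ⊗ₜ[k] a = r • incl R A a := by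
  change _ = r • (1 ⊗ₜ a)
  rw [TensorProduct.smul_tmul', smul_eq_mul, mul_one]

/-- An `R`-multilinear function on `R ⊗ A` is determined by its values on `A`. -/
theorem IsMultilin.eq_zero_of_incl {N : Type*} [AddCommGroup N] [Module R N]
    {g : List (R ⊗[k] A) → N} (hg : IsMultilin (RingHom.id R) g)
    (h : ∀ l : List A, g (l.map (incl R A)) = 0) (l : List (R ⊗[k] A)) : g l = 0 := by
  -- The induction moves letters one at a time from the arbitrary part `v` to the part `u` whose
  -- letters come from `A`.
  suffices H : ∀ (v : List (R ⊗[k] A)) (u : List A), g (u.map (incl R A) ++ v) = 0 from H l []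
  intro v
  induction v with
  | nil => intro u; rw [List.append_nil, h]
  | cons z v ih =>
    intro u
    induction z with
    | zero => exact hg.map_slot_zero _ _
    | add a b ha hb => rw [hg.add, ha, hb, add_zero]
    | tmul r a =>
      rw [tmul_eq_smul_incl, hg.smul]
      have := ih (u ++ [a])
      rw [List.map_append, List.append_assoc] at this
      exact (congrArg _ this).trans (smul_zero _)

theorem IsMultilin.eq_of_incl {N : Type*} [AddCommGroup N] [Module R N]
    {g g' : List (R ⊗[k] A) → N} (hg : IsMultilin (RingHom.id R) g)
    (hg' : IsMultilin (RingHom.id R) g')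
    (h : ∀ l : List A, g (l.map (incl R A)) = g' (l.map (incl R A))) : g = g' := by
  funext l
  have := (hg.add' (hg'.const_smul (-1))).eq_zero_of_incl (fun l => by simp [h]) l
  simpa [← sub_eq_add_neg, sub_eq_zero] using this

/-- The arguments on the two sides of the unit are reduced to `A` separately, each side with the
other one held fixed. -/
theorem IsMultilin.kills_of_incl {N : Type*} [AddCommGroup N] [Module R N]
    {g : List (R ⊗[k] A) → N} (hg : IsMultilin (RingHom.id R) g)
    (h : ∀ u v : List A, g (u.map (incl R A) ++ 1 :: v.map (incl R A)) = 0) :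
    Kills (1 : R ⊗[k] A) g := by
  intro u v
  refine (hg.suffix_const (1 :: v)).eq_zero_of_incl (fun u' => ?_) u
  have := (hg.prefix_const (u'.map (incl R A) ++ [1])).eq_zero_of_incl (fun v' => by
    simpa using h u' v') v
  simpa using this

theorem IsMultilin.hasDegree_of_incl {N : Type*} [AddCommGroup N] [Module R N]
    {g : List (R ⊗[k] A) → N} (hg : IsMultilin (RingHom.id R) g) {p : ℤ}
    (h : ∀ l : List A, (l.length : ℤ) ≠ p + 1 → g (l.map (incl R A)) = 0) : HasDegree p g := by
  intro l hl
  -- Cutting `g` down to the lists of the wrong length leaves it multilinear in each argument, and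
  -- the result vanishes on all lists from `A`.
  have := (hg.length_smul (fun n => if (n : ℤ) = p + 1 then 0 else 1)).eq_zero_of_incl
    (fun l' => by
      rw [List.length_map]
      split_ifs with h'
      · exact zero_smul _ _
      · rw [h l' h', smul_zero]) l
  rwa [if_neg hl, one_smul] at this

theorem extFun_kills {f : multilinFun k A M} (hf : Kills (1 : A) f.1) :
    Kills (1 : R ⊗[k] A) (fun l => extFun M R l f) :=
  (extFun_multilin f).kills_of_incl fun u v => by
    have := extFun_map_incl (R := R) f (u ++ 1 :: v)
    rw [List.map_append, List.map_cons] at this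
    exact this.trans (by rw [hf u v, TensorProduct.tmul_zero])

/-- The values of the extension of a function lie in the extension of a submodule. -/
theorem extFun_mem (N : Submodule k M) (n : ℕ) (f : multilinFun k A M)
    (hf : ∀ l : List A, l.length = n → f.1 l ∈ N) (l : List (R ⊗[k] A)) (hl : l.length = n) :
    extFun M R l f ∈ N.baseChange R := by
  induction l generalizing f n with
  | nil => exact Submodule.tmul_mem_baseChange_of_mem _ (hf [] hl)
  | cons z l ih =>
    obtain rfl : l.length + 1 = n := hl
    rw [extFun_cons]
    induction z with
    | zero => rw [map_zero]; exact zero_mem _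
    | add a b ha hb => rw [map_add]; exact add_mem ha hb
    | tmul r a =>
      rw [ext₁_tmul]
      refine Submodule.smul_mem _ _ (ih l.length _ (fun t ht => ?_) rfl)
      exact hf (a :: t) (by rw [List.length_cons, ht])

/-- The part of an element of `R ⊗ M` along a functional on `R`. -/
noncomputable def slice (M : Type*) [AddCommGroup M] [Module k M] (σ : R →ₗ[k] k) :
    R ⊗[k] M →ₗ[k] M := TensorProduct.lid k M ∘ₗ σ.rTensor M

theorem slice_tmul (σ : R →ₗ[k] k) (r : R) (v : M) : slice M σ (r ⊗ₜ v) = σ r • v := by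
  simp [slice]

/-- A slice is not `R`-linear; the scalar moves into the functional. Inductions over `R`-spans
therefore quantify over all functionals. -/
theorem slice_smul (σ : R →ₗ[k] k) (r : R) (w : R ⊗[k] M) :
    slice M σ (r • w) = slice M (σ ∘ₗ LinearMap.mulLeft k r) w := by
  induction w with
  | zero => simp
  | add a b ha hb => rw [smul_add, map_add, map_add, ha, hb]
  | tmul s v => rw [TensorProduct.smul_tmul', slice_tmul, slice_tmul]; rfl

theorem slice_mem (N : Submodule k M) {w : R ⊗[k] M} (hw : w ∈ N.baseChange R)
    (σ : R →ₗ[k] k) : slice M σ w ∈ N := by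
  rw [Submodule.baseChange_eq_span] at hw
  induction hw using Submodule.span_induction generalizing σ with
  | mem w hw =>
    obtain ⟨v, hv, rfl⟩ := hw
    rw [TensorProduct.mk_apply, slice_tmul]
    exact N.smul_mem _ hv
  | zero => rw [map_zero]; exact zero_mem _
  | add a b _ _ ha hb => rw [map_add]; exact add_mem (ha σ) (hb σ)
  | smul r a _ ha => rw [slice_smul]; exact ha _

end Extension

/-! ### Dual bases of a finite dimensional ideal. -/

section Dual

variable {k : Type*} [Field k] {R : Type*} [CommRing R] [Algebra k R]

/-- The coordinates of a `k`-basis of `I` extend to functionals on `R`. Here finite dimension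
enters: one finite dual basis serves all arguments of a cochain and all powers of `u` at once,
although cochains and negative cyclic chains form infinite products. -/
theorem exists_dual (I : Ideal R) [Module.Finite k R] : ∃ (n : ℕ) (b : Fin n → I)
    (σ : Fin n → R →ₗ[k] k), ∀ r : I, r = ∑ j, σ j r • b j := by
  let J : Submodule k R := I.restrictScalars k
  let b := Module.finBasis k J
  choose σ hσ using fun j => LinearMap.exists_extend (p := J) (b.coord j)
  refine ⟨_, b, σ, fun r => (b.sum_repr r).symm.trans (Finset.sum_congr rfl fun j _ => ?_)⟩
  congr 1
  exact (LinearMap.congr_fun (hσ j) r).symm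

/-- For `r ∈ I` the product `r s` is again in `I`, so it can be expanded in the dual basis and the
coefficients moved to the other tensor factor. -/
theorem eq_sum_slice {I : Ideal R} {n : ℕ} {b : Fin n → I} {σ : Fin n → R →ₗ[k] k}
    (h : ∀ r : I, r = ∑ j, σ j r • b j) {M : Type*} [AddCommGroup M] [Module k M] {w : R ⊗[k] M}
    (hw : w ∈ I • (⊤ : Submodule R (R ⊗[k] M))) : w = ∑ j, (b j : R) ⊗ₜ slice M (σ j) w := by
  induction hw using Submodule.smul_induction_on' with
  | smul r hr a ha =>
    clear ha
    induction a with
    | zero => simp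
    | add x y hx hy =>
      rw [smul_add]
      nth_rewrite 1 [hx, hy]
      rw [← Finset.sum_add_distrib]
      exact Finset.sum_congr rfl fun j _ => by rw [map_add, TensorProduct.tmul_add]
    | tmul s v =>
      rw [TensorProduct.smul_tmul', smul_eq_mul]
      have h2 := congrArg Subtype.val (h ⟨r * s, I.mul_mem_right s hr⟩)
      rw [Submodule.coe_sum] at h2
      change r * s = ∑ j, σ j (r * s) • (b j : R) at h2
      nth_rewrite 1 [h2]
      rw [TensorProduct.sum_tmul]
      exact Finset.sum_congr rfl fun j _ => by
        rw [slice_tmul, TensorProduct.smul_tmul]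
  | add x _ y _ hx hy =>
    nth_rewrite 1 [hx, hy]
    rw [← Finset.sum_add_distrib]
    exact Finset.sum_congr rfl fun j _ => by rw [map_add, TensorProduct.tmul_add]

/-- The part of an element of `X ⊗ I` along a functional. -/
noncomputable def tslice {I : Ideal R} (X : Type*) [AddCommGroup X] [Module k X] (σ : R →ₗ[k] k) :
    X ⊗[k] I →ₗ[k] X :=
  TensorProduct.rid k X ∘ₗ (σ ∘ₗ (I.restrictScalars k).subtype).lTensor X

theorem tslice_tmul {I : Ideal R} {X : Type*} [AddCommGroup X] [Module k X] (σ : R →ₗ[k] k)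
    (x : X) (r : I) : tslice X σ (x ⊗ₜ r) = σ r • x :=
  TensorProduct.rid_tmul _ _

theorem eq_sum_tslice {I : Ideal R} {n : ℕ} {b : Fin n → I} {σ : Fin n → R →ₗ[k] k}
    (h : ∀ r : I, r = ∑ j, σ j r • b j) {X : Type*} [AddCommGroup X] [Module k X]
    (w : X ⊗[k] I) : w = ∑ j, tslice X (σ j) w ⊗ₜ b j := by
  induction w with
  | zero => simp
  | add x y hx hy =>
    nth_rewrite 1 [hx, hy]
    rw [← Finset.sum_add_distrib]
    exact Finset.sum_congr rfl fun j _ => by rw [map_add, TensorProduct.add_tmul]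
  | tmul x r =>
    nth_rewrite 1 [h r]
    rw [TensorProduct.tmul_sum]
    exact Finset.sum_congr rfl fun j _ => by
      rw [tslice_tmul, TensorProduct.smul_tmul]

end Dual

end CYDef

namespace CYDef

/-! ### Naturality of the braces. -/

section BraceMap

variable {R S : Type*} [CommRing R] [CommRing S] {B B' M N : Type*} [AddCommGroup B] [Module R B]
  [AddCommGroup B'] [Module S B'] [AddCommGroup M] [AddCommGroup N] {σ : R →+* S}

/-- A brace only inserts values of one function into another, so it is natural for maps of arguments
and of values; it is used along `A → R ⊗ A`. -/
theorem brace_map (g : B →ₛₗ[σ] B') (γ : M →+ N) (p : ℤ) {φ : List B → M} {φ' : List B' → N}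
    {x : List B → B} {x' : List B' → B'} (hφ : ∀ l, φ' (l.map g) = γ (φ l))
    (hx : ∀ l, x' (l.map g) = g (x l)) (l : List B) :
    brace p φ' x' (l.map g) = γ (brace p φ x l) := by
  unfold brace cut3
  simp only [cut_map, map_cut, map_zsmul, ← hφ, List.map_append, List.map_cons, hx, List.length_map]

theorem gbr_map (g : B →ₛₗ[σ] B') (p q : ℤ) {x y : List B → B} {x' y' : List B' → B'}
    (hx : ∀ l, x' (l.map g) = g (x l)) (hy : ∀ l, y' (l.map g) = g (y l)) (l : List B) :
    gbr p q x' y' (l.map g) = g (gbr p q x y l) := by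
  have h1 := brace_map g g.toAddMonoidHom q hx hy l
  have h2 := brace_map g g.toAddMonoidHom p hy hx l
  rw [gbr, gbr, h1, h2, map_sub, map_zsmul]
  rfl

end BraceMap

/-! ### Words as multilinear functions of their letters. -/

section WordFun

variable {k : Type*} [CommRing k] {A : Type*} [Ring A] [Algebra k A]

variable (k A) in
/-- The function `(b₀, …, bₙ) ↦ b₀ ⊗ ⋯ ⊗ bₙ`. -/
noncomputable def wordFun : multilinFun k A (NChain k (1 : A)) :=
  ⟨fun l => match l with
    -- The empty list is not a word, and any value would do. With 0 the function is defined on all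
    -- lists, as the extension to `R ⊗ A` requires.
    | [] => 0
    | b :: l => word k 1 b l,
   { add := fun u a b v => by
      match u with
      | [] => exact (word_isChainFun k (1 : A)).add a b v
      | c :: u => exact (word_multilin c).add u a b v
     smul := fun u r a v => by
      match u with
      | [] => exact (word_isChainFun k (1 : A)).smul r a v
      | c :: u => exact (word_multilin c).smul u r a v }⟩

theorem wordFun_cons (b : A) (l : List A) : (wordFun k A).1 (b :: l) = word k 1 b l := rfl

end WordFun

/-! ### Cochains and chains of `R ⊗ A` in terms of those of `A`. -/

section Extension

variable {k : Type*} [Field k] {A : Type*} [Ring A] [Algebra k A] (R : Type*) [CommRing R]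
  [Algebra k R]

/-- The `R`-multilinear extension of a normalized cochain. -/
noncomputable def extCochain {p : ℤ} : NCochain k (1 : A) p →ₗ[k] NCochain R (1 : R ⊗[k] A) p where
  toFun x := ⟨fun l => extFun A R l ⟨x.1, x.2.1⟩, extFun_multilin _, extFun_kills x.2.2.1,
    (extFun_multilin _).hasDegree_of_incl fun l hl =>
      (extFun_map_incl _ l).trans (by rw [x.2.2.2 l hl, TensorProduct.tmul_zero])⟩
  map_add' x y := Subtype.ext (funext fun l => map_add (extFun A R l) ⟨x.1, x.2.1⟩ ⟨y.1, y.2.1⟩)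
  map_smul' c x := Subtype.ext (funext fun l => map_smul (extFun A R l) c ⟨x.1, x.2.1⟩)

variable {R}

theorem extCochain_incl {p : ℤ} (x : NCochain k (1 : A) p) (l : List A) :
    (extCochain R x).1 (l.map (incl R A)) = incl R A (x.1 l) := extFun_map_incl _ l

theorem cochain_ext_incl {p : ℤ} {x y : NCochain R (1 : R ⊗[k] A) p}
    (h : ∀ l : List A, x.1 (l.map (incl R A)) = y.1 (l.map (incl R A))) : x = y :=
  Subtype.ext (x.2.1.eq_of_incl y.2.1 h)

/-- Multilinear functions on `R ⊗ A` are determined on `A`, where both sides are the bracket over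
`k` by naturality of the braces. -/
theorem extCochain_br {p q n : ℤ} (h : p + q = n) (x : NCochain k (1 : A) p)
    (y : NCochain k (1 : A) q) :
    extCochain R (ncBr h x y) = ncBr h (extCochain R x) (extCochain R y) :=
  cochain_ext_incl fun l => (extCochain_incl _ l).trans
    (gbr_map (incl R A) p q (extCochain_incl x) (extCochain_incl y) l).symm

theorem ofBilin_mulBilin_incl (l : List A) :
    ofBilin (mulBilin R (R ⊗[k] A)) (l.map (incl R A)) = incl R A (ofBilin (mulBilin k A) l) := by
  by_cases hl : l.length = 2
  · match l, hl with
    | [a, b], _ =>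
      change -((1 : R) ⊗ₜ[k] a * (1 : R) ⊗ₜ[k] b) = (1 : R) ⊗ₜ[k] (-(a * b))
      rw [Algebra.TensorProduct.tmul_mul_tmul, one_mul, TensorProduct.tmul_neg]
  · rw [ofBilin_of_length _ hl, ofBilin_of_length _ (by simpa using hl), map_zero]

theorem extCochain_diff {p n : ℤ} (h : p + 1 = n) (x : NCochain k (1 : A) p) :
    extCochain R (ncDiff (ofBilin_multilin _) (ofBilin_hasDegree _) (mulBilin_unital k A) h x) =
      ncDiff (ofBilin_multilin _) (ofBilin_hasDegree _) (mulBilin_unital R (R ⊗[k] A)) h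
        (extCochain R x) :=
  cochain_ext_incl fun l => (extCochain_incl _ l).trans
    (gbr_map (incl R A) 1 p ofBilin_mulBilin_incl (extCochain_incl x) l).symm

theorem bcNeg_act {p n m : ℤ} (h : n = m + p) (x : NCochain k (1 : A) p) (c : NegCyc k (1 : A) n) :
    bcNeg R m (ncAct h x c) = ncAct h (extCochain R x) (bcNeg R n c) :=
  Subtype.ext (funext fun i => chainMap_chainLie (incl R A) (incl_one R) (extCochain_incl x)
    (lieFun_isChainFun x.2.1 x.2.2.1)
    (lieFun_isChainFun (extCochain R x).2.1 (extCochain R x).2.2.1) (c.1 i))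

theorem bcNeg_diff {n m : ℤ} (h : n = m + 1) (c : NegCyc k (1 : A) n) :
    bcNeg R m (negDiff h (ofBilin (mulBilin k A)) (ofBilin_hasDegree _) c) =
      negDiff h (ofBilin (mulBilin R (R ⊗[k] A))) (ofBilin_hasDegree _) (bcNeg R n c) :=
  negMap_negDiff (incl R A) (incl_one R) h (mulBilin_unital k A) (mulBilin_unital R (R ⊗[k] A))
    (fun a b => (ofBilin_mulBilin_incl [a, b]).symm) c

variable (k A R) in
/-- The chains of `R ⊗ A` over `R` as elements of `R ⊗ C(A)`. -/
noncomputable def splitChain : NChain R (1 : R ⊗[k] A) →ₗ[R] R ⊗[k] NChain k (1 : A) :=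
  NChain.lift (F := fun b l => extFun (NChain k (1 : A)) R (b :: l) (wordFun k A))
    { add := fun a b l => (extFun_multilin (wordFun k A)).add [] a b l
      smul := fun r a l => (extFun_multilin (wordFun k A)).smul [] r a l
      multilin := fun b => (extFun_multilin (wordFun k A)).prefix_const [b]
      kills := fun b => by
        intro u v
        change extFun _ R (b :: (u ++ 1 :: v)) _ = 0
        rw [extFun_cons]
        -- A unit makes a word vanish only in the tail. So the head is contracted first: for each
        -- head in `A` the remaining function of the tail vanishes at 1.
        have : extFun (NChain k (1 : A)) R (u ++ 1 :: v) ∘ₗ contract k A _ (wordFun k A) = 0 :=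
          LinearMap.ext fun a => extFun_kills (f := contract k A _ (wordFun k A) a)
            (fun s t => word_degen a s t) u v
        rw [this, map_zero, LinearMap.zero_apply] }

theorem splitChain_word (b : R ⊗[k] A) (l : List (R ⊗[k] A)) :
    splitChain k A R (word R 1 b l) = extFun (NChain k (1 : A)) R (b :: l) (wordFun k A) :=
  NChain.lift_word _ _ _

/-- Needed to read off the slices of an element of `𝔇 ⊗ I` from its chain component. -/
theorem splitChain_chainMap (c : NChain k (1 : A)) :
    splitChain k A R (chainMap (incl R A) (incl_one R) c) = 1 ⊗ₜ c := by
  let F : NChain k (1 : A) →ₗ[k] R ⊗[k] NChain k (1 : A) :=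
    { toFun := fun c => splitChain k A R (chainMap (incl R A) (incl_one R) c)
      map_add' := fun a b => by rw [map_add, map_add]
      map_smul' := fun r a => by
        rw [map_smulₛₗ, map_smul, RingHom.id_apply, algebraMap_smul] }
  suffices h : F = TensorProduct.mk k R _ 1 from LinearMap.congr_fun h c
  refine NChain.hom_ext fun b l => ?_
  change splitChain k A R (chainMap (incl R A) (incl_one R) (word k 1 b l)) = _
  rw [chainMap_word, splitChain_word]
  exact extFun_map_incl (wordFun k A) (b :: l)

variable (k A R) in
/-- The chain `r c` of `R ⊗ A`, for `r ∈ R` and a chain `c` of `A`. -/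
noncomputable def joinChain : R ⊗[k] NChain k (1 : A) →ₗ[R] NChain R (1 : R ⊗[k] A) :=
  LinearMap.liftBaseChange R
    { toFun := fun c => chainMap (incl R A) (incl_one R) c
      map_add' := fun a b => map_add _ a b
      map_smul' := fun r a => by rw [map_smulₛₗ, RingHom.id_apply, algebraMap_smul] }

theorem joinChain_tmul (r : R) (c : NChain k (1 : A)) :
    joinChain k A R (r ⊗ₜ c) = r • chainMap (incl R A) (incl_one R) c :=
  LinearMap.liftBaseChange_tmul _ _ _ _

/-- Both sides are `R`-multilinear in the letters of a word, so it suffices to take letters from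
`A`. It allows a chain to be rebuilt from its slices. -/
theorem joinChain_splitChain (c : NChain R (1 : R ⊗[k] A)) :
    joinChain k A R (splitChain k A R c) = c := by
  suffices h : joinChain k A R ∘ₗ splitChain k A R = LinearMap.id from LinearMap.congr_fun h c
  refine NChain.hom_ext fun b l => ?_
  rw [LinearMap.comp_apply, splitChain_word, LinearMap.id_apply]
  refine congrFun (IsMultilin.eq_of_incl (k := k) (A := A)
    (g := fun l => joinChain k A R (extFun (NChain k (1 : A)) R l (wordFun k A)))
    (g' := (wordFun R (R ⊗[k] A)).1) ⟨fun u a b v => ?_, fun u r a v => ?_⟩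
    (wordFun R (R ⊗[k] A)).2 fun l => ?_) (b :: l)
  · rw [(extFun_multilin (wordFun k A)).add, map_add]
  · rw [(extFun_multilin (wordFun k A)).smul, map_smul]
  · rw [extFun_map_incl, joinChain_tmul, one_smul]
    cases l with
    | nil => exact map_zero _
    | cons a l => rw [wordFun_cons, chainMap_word, List.map_cons, wordFun_cons]

/-- The extension of `wordFun` on lists of length `n + 1` takes values in the base change of the
chains of degree `n`, so slices keep the degree. -/
theorem splitChain_mem {n : ℤ} {c : NChain R (1 : R ⊗[k] A)} (hc : c ∈ chainDeg R 1 n) :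
    splitChain k A R c ∈ (chainDeg k (1 : A) n).baseChange R := by
  induction hc using Submodule.span_induction with
  | mem c hc =>
    obtain ⟨b, l, hl, rfl⟩ := hc
    rw [splitChain_word]
    refine extFun_mem _ (l.length + 1) _ (fun t ht => ?_) _ (by simp)
    match t, ht with
    | a :: t, ht =>
      rw [wordFun_cons]
      refine chainDeg_word _ _ ?_
      rw [← hl]
      exact_mod_cast Nat.succ.inj ht
  | zero => rw [map_zero]; exact zero_mem _
  | add a b _ _ ha hb => rw [map_add]; exact add_mem ha hb
  | smul r a _ ha => rw [map_smul]; exact Submodule.smul_mem _ _ ha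

end Extension

/-! ### Elements of `𝔇 ⊗ I` as pairs of a cochain and a chain of `R ⊗ A`. -/

section Realization

variable {k : Type*} [Field k] {A : Type*} [Ring A] [Algebra k A] {R : Type*} [CommRing R]
  [Algebra k R] (I : Ideal R)

/-- The element `(x, c) ⊗ r` as the cochain `r x`. -/
noncomputable def realC (p : ℤ) (Y : Type*) [AddCommGroup Y] [Module k Y] :
    (NCochain k (1 : A) p × Y) ⊗[k] I →ₗ[k] NCochain R (1 : R ⊗[k] A) p :=
  TensorProduct.lift (LinearMap.mk₂ k (fun z r => (r : R) • extCochain R z.1)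
    (fun z z' r => by rw [Prod.fst_add, map_add, smul_add])
    (fun c z r => by rw [Prod.smul_fst, map_smul, smul_comm])
    (fun z r r' => by rw [Submodule.coe_add, add_smul])
    (fun c z r => smul_assoc c (r : R) _))

/-- The element `(x, c) ⊗ r` as the chain `r c`. -/
noncomputable def realN (X : Type*) [AddCommGroup X] [Module k X] {n' n : ℤ} (h : n' = n) :
    (X × NegCyc k (1 : A) n') ⊗[k] I →ₗ[k] NegCyc R (1 : R ⊗[k] A) n :=
  TensorProduct.lift (LinearMap.mk₂ k (fun z r => (r : R) • bcNeg R n (NegCyc.cast h z.2))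
    (fun z z' r => by rw [Prod.snd_add, map_add, map_add, smul_add])
    (fun c z r => by
      rw [Prod.smul_snd, map_smul, map_smulₛₗ, smul_comm, algebraMap_smul])
    (fun z r r' => by rw [Submodule.coe_add, add_smul])
    (fun c z r => smul_assoc c (r : R) _))

variable {I}

theorem realC_tmul {p : ℤ} {Y : Type*} [AddCommGroup Y] [Module k Y]
    (z : NCochain k (1 : A) p × Y) (r : I) :
    realC I p Y (z ⊗ₜ r) = (r : R) • extCochain R z.1 := rfl

theorem realN_tmul {X : Type*} [AddCommGroup X] [Module k X] {n' n : ℤ} (h : n' = n)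
    (z : X × NegCyc k (1 : A) n') (r : I) :
    realN I X h (z ⊗ₜ r) = (r : R) • bcNeg R n (NegCyc.cast h z.2) := rfl

theorem realC_mem {p : ℤ} {Y : Type*} [AddCommGroup Y] [Module k Y]
    (w : (NCochain k (1 : A) p × Y) ⊗[k] I) :
    realC I p Y w ∈ I • (⊤ : Submodule R (NCochain R (1 : R ⊗[k] A) p)) := by
  induction w with
  | zero => rw [map_zero]; exact zero_mem _
  | add a b ha hb => rw [map_add]; exact add_mem ha hb
  | tmul z r => exact Submodule.smul_mem_smul r.2 trivial

theorem realN_mem {X : Type*} [AddCommGroup X] [Module k X] {n' n : ℤ} (h : n' = n)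
    (w : (X × NegCyc k (1 : A) n') ⊗[k] I) :
    realN I X h w ∈ I • (⊤ : Submodule R (NegCyc R (1 : R ⊗[k] A) n)) := by
  induction w with
  | zero => rw [map_zero]; exact zero_mem _
  | add a b ha hb => rw [map_add]; exact add_mem ha hb
  | tmul z r => exact Submodule.smul_mem_smul r.2 trivial

/-- The slices of `w` are recovered from its realization, the cochain part here and the chain part
in `tslice_snd`; this is what makes the realization injective. -/
theorem tslice_fst (σ : R →ₗ[k] k) {p : ℤ} {Y : Type*} [AddCommGroup Y] [Module k Y]
    (w : (NCochain k (1 : A) p × Y) ⊗[k] I) (l : List A) :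
    (tslice _ σ w).1.1 l = slice A σ ((realC I p Y w).1 (l.map (incl R A))) := by
  induction w with
  | zero => simp
  | add a b ha hb =>
    rw [map_add, map_add]
    exact (congrArg₂ (· + ·) ha hb).trans (map_add (slice A σ) _ _).symm
  | tmul z r =>
    rw [tslice_tmul, realC_tmul]
    change σ r • z.1.1 l = slice A σ ((r : R) • (extCochain R z.1).1 (l.map (incl R A)))
    rw [extCochain_incl, ← tmul_eq_smul_incl, slice_tmul]

theorem tslice_snd (σ : R →ₗ[k] k) {X : Type*} [AddCommGroup X] [Module k X] {n' n : ℤ}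
    (h : n' = n) (w : (X × NegCyc k (1 : A) n') ⊗[k] I) (i : ℕ) :
    (tslice _ σ w).2.1 i = slice _ σ (splitChain k A R ((realN I X h w).1 i)) := by
  induction w with
  | zero => simp
  | add a b ha hb =>
    rw [map_add, map_add]
    refine (congrArg₂ (· + ·) ha hb).trans ?_
    rw [← map_add, ← map_add]
    rfl
  | tmul z r =>
    rw [tslice_tmul, realN_tmul]
    change σ r • z.2.1 i = slice _ σ (splitChain k A R ((r : R) •
      chainMap (incl R A) (incl_one R) (z.2.1 i)))
    rw [map_smul, splitChain_chainMap, TensorProduct.smul_tmul', slice_tmul, smul_eq_mul, mul_one]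

variable [Module.Finite k R]

/-- An element of the tensor product is the sum of its slices against the dual basis, and its slices
are determined by the two realizations. -/
theorem real_injective {p n' n : ℤ} (h : n' = n)
    {w : (NCochain k (1 : A) p × NegCyc k (1 : A) n') ⊗[k] I} (h₁ : realC I p _ w = 0)
    (h₂ : realN I _ h w = 0) : w = 0 := by
  obtain ⟨m, b, σ, hσ⟩ := exists_dual (k := k) I
  rw [eq_sum_tslice hσ w]
  refine Finset.sum_eq_zero fun j _ => ?_
  have : tslice _ (σ j) w = 0 := by
    refine Prod.ext (Subtype.ext (funext fun l => ?_)) (Subtype.ext (funext fun i => ?_))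
    · rw [tslice_fst, h₁]
      exact map_zero _
    · rw [tslice_snd _ h, h₂]
      exact (congrArg _ (map_zero _)).trans (map_zero _)
  rw [this, TensorProduct.zero_tmul]

/-- The preimage is `∑ (x_j, y_j) ⊗ b_j`, where `x_j` and `y_j` are the slices of `z` and of the
coefficients of `c` along the dual basis. For `z` it is enough that each value on `A` is divisible
by `I`, because the basis does not depend on the arguments. -/
theorem real_surjective {p n' n : ℤ} (h : n' = n) (z : NCochain R (1 : R ⊗[k] A) p)
    (hz : ∀ l : List A, z.1 (l.map (incl R A)) ∈ I • (⊤ : Submodule R (R ⊗[k] A)))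
    (c : NegCyc R (1 : R ⊗[k] A) n)
    (hc : c ∈ I • (⊤ : Submodule R (NegCyc R (1 : R ⊗[k] A) n))) :
    ∃ w : (NCochain k (1 : A) p × NegCyc k (1 : A) n') ⊗[k] I,
      realC I p _ w = z ∧ realN I _ h w = c := by
  subst h
  obtain ⟨m, b, σ, hσ⟩ := exists_dual (k := k) I
  -- Slicing is `k`-linear, so the slices of `z` on lists from `A` inherit multilinearity,
  -- normalization and degree.
  let x : Fin m → NCochain k (1 : A) p := fun j =>
    ⟨fun l => slice A (σ j) (z.1 (l.map (incl R A))),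
      ⟨fun u a b v => by
        simp only [List.map_append, List.map_cons, map_add, z.2.1.add],
       fun u r a v => by
        rw [List.map_append, List.map_cons, map_smulₛₗ, z.2.1.smul, RingHom.id_apply,
          algebraMap_smul, map_smul, List.map_append, List.map_cons]
        rfl⟩,
      fun u v => by
        simp only [List.map_append, List.map_cons, incl_one]
        rw [z.2.2.1, map_zero],
      fun l hl => by
        dsimp only
        rw [z.2.2.2 _ (by simpa using hl), map_zero]⟩
  let y : Fin m → NegCyc k (1 : A) n' := fun j =>
    ⟨fun i => slice _ (σ j) (splitChain k A R (c.1 i)), fun i =>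
      slice_mem _ (splitChain_mem (c.2 i)) _⟩
  refine ⟨∑ j, (x j, y j) ⊗ₜ b j, ?_, ?_⟩
  · rw [map_sum]
    refine cochain_ext_incl fun l => ?_
    rw [eq_sum_slice hσ (hz l)]
    simp only [realC_tmul]
    rw [Submodule.coe_sum, Finset.sum_apply]
    refine Finset.sum_congr rfl fun j _ => ?_
    change (b j : R) • (extCochain R (x j)).1 (l.map (incl R A)) = _
    rw [extCochain_incl, ← tmul_eq_smul_incl]
  · rw [map_sum]
    refine Subtype.ext (funext fun i => ?_)
    -- Taking the coefficient of `uⁱ` and splitting are `R`-linear, so they carry divisibility of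
    -- `c` by `I` to each coefficient.
    have hi : splitChain k A R (c.1 i) ∈ I • (⊤ : Submodule R (R ⊗[k] NChain k (1 : A))) :=
      map_smul_top' (splitChain k A R ∘ₗ LinearMap.proj i ∘ₗ (NegCyc R _ n').subtype) hc
    rw [← joinChain_splitChain (k := k) (c.1 i), eq_sum_slice hσ hi, map_sum]
    simp only [realN_tmul, joinChain_tmul]
    rw [Submodule.coe_sum, Finset.sum_apply]
    rfl

end Realization

end CYDef

namespace CYDef

/-! ### Affine maps of negative cyclic chains. -/

section Translation

variable {R : Type*} [CommRing R] {B : Type*} [AddCommGroup B] [Module R B] {e : B}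

/-- A cochain of degree one, as a bilinear map. -/
def coBilin : NCochain R e 1 →ₗ[R] (B →ₗ[R] B →ₗ[R] B) where
  toFun x := LinearMap.mk₂ R (fun a b => x.1 [a, b])
    (fun a a' b => x.2.1.add [] a a' [b]) (fun c a b => x.2.1.smul [] c a [b])
    (fun a b b' => x.2.1.add [a] b b' []) (fun c a b => x.2.1.smul [a] c b [])
  map_add' _ _ := rfl
  map_smul' _ _ := rfl

theorem ofBilin_coBilin (x : NCochain R e 1) : ofBilin (coBilin x) = x.1 := by
  funext l
  by_cases hl : l.length = 2
  · match l, hl with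
    | [a, b], _ => rfl
  · rw [ofBilin_of_length _ hl, x.2.2.2 l (by exact_mod_cast hl)]

theorem coBilin_injective : Function.Injective (coBilin (R := R) (e := e)) := fun x y h =>
  Subtype.ext (by rw [← ofBilin_coBilin, h, ofBilin_coBilin])

/-- A bilinear map which vanishes if one of its arguments is `e`, as a normalized cochain. -/
def bilinCochain (ν : B →ₗ[R] B →ₗ[R] B) (h₁ : ∀ a, ν e a = 0) (h₂ : ∀ a, ν a e = 0) :
    NCochain R e 1 :=
  ⟨ofBilin ν, ofBilin_multilin ν, fun u v => by
    match u, v with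
    | [], [] => rfl
    | [], [c] => exact h₁ c
    | [c], [] => exact h₂ c
    | [], _ :: _ :: _ => rfl
    | [_], _ :: _ => rfl
    | _ :: _ :: _, _ => exact ofBilin_of_length _ (by simp), ofBilin_hasDegree ν⟩

theorem coBilin_bilinCochain (ν : B →ₗ[R] B →ₗ[R] B) (h₁ : ∀ a, ν e a = 0)
    (h₂ : ∀ a, ν a e = 0) : coBilin (bilinCochain ν h₁ h₂) = ν := rfl

theorem ofBilin_add_coBilin (μ : B →ₗ[R] B →ₗ[R] B) (x : NCochain R e 1) :
    ofBilin (μ + coBilin x) = ofBilin μ + x.1 := by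
  rw [← ofBilin_coBilin]
  funext l
  by_cases hl : l.length = 2
  · match l, hl with
    | [a, b], _ => rfl
  · rw [Pi.add_apply, ofBilin_of_length _ hl, ofBilin_of_length _ hl, ofBilin_of_length _ hl,
      add_zero]

/-- A normalized cochain vanishes when an argument is the unit, so adding it does not move the unit
of the product. -/
theorem isUnital_add {μ : B →ₗ[R] B →ₗ[R] B} (hu : IsUnital e (ofBilin μ)) (x : NCochain R e 1) :
    IsUnital e (ofBilin (μ + coBilin x)) := fun a => by
  have h₁ : x.1 [e, a] = 0 := x.2.2.1 [] [a]
  have h₂ : x.1 [a, e] = 0 := x.2.2.1 [a] []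
  rw [ofBilin_add_coBilin]
  exact ⟨by rw [Pi.add_apply, (hu a).1, h₁, add_zero],
    by rw [Pi.add_apply, (hu a).2, h₂, add_zero]⟩

/-- The Lie derivative is additive in the cochain, and the Connes part does not involve the product.
-/
theorem negDiff_add {μ : B →ₗ[R] B →ₗ[R] B} (hu : IsUnital e (ofBilin μ)) (x : NCochain R e 1)
    {n m : ℤ} (h : n = m + 1) (c : NegCyc R e n) :
    negDiff h (ofBilin (μ + coBilin x)) (ofBilin_hasDegree _) c =
      negDiff h (ofBilin μ) (ofBilin_hasDegree _) c + ncAct h x c := by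
  have hC := lieFun_isChainFun_unital (ofBilin_multilin (μ + coBilin x)) (ofBilin_hasDegree _)
    (isUnital_add hu x)
  have key := chainLie_add
    (lieFun_isChainFun_unital (ofBilin_multilin μ) (ofBilin_hasDegree _) hu)
    (lieFun_isChainFun x.2.1 x.2.2.1) (by rwa [ofBilin_add_coBilin] at hC)
  refine Subtype.ext (funext fun i => ?_)
  change chainLie R e 1 (ofBilin (μ + coBilin x)) (c.1 i) + uConnes R e c.1 i =
    chainLie R e 1 (ofBilin μ) (c.1 i) + uConnes R e c.1 i + chainLie R e 1 x.1 (c.1 i)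
  rw [ofBilin_add_coBilin, key, LinearMap.add_apply]
  abel

variable (R e) in
/-- The Lie derivative along cochains of degree zero. -/
noncomputable def lieEnd : NCochain R e 0 →ₗ[R] Module.End R (NChain R e) where
  toFun x := chainLie R e 0 x.1
  map_add' x y := chainLie_add (lieFun_isChainFun x.2.1 x.2.2.1)
      (lieFun_isChainFun y.2.1 y.2.2.1) (lieFun_isChainFun (x + y).2.1 (x + y).2.2.1)
  map_smul' r x := chainLie_smul r (lieFun_isChainFun x.2.1 x.2.2.1)
      (lieFun_isChainFun (r • x).2.1 (r • x).2.2.1)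

/-- The Lie derivative along cochains of degree zero, on negative cyclic chains. -/
noncomputable abbrev negLie₀ (n : ℤ) : NCochain R e 0 →ₗ[R] Module.End R (NegCyc R e n) :=
  ncAct (add_zero n).symm

/-- The affine action `z ↦ L_f z + c` of a pair `(f, c)` on negative cyclic chains, linearized. -/
noncomputable def transl (n : ℤ) :
    NCochain R e 0 × NegCyc R e n →ₗ[R] Module.End R (NegCyc R e n × R) where
  toFun p := LinearMap.prod (negLie₀ n p.1 ∘ₗ LinearMap.fst R _ _ +
    LinearMap.toSpanSingleton R _ p.2 ∘ₗ LinearMap.snd R _ _) 0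
  map_add' p q := LinearMap.ext fun w => Prod.ext (by
    change negLie₀ n (p.1 + q.1) w.1 + w.2 • (p.2 + q.2) =
      (negLie₀ n p.1 w.1 + w.2 • p.2) + (negLie₀ n q.1 w.1 + w.2 • q.2)
    rw [map_add, LinearMap.add_apply, smul_add]
    abel) (add_zero 0).symm
  map_smul' r p := LinearMap.ext fun w => Prod.ext (by
    change negLie₀ n (r • p.1) w.1 + w.2 • (r • p.2) = r • (negLie₀ n p.1 w.1 + w.2 • p.2)
    rw [map_smul, LinearMap.smul_apply, smul_add, smul_comm]) (smul_zero r).symm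

theorem transl_apply {n : ℤ} (p : NCochain R e 0 × NegCyc R e n) (w : NegCyc R e n × R) :
    transl n p w = (negLie₀ n p.1 w.1 + w.2 • p.2, 0) := rfl

/-- The linearized affine maps are a semidirect product of linear maps with translations, so the
only content is `[L_f, L_g] = L_{[f, g]}`. It is half of the statement that `Realization.rep` is a
representation. -/
theorem transl_bracket {n : ℤ} (p q : NCochain R e 0 × NegCyc R e n) :
    transl n (ncBr (add_zero 0) p.1 q.1,
      negLie₀ n p.1 q.2 - negLie₀ n q.1 p.2) =
      transl n p * transl n q - transl n q * transl n p := by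
  refine LinearMap.ext fun w => Prod.ext ?_ (sub_zero 0).symm
  change negLie₀ n (ncBr _ p.1 q.1) w.1 + w.2 • (negLie₀ n p.1 q.2 - negLie₀ n q.1 p.2) =
    (negLie₀ n p.1 (negLie₀ n q.1 w.1 + w.2 • q.2) + (0 : R) • p.2) -
    (negLie₀ n q.1 (negLie₀ n p.1 w.1 + w.2 • p.2) + (0 : R) • q.2)
  have h := ncAct_bracket (add_zero 0) (add_zero n).symm (add_zero n).symm (add_zero n).symm
    (add_zero n).symm (add_zero n).symm p.1 q.1 w.1
  rw [mul_zero, sgn_zero, one_smul] at h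
  rw [map_add, map_add, h, map_smul, map_smul, smul_sub, zero_smul, zero_smul]
  abel

end Translation

/-! ### Exponentials of affine maps. -/

section TranslationExponential

variable {k : Type*} [Field k] {R : Type*} [CommRing R] [Algebra k R] {B : Type*}
  [AddCommGroup B] [Module R B] {e : B} {n : ℤ}

/-- The line `c ↦ c v` intertwines the zero operator with `D`. -/
theorem nexp_eq_self_of_eq_zero {V : Type*} [AddCommGroup V] [Module R V] [Module k V]
    [IsScalarTower k R V] {D : Module.End R V} (hD : IsNilpotent D) {v : V} (hv : D v = 0) :
    nexp k D v = v := by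
  have := nexp_intertwine (R := k) (S := R) (LinearMap.toSpanSingleton k V v)
    (D := (0 : Module.End k k)) (D' := D) IsNilpotent.zero hD (fun c => by
      rw [LinearMap.zero_apply, map_zero, LinearMap.toSpanSingleton_apply,
        LinearMap.map_smul_of_tower, hv, smul_zero]) 1
  rw [nexp_zero, Module.End.one_apply, LinearMap.toSpanSingleton_apply, one_smul] at this
  exact this.symm

theorem nexp_transl_snd {p : NCochain R e 0 × NegCyc R e n} (hp : IsNilpotent (transl n p))
    (w : NegCyc R e n × R) : (nexp k (transl n p) w).2 = w.2 := by
  have := nexp_intertwine (R := R) (S := k) (LinearMap.snd k (NegCyc R e n) R) hp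
    (D' := 0) IsNilpotent.zero (fun v => rfl) w
  rw [nexp_zero] at this
  exact this

theorem nexp_transl_inl {p : NCochain R e 0 × NegCyc R e n} (hp : IsNilpotent (transl n p))
    (hN : IsNilpotent (negLie₀ n p.1))
    (z : NegCyc R e n) : nexp k (transl n p) (z, 0) =
      (nexp k (negLie₀ n p.1) z, 0) :=
  (nexp_intertwine (R := R) (S := R) (LinearMap.inl k (NegCyc R e n) R) hN hp (fun v => by
    rw [transl_apply]
    simp) z).symm

/-- A pure translation has square zero, so the exponential series stops after the linear term. -/
theorem nexp_transl_translation (c : NegCyc R e n) :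
    nexp k (transl n ((0 : NCochain R e 0), c)) (0, 1) = (c, 1) := by
  have h : (transl n ((0 : NCochain R e 0), c)) ^ 2 = 0 := by
    refine LinearMap.ext fun w => ?_
    rw [pow_two, Module.End.mul_apply, transl_apply, transl_apply]
    simp
  rw [nexp_apply h, Finset.sum_range_succ, Finset.sum_range_one, pow_zero, pow_one, transl_apply]
  simp

end TranslationExponential

end CYDef

namespace CYDef

universe u v w

/-! ### Realizations of a DG-Lie algebra by cochains and chains, and Maurer–Cartan elements. -/

section Realization

variable {k : Type u} [Field k] [CharZero k]

/-- A description of a DG-Lie algebra `h` by cochains and negative cyclic chains of a module `B`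
over `R` with a unital multiplication `-μ` and a negative cyclic cycle `η`: the elements of `h` are
the pairs of a cochain and a chain which vanish modulo the nilpotent ideal `I`. -/
structure Realization (h : DGLie.{u, v} k) {R : Type*} [CommRing R] [Algebra k R] (I : Ideal R)
    {B : Type*} [AddCommGroup B] [Module R B] [Module k B] [IsScalarTower k R B] {e : B}
    (μ : B →ₗ[R] B →ₗ[R] B) {d : ℤ} (η : NegCyc R e d) where
  nilp : ∃ N : ℕ, I ^ N = ⊥
  unital : IsUnital e (ofBilin μ)
  gbr_self : gbr 1 1 (ofBilin μ) (ofBilin μ) = 0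
  cycle : negDiff (show d = (d - 1) + 1 by omega) (ofBilin μ) (ofBilin_hasDegree μ) η = 0
  C : ∀ p, h.X p →ₗ[k] NCochain R e p
  N : ∀ (p : ℤ) {n : ℤ}, d + 1 - p = n → h.X p →ₗ[k] NegCyc R e n
  C_br : ∀ {i j n : ℤ} (hn : i + j = n) (x : h.X i) (y : h.X j),
    C n (h.br hn x y) = ncBr hn (C i x) (C j y)
  N_br : ∀ {i j n a b c : ℤ} (hn : i + j = n) (ha : d + 1 - i = a) (hb : d + 1 - j = b)
    (hc : d + 1 - n = c) (h₁ : b = c + i) (h₂ : a = c + j) (x : h.X i) (y : h.X j),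
    N n hc (h.br hn x y) = sgn ((d + 1) * i) • ncAct h₁ (C i x) (N j hb y) -
      sgn (j * i) • sgn ((d + 1) * j) • ncAct h₂ (C j y) (N i ha x)
  C_d : ∀ {i j : ℤ} (hj : i + 1 = j) (x : h.X i), C j (h.d hj x) =
    ncDiff (ofBilin_multilin μ) (ofBilin_hasDegree μ) unital hj (C i x)
  N_d : ∀ {i j a c : ℤ} (hj : i + 1 = j) (ha : d + 1 - i = a) (hc : d + 1 - j = c)
    (h₁ : a = c + 1) (h₂ : d = c + i) (x : h.X i), N j hc (h.d hj x) =
    sgn (d + 1) • negDiff h₁ (ofBilin μ) (ofBilin_hasDegree μ) (N i ha x) -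
      sgn (i * 1) • sgn ((d + 1) * i) • ncAct h₂ (C i x) η
  C_mem : ∀ p x, C p x ∈ I • (⊤ : Submodule R (NCochain R e p))
  N_mem : ∀ p {n : ℤ} (hn : d + 1 - p = n) x, N p hn x ∈ I • (⊤ : Submodule R (NegCyc R e n))
  inj : ∀ (p : ℤ) {n : ℤ} (hn : d + 1 - p = n) x, C p x = 0 → N p hn x = 0 → x = 0
  -- For the cochain, divisibility by `I` is asked value by value; this is what a product, or an
  -- endomorphism, that is trivial modulo `I` supplies.
  surj : ∀ (p : ℤ) {n : ℤ} (hn : d + 1 - p = n) (z : NCochain R e p) (c : NegCyc R e n),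
    (∀ l, z.1 l ∈ I • (⊤ : Submodule R B)) → c ∈ I • (⊤ : Submodule R (NegCyc R e n)) →
    ∃ x, C p x = z ∧ N p hn x = c

/-- For a cochain of degree one the two braces in `[μ, μ]` add up, so the associator appears twice.
-/
theorem gbr_self_apply {R : Type*} [CommRing R] {B : Type*} [AddCommGroup B] [Module R B]
    (μ : B →ₗ[R] B →ₗ[R] B) (a b c : B) : gbr 1 1 (ofBilin μ) (ofBilin μ) [a, b, c] =
      (μ (μ a b) c - μ a (μ b c)) + (μ (μ a b) c - μ a (μ b c)) := by
  simp [gbr, brace, cut3, cut_cons, ofBilin, sgn]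
  abel

namespace Realization

variable {h : DGLie.{u, v} k} {R : Type*} [CommRing R] [Algebra k R] {I : Ideal R}
    {B : Type*} [AddCommGroup B] [Module R B] [Module k B] [IsScalarTower k R B] {e : B}
    {μ : B →ₗ[R] B →ₗ[R] B} {d : ℤ} {η : NegCyc R e d} (Z : Realization h I μ η)

/-- The deformed multiplication. -/
noncomputable def mul (y : h.X 1) : B →ₗ[R] B →ₗ[R] B := μ + coBilin (Z.C 1 y)

/-- The deformed chain. -/
noncomputable def chain (y : h.X 1) : NegCyc R e d := η + Z.N 1 (by omega) y

theorem mul_unital (y : h.X 1) : IsUnital e (ofBilin (Z.mul y)) := isUnital_add Z.unital _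

/-- The bracket is symmetric in degree one, so `[μ + C, μ + C] = [μ, μ] + 2 [μ, C] + [C, C]`, and
`[μ, μ] = 0`. -/
theorem gbr_mul (y : h.X 1) : gbr 1 1 (ofBilin (Z.mul y)) (ofBilin (Z.mul y)) = (2 : k) •
    (Z.C 2 (h.d (show 1 + 1 = (2 : ℤ) by norm_num) y +
      (2 : k)⁻¹ • h.br (show 1 + 1 = (2 : ℤ) by norm_num) y y)).1 := by
  rw [mul, map_add, map_smul, Z.C_br, Z.C_d, ofBilin_add_coBilin]
  have h₁ := gbr_add_left (p := 1) (q := 1) (ofBilin μ) (Z.C 1 y).1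
    ((ofBilin_multilin μ).add' (Z.C 1 y).2.1)
  have h₂ := gbr_add_left (p := 1) (q := 1) (ofBilin μ) (Z.C 1 y).1 (ofBilin_multilin μ)
  have h₃ := gbr_add_left (p := 1) (q := 1) (ofBilin μ) (Z.C 1 y).1 (Z.C 1 y).2.1
  have hs : - sgn (1 * 1) = 1 := rfl
  have h₄ := gbr_swap 1 1 (ofBilin μ) (ofBilin μ + (Z.C 1 y).1)
  have h₅ := gbr_swap 1 1 (Z.C 1 y).1 (ofBilin μ + (Z.C 1 y).1)
  have h₆ := gbr_swap 1 1 (Z.C 1 y).1 (ofBilin μ)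
  rw [hs, one_smul] at h₄ h₅ h₆
  have h₁' : gbr 1 1 (ofBilin μ + (Z.C 1 y).1) (ofBilin μ + (Z.C 1 y).1) =
      gbr 1 1 (ofBilin μ) (ofBilin μ + (Z.C 1 y).1) +
        gbr 1 1 (Z.C 1 y).1 (ofBilin μ + (Z.C 1 y).1) := h₁
  rw [h₁', h₄, h₅, h₂, h₃, Z.gbr_self, h₆, zero_add]
  change gbr 1 1 (ofBilin μ) (Z.C 1 y).1 + (gbr 1 1 (ofBilin μ) (Z.C 1 y).1 +
    gbr 1 1 (Z.C 1 y).1 (Z.C 1 y).1) = (2 : k) • (gbr 1 1 (ofBilin μ) (Z.C 1 y).1 +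
      (2 : k)⁻¹ • gbr 1 1 (Z.C 1 y).1 (Z.C 1 y).1)
  rw [smul_add, smul_smul, mul_inv_cancel₀ two_ne_zero, one_smul, two_smul, add_assoc]

/-- Expanding `(L_μ + L_C + uB)(η + N)`, the term of `μ` and `η` vanishes because `η` is a cycle,
`L_C η` is the contribution of the twist, and `L_C N` occurs twice in `[y, y]`, which the factor `½`
corrects. -/
theorem negDiff_chain (y : h.X 1) : sgn (d + 1) • negDiff (show d = (d - 1) + 1 by omega)
    (ofBilin (Z.mul y)) (ofBilin_hasDegree _) (Z.chain y) =
    Z.N 2 (show d + 1 - 2 = d - 1 by omega) (h.d (show 1 + 1 = (2 : ℤ) by norm_num) y +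
      (2 : k)⁻¹ • h.br (show 1 + 1 = (2 : ℤ) by norm_num) y y) := by
  rw [map_add, map_smul, Z.N_d _ (show d + 1 - 1 = d by omega) _ (by omega) (by omega),
    Z.N_br _ (show d + 1 - 1 = d by omega) (show d + 1 - 1 = d by omega) _ (by omega) (by omega)]
  rw [mul, chain, negDiff_add Z.unital, map_add, map_add, Z.cycle, zero_add,
    show sgn (1 * 1) = -1 from rfl, mul_one]
  simp only [smul_add, neg_smul, one_smul, sub_neg_eq_add]
  rw [← two_smul k, smul_smul, inv_mul_cancel₀ two_ne_zero, one_smul]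
  abel

/-- By the two preceding identities the components of the Maurer–Cartan expression are, up to the
invertible factors 2 and `(-1)^(d+1)`, the bracket and the boundary; `inj` says that the components
decide whether it vanishes. -/
theorem isMC_iff (y : h.X 1) : h.IsMC y ↔
    gbr 1 1 (ofBilin (Z.mul y)) (ofBilin (Z.mul y)) = 0 ∧
    negDiff (show d = (d - 1) + 1 by omega) (ofBilin (Z.mul y)) (ofBilin_hasDegree _)
      (Z.chain y) = 0 := by
  have hu : ∀ {c : NegCyc R e (d - 1)}, sgn (d + 1) • c = 0 ↔ c = 0 := fun {c} =>
    ⟨fun hc => by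
      have := congrArg (fun z => sgn (d + 1) • z) hc
      simpa only [smul_smul, sgn_mul_sgn_self, one_smul, smul_zero] using this,
     fun hc => by rw [hc, smul_zero]⟩
  rw [Z.gbr_mul, smul_eq_zero_iff_right two_ne_zero, ← hu, Z.negDiff_chain]
  refine ⟨fun hy => ?_, fun hy => Z.inj 2 _ _ (Subtype.ext hy.1) hy.2⟩
  rw [DGLie.IsMC] at hy
  rw [hy, map_zero, map_zero]
  exact ⟨rfl, rfl⟩

theorem mul_assoc_iff (y : h.X 1) : gbr 1 1 (ofBilin (Z.mul y)) (ofBilin (Z.mul y)) = 0 ↔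
    ∀ a b c, Z.mul y (Z.mul y a b) c = Z.mul y a (Z.mul y b c) := by
  refine ⟨fun hy a b c => ?_, fun hy => gbr_assoc hy⟩
  have := gbr_self_apply (Z.mul y) a b c
  rw [hy, Pi.zero_apply, ← two_smul k] at this
  exact sub_eq_zero.1 ((smul_eq_zero_iff_right two_ne_zero).1 this.symm)

theorem ext_total {y y' : h.X 1} (h₁ : Z.mul y = Z.mul y') (h₂ : Z.chain y = Z.chain y') :
    y = y' := by
  rw [← sub_eq_zero]
  refine Z.inj 1 (show d + 1 - 1 = d by omega) _ ?_ ?_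
  · rw [map_sub, sub_eq_zero]
    exact coBilin_injective (add_left_cancel h₁)
  · rw [map_sub, sub_eq_zero]
    exact add_left_cancel h₂

/-- The pair of a cochain and a chain which describes an element of `h⁰`. -/
noncomputable def pair (x : h.X 0) : NCochain R e 0 × NegCyc R e (d + 1) :=
  (Z.C 0 x, Z.N 0 (by omega) x)

theorem pair_mem (x : h.X 0) :
    Z.pair x ∈ I • (⊤ : Submodule R (NCochain R e 0 × NegCyc R e (d + 1))) := by
  have := add_mem (map_smul_top' (LinearMap.inl R (NCochain R e 0) (NegCyc R e (d + 1)))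
    (Z.C_mem 0 x)) (map_smul_top' (LinearMap.inr R (NCochain R e 0) (NegCyc R e (d + 1)))
    (Z.N_mem 0 (show d + 1 - 0 = d + 1 by omega) x))
  rwa [LinearMap.inl_apply, LinearMap.inr_apply, Prod.mk_add_mk, add_zero, zero_add] at this

/-- In degree zero all signs of the semidirect product disappear, and the bracket takes the shape
expected by `transl_bracket`. -/
theorem pair_br (x y : h.X 0) : Z.pair (h.br (add_zero 0) x y) =
    (ncBr (add_zero 0) (Z.pair x).1 (Z.pair y).1,
      negLie₀ _ (Z.pair x).1 (Z.pair y).2 - negLie₀ _ (Z.pair y).1 (Z.pair x).2) := by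
  refine Prod.ext (Z.C_br _ x y) ((Z.N_br (add_zero 0) (show d + 1 - 0 = d + 1 by omega)
    (show d + 1 - 0 = d + 1 by omega) (show d + 1 - 0 = d + 1 by omega) (by omega) (by omega)
    x y).trans ?_)
  rw [mul_zero, mul_zero, sgn_zero, one_smul, one_smul, one_smul]
  rfl

/-- The representation of `h⁰` on `B` and on negative cyclic chains. -/
noncomputable def rep : NilRep h R I (Module.End R B × Module.End R (NegCyc R e (d + 1) × R)) where
  ρ :=
    { toFun := fun x => (coEnd (Z.pair x).1, transl (d + 1) (Z.pair x))
      map_add' := fun x y => by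
        have : Z.pair (x + y) = Z.pair x + Z.pair y := Prod.ext (map_add _ _ _) (map_add _ _ _)
        rw [this, map_add, Prod.fst_add, map_add]
        rfl
      map_smul' := fun c x => by
        have : Z.pair (c • x) = c • Z.pair x := Prod.ext (map_smul _ _ _) (map_smul _ _ _)
        rw [this, ← algebraMap_smul R c (Z.pair x), map_smul, Prod.smul_fst, map_smul,
          RingHom.id_apply, ← algebraMap_smul R c]
        rfl }
  map_br x y := by
    refine Prod.ext ?_ ?_
    · exact (congrArg (fun p => coEnd p.1) (Z.pair_br x y)).trans (coEnd_ncBr _ _)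
    · exact (congrArg (transl (d + 1)) (Z.pair_br x y)).trans (transl_bracket _ _)
  mem x := by
    let F : NCochain R e 0 × NegCyc R e (d + 1) →ₗ[R]
        Module.End R B × Module.End R (NegCyc R e (d + 1) × R) :=
      (coEnd ∘ₗ LinearMap.fst R (NCochain R e 0) (NegCyc R e (d + 1))).prod (transl (d + 1))
    exact map_smul_top' (N := Module.End R B × Module.End R (NegCyc R e (d + 1) × R)) F (Z.pair_mem x)
  nilp := Z.nilp

theorem rep_apply (x : h.X 0) : Z.rep.ρ x = (coEnd (Z.pair x).1, transl (d + 1) (Z.pair x)) := rfl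

/-- The cochain of degree zero is recovered from its endomorphism of `B`, and the chain as the value
of the affine map at the origin `(0, 1)`. -/
theorem rep_faithful (x : h.X 0) (hx : Z.rep.ρ x = 0) : x = 0 := by
  rw [rep_apply, Prod.mk_eq_zero] at hx
  refine Z.inj 0 (show d + 1 - 0 = d + 1 by omega) x ?_ ?_
  · exact coEnd_injective (hx.1.trans (map_zero _).symm)
  · have := congrArg Prod.fst (LinearMap.congr_fun hx.2 (0, 1))
    rw [transl_apply] at this
    change _ + (1 : R) • Z.N 0 _ x = 0 at this
    rwa [map_zero, zero_add, one_smul] at this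

/-- Every `R`-linear image of the pair of `x` in an algebra is divisible by `I`; the four instances
that follow are the operators to be exponentiated. -/
theorem isNilpotent_of {𝒜 : Type*} [Ring 𝒜] [Algebra R 𝒜] (F : NCochain R e 0 × NegCyc R e (d + 1) →ₗ[R] 𝒜) (x : h.X 0) :
    IsNilpotent (F (Z.pair x)) :=
  isNilpotent_of_mem_smul_top Z.nilp (map_smul_top' F (Z.pair_mem x))

theorem nilp_coEnd (x : h.X 0) : IsNilpotent (coEnd (Z.pair x).1) :=
  Z.isNilpotent_of (coEnd ∘ₗ LinearMap.fst R _ _) x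

theorem nilp_lieEnd (x : h.X 0) : IsNilpotent (lieEnd R e (Z.pair x).1) :=
  Z.isNilpotent_of (lieEnd R e ∘ₗ LinearMap.fst R _ _) x

theorem nilp_negLie (n : ℤ) (x : h.X 0) : IsNilpotent (negLie₀ n (Z.pair x).1) :=
  Z.isNilpotent_of (𝒜 := Module.End R (NegCyc R e n)) (negLie₀ n ∘ₗ LinearMap.fst R _ _) x

theorem nilp_transl (x : h.X 0) : IsNilpotent (transl (d + 1) (Z.pair x)) :=
  Z.isNilpotent_of (𝒜 := Module.End R (NegCyc R e (d + 1) × R)) (transl (d + 1)) x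

/-- The automorphism `exp(x)` of `B`. -/
noncomputable def expEnd (x : h.X 0) : Module.End R B := nexp k (coEnd (Z.pair x).1)

theorem expEnd_unit (x : h.X 0) : Z.expEnd x e = e :=
  nexp_eq_self_of_eq_zero (Z.nilp_coEnd x) (coEnd_unit _)

theorem nexp_negLie (n : ℤ) (x : h.X 0) (c : NegCyc R e n) :
    nexp k (negLie₀ n (Z.pair x).1) c = negMap (Z.expEnd x) (Z.expEnd_unit x) n c :=
  nexp_ncAct (Z.pair x).1 (Z.nilp_coEnd x) (Z.nilp_lieEnd x) (Z.nilp_negLie n x) _ c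

theorem gauge_gaugeExp (x : h.X 0) :
    Z.rep.gauge (h.gaugeExp x) = (Z.expEnd x, nexp k (transl (d + 1) (Z.pair x))) := by
  rw [NilRep.gauge_gaugeExp]
  exact Prod.ext (map_nexp k (Z.rep.isNilpotent x) (RingHom.fst _ _) fun _ => rfl)
    (map_nexp k (Z.rep.isNilpotent x) (RingHom.snd _ _) fun _ => rfl)

end Realization

end Realization

end CYDef

namespace CYDef

universe u v w

/-- Divisibility is assumed only pointwise: `f` itself need not lie in `I • End`, since `M` can be
infinite dimensional. Still, the values of `fⁿ` lie in `Iⁿ M`. -/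
theorem isNilpotent_of_apply_mem {R M : Type*} [CommRing R] [AddCommGroup M] [Module R M]
    {I : Ideal R} (hI : ∃ N : ℕ, I ^ N = ⊥) {f : Module.End R M}
    (hf : ∀ x, f x ∈ I • (⊤ : Submodule R M)) : IsNilpotent f := by
  obtain ⟨N, hN⟩ := hI
  have key : ∀ n x, (f ^ n) x ∈ (I ^ n) • (⊤ : Submodule R M) := by
    intro n
    induction n with
    | zero => intro x; simp
    | succ n ih =>
      intro x
      rw [pow_succ f, Module.End.mul_apply]
      have h := hf x
      generalize f x = z at h
      induction h using Submodule.smul_induction_on' with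
      | smul r hr a _ =>
        rw [map_smul, pow_succ', Submodule.mul_smul]
        exact Submodule.smul_mem_smul hr (ih a)
      | add a _ b _ ha hb => rw [map_add]; exact add_mem ha hb
  refine ⟨N, LinearMap.ext fun x => ?_⟩
  have := key N x
  rwa [hN, Submodule.bot_smul, Submodule.mem_bot] at this

theorem nexp_sub_one_mem {k R 𝒜 : Type*} [Field k] [CommRing R] [Ring 𝒜] [Algebra R 𝒜]
    [Algebra k 𝒜] {I : Ideal R} (hI : ∃ N : ℕ, I ^ N = ⊥) {a : 𝒜}
    (ha : a ∈ I • (⊤ : Submodule R 𝒜)) : nexp k a - 1 ∈ I • (⊤ : Submodule R 𝒜) := by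
  obtain ⟨q, hq⟩ := exists_nexp_eq k (isNilpotent_of_mem_smul_top hI ha)
  rw [hq, add_sub_cancel_left]
  have := mul_mem_smul_top (J := (⊤ : Ideal R)) ha
    (show 1 + a * Polynomial.aeval a q ∈ (⊤ : Ideal R) • (⊤ : Submodule R 𝒜) by simp)
  rwa [Ideal.mul_top] at this

/-! ### Leibniz rules for the affine action on `h¹ × k`, and their exponentials. -/

namespace Realization

variable {k : Type u} [Field k] [CharZero k]
  {h : DGLie.{u, v} k} {R : Type*} [CommRing R] [Algebra k R] {I : Ideal R}
  {B : Type*} [AddCommGroup B] [Module R B] [Module k B] [IsScalarTower k R B] {e : B}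
  {μ : B →ₗ[R] B →ₗ[R] B} {d : ℤ} {η : NegCyc R e d} (Z : Realization h I μ η)

theorem affine_C (x : h.X 0) (v : h.X 1 × k) (a b : B) :
    (Z.C 1 (h.affine x v).1).1 [a, b] =
      coEnd (Z.C 0 x) ((Z.C 1 v.1).1 [a, b]) - (Z.C 1 v.1).1 [coEnd (Z.C 0 x) a, b] -
        (Z.C 1 v.1).1 [a, coEnd (Z.C 0 x) b] -
        v.2 • (μ (coEnd (Z.C 0 x) a) b + μ a (coEnd (Z.C 0 x) b) - coEnd (Z.C 0 x) (μ a b)) := by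
  rw [DGLie.affine_apply, map_sub, map_smul, Z.C_br, Z.C_d]
  have h₁ := ncBr_one_apply (Z.C 0 x) (Z.C 1 v.1) a b
  have h₂ := gbr_one_zero_apply (Z.C 0 x) μ a b
  exact congrArg₂ (fun s t => s - v.2 • t) h₁ h₂

/-- The multiplications of the line through `μ` and the multiplication of `y`. -/
noncomputable def mulPairing : h.X 1 × k →ₗ[k] B →ₗ[k] Module.End k B :=
  LinearMap.mk₂ k (fun v a => v.2 • (μ a).restrictScalars k +
      (coBilin (Z.C 1 v.1) a).restrictScalars k)
    (fun v v' a => LinearMap.ext fun b => by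
      change (v.2 + v'.2) • μ a b + coBilin (Z.C 1 (v.1 + v'.1)) a b =
        (v.2 • μ a b + coBilin (Z.C 1 v.1) a b) + (v'.2 • μ a b + coBilin (Z.C 1 v'.1) a b)
      rw [map_add, map_add, add_smul, LinearMap.add_apply, LinearMap.add_apply]
      abel)
    (fun c v a => LinearMap.ext fun b => by
      change (c • v.2) • μ a b + (Z.C 1 (c • v.1)).1 [a, b] =
        c • (v.2 • μ a b + (Z.C 1 v.1).1 [a, b])
      rw [map_smul, smul_add, smul_assoc]
      rfl)
    (fun v a a' => LinearMap.ext fun b => by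
      change v.2 • μ (a + a') b + coBilin (Z.C 1 v.1) (a + a') b =
        (v.2 • μ a b + coBilin (Z.C 1 v.1) a b) + (v.2 • μ a' b + coBilin (Z.C 1 v.1) a' b)
      rw [map_add, map_add, LinearMap.add_apply, LinearMap.add_apply, smul_add]
      abel)
    (fun c v a => LinearMap.ext fun b => by
      change v.2 • μ (c • a) b + coBilin (Z.C 1 v.1) (c • a) b =
        c • (v.2 • μ a b + coBilin (Z.C 1 v.1) a b)
      rw [LinearMap.map_smul_of_tower, LinearMap.map_smul_of_tower, LinearMap.smul_apply,
        LinearMap.smul_apply, smul_add, smul_comm])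

theorem mulPairing_apply (v : h.X 1 × k) (a b : B) :
    Z.mulPairing v a b = v.2 • μ a b + (Z.C 1 v.1).1 [a, b] := rfl

theorem mulPairing_one (y : h.X 1) (a b : B) : Z.mulPairing (y, 1) a b = Z.mul y a b := by
  rw [mulPairing_apply, one_smul]
  rfl

/-- The affine action of `x` is the change of the product under the derivation rule, so the map
which sends `(v, a)` to left multiplication by `a` for the product `v` satisfies the Leibniz rule
with `[f, -]` on endomorphisms, where `f` is the endomorphism of `x`. Exponentiating it, and then
the evaluation of endomorphisms, makes `exp f` multiplicative. -/
theorem exp_mul [h.IsNilp] (x : h.X 0) {y y' : h.X 1}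
    (hy : nexp k (h.affine x) (y, 1) = (y', 1)) (a b : B) :
    Z.expEnd x (Z.mul y a b) = Z.mul y' (Z.expEnd x a) (Z.expEnd x b) := by
  have hf := Z.nilp_coEnd x
  have hf' := isNilpotent_restrictScalars (k := k) hf
  set f : Module.End k B := (coEnd (Z.pair x).1).restrictScalars k with hfdef
  have fapp : ∀ b, f b = coEnd (Z.C 0 x) b := fun b => rfl
  -- `D` is the commutator with `f`. It is nilpotent as the difference of the commuting nilpotent
  -- operators of left and right multiplication.
  let D : Module.End k (Module.End k B) := LinearMap.mulLeft k f - LinearMap.mulRight k f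
  have hD : IsNilpotent D := (LinearMap.commute_mulLeft_right (R := k) f f).isNilpotent_sub
    ((LinearMap.isNilpotent_mulLeft_iff k f).2 hf') ((LinearMap.isNilpotent_mulRight_iff k f).2 hf')
  have Dapp : ∀ (g : Module.End k B) b, D g b = f (g b) - g (f b) := fun g b => rfl
  have h₁ := nexp_bilin Z.mulPairing (h.isNilpotent_affine x) hf' hD (fun v a => by
    refine LinearMap.ext fun b => ?_
    rw [Dapp, LinearMap.add_apply]
    simp only [mulPairing_apply]
    rw [Z.affine_C, DGLie.affine_apply]
    simp only [fapp, map_add, LinearMap.map_smul_of_tower, zero_smul, zero_add, smul_sub, smul_add]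
    abel) (y, 1) a
  -- Evaluation obeys `f (g b) = [f, g] b + g (f b)`, hence `exp f (g b) = (exp D g)(exp f b)`.
  let ev : Module.End k B →ₗ[k] B →ₗ[k] B := LinearMap.id
  have h₂ := nexp_bilin ev hD hf' hf' (fun g b => by
    change f (g b) = D g b + g (f b)
    rw [Dapp, sub_add_cancel]) (Z.mulPairing (y, 1) a) b
  change nexp k f (Z.mulPairing (y, 1) a b) =
    nexp k D (Z.mulPairing (y, 1) a) (nexp k f b) at h₂
  rw [h₁, hy, mulPairing_one, mulPairing_one, nexp_restrictScalars hf, nexp_restrictScalars hf,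
    nexp_restrictScalars hf] at h₂
  exact h₂

theorem affine_N (x : h.X 0) (v : h.X 1 × k) :
    Z.N 1 (show d + 1 - 1 = d by omega) (h.affine x v).1 =
      negLie₀ d (Z.pair x).1 (Z.N 1 (by omega) v.1) -
        sgn (d + 1) • ncAct rfl (Z.C 1 v.1) (Z.pair x).2 -
        algebraMap k R v.2 • (sgn (d + 1) • negDiff rfl (ofBilin μ) (ofBilin_hasDegree μ) (Z.pair x).2 -
          negLie₀ d (Z.pair x).1 η) := by
  rw [DGLie.affine_apply, map_sub, map_smul,
    Z.N_br (zero_add 1) (show d + 1 - 0 = d + 1 by omega) (show d + 1 - 1 = d by omega)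
      (show d + 1 - 1 = d by omega) (add_zero d).symm rfl,
    Z.N_d (zero_add 1) (show d + 1 - 0 = d + 1 by omega) (show d + 1 - 1 = d by omega) rfl
      (add_zero d).symm]
  simp only [mul_zero, mul_one, sgn_zero, one_smul, algebraMap_smul]
  rfl

/-- The boundary of a chain for the multiplication of `y`, and the chain of `y`. -/
noncomputable def chainPairing : h.X 1 × k →ₗ[k] NegCyc R e (d + 1) × R →ₗ[k] NegCyc R e d :=
  LinearMap.mk₂ k (fun v w => sgn (d + 1) • (algebraMap k R v.2 •
        negDiff rfl (ofBilin μ) (ofBilin_hasDegree μ) w.1 + ncAct rfl (Z.C 1 v.1) w.1) +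
      w.2 • (algebraMap k R v.2 • η + Z.N 1 (by omega) v.1))
    (fun v v' w => by
      simp only [Prod.fst_add, Prod.snd_add, map_add, add_smul, LinearMap.add_apply, smul_add]
      abel)
    (fun c v w => by
      simp only [← algebraMap_smul R c (_ : NegCyc R e d), Prod.smul_fst, Prod.smul_snd, map_smul,
        smul_eq_mul, map_mul, ← algebraMap_smul R c (Z.C 1 v.1), LinearMap.smul_apply]
      module)
    (fun v w w' => by
      simp only [Prod.fst_add, Prod.snd_add, map_add, add_smul, smul_add]
      abel)
    (fun c v w => by
      simp only [← algebraMap_smul R c (_ : NegCyc R e d), Prod.smul_fst, Prod.smul_snd,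
        ← algebraMap_smul R c w.1, ← algebraMap_smul R c w.2, map_smul, smul_eq_mul]
      module)

theorem chainPairing_apply (v : h.X 1 × k) (w : NegCyc R e (d + 1) × R) :
    Z.chainPairing v w = sgn (d + 1) • (algebraMap k R v.2 •
        negDiff rfl (ofBilin μ) (ofBilin_hasDegree μ) w.1 + ncAct rfl (Z.C 1 v.1) w.1) +
      w.2 • (algebraMap k R v.2 • η + Z.N 1 (by omega) v.1) := rfl

theorem chainPairing_one (y : h.X 1) (z : NegCyc R e (d + 1)) : Z.chainPairing (y, 1) (z, 1) =
    sgn (d + 1) • negDiff rfl (ofBilin (Z.mul y)) (ofBilin_hasDegree _) z + Z.chain y := by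
  rw [chainPairing_apply, mul, negDiff_add Z.unital, map_one, one_smul, one_smul, one_smul]
  rfl

/-- The content is `[L_f, L_y] = L_{[f, y]}` and `[L_μ + uB, L_f] = L_{[μ, f]}`. The factor
`(-1)^(d+1)` in the pairing makes the terms of the translation by the chain of `x` cancel those
which the affine action contributes through `affine_N`. -/
theorem chainPairing_leibniz (x : h.X 0) (v : h.X 1 × k) (w : NegCyc R e (d + 1) × R) :
    negLie₀ d (Z.pair x).1 (Z.chainPairing v w) =
      Z.chainPairing (h.affine x v) w + Z.chainPairing v (transl (d + 1) (Z.pair x) w) := by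
  have h₁ := ncAct_bracket (zero_add 1) (show d + 1 = d + 1 from rfl) (add_zero d).symm rfl
    (add_zero (d + 1)).symm rfl (Z.pair x).1 (Z.C 1 v.1) w.1
  have h₂ := negDiff_act (ofBilin_multilin μ) (ofBilin_hasDegree μ) Z.unital (zero_add 1)
    (add_zero (d + 1)).symm rfl rfl rfl (add_zero d).symm (Z.pair x).1 w.1
  rw [zero_mul, sgn_zero, one_smul] at h₁
  rw [sgn_zero, one_smul] at h₂
  have h₃ : ncAct (show d + 1 = d + 1 from rfl) (Z.C 1 (h.affine x v).1) w.1 =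
      ncAct rfl (ncBr (zero_add 1) (Z.pair x).1 (Z.C 1 v.1)) w.1 -
        algebraMap k R v.2 • ncAct rfl (ncDiff (ofBilin_multilin μ) (ofBilin_hasDegree μ) Z.unital
          (zero_add 1) (Z.pair x).1) w.1 := by
    have : Z.C 1 (h.affine x v).1 = ncBr (zero_add 1) (Z.pair x).1 (Z.C 1 v.1) -
        algebraMap k R v.2 • ncDiff (ofBilin_multilin μ) (ofBilin_hasDegree μ) Z.unital
          (zero_add 1) (Z.pair x).1 := by
      rw [DGLie.affine_apply, map_sub, map_smul, Z.C_br, Z.C_d, algebraMap_smul]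
      rfl
    rw [this, map_sub, map_smul, LinearMap.sub_apply, LinearMap.smul_apply]
  simp only [chainPairing_apply, transl_apply]
  rw [Z.affine_N, h₃, show (h.affine x v).2 = 0 from rfl, map_zero]
  have h₁' : negLie₀ d (Z.pair x).1 (ncAct (show d + 1 = d + 1 from rfl) (Z.C 1 v.1) w.1) = _ := h₁
  have h₂' : negDiff (show d + 1 = d + 1 from rfl) (ofBilin μ) (ofBilin_hasDegree μ)
      (negLie₀ (d + 1) (Z.pair x).1 w.1) = _ := h₂
  simp only [map_add, map_zsmul, map_smul]
  rw [h₁', h₂']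
  module

/-- Paired with the origin `(0, 1)`, `y` gives its chain. The exponential moves the origin to the
translation part, with last coordinate still 1, so on the other side the boundary of the translation
part appears next to the chain of `y'`. -/
theorem exp_chain [h.IsNilp] (x : h.X 0) {y y' : h.X 1}
    (hy : nexp k (h.affine x) (y, 1) = (y', 1)) :
    negMap (Z.expEnd x) (Z.expEnd_unit x) d (Z.chain y) =
      sgn (d + 1) • negDiff rfl (ofBilin (Z.mul y')) (ofBilin_hasDegree _)
        (nexp k (transl (d + 1) (Z.pair x)) (0, 1)).1 + Z.chain y' := by
  have key := nexp_bilin Z.chainPairing (h.isNilpotent_affine x)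
    (isNilpotent_restrictScalars (k := k) (Z.nilp_transl x))
    (isNilpotent_restrictScalars (k := k) (Z.nilp_negLie d x))
    (fun v w => Z.chainPairing_leibniz x v w) (y, 1) (0, 1)
  rw [nexp_restrictScalars (Z.nilp_negLie d x), nexp_restrictScalars (Z.nilp_transl x), hy,
    chainPairing_one, map_zero, smul_zero, zero_add, nexp_negLie] at key
  rw [key, ← chainPairing_one]
  congr 1
  exact Prod.ext rfl (nexp_transl_snd (Z.nilp_transl x) _)

end Realization

end CYDef

namespace CYDef

universe u v w

theorem nexp_apply_fst_mem {k R V : Type*} [Field k] [CommRing R] [Algebra k R] [AddCommGroup V]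
    [Module R V] [Module k V] [IsScalarTower k R V] {I : Ideal R} (hI : ∃ N : ℕ, I ^ N = ⊥)
    {D : Module.End R (V × R)} (hD : D ∈ I • (⊤ : Submodule R (Module.End R (V × R)))) :
    (nexp k D (0, 1)).1 ∈ I • (⊤ : Submodule R V) := by
  have := map_smul_top' (LinearMap.fst R V R)
    (map_smul_top' (LinearMap.applyₗ ((0, 1) : V × R)) (nexp_sub_one_mem (k := k) hI hD))
  rwa [LinearMap.applyₗ_apply_apply, LinearMap.sub_apply, Module.End.one_apply,
    LinearMap.fst_apply, Prod.fst_sub, sub_zero] at this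

/-! ### Gauge elements as pairs of an automorphism and a chain. -/

namespace Realization

variable {k : Type u} [Field k] [CharZero k]
  {h : DGLie.{u, v} k} {R : Type*} [CommRing R] [Algebra k R] {I : Ideal R}
  {B : Type*} [AddCommGroup B] [Module R B] [Module k B] [IsScalarTower k R B] {e : B}
  {μ : B →ₗ[R] B →ₗ[R] B} {d : ℤ} {η : NegCyc R e d} (Z : Realization h I μ η)

/-- The automorphism of `B` given by an element of the gauge group. -/
noncomputable def autom (g : h.gauge) : B →ₗ[R] B := (Z.rep.gauge g).1

/-- The chain given by an element of the gauge group. -/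
noncomputable def homotopy (g : h.gauge) : NegCyc R e (d + 1) :=
  -- The shift multiplies the differential by `(-1)^(d+1)`. Putting this sign into the chain removes
  -- it from the boundary relation.
  sgn (d + 1) • ((Z.rep.gauge g).2 (0, 1)).1

theorem exists_gaugeExp (Z : Realization h I μ η) (g : h.gauge) : ∃ x, g = h.gaugeExp x :=
  Z.rep.exists_gaugeExp Z.rep_faithful g

theorem autom_gaugeExp (x : h.X 0) : Z.autom (h.gaugeExp x) = Z.expEnd x := by
  rw [autom, gauge_gaugeExp]

theorem homotopy_gaugeExp (x : h.X 0) : Z.homotopy (h.gaugeExp x) =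
    sgn (d + 1) • (nexp k (transl (d + 1) (Z.pair x)) (0, 1)).1 := by
  rw [homotopy, gauge_gaugeExp]

theorem autom_unit (g : h.gauge) : Z.autom g e = e := by
  obtain ⟨x, rfl⟩ := Z.exists_gaugeExp g
  rw [autom_gaugeExp, expEnd_unit]

theorem autom_one : Z.autom 1 = LinearMap.id := by
  rw [autom, map_one]
  rfl

theorem autom_mul (g g' : h.gauge) : Z.autom (g * g') = Z.autom g ∘ₗ Z.autom g' := by
  rw [autom, map_mul]
  rfl

theorem homotopy_one : Z.homotopy 1 = 0 := by
  rw [homotopy, map_one]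
  exact smul_zero _

/-- A gauge element acts on chains by an affine map: its linear part is induced by the automorphism,
because `exp(L_x)` is induced by `exp x`, and its translation part is the value at the origin. -/
theorem gauge_snd_apply (g : h.gauge) (z : NegCyc R e (d + 1)) (t : R) :
    (Z.rep.gauge g).2 (z, t) = (negMap (Z.autom g) (Z.autom_unit g) (d + 1) z +
      t • ((Z.rep.gauge g).2 (0, 1)).1, t) := by
  obtain ⟨x, rfl⟩ := Z.exists_gaugeExp g
  have h₀ : ((z, t) : NegCyc R e (d + 1) × R) = (z, 0) + t • (0, 1) := by simp
  have h₁ := nexp_transl_inl (k := k) (Z.nilp_transl x) (Z.nilp_negLie (d + 1) x) z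
  have h₂ := nexp_transl_snd (k := k) (Z.nilp_transl x) (0, 1)
  have h₃ : negMap (Z.autom (h.gaugeExp x)) (Z.autom_unit _) (d + 1) z =
      negMap (Z.expEnd x) (Z.expEnd_unit x) (d + 1) z := by
    congr 1
    simp only [autom_gaugeExp]
  rw [h₃, gauge_gaugeExp]
  rw [h₀, map_add, map_smul, h₁, nexp_negLie]
  refine Prod.ext rfl ?_
  change (0 : R) + t • _ = t
  rw [h₂, zero_add, smul_eq_mul, mul_one]

/-- Composing affine maps gives the composition law of `Def♭`. -/
theorem homotopy_mul (g g' : h.gauge) : Z.homotopy (g * g') =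
    negMap (Z.autom g) (Z.autom_unit g) (d + 1) (Z.homotopy g') + Z.homotopy g := by
  have h₁ : (Z.rep.gauge g').2 (0, 1) = (((Z.rep.gauge g').2 (0, 1)).1, 1) := by
    rw [gauge_snd_apply]
  have h₂ : (Z.rep.gauge (g * g')).2 (0, 1) =
      (Z.rep.gauge g).2 ((Z.rep.gauge g').2 (0, 1)) := by
    rw [map_mul]
    rfl
  rw [homotopy, h₂, h₁, gauge_snd_apply, one_smul, smul_add, homotopy, map_zsmul, homotopy]

/-- The automorphism and the translation part determine the action on both factors of the faithful
representation. -/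
theorem autom_homotopy_injective {g g' : h.gauge} (h₁ : Z.autom g = Z.autom g')
    (h₂ : Z.homotopy g = Z.homotopy g') : g = g' := by
  refine Z.rep.gauge_injective Z.rep_faithful (Prod.ext h₁ (LinearMap.ext fun w => ?_))
  have h₃ : ((Z.rep.gauge g).2 (0, 1)).1 = ((Z.rep.gauge g').2 (0, 1)).1 := by
    have := congrArg (fun z => sgn (d + 1) • z) h₂
    simpa only [homotopy, smul_smul, sgn_mul_sgn_self, one_smul] using this
  obtain ⟨z, t⟩ := w
  rw [Z.gauge_snd_apply g z t, Z.gauge_snd_apply g' z t, h₃]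
  have h₄ : negMap (Z.autom g) (Z.autom_unit g) (d + 1) z =
      negMap (Z.autom g') (Z.autom_unit g') (d + 1) z := by
    congr 1
    simp only [h₁]
  rw [h₄]

theorem autom_sub_mem (g : h.gauge) (a : B) : Z.autom g a - a ∈ I • (⊤ : Submodule R B) := by
  obtain ⟨x, rfl⟩ := Z.exists_gaugeExp g
  have h₁ : coEnd (Z.pair x).1 ∈ I • (⊤ : Submodule R (Module.End R B)) :=
    map_smul_top' coEnd (Z.C_mem 0 x)
  have h₂ := nexp_sub_one_mem (k := k) Z.nilp h₁
  rw [autom_gaugeExp]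
  exact map_smul_top' (LinearMap.applyₗ a) h₂

theorem homotopy_mem (g : h.gauge) :
    Z.homotopy g ∈ I • (⊤ : Submodule R (NegCyc R e (d + 1))) := by
  obtain ⟨x, rfl⟩ := Z.exists_gaugeExp g
  have h₁ := map_smul_top' (N := Module.End R (NegCyc R e (d + 1) × R)) (transl (d + 1))
    (Z.pair_mem x)
  rw [homotopy_gaugeExp]
  exact zsmul_mem (nexp_apply_fst_mem Z.nilp h₁) _

theorem nexp_affine_gaugeExp [h.IsNilp] (x : h.X 0) (y : h.X 1) :
    nexp k (h.affine x) (y, 1) = (h.gaugeAct (h.gaugeExp x) y, 1) := by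
  rw [← DGLie.gaugeRep_gaugeExp, DGLie.gaugeRep_apply]

theorem autom_mul_apply [h.IsNilp] (g : h.gauge) (y : h.X 1) (a b : B) :
    Z.autom g (Z.mul y a b) = Z.mul (h.gaugeAct g y) (Z.autom g a) (Z.autom g b) := by
  obtain ⟨x, rfl⟩ := Z.exists_gaugeExp g
  rw [autom_gaugeExp]
  exact Z.exp_mul x (nexp_affine_gaugeExp x y) a b

/-- This is `exp_chain` with the sign absorbed in the definition of `homotopy`: the condition on `ξ`
in a morphism of `Def♭`. -/
theorem negDiff_homotopy [h.IsNilp] (g : h.gauge) (y : h.X 1) :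
    negDiff rfl (ofBilin (Z.mul (h.gaugeAct g y))) (ofBilin_hasDegree _) (Z.homotopy g) =
      negMap (Z.autom g) (Z.autom_unit g) d (Z.chain y) - Z.chain (h.gaugeAct g y) := by
  obtain ⟨x, rfl⟩ := Z.exists_gaugeExp g
  have h₃ : negMap (Z.autom (h.gaugeExp x)) (Z.autom_unit _) d (Z.chain y) =
      negMap (Z.expEnd x) (Z.expEnd_unit x) d (Z.chain y) := by
    congr 1
    simp only [autom_gaugeExp]
  rw [h₃, homotopy_gaugeExp, map_zsmul, Z.exp_chain x (nexp_affine_gaugeExp x y),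
    add_sub_cancel_right]

/-- The logarithm of `φ` is a polynomial in `φ - 1` without constant term. So it kills `e` and takes
values in `I B`, and with the chain 0 it comes from an element of `h⁰`; the affine map of that
element fixes the origin. -/
theorem exists_gauge_autom {φ : B →ₗ[R] B} (h₁ : φ e = e)
    (h₂ : ∀ a, φ a - a ∈ I • (⊤ : Submodule R B)) :
    ∃ g, Z.autom g = φ ∧ Z.homotopy g = 0 := by
  let f : Module.End R B := φ - 1
  have hf : IsNilpotent f := isNilpotent_of_apply_mem Z.nilp h₂
  obtain ⟨q, hq⟩ := exists_nexp_aeval_eq k hf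
  have hq' : Polynomial.aeval f (Polynomial.X * q) = Polynomial.aeval f q * f := by
    rw [mul_comm, map_mul, Polynomial.aeval_X]
  have he : Polynomial.aeval f (Polynomial.X * q) e = 0 := by
    rw [hq', Module.End.mul_apply, show f e = 0 from sub_eq_zero.2 h₁, map_zero]
  obtain ⟨x, hx₁, hx₂⟩ := Z.surj 0 (show d + 1 - 0 = d + 1 by omega) (ofEnd _ he) 0 (fun l => by
    match l with
    | [b] =>
      change Polynomial.aeval f (Polynomial.X * q) b ∈ _
      rw [mul_comm, map_mul, Polynomial.aeval_X, Module.End.mul_apply]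
      exact map_smul_top' _ (h₂ b)
    | [] => exact zero_mem _
    | _ :: _ :: _ => exact zero_mem _) (zero_mem _)
  refine ⟨h.gaugeExp x, ?_, ?_⟩
  · rw [autom_gaugeExp, expEnd, pair, hx₁, coEnd_ofEnd, hq]
    exact add_sub_cancel _ _
  · rw [homotopy_gaugeExp, nexp_eq_self_of_eq_zero (Z.nilp_transl x), smul_zero]
    rw [transl_apply]
    refine Prod.ext ?_ rfl
    change _ + (1 : R) • Z.N 0 _ x = 0
    rw [hx₂, smul_zero, add_zero, map_zero]

/-- Exponentials with zero cochain are pure translations; the sign in the preimage cancels the one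
in `homotopy`. -/
theorem exists_gauge_homotopy {ξ : NegCyc R e (d + 1)}
    (hξ : ξ ∈ I • (⊤ : Submodule R (NegCyc R e (d + 1)))) :
    ∃ g, Z.autom g = LinearMap.id ∧ Z.homotopy g = ξ := by
  obtain ⟨x, hx₁, hx₂⟩ := Z.surj 0 (show d + 1 - 0 = d + 1 by omega) 0 (sgn (d + 1) • ξ)
    (fun l => zero_mem _) (zsmul_mem hξ _)
  have hp : Z.pair x = (0, sgn (d + 1) • ξ) := Prod.ext hx₁ hx₂
  refine ⟨h.gaugeExp x, ?_, ?_⟩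
  · rw [autom_gaugeExp, expEnd, hp, map_zero, nexp_zero]
    rfl
  · rw [homotopy_gaugeExp, hp, nexp_transl_translation, smul_smul, sgn_mul_sgn_self, one_smul]

/-- Every affine map is a linear map followed by a translation. -/
theorem exists_gauge {φ : B →ₗ[R] B} {ξ : NegCyc R e (d + 1)} (h₁ : φ e = e)
    (h₂ : ∀ a, φ a - a ∈ I • (⊤ : Submodule R B))
    (hξ : ξ ∈ I • (⊤ : Submodule R (NegCyc R e (d + 1)))) :
    ∃ g, Z.autom g = φ ∧ Z.homotopy g = ξ := by
  obtain ⟨g₁, hg₁, hg₁'⟩ := Z.exists_gauge_autom h₁ h₂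
  obtain ⟨g₂, hg₂, hg₂'⟩ := Z.exists_gauge_homotopy hξ
  refine ⟨g₂ * g₁, ?_, ?_⟩
  · rw [autom_mul, hg₁, hg₂, LinearMap.id_comp]
  · rw [homotopy_mul, hg₁', hg₂', map_zero, zero_add]

/-- A gauge transformation which induces a morphism of deformations relates them. -/
theorem gaugeAct_eq [h.IsNilp] {g : h.gauge} {y y' : h.X 1}
    (h₁ : ∀ a b, Z.autom g (Z.mul y a b) = Z.mul y' (Z.autom g a) (Z.autom g b))
    (h₂ : negDiff rfl (ofBilin (Z.mul y')) (ofBilin_hasDegree _) (Z.homotopy g) =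
      negMap (Z.autom g) (Z.autom_unit g) d (Z.chain y) - Z.chain y') :
    h.gaugeAct g y = y' := by
  -- The automorphism is onto, so the products of `g * y` and of `y'`, both transported from that of
  -- `y`, coincide.
  have hs : ∀ a, Z.autom g (Z.autom g⁻¹ a) = a := fun a => by
    rw [← LinearMap.comp_apply, ← autom_mul, mul_inv_cancel, autom_one, LinearMap.id_apply]
  have hm : Z.mul (h.gaugeAct g y) = Z.mul y' := LinearMap.ext₂ fun a b => by
    rw [← hs a, ← hs b, ← h₁, autom_mul_apply]
  refine Z.ext_total hm ?_
  -- With equal products the boundaries of the homotopy agree as well, and the two boundary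
  -- relations then force equal chains.
  have h₃ := Z.negDiff_homotopy g y
  simp only [hm] at h₃
  rw [h₂] at h₃
  exact (sub_right_injective h₃).symm

end Realization

end CYDef

namespace CYDef

universe u v w

/-! ### The realization of `𝔇(A, η₀) ⊗ m`. -/

section Concrete

variable {k : Type u} [Field k] {A : Type v} [Ring A] [Algebra k A] {d : ℤ}
  (η₀ : NegCyc k (1 : A) d) {R : Type w} [CommRing R] [Algebra k R]

variable (R) in
theorem extCochain_br_smul {i j n : ℤ} (hn : i + j = n) (r s : R) (x : NCochain k (1 : A) i)
    (y : NCochain k (1 : A) j) : (r * s) • extCochain R (ncBr hn x y) =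
      ncBr hn (r • extCochain R x) (s • extCochain R y) := by
  rw [map_smul, map_smul, LinearMap.smul_apply, smul_smul, mul_comm s, extCochain_br]

/-- The signs are arbitrary integers, so the lemma matches the bracket of the semidirect product
with its shift signs by unification. -/
theorem bcNeg_semidirect_br {i j a b c : ℤ} (h₁ : b = c + i) (h₂ : a = c + j) (s₁ s₂ s₃ : ℤ)
    (r s : R) (x : NCochain k (1 : A) i) (y : NCochain k (1 : A) j) (m : NegCyc k (1 : A) a)
    (n : NegCyc k (1 : A) b) :
    (r * s) • bcNeg R c (s₁ • ncAct h₁ x n - s₂ • s₃ • ncAct h₂ y m) =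
      s₁ • ncAct h₁ (r • extCochain R x) (s • bcNeg R b n) -
        s₂ • s₃ • ncAct h₂ (s • extCochain R y) (r • bcNeg R a m) := by
  rw [map_sub, map_zsmul, map_zsmul, map_zsmul, bcNeg_act, bcNeg_act]
  simp only [map_smul, LinearMap.smul_apply]
  module

-- The twisting element has no cochain component, so the twist does not affect the differential of
-- cochains.
variable (R) in
theorem extCochain_twisted_diff {i j : ℤ} (hj : i + 1 = j) (hj' : 1 + i = j) (r : R)
    (x : NCochain k (1 : A) i) :
    r • extCochain R (ncDiff (ofBilin_multilin _) (ofBilin_hasDegree _) (mulBilin_unital k A) hj x +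
        ncBr hj' (0 : NCochain k (1 : A) 1) x) =
      ncDiff (ofBilin_multilin _) (ofBilin_hasDegree _) (mulBilin_unital R (R ⊗[k] A)) hj
        (r • extCochain R x) := by
  rw [map_zero, LinearMap.zero_apply, add_zero, map_smul, extCochain_diff]

theorem ncAct_cast {R : Type*} [CommRing R] {B : Type*} [AddCommGroup B] [Module R B] {e : B}
    {p n n' m : ℤ} (h : n = n') (h₁ : n = m + p) (h₂ : n' = m + p) (x : NCochain R e p)
    (c : NegCyc R e n) : ncAct h₂ x (NegCyc.cast h c) = ncAct h₁ x c := rfl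

/-- In the bracket with `(0, η₀)` only the action of `x` on `η₀` survives; it is the additional term
of the twisted differential. -/
theorem bcNeg_twisted_diff {i a c d' : ℤ} (h₁ : a = c + 1) (h₂ : d = c + i) (h₂' : d' = c + i)
    (h : d = d') (s₁ s₂ s₃ s₄ : ℤ) (r : R) (x : NCochain k (1 : A) i) (m : NegCyc k (1 : A) a) :
    r • bcNeg R c (s₁ • negDiff h₁ (ofBilin (mulBilin k A)) (ofBilin_hasDegree _) m +
        (s₂ • ncAct h₁ (0 : NCochain k (1 : A) 1) m -
          s₃ • s₄ • ncAct h₂' x (NegCyc.cast h η₀))) =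
      s₁ • negDiff h₁ (ofBilin (mulBilin R (R ⊗[k] A))) (ofBilin_hasDegree _) (r • bcNeg R a m) -
        s₃ • s₄ • ncAct h₂ (r • extCochain R x) (bcNeg R d η₀) := by
  rw [ncAct_cast _ h₂, map_zero, LinearMap.zero_apply, smul_zero, zero_sub, map_add,
    map_neg, map_zsmul, map_zsmul, map_zsmul, bcNeg_act, bcNeg_diff]
  simp only [map_smul, LinearMap.smul_apply]
  module

variable [CharZero k] (hη₀ : IsNegCycle η₀) (I : Ideal R)

/-- The cochain component of an element of `𝔇(A, η₀) ⊗ I`. -/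
noncomputable def frakC (p : ℤ) : (frakD η₀ hη₀).X p ⊗[k] I →ₗ[k] NCochain R (1 : R ⊗[k] A) p :=
  realC I p (NegCyc k (1 : A) (d + 1 - p))

/-- The chain component of an element of `𝔇(A, η₀) ⊗ I`. -/
noncomputable def frakN (p : ℤ) {n : ℤ} (h : d + 1 - p = n) :
    (frakD η₀ hη₀).X p ⊗[k] I →ₗ[k] NegCyc R (1 : R ⊗[k] A) n :=
  realN I (NCochain k (1 : A) p) h

theorem frakC_tmul {p : ℤ} (z : (frakD η₀ hη₀).X p) (r : I) :
    frakC η₀ hη₀ I p (z ⊗ₜ r) =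
      (r : R) • extCochain R (z : NCochain k (1 : A) p × NegCyc k (1 : A) (d + 1 - p)).1 := rfl

theorem frakN_tmul {p n : ℤ} (h : d + 1 - p = n) (z : (frakD η₀ hη₀).X p) (r : I) :
    frakN η₀ hη₀ I p h (z ⊗ₜ r) = (r : R) • bcNeg R n (NegCyc.cast h
      (z : NCochain k (1 : A) p × NegCyc k (1 : A) (d + 1 - p)).2) := rfl

theorem frakC_br {i j n : ℤ} (hn : i + j = n) (x : (frakD η₀ hη₀).X i ⊗[k] I)
    (y : (frakD η₀ hη₀).X j ⊗[k] I) :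
    frakC η₀ hη₀ I n (TensorProduct.map₂ ((frakD η₀ hη₀).br hn) (idealMul k I) x y) =
      ncBr hn (frakC η₀ hη₀ I i x) (frakC η₀ hη₀ I j y) := by
  induction x with
  | zero => simp
  | add a b ha hb => simp only [map_add, LinearMap.add_apply, ha, hb]
  | tmul x r =>
    induction y with
    | zero => simp
    | add a b ha hb => simp only [map_add, ha, hb]
    | tmul y s =>
      exact extCochain_br_smul R hn (r : R) s (Prod.fst x) (Prod.fst y)

theorem frakN_br {i j n a b c : ℤ} (hn : i + j = n) (ha : d + 1 - i = a) (hb : d + 1 - j = b)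
    (hc : d + 1 - n = c) (h₁ : b = c + i) (h₂ : a = c + j) (x : (frakD η₀ hη₀).X i ⊗[k] I)
    (y : (frakD η₀ hη₀).X j ⊗[k] I) :
    frakN η₀ hη₀ I n hc (TensorProduct.map₂ ((frakD η₀ hη₀).br hn) (idealMul k I) x y) =
      sgn ((d + 1) * i) • ncAct h₁ (frakC η₀ hη₀ I i x) (frakN η₀ hη₀ I j hb y) -
      sgn (j * i) • sgn ((d + 1) * j) • ncAct h₂ (frakC η₀ hη₀ I j y) (frakN η₀ hη₀ I i ha x) := by
  induction x with
  | zero => simp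
  | add a b ha hb =>
    simp only [map_add, LinearMap.add_apply, ha, hb, smul_add]
    abel
  | tmul x r =>
    induction y with
    | zero => simp
    | add a b ha hb =>
      simp only [map_add, LinearMap.add_apply, ha, hb, smul_add]
      abel
    | tmul y s =>
      subst ha hb hc
      exact bcNeg_semidirect_br h₁ h₂ _ _ _ (r : R) s (Prod.fst x) (Prod.fst y) (Prod.snd x)
        (Prod.snd y)

theorem frakC_d {i j : ℤ} (hj : i + 1 = j) (x : (frakD η₀ hη₀).X i ⊗[k] I) :
    frakC η₀ hη₀ I j (((frakD η₀ hη₀).d hj).rTensor I x) =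
      ncDiff (ofBilin_multilin _) (ofBilin_hasDegree _) (mulBilin_unital R (R ⊗[k] A)) hj
        (frakC η₀ hη₀ I i x) := by
  induction x with
  | zero => simp
  | add a b ha hb => simp only [map_add, ha, hb]
  | tmul x r =>
    exact extCochain_twisted_diff R hj (by omega) (r : R) (Prod.fst x)

theorem frakN_d {i j a c : ℤ} (hj : i + 1 = j) (ha : d + 1 - i = a) (hc : d + 1 - j = c)
    (h₁ : a = c + 1) (h₂ : d = c + i) (x : (frakD η₀ hη₀).X i ⊗[k] I) :
    frakN η₀ hη₀ I j hc (((frakD η₀ hη₀).d hj).rTensor I x) =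
      sgn (d + 1) • negDiff h₁ (ofBilin (mulBilin R (R ⊗[k] A))) (ofBilin_hasDegree _)
        (frakN η₀ hη₀ I i ha x) -
      sgn (i * 1) • sgn ((d + 1) * i) • ncAct h₂ (frakC η₀ hη₀ I i x) (bcNeg R d η₀) := by
  induction x with
  | zero => simp
  | add a b ha hb =>
    simp only [map_add, LinearMap.add_apply, ha, hb, smul_add]
    abel
  | tmul x r =>
    subst ha hc
    exact bcNeg_twisted_diff η₀ h₁ h₂ (by omega) (by omega) _ _ _ _ (r : R) (Prod.fst x)
      (Prod.snd x)

/-- The description of `𝔇(A, η₀) ⊗ m` by cochains and chains of `R ⊗ A`. -/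
noncomputable def frakReal (R : Nilp k) : Realization ((frakD η₀ hη₀).tensor R.m) R.m
    (mulBilin R.R (R.R ⊗[k] A)) (bcNeg R.R d η₀) where
  nilp := R.m_nilpotent
  unital := mulBilin_unital R.R (R.R ⊗[k] A)
  gbr_self := mulBilin_gbr R.R (R.R ⊗[k] A)
  cycle := by rw [← bcNeg_diff, show negDiff _ _ _ η₀ = 0 from hη₀, map_zero]
  C := frakC η₀ hη₀ R.m
  N p _ h := frakN η₀ hη₀ R.m p h
  C_br := frakC_br η₀ hη₀ R.m
  N_br := frakN_br η₀ hη₀ R.m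
  C_d := frakC_d η₀ hη₀ R.m
  N_d := frakN_d η₀ hη₀ R.m
  C_mem p x := realC_mem (p := p) (Y := NegCyc k (1 : A) (d + 1 - p)) x
  N_mem p _ h x := realN_mem (X := NCochain k (1 : A) p) h x
  inj p _ h x h₁ h₂ := real_injective (p := p) h h₁ h₂
  surj p _ h z c hz hc := real_surjective h z (fun l => hz _) c hc

end Concrete

/-! ### The components of the realization in the notation of the theorem. -/

section Components

variable {k : Type u} [Field k] {A : Type v} [Ring A] [Algebra k A] {d : ℤ} (R : Nilp k)
  (y : (NCochain k (1 : A) 1 × NegCyc k (1 : A) (d + 1 - 1)) ⊗[k] R.m)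

theorem coBilin_realC : coBilin (realC R.m 1 _ y) = cochainPart R y := by
  rw [cochainPart]
  refine LinearMap.ext₂ fun a b => ?_
  induction a with
  | zero => simp
  | add a a' ha ha' => simp only [map_add, LinearMap.add_apply, ha, ha']
  | tmul s a =>
    induction b with
    | zero => simp
    | add b b' hb hb' => simp only [map_add, hb, hb']
    | tmul t b =>
      rw [ext₂_tmul, tmul_eq_smul_incl, tmul_eq_smul_incl, map_smul, map_smul, LinearMap.smul_apply,
        smul_comm]
      congr 2
      induction y with
      | zero => simp
      | add y y' hy hy' =>
        rw [map_add, map_add, map_add, LinearMap.add_apply, LinearMap.add_apply, hy, hy']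
        rfl
      | tmul z r =>
        change (r : R.R) • (extCochain R.R z.1).1 ([a, b].map (incl R.R A)) =
          (r : R.R) ⊗ₜ[k] z.1.1 [a, b]
        rw [extCochain_incl, tmul_eq_smul_incl]

theorem realN_eq_chainPart : realN R.m _ (by omega) y = chainPart R y := by
  induction y with
  | zero => rw [map_zero, map_zero]
  | add y y' hy hy' => rw [map_add, map_add, hy, hy']
  | tmul z r => rfl

end Components

end CYDef

namespace CYDef

universe u v w

/-! ### Base change along morphisms of the coefficient algebras. -/

section BaseChangeOfCochains

variable {k : Type u} [Field k] {A : Type v} [Ring A] [Algebra k A] {R S : Type*} [CommRing R]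
  [Algebra k R] [CommRing S] [Algebra k S] (f : R →ₐ[k] S)

theorem extCochain_bcMap {p : ℤ} (x : NCochain k (1 : A) p) (l : List (R ⊗[k] A)) :
    (extCochain S x).1 (l.map (bcMap A f)) = bcMap A f ((extCochain R x).1 l) := by
  -- With `S ⊗ A` regarded as an `R`-module through `f`, both sides are `R`-multilinear functions
  -- and can be compared on `A`.
  let _ : Module R (S ⊗[k] A) := Module.compHom _ (f : R →+* S)
  refine congrFun (IsMultilin.eq_of_incl (k := k) (A := A) (R := R) (N := S ⊗[k] A)
    (g := fun l => (extCochain S x).1 (l.map (bcMap A f)))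
    (g' := fun l => bcMap A f ((extCochain R x).1 l)) ?_ ?_ fun l => ?_) l
  · exact
      { add := fun u a b v => by
          simp only [List.map_append, List.map_cons, map_add, (extCochain S x).2.1.add]
        smul := fun u r a v => by
          simp only [List.map_append, List.map_cons]
          rw [map_smulₛₗ]
          exact (extCochain S x).2.1.smul _ (f r) _ _ }
  · exact
      { add := fun u a b v => by rw [(extCochain R x).2.1.add, map_add]
        smul := fun u r a v => by
          rw [(extCochain R x).2.1.smul]
          exact map_smulₛₗ (bcMap A f) r _ }
  · have h : (l.map (incl R A)).map (bcMap A f) = l.map (incl S A) := by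
      rw [List.map_map]
      exact List.map_congr_left fun a _ => bcMap_incl f a
    change (extCochain S x).1 ((l.map (incl R A)).map (bcMap A f)) = _
    rw [h, extCochain_incl, extCochain_incl, bcMap_incl]

/-- Base change of negative cyclic chains, as a `k`-linear map. -/
noncomputable def bcNegLin (A : Type v) [Ring A] [Algebra k A] (f : R →ₐ[k] S) (n : ℤ) :
    NegCyc R (1 : R ⊗[k] A) n →ₗ[k] NegCyc S (1 : S ⊗[k] A) n where
  toFun := bcNegMap A f n
  map_add' := map_add _
  map_smul' c z := by
    rw [← algebraMap_smul R c z, map_smulₛₗ, RingHom.id_apply, ← algebraMap_smul S c]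
    exact congrArg (· • bcNegMap A f n z) (f.commutes c)

theorem bcNegMap_act {p n m : ℤ} (h : n = m + p) {x : NCochain R (1 : R ⊗[k] A) p}
    {x' : NCochain S (1 : S ⊗[k] A) p} (hx : ∀ l, x'.1 (l.map (bcMap A f)) = bcMap A f (x.1 l))
    (c : NegCyc R (1 : R ⊗[k] A) n) :
    bcNegMap A f m (ncAct h x c) = ncAct h x' (bcNegMap A f n c) :=
  Subtype.ext (funext fun i => chainMap_chainLie (bcMap A f) (bcMap_one f) hx
    (lieFun_isChainFun x.2.1 x.2.2.1) (lieFun_isChainFun x'.2.1 x'.2.2.1) (c.1 i))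

/-- Base change intertwines the two endomorphisms, so it intertwines their exponentials, although
they are linear over different rings. -/
theorem nexp_coEnd_bcMap {x : NCochain R (1 : R ⊗[k] A) 0} {x' : NCochain S (1 : S ⊗[k] A) 0}
    (hx : ∀ l, x'.1 (l.map (bcMap A f)) = bcMap A f (x.1 l)) (h : IsNilpotent (coEnd x))
    (h' : IsNilpotent (coEnd x')) (b : R ⊗[k] A) :
    nexp k (coEnd x') (bcMap A f b) = bcMap A f (nexp k (coEnd x) b) :=
  (nexp_intertwine (R := R) (S := S) (f.toLinearMap.rTensor A) h h'
    (fun v => (hx [v]).symm) b).symm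

/-- Base change of chains together with `f` on the last coordinate intertwines the two affine
actions and preserves the origin `(0, 1)`. -/
theorem nexp_transl_bcNegMap {n : ℤ} {x : NCochain R (1 : R ⊗[k] A) 0 × NegCyc R (1 : R ⊗[k] A) n}
    {x' : NCochain S (1 : S ⊗[k] A) 0 × NegCyc S (1 : S ⊗[k] A) n}
    (hx : ∀ l, x'.1.1 (l.map (bcMap A f)) = bcMap A f (x.1.1 l))
    (hx' : x'.2 = bcNegMap A f n x.2) (h : IsNilpotent (transl n x))
    (h' : IsNilpotent (transl n x')) :
    (nexp k (transl n x') (0, 1)).1 = bcNegMap A f n (nexp k (transl n x) (0, 1)).1 := by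
  have key := nexp_intertwine (R := R) (S := S) ((bcNegLin A f n).prodMap f.toLinearMap) h h'
    (fun v => by
      rw [transl_apply, transl_apply]
      refine Prod.ext ?_ (map_zero f)
      change bcNegMap A f n (negLie₀ n x.1 v.1 + v.2 • x.2) =
        negLie₀ n x'.1 (bcNegMap A f n v.1) + f v.2 • x'.2
      rw [map_add, map_smulₛₗ, bcNegMap_act f _ hx, hx']
      rfl) (0, 1)
  have h₁ : (bcNegLin A f n).prodMap f.toLinearMap (0, 1) = (0, 1) :=
    Prod.ext (map_zero (bcNegLin A f n)) (map_one f)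
  rw [h₁] at key
  exact (congrArg Prod.fst key).symm

end BaseChangeOfCochains

/-! ### The functor from Maurer–Cartan elements to deformations. -/

section Functor

variable {k : Type u} [Field k] [CharZero k] {A : Type v} [Ring A] [Algebra k A] {d : ℤ}
  (η₀ : NegCyc k (1 : A) d) (hη₀ : IsNegCycle η₀)

/-- The deformation described by a Maurer-Cartan element. -/
noncomputable def mcToDef (R : Nilp k) (y : ((frakD η₀ hη₀).tensor R.m).MC) : DefFlat η₀ R where
  μ := (frakReal η₀ hη₀ R).mul y.val
  η := (frakReal η₀ hη₀ R).chain y.val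
  unital := (frakReal η₀ hη₀ R).mul_unital _
  assoc := ((frakReal η₀ hη₀ R).mul_assoc_iff _).1
    (((frakReal η₀ hη₀ R).isMC_iff _).1 y.prop).1
  μ_mod a b := by
    rw [Realization.mul, LinearMap.add_apply, LinearMap.add_apply, add_sub_cancel_left]
    exact map_smul_top' (LinearMap.applyₗ b) (map_smul_top' (LinearMap.applyₗ a)
      (map_smul_top' coBilin ((frakReal η₀ hη₀ R).C_mem 1 y.val)))
  cycle := (((frakReal η₀ hη₀ R).isMC_iff _).1 y.prop).2
  η_mod := by
    rw [Realization.chain, add_sub_cancel_left]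
    exact (frakReal η₀ hη₀ R).N_mem 1 _ y.val

/-- The functor from Maurer-Cartan elements to deformations. -/
noncomputable def mcToDefFunctor (R : Nilp k) :
    ((frakD η₀ hη₀).tensor R.m).MC ⥤ DefFlat η₀ R where
  obj := mcToDef η₀ hη₀ R
  map {y z} g :=
    { φ := (frakReal η₀ hη₀ R).autom g.1
      ξ := (frakReal η₀ hη₀ R).homotopy g.1
      map_one := (frakReal η₀ hη₀ R).autom_unit g.1
      map_μ := fun a b => by
        have := (frakReal η₀ hη₀ R).autom_mul_apply g.1 y.val a b
        rwa [g.2] at this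
      φ_mod := (frakReal η₀ hη₀ R).autom_sub_mem g.1
      ξ_mem := (frakReal η₀ hη₀ R).homotopy_mem g.1
      boundary := by
        have := (frakReal η₀ hη₀ R).negDiff_homotopy g.1 y.val
        simp only [g.2] at this
        exact this }
  map_id y := DefFlat.Hom.ext (Realization.autom_one _) (Realization.homotopy_one _)
  map_comp g g' := DefFlat.Hom.ext (Realization.autom_mul _ g'.1 g.1)
    (Realization.homotopy_mul _ g'.1 g.1)

variable {η₀}

/-- Both products have the same unit, so their difference is a normalized cochain; it and the
difference of the cycles are trivial modulo `m`, and `surj` provides the element of `h¹`. -/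
theorem exists_mcToDef {R : Nilp k} (X : DefFlat η₀ R) :
    ∃ y, mcToDef η₀ hη₀ R y = X := by
  have h₁ : ∀ a, (X.μ - mulBilin R.R (R.R ⊗[k] A)) 1 a = 0 := fun a => by
    have := (X.unital a).1
    change X.μ 1 a = -a at this
    rw [LinearMap.sub_apply, LinearMap.sub_apply, this, mulBilin_apply, one_mul, sub_self]
  have h₂ : ∀ a, (X.μ - mulBilin R.R (R.R ⊗[k] A)) a 1 = 0 := fun a => by
    have := (X.unital a).2
    change X.μ a 1 = -a at this
    rw [LinearMap.sub_apply, LinearMap.sub_apply, this, mulBilin_apply, mul_one, sub_self]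
  obtain ⟨y, hy₁, hy₂⟩ := (frakReal η₀ hη₀ R).surj 1 (show d + 1 - 1 = d by omega)
    (bilinCochain _ h₁ h₂) (X.η - bcNeg R.R d η₀) (fun l => by
      match l with
      | [a, b] => exact X.μ_mod a b
      | [] => exact zero_mem _
      | [_] => exact zero_mem _
      | _ :: _ :: _ :: _ => exact zero_mem _) X.η_mod
  have hm : (frakReal η₀ hη₀ R).mul y = X.μ := by
    rw [Realization.mul, hy₁, coBilin_bilinCochain, add_sub_cancel]
  have hc : (frakReal η₀ hη₀ R).chain y = X.η := by
    rw [Realization.chain, hy₂, add_sub_cancel]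
  refine ⟨⟨y, ((frakReal η₀ hη₀ R).isMC_iff y).2
    ⟨((frakReal η₀ hη₀ R).mul_assoc_iff y).2 ?_, ?_⟩⟩, DefFlat.ext hm hc⟩
  · simpa only [hm] using X.assoc
  · simp only [hm, hc]
    exact X.cycle

theorem mcToDef_injective {R : Nilp k} {y z : ((frakD η₀ hη₀).tensor R.m).MC}
    (h : mcToDef η₀ hη₀ R y = mcToDef η₀ hη₀ R z) : y = z :=
  DGLie.MC.ext ((frakReal η₀ hη₀ R).ext_total (congrArg DefFlat.μ h) (congrArg DefFlat.η h))

/-- `exists_gauge` produces the gauge element from `(φ, ξ)` alone; `gaugeAct_eq` then shows that it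
carries `y` to `z`. -/
theorem exists_mcToDef_hom {R : Nilp k} {y z : ((frakD η₀ hη₀).tensor R.m).MC}
    (f : DefFlat.Hom (mcToDef η₀ hη₀ R y) (mcToDef η₀ hη₀ R z)) :
    ∃ g : ((frakD η₀ hη₀).tensor R.m).gauge,
      ((frakD η₀ hη₀).tensor R.m).gaugeAct g y.val = z.val ∧
        (frakReal η₀ hη₀ R).autom g = f.φ ∧ (frakReal η₀ hη₀ R).homotopy g = f.ξ := by
  obtain ⟨g, hg₁, hg₂⟩ := (frakReal η₀ hη₀ R).exists_gauge f.map_one f.φ_mod f.ξ_mem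
  refine ⟨g, (frakReal η₀ hη₀ R).gaugeAct_eq ?_ ?_, hg₁, hg₂⟩
  · rw [hg₁]
    exact f.map_μ
  · simp only [hg₁, hg₂]
    exact f.boundary

end Functor

end CYDef

namespace CYDef

universe u v w

/-- A fully faithful functor which is bijective on objects has an inverse. -/
theorem exists_inverse_functor {C D : Type*} [Category C] [Category D] (F : C ⥤ D) [F.Full]
    [F.Faithful] (hF : Function.Bijective F.obj) : ∃ G : D ⥤ C, F ⋙ G = 𝟭 C ∧ G ⋙ F = 𝟭 D := by
  choose o ho using hF.2
  -- The chosen preimages of objects map back only up to propositional equality, so morphisms are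
  -- conjugated by `eqToHom`.
  let G : D ⥤ C :=
    { obj := o
      map := fun {X Y} f => F.preimage (eqToHom (ho X) ≫ f ≫ eqToHom (ho Y).symm)
      map_id := fun X => F.map_injective (by simp)
      map_comp := fun f g => F.map_injective (by simp) }
  have hG : ∀ {X Y : D} (f : X ⟶ Y), F.map (G.map f) =
      eqToHom (ho X) ≫ f ≫ eqToHom (ho Y).symm := fun f => F.map_preimage _
  refine ⟨G, CategoryTheory.Functor.ext (fun X => hF.1 (ho _)) fun X Y f => F.map_injective ?_,
    CategoryTheory.Functor.ext (fun X => ho X) fun X Y f => ?_⟩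
  · rw [Functor.comp_map, hG]
    simp [eqToHom_map]
  · rw [Functor.comp_map, hG]
    rfl

/-! ### Inverse functors, naturality and the isomorphism. -/

section Naturality

variable {k : Type u} [Field k] [CharZero k] {A : Type v} [Ring A] [Algebra k A] {d : ℤ}
  (η₀ : NegCyc k (1 : A) d) (hη₀ : IsNegCycle η₀)

instance mcToDefFunctor_faithful (R : Nilp k) : (mcToDefFunctor η₀ hη₀ R).Faithful where
  map_injective h := Subtype.ext ((frakReal η₀ hη₀ R).autom_homotopy_injective
    (congrArg DefFlat.Hom.φ h) (congrArg DefFlat.Hom.ξ h))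

instance mcToDefFunctor_full (R : Nilp k) : (mcToDefFunctor η₀ hη₀ R).Full where
  map_surjective f := by
    obtain ⟨g, hg, h₁, h₂⟩ := exists_mcToDef_hom hη₀ f
    exact ⟨⟨g, hg⟩, DefFlat.Hom.ext h₁ h₂⟩

theorem mcToDefFunctor_bijective (R : Nilp k) :
    Function.Bijective (mcToDefFunctor η₀ hη₀ R).obj :=
  ⟨fun _ _ h => mcToDef_injective hη₀ h, exists_mcToDef hη₀⟩

variable {R S : Nilp k} (f : R ⟶ S)

/-- The base change of `𝔇(A, η₀) ⊗ m`. -/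
noncomputable abbrev frakMap :
    DGLieHom ((frakD η₀ hη₀).tensor R.m) ((frakD η₀ hη₀).tensor S.m) :=
  (frakD η₀ hη₀).tensorMap (Nilp.hom f) (Nilp.map_m f)

theorem frakC_map {p : ℤ} (x : (frakD η₀ hη₀).X p ⊗[k] R.m) (l : List (R.R ⊗[k] A)) :
    (frakC η₀ hη₀ S.m p ((idealMap (Nilp.hom f) (Nilp.map_m f)).lTensor _ x)).1
      (l.map (bcMap A (Nilp.hom f))) = bcMap A (Nilp.hom f) ((frakC η₀ hη₀ R.m p x).1 l) := by
  induction x with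
  | zero => simp
  | add a b ha hb =>
    rw [map_add, map_add, map_add, Submodule.coe_add, Pi.add_apply, ha, hb, Submodule.coe_add,
      Pi.add_apply, map_add]
  | tmul z r =>
    rw [LinearMap.lTensor_tmul, frakC_tmul, frakC_tmul]
    refine (congrArg (fun t => Nilp.hom f r • t) (extCochain_bcMap (Nilp.hom f) _ l)).trans ?_
    exact (map_smulₛₗ (bcMap A (Nilp.hom f)) (r : R.R) _).symm

theorem frakN_map {p n : ℤ} (h : d + 1 - p = n) (x : (frakD η₀ hη₀).X p ⊗[k] R.m) :
    frakN η₀ hη₀ S.m p h ((idealMap (Nilp.hom f) (Nilp.map_m f)).lTensor _ x) =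
      bcNegMap A (Nilp.hom f) n (frakN η₀ hη₀ R.m p h x) := by
  induction x with
  | zero => simp
  | add a b ha hb => simp only [map_add, ha, hb]
  | tmul z r =>
    rw [LinearMap.lTensor_tmul, frakN_tmul, frakN_tmul, map_smulₛₗ, bcNegMap_bcNeg]
    rfl

/-- A bilinear map on `S ⊗ A` compatible with base change from `R ⊗ A` is unique, so it suffices to
compare values on the image. -/
theorem mul_frakMap (y : ((frakD η₀ hη₀).tensor R.m).X 1) :
    (frakReal η₀ hη₀ S).mul ((frakMap η₀ hη₀ f).f 1 y) =
      bcBilin (Nilp.hom f) ((frakReal η₀ hη₀ R).mul y) := by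
  refine bcBilin_unique _ fun a b => ?_
  have h₁ := frakC_map η₀ hη₀ f y [a, b]
  have h₂ := bcMap_mul (Nilp.hom f) a b
  change -(bcMap A (Nilp.hom f) a * bcMap A (Nilp.hom f) b) + _ =
    bcMap A (Nilp.hom f) (-(a * b) + _)
  rw [map_add, map_neg, h₂]
  exact congrArg _ h₁

theorem chain_frakMap (y : ((frakD η₀ hη₀).tensor R.m).X 1) :
    (frakReal η₀ hη₀ S).chain ((frakMap η₀ hη₀ f).f 1 y) =
      bcNegMap A (Nilp.hom f) d ((frakReal η₀ hη₀ R).chain y) := by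
  rw [Realization.chain, Realization.chain, map_add, bcNegMap_bcNeg]
  exact congrArg _ (frakN_map η₀ hη₀ f _ y)

/-- On exponentials the claim concerns operators which base change intertwines; `bcEnd_unique` then
identifies the automorphism over `S`. -/
theorem autom_frakMap (g : ((frakD η₀ hη₀).tensor R.m).gauge) :
    (frakReal η₀ hη₀ S).autom ((frakMap η₀ hη₀ f).gauge g) =
      bcEnd (Nilp.hom f) ((frakReal η₀ hη₀ R).autom g) := by
  obtain ⟨x, rfl⟩ := (frakReal η₀ hη₀ R).exists_gaugeExp g
  rw [DGLieHom.gauge_gaugeExp, Realization.autom_gaugeExp, Realization.autom_gaugeExp]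
  exact bcEnd_unique _ fun b => nexp_coEnd_bcMap (Nilp.hom f) (frakC_map η₀ hη₀ f x)
    ((frakReal η₀ hη₀ R).nilp_coEnd x) ((frakReal η₀ hη₀ S).nilp_coEnd _) b

theorem homotopy_frakMap (g : ((frakD η₀ hη₀).tensor R.m).gauge) :
    (frakReal η₀ hη₀ S).homotopy ((frakMap η₀ hη₀ f).gauge g) =
      bcNegMap A (Nilp.hom f) (d + 1) ((frakReal η₀ hη₀ R).homotopy g) := by
  obtain ⟨x, rfl⟩ := (frakReal η₀ hη₀ R).exists_gaugeExp g
  rw [DGLieHom.gauge_gaugeExp, Realization.homotopy_gaugeExp, Realization.homotopy_gaugeExp,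
    map_zsmul]
  exact congrArg (sgn (d + 1) • ·) (nexp_transl_bcNegMap (Nilp.hom f) (frakC_map η₀ hη₀ f x)
    (frakN_map η₀ hη₀ f (by omega) x) ((frakReal η₀ hη₀ R).nilp_transl x)
    ((frakReal η₀ hη₀ S).nilp_transl _))

theorem mcToDefFunctor_naturality :
    (frakMap η₀ hη₀ f).mc ⋙ mcToDefFunctor η₀ hη₀ S =
      mcToDefFunctor η₀ hη₀ R ⋙ DefFlat.baseChangeFunctor η₀ f :=
  DefFlat.functor_ext (fun y => mul_frakMap η₀ hη₀ f y.val) (fun y => chain_frakMap η₀ hη₀ f y.val)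
    (fun g => autom_frakMap η₀ hη₀ f g.1) (fun g => homotopy_frakMap η₀ hη₀ f g.1)

/-- The isomorphism of groupoids from Maurer-Cartan elements to deformations. -/
noncomputable def mcIsoDef (R : Nilp k) :
    (frakD η₀ hη₀).mcFunctor.obj R ≅ (defFlat η₀).obj R where
  hom := mcToDefFunctor η₀ hη₀ R
  inv := (exists_inverse_functor (mcToDefFunctor η₀ hη₀ R)
    (mcToDefFunctor_bijective η₀ hη₀ R)).choose
  hom_inv_id := (exists_inverse_functor (mcToDefFunctor η₀ hη₀ R)
    (mcToDefFunctor_bijective η₀ hη₀ R)).choose_spec.1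
  inv_hom_id := (exists_inverse_functor (mcToDefFunctor η₀ hη₀ R)
    (mcToDefFunctor_bijective η₀ hη₀ R)).choose_spec.2

end Naturality

end CYDef

theorem theorem8p1 {k : Type*} [Field k] [CharZero k] {A : Type*} [Ring A] [Algebra k A] {d : ℤ}
    (η₀ : NegCyc k (1 : A) d) (hη₀ : IsNegCycle η₀) :
    ∃ Φ : (frakD η₀ hη₀).mcFunctor ≅ defFlat η₀,
      ∀ (R : Nilp k) (y : ((frakD η₀ hη₀).tensor R.m).MC),
        (onObj (D := DefFlat η₀ R) (Φ.hom.app R) y).μ =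
          mulBilin R.R (R.R ⊗[k] A) + cochainPart R y.val ∧
        (onObj (D := DefFlat η₀ R) (Φ.hom.app R) y).η = bcNeg R.R d η₀ + chainPart R y.val := by
  refine ⟨NatIso.ofComponents (mcIsoDef η₀ hη₀) fun f => mcToDefFunctor_naturality η₀ hη₀ f,
    fun R y => ⟨?_, ?_⟩⟩
  -- By definition the functor adds the realized components to `μ₀` and `η₀`; only their
  -- identification with `cochainPart` and `chainPart` remains.
  · exact congrArg (mulBilin R.R (R.R ⊗[k] A) + ·) (coBilin_realC R y.val)
  · exact congrArg (bcNeg R.R d η₀ + ·) (realN_eq_chainPart R y.val)
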